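/- Notation. Let $\widehat f(\xi)=\int_{\mathbb R}e^{-ix\xi}f(x)\,dx$, extended to the (complex) tempered distributions $\mathcal S'(\mathbb R)$, and for a smooth symbol $m$ of temperate growth let $\widehat{m(D)f}=m\widehat f$. Put $\varphi(\xi)=\xi/(1+\xi^2)$ and $S(t)=e^{-it\varphi(D)}$, $t\in\mathbb R$. Fix a smooth $\rho:\mathbb R\to[0,1]$ with $\rho(\xi)=1$ for $|\xi|\le\frac12$ and $\rho(\xi)=0$ for $|\xi|\ge1$; let $\sigma_k(\xi)=\rho(\xi-k)\big(\sum_{l\in\mathbb Z}\rho(\xi-l)\big)^{-1}$ and $\square_k=\sigma_k(D)$, $k\in\mathbb Z$. For $s\in\mathbb R$, $1\le p\le\infty$, $1\le q<\infty$, the modulation space $M^s_{p,q}$ is the set of $f\in\mathcal S'(\mathbb R)$ with $$\|f\|_{M^s_{p,q}}=\Big(\sum_{k\in\mathbb Z}(1+|k|)^{sq}\|\square_kf\|_{L^p(\mathbb R)}^q\Big)^{1/q}<\infty .$$ $L^r(\mathbb R;M^s_{p,q})$ is the space of (classes modulo a.e. equality of) Bochner measurable $u:\mathbb R\to M^s_{p,q}$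 with $\|u\|_{L^r(\mathbb R;M^s_{p,q})}=\big(\int_{\mathbb R}\|u(t)\|_{M^s_{p,q}}^r\,dt\big)^{1/r}<\infty$. For $\sigma<-1$ let $$\beta_\sigma=\frac{\sigma+1}{1-2\sigma}\ \text{ if } -4\le\sigma<-1,\qquad \beta_\sigma=\frac{-3}{1-2\sigma}\ \text{ if }\sigma\le-4 .$$ Theorem. Let $\lambda\ge1$ be an integer, $p=\lambda+2$, $1\le q<\infty$ and $1-\frac1q\le s<\frac1q$. Let $\sigma<-1$ and $0<\theta\le-\frac1\sigma$ be such that $0<\frac{-\lambda\theta\beta_\sigma}{\lambda+2}<1$, and set $r=\frac{\lambda(\lambda+2)}{\lambda+2+\lambda\theta\beta_\sigma}$. Then there is $\epsilon>0$ such that for every $u_0\in\mathcal S'(\mathbb R)$ with $\|S(t)u_0\|_{L^r(\mathbb R;M^s_{p,q})}<\epsilon$ the integral equation of the generalized Benjamin--Bona--Mahony equation $u_t+u_x+u^\lambda u_x-u_{xxt}=0$, $u(0)=u_0$, $$u(t)=S(t)u_0-\frac{i}{\lambda+1}\int_0^tS(t-\tau)\varphi(D)\big[u(\tau)^{\lambda+1}\big]\,d\tau\qquad\text{for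 a.e. }t\in\mathbb R,$$ has one and only one solution $u\in L^r(\mathbb R;M^s_{p,q})$; here $u(\tau)^{\lambda+1}$ is the pointwise power, and being a solution includes that for a.e. $t$ the integral exists as a Bochner integral in $M^s_{p,q}$. If $u_0$ is real-valued, then $u(t)$ is real-valued for a.e. $t$. -/

import Mathlib

open MeasureTheory Filter Topology
open scoped SchwartzMap ENNReal ContDiff

noncomputable section

namespace GBBM

/-- The profile `ρ` from which the frequency-uniform decomposition of the line is built: a smooth
function with values in `[0, 1]`, equal to `1` on `|ξ| ≤ 1/2` and to `0` on `|ξ| ≥ 1`. -/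
structure IsCutoff (ρ : ℝ → ℝ) : Prop where
  smooth : ContDiff ℝ ∞ ρ
  nonneg : ∀ ξ, 0 ≤ ρ ξ
  le_one : ∀ ξ, ρ ξ ≤ 1
  eq_one : ∀ ξ, |ξ| ≤ 1 / 2 → ρ ξ = 1
  eq_zero : ∀ ξ, 1 ≤ |ξ| → ρ ξ = 0

/-- `σ_k(ξ) = ρ(ξ - k) / ∑_l ρ(ξ - l)`; at each point only finitely many summands are nonzero. -/
def window (ρ : ℝ → ℝ) (k : ℤ) (ξ : ℝ) : ℝ :=
  ρ (ξ - k) * (∑' l : ℤ, ρ (ξ - l))⁻¹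

/-- The Fourier multiplier `m(D)` on tempered distributions, in the normalisation
`f̂(ξ) = ∫ e^{-ixξ} f(x) dx`, in which `D = -i d/dx`. Mathlib's transform has the kernel
`e^{-2πixξ}`, so `m(D)` is Mathlib's multiplier with symbol `ξ ↦ m(2πξ)`. -/
def multiplier (m : ℝ → ℂ) : 𝓢'(ℝ, ℂ) →L[ℂ] 𝓢'(ℝ, ℂ) :=
  TemperedDistribution.fourierMultiplierCLM ℂ (fun ξ : ℝ => m (2 * Real.pi * ξ))

/-- The frequency-uniform decomposition operator `□_k = F⁻¹ σ_k F`. -/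
def box (ρ : ℝ → ℝ) (k : ℤ) : 𝓢'(ℝ, ℂ) →L[ℂ] 𝓢'(ℝ, ℂ) :=
  multiplier (fun ξ => (window ρ k ξ : ℂ))

/-- The symbol `φ(ξ) = ξ / (1 + ξ²)`. -/
def phi (ξ : ℝ) : ℝ := ξ / (1 + ξ ^ 2)

/-- `φ(D)`. -/
def phiD : 𝓢'(ℝ, ℂ) →L[ℂ] 𝓢'(ℝ, ℂ) :=
  multiplier (fun ξ => (phi ξ : ℂ))

/-- The group `S(t) = e^{-itφ(D)}`. -/
def S (t : ℝ) : 𝓢'(ℝ, ℂ) →L[ℂ] 𝓢'(ℝ, ℂ) :=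
  multiplier (fun ξ => Complex.exp (-(Complex.I * t * phi ξ)))

/-- The tempered distribution `T` is the function `g`, that is `T f = ∫ f g` for every Schwartz
function `f`, the integral being absolutely convergent. -/
def IsFunction (T : 𝓢'(ℝ, ℂ)) (g : ℝ → ℂ) : Prop :=
  ∀ f : 𝓢(ℝ, ℂ), Integrable (fun x => f x * g x) ∧ T f = ∫ x, f x * g x

/-- The `L^p` norm of a tempered distribution; it is `∞` if the distribution is not a function. -/
def lpNorm (p : ℝ≥0∞) (T : 𝓢'(ℝ, ℂ)) : ℝ≥0∞ :=
  ⨅ (g : ℝ → ℂ) (_ : IsFunction T g), eLpNorm g p volume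

/-- The norm of the modulation space `M^s_{p,q}(ℝ)`, for `q < ⊤`, with values in `[0, ∞]`. The
space itself consists of the tempered distributions of finite norm. -/
def modNorm (ρ : ℝ → ℝ) (s : ℝ) (p : ℝ≥0∞) (q : ℝ) (T : 𝓢'(ℝ, ℂ)) : ℝ≥0∞ :=
  (∑' k : ℤ, ENNReal.ofReal ((1 + |(k : ℝ)|) ^ (s * q)) * lpNorm p (box ρ k T) ^ q) ^ (1 / q)

/-- Bochner (strong) measurability of an `M^s_{p,q}`-valued function of time: it is, almost
everywhere, the limit in norm of a sequence of simple `M^s_{p,q}`-valued functions. -/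
def ModStronglyMeasurable (ρ : ℝ → ℝ) (s : ℝ) (p : ℝ≥0∞) (q : ℝ) (u : ℝ → 𝓢'(ℝ, ℂ))
    (μ : Measure ℝ) : Prop :=
  ∃ U : ℕ → SimpleFunc ℝ 𝓢'(ℝ, ℂ), (∀ n t, modNorm ρ s p q (U n t) < ⊤) ∧
    ∀ᵐ t ∂μ, Tendsto (fun n => modNorm ρ s p q (u t - U n t)) atTop (𝓝 0)

/-- The norm of `L^r(ℝ; M^s_{p,q})`, for `r < ⊤`, with values in `[0, ∞]`. -/
def timeNorm (ρ : ℝ → ℝ) (r s : ℝ) (p : ℝ≥0∞) (q : ℝ) (u : ℝ → 𝓢'(ℝ, ℂ)) : ℝ≥0∞ :=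
  (∫⁻ t : ℝ, modNorm ρ s p q (u t) ^ r) ^ (1 / r)

/-- `u ∈ L^r(ℝ; M^s_{p,q})`. -/
structure MemTime (ρ : ℝ → ℝ) (r s : ℝ) (p : ℝ≥0∞) (q : ℝ) (u : ℝ → 𝓢'(ℝ, ℂ)) : Prop where
  measurable : ModStronglyMeasurable ρ s p q u volume
  finite : timeNorm ρ r s p q u < ⊤

/-- Bochner integrability in `M^s_{p,q}` of a function of time over the interval between `a`
and `b`. -/
structure ModIntegrable (ρ : ℝ → ℝ) (s : ℝ) (p : ℝ≥0∞) (q : ℝ) (G : ℝ → 𝓢'(ℝ, ℂ))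
    (a b : ℝ) : Prop where
  measurable : ModStronglyMeasurable ρ s p q G (volume.restrict (Set.uIoc a b))
  finite : ∫⁻ τ in Set.uIoc a b, modNorm ρ s p q (G τ) < ⊤

/-- `W` is the `n`-th power of `T`: both are functions, and `W` is the pointwise `n`-th power
of `T`. -/
def IsPower (n : ℕ) (T W : 𝓢'(ℝ, ℂ)) : Prop :=
  ∃ g : ℝ → ℂ, IsFunction T g ∧ IsFunction W (fun x => g x ^ n)

open Classical in
/-- The pointwise power `T ^ n`. The value `0` is used where `T`, or its power, is not a function;
this does not occur for `T` in `L^p` with `n ≤ p`. -/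
def power (n : ℕ) (T : 𝓢'(ℝ, ℂ)) : 𝓢'(ℝ, ℂ) :=
  if h : ∃ W, IsPower n T W then h.choose else 0

/-- The integrand `τ ↦ S(t - τ) φ(D) [u(τ)^{lam+1}]` of the Duhamel term. -/
def duhamelIntegrand (lam : ℕ) (u : ℝ → 𝓢'(ℝ, ℂ)) (t τ : ℝ) : 𝓢'(ℝ, ℂ) :=
  S (t - τ) (phiD (power (lam + 1) (u τ)))

/-- `u` solves
`u(t) = S(t) u₀ - (i / (lam + 1)) ∫₀ᵗ S(t - τ) φ(D) [u(τ)^{lam+1}] dτ` for almost every `t ∈ ℝ`.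
The integral is a Bochner integral in `M^s_{p,q}`; its value, a tempered distribution, is
determined by its action on the Schwartz functions, which is the integral of the actions. -/
def IsSolution (ρ : ℝ → ℝ) (s : ℝ) (p : ℝ≥0∞) (q : ℝ) (lam : ℕ) (u₀ : 𝓢'(ℝ, ℂ))
    (u : ℝ → 𝓢'(ℝ, ℂ)) : Prop :=
  ∀ᵐ t : ℝ, ModIntegrable ρ s p q (duhamelIntegrand lam u t) 0 t ∧
    ∀ f : 𝓢(ℝ, ℂ), u t f =
      S t u₀ f - Complex.I / ((lam : ℂ) + 1) * ∫ τ in (0 : ℝ)..t, duhamelIntegrand lam u t τ f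

/-- A tempered distribution is real-valued if it commutes with complex conjugation. -/
def IsRealValued (T : 𝓢'(ℝ, ℂ)) : Prop :=
  ∀ f g : 𝓢(ℝ, ℂ), (∀ x, g x = starRingEnd ℂ (f x)) → T g = starRingEnd ℂ (T f)

/-- The decay exponent `β_σ`, for `σ < -1`. -/
def beta (σ : ℝ) : ℝ :=
  if -4 ≤ σ then (σ + 1) / (1 - 2 * σ) else -3 / (1 - 2 * σ)

/- The symbols above have temperate growth, so the multipliers are the genuine ones
(Mathlib's multiplier is zero for other symbols). -/

theorem hasTemperateGrowth_phi :
    (fun ξ : ℝ => (phi (2 * Real.pi * ξ) : ℂ)).HasTemperateGrowth := by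
  have h : (fun ξ : ℝ => (phi (2 * Real.pi * ξ) : ℂ)) =
      fun ξ : ℝ => ((2 * Real.pi * ξ * (1 + ‖2 * Real.pi * ξ‖ ^ 2) ^ (-1 : ℝ) : ℝ) : ℂ) := by
    funext ξ
    rw [Real.rpow_neg_one, Real.norm_eq_abs, sq_abs, phi, div_eq_mul_inv]
  have h1 : (fun ξ : ℝ => 2 * Real.pi * ξ).HasTemperateGrowth := by fun_prop
  have h2 : (fun ξ : ℝ => (1 + ‖2 * Real.pi * ξ‖ ^ 2) ^ (-1 : ℝ)).HasTemperateGrowth :=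
    (Function.hasTemperateGrowth_one_add_norm_sq_rpow (H := ℝ) (-1)).comp h1
  rw [h]
  exact Function.Complex.hasTemperateGrowth_ofReal.comp (h1.mul h2)

theorem hasTemperateGrowth_cexp :
    (fun x : ℝ => Complex.exp (-(Complex.I * x))).HasTemperateGrowth := by
  have hd : ∀ n : ℕ, iteratedDeriv n (fun x : ℝ => Complex.exp (-(Complex.I * x))) =
      fun x : ℝ => (-Complex.I) ^ n * Complex.exp (-(Complex.I * x)) := by
    intro n
    induction n with
    | zero => simp
    | succ n ih =>
      rw [iteratedDeriv_succ, ih]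
      funext x
      have h0 : HasDerivAt (fun y : ℝ => -(Complex.I * (y : ℂ))) (-(Complex.I * 1)) x :=
        ((Complex.ofRealCLM.hasDerivAt (x := x)).const_mul Complex.I).neg
      rw [((h0.cexp).const_mul _).deriv]
      ring
  refine ⟨?_, fun n => ⟨0, 1, fun x => ?_⟩⟩
  · exact (((contDiff_const (c := Complex.I)).mul Complex.ofRealCLM.contDiff).neg).cexp
  · rw [norm_iteratedFDeriv_eq_norm_iteratedDeriv, hd]
    have : -(Complex.I * (x : ℂ)) = ((-x : ℝ) : ℂ) * Complex.I := by push_cast; ring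
    simp [this, Complex.norm_exp]

theorem hasTemperateGrowth_group (t : ℝ) :
    (fun ξ : ℝ => Complex.exp (-(Complex.I * t * phi (2 * Real.pi * ξ)))).HasTemperateGrowth := by
  have h1 : (fun ξ : ℝ => t * phi (2 * Real.pi * ξ)).HasTemperateGrowth := by
    have h := Complex.reCLM.hasTemperateGrowth.comp hasTemperateGrowth_phi
    have h' : (fun ξ : ℝ => phi (2 * Real.pi * ξ)).HasTemperateGrowth := h
    exact (Function.HasTemperateGrowth.const t).mul h'
  have h2 := hasTemperateGrowth_cexp.comp h1
  convert h2 using 2 with ξ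
  simp [mul_assoc]

theorem hasTemperateGrowth_window {ρ : ℝ → ℝ} (hρ : IsCutoff ρ) (k : ℤ) :
    (fun ξ : ℝ => (window ρ k (2 * Real.pi * ξ) : ℂ)).HasTemperateGrowth := by
  have hfin : ∀ N : ℕ, ∀ x : ℝ, |x| ≤ N →
      ∑' l : ℤ, ρ (x - l) = ∑ l ∈ Finset.Icc (-(N : ℤ) - 1) (N + 1), ρ (x - l) := by
    intro N x hx
    refine tsum_eq_sum fun l hl => hρ.eq_zero _ ?_
    by_contra! hlt
    apply hl
    rw [abs_lt] at hlt
    rw [abs_le] at hx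
    rw [Finset.mem_Icc]
    have a1 : (-(N : ℝ) - 1) < l := by linarith
    have a2 : (l : ℝ) < N + 1 := by linarith
    constructor
    · have : ((-(N : ℤ) - 1 : ℤ) : ℝ) < l := by push_cast; exact a1
      exact le_of_lt (by exact_mod_cast this)
    · have : (l : ℝ) < ((N + 1 : ℤ) : ℝ) := by push_cast; exact a2
      exact le_of_lt (by exact_mod_cast this)
  have hsm : ContDiff ℝ ∞ (fun x : ℝ => ∑' l : ℤ, ρ (x - l)) := by
    rw [contDiff_iff_contDiffAt]
    intro x
    obtain ⟨N, hN⟩ := exists_nat_gt |x|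
    have : ContDiff ℝ ∞ (fun x : ℝ => ∑ l ∈ Finset.Icc (-(N : ℤ) - 1) (N + 1), ρ (x - l)) :=
      ContDiff.sum fun l _ => hρ.smooth.comp (contDiff_id.sub contDiff_const)
    refine this.contDiffAt.congr_of_eventuallyEq ?_
    filter_upwards [continuous_abs.continuousAt.eventually_lt_const hN] with y hy
    exact hfin N y hy.le
  have hpos : ∀ x : ℝ, ∑' l : ℤ, ρ (x - l) ≠ 0 := by
    intro x
    obtain ⟨N, hN⟩ := exists_nat_gt (|x| + 1)
    rw [hfin N x (by linarith)]
    refine ne_of_gt (Finset.sum_pos' (fun l _ => hρ.nonneg _) ⟨round x, ?_, ?_⟩)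
    · have h := abs_sub_round x
      rw [abs_le] at h
      have h3 := abs_le.1 (show |x| ≤ N - 1 by linarith)
      have a1 : ((-(N : ℤ) - 1 : ℤ) : ℝ) ≤ round x := by push_cast; linarith
      have a2 : (round x : ℝ) ≤ ((N + 1 : ℤ) : ℝ) := by push_cast; linarith
      exact Finset.mem_Icc.2 ⟨by exact_mod_cast a1, by exact_mod_cast a2⟩
    · rw [hρ.eq_one _ (abs_sub_round x)]; exact one_pos
  have hw : ContDiff ℝ ∞ (window ρ k) :=
    (hρ.smooth.comp (contDiff_id.sub contDiff_const)).mul (hsm.inv hpos)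
  refine HasCompactSupport.hasTemperateGrowth ?_ ?_
  · refine HasCompactSupport.of_support_subset_isCompact
      (isCompact_Icc (a := -(|(k : ℝ)| + 1)) (b := |(k : ℝ)| + 1)) fun ξ hξ => ?_
    have h1 : ρ (2 * Real.pi * ξ - k) ≠ 0 := by
      intro h0
      apply hξ
      simp [window, h0]
    have h2 : |2 * Real.pi * ξ - k| < 1 := by
      by_contra! h
      exact h1 (hρ.eq_zero _ h)
    have h3 : |2 * Real.pi * ξ| ≤ |(k : ℝ)| + 1 := by
      have := abs_sub_abs_le_abs_sub (2 * Real.pi * ξ) k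
      linarith
    rw [abs_mul, abs_of_pos Real.two_pi_pos] at h3
    have h4 : |ξ| ≤ 2 * Real.pi * |ξ| := by
      nlinarith [abs_nonneg ξ, Real.pi_gt_three]
    exact Set.mem_Icc.2 (abs_le.1 (h4.trans h3))
  · exact Complex.ofRealCLM.contDiff.comp (hw.comp (contDiff_const.mul contDiff_id))

end GBBM

end

noncomputable section

namespace GBBM

open FourierTransform

/-! ### Young's inequality and weighted sequence spaces -/

theorem lintegral_conv_rpow_le {G : Type*} [AddCommGroup G] [MeasurableSpace G] [MeasurableAdd₂ G]
    [MeasurableNeg G] (μ : Measure G) [SFinite μ] [μ.IsAddLeftInvariant] [μ.IsNegInvariant]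
    {f g : G → ℝ≥0∞} (hf : Measurable f) (hg : Measurable g) {a b r : ℝ} (ha : 0 < a) (hb : 0 < b)
    (har : a ≤ r) (hbr : b ≤ r) (h : 1 + 1 / r = 1 / a + 1 / b) :
    (∫⁻ x, (∫⁻ y, f (x - y) * g y ∂μ) ^ r ∂μ) ^ (1 / r) ≤
      (∫⁻ x, f x ^ a ∂μ) ^ (1 / a) * (∫⁻ x, g x ^ b ∂μ) ^ (1 / b) := by
  have hr : 0 < r := ha.trans_le har
  have hra : 0 ≤ 1 / a - 1 / r := sub_nonneg.2 (one_div_le_one_div_of_le ha har)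
  have hrb : 0 ≤ 1 / b - 1 / r := sub_nonneg.2 (one_div_le_one_div_of_le hb hbr)
  have h1r : 0 < 1 / r := by positivity
  set F := ∫⁻ x, f x ^ a ∂μ
  set K := ∫⁻ x, g x ^ b ∂μ
  have hfac : ∀ (c : ℝ) (hc : 0 < c) (hcr : 0 ≤ 1 / c - 1 / r) (z : ℝ≥0∞),
      z = (z ^ c) ^ (1 / r) * (z ^ c) ^ (1 / c - 1 / r) := by
    intro c hc hcr z
    rw [← ENNReal.rpow_add_of_nonneg _ _ h1r.le hcr, add_sub_cancel, ← ENNReal.rpow_mul,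
      mul_one_div_cancel hc.ne', ENNReal.rpow_one]
  have key : ∀ x, ∫⁻ y, f (x - y) * g y ∂μ ≤
      (∫⁻ y, f (x - y) ^ a * g y ^ b ∂μ) ^ (1 / r) *
        (F ^ (1 / a - 1 / r) * K ^ (1 / b - 1 / r)) := by
    intro x
    have hfx : Measurable fun y => f (x - y) := hf.comp (measurable_const.sub measurable_id)
    let w : Fin 3 → G → ℝ≥0∞ :=
      ![fun y => f (x - y) ^ a * g y ^ b, fun y => f (x - y) ^ a, fun y => g y ^ b]
    let e : Fin 3 → ℝ := ![1 / r, 1 / a - 1 / r, 1 / b - 1 / r]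
    have := ENNReal.lintegral_prod_norm_pow_le (μ := μ) Finset.univ (f := w) (p := e)
      (by
        intro i _
        fin_cases i
        · exact ((hfx.pow_const a).mul (hg.pow_const b)).aemeasurable
        · exact (hfx.pow_const a).aemeasurable
        · exact (hg.pow_const b).aemeasurable)
      (by simp [Fin.sum_univ_three, e]; simp at h; linarith)
      (by
        intro i _
        fin_cases i
        · exact h1r.le
        · exact hra
        · exact hrb)
    simp only [Fin.prod_univ_three] at this
    simp only [w, e, Matrix.cons_val_zero, Matrix.cons_val_one, Matrix.cons_val_two,
      Matrix.head_cons, Matrix.tail_cons] at this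
    rw [lintegral_sub_left_eq_self (fun y => f y ^ a) x] at this
    calc ∫⁻ y, f (x - y) * g y ∂μ = _ := by
          refine lintegral_congr fun y => ?_
          conv_lhs => rw [hfac a ha hra (f (x - y)), hfac b hb hrb (g y)]
          rw [ENNReal.mul_rpow_of_nonneg _ _ h1r.le]
          ring
      _ ≤ _ := this
      _ = _ := by ring
  have hprod : ∫⁻ x, ∫⁻ y, f (x - y) ^ a * g y ^ b ∂μ ∂μ = F * K := by
    rw [lintegral_lintegral_swap]
    · have : ∀ y, ∫⁻ x, f (x - y) ^ a * g y ^ b ∂μ = F * g y ^ b := by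
        intro y
        rw [lintegral_mul_const, lintegral_sub_right_eq_self (fun y => f y ^ a) y]
        exact (hf.comp (measurable_id.sub measurable_const)).pow_const a
      simp_rw [this]
      rw [lintegral_const_mul _ (hg.pow_const b)]
    · exact (((hf.comp (measurable_fst.sub measurable_snd)).pow_const a).mul
        ((hg.comp measurable_snd).pow_const b)).aemeasurable
  calc (∫⁻ x, (∫⁻ y, f (x - y) * g y ∂μ) ^ r ∂μ) ^ (1 / r)
      ≤ (∫⁻ x, (∫⁻ y, f (x - y) ^ a * g y ^ b ∂μ) *
          (F ^ (1 / a - 1 / r) * K ^ (1 / b - 1 / r)) ^ r ∂μ) ^ (1 / r) := by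
        gcongr with x
        refine (ENNReal.rpow_le_rpow (key x) hr.le).trans_eq ?_
        rw [ENNReal.mul_rpow_of_nonneg _ _ hr.le, ← ENNReal.rpow_mul, one_div_mul_cancel hr.ne',
          ENNReal.rpow_one]
    _ = (F * K) ^ (1 / r) * (F ^ (1 / a - 1 / r) * K ^ (1 / b - 1 / r)) := by
        rw [lintegral_mul_const, hprod, ENNReal.mul_rpow_of_nonneg _ _ h1r.le, ← ENNReal.rpow_mul,
          mul_one_div_cancel hr.ne', ENNReal.rpow_one]
        refine Measurable.lintegral_prod_right' (f := fun z : G × G => f (z.1 - z.2) ^ a * g z.2 ^ b) ?_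
        exact (((hf.comp (measurable_fst.sub measurable_snd)).pow_const a).mul
          ((hg.comp measurable_snd).pow_const b))
    _ = F ^ (1 / a) * K ^ (1 / b) := by
        rw [ENNReal.mul_rpow_of_nonneg _ _ h1r.le]
        have e1 : F ^ (1 / a) = F ^ (1 / r) * F ^ (1 / a - 1 / r) := by
          rw [← ENNReal.rpow_add_of_nonneg _ _ h1r.le hra, add_sub_cancel]
        have e2 : K ^ (1 / b) = K ^ (1 / r) * K ^ (1 / b - 1 / r) := by
          rw [← ENNReal.rpow_add_of_nonneg _ _ h1r.le hrb, add_sub_cancel]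
        rw [e1, e2]
        ring

/-- The `ℓ^q` norm of a sequence with values in `[0, ∞]`. -/
def lq (q : ℝ) (c : ℤ → ℝ≥0∞) : ℝ≥0∞ := (∑' k, c k ^ q) ^ (1 / q)

theorem lq_eq_lintegral (q : ℝ) (c : ℤ → ℝ≥0∞) :
    lq q c = (∫⁻ k, c k ^ q ∂Measure.count) ^ (1 / q) := by
  rw [lq, lintegral_count]

theorem lq_mono {q : ℝ} (hq : 0 < q) {c d : ℤ → ℝ≥0∞} (h : ∀ k, c k ≤ d k) : lq q c ≤ lq q d :=
  ENNReal.rpow_le_rpow (ENNReal.tsum_le_tsum fun k => ENNReal.rpow_le_rpow (h k) hq.le)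
    (by positivity)

theorem lq_const_mul {q : ℝ} (hq : 0 < q) (C : ℝ≥0∞) (c : ℤ → ℝ≥0∞) :
    lq q (fun k => C * c k) = C * lq q c := by
  simp_rw [lq, ENNReal.mul_rpow_of_nonneg _ _ hq.le]
  rw [ENNReal.tsum_mul_left, ENNReal.mul_rpow_of_nonneg _ _ (by positivity), ← ENNReal.rpow_mul,
    mul_one_div_cancel hq.ne', ENNReal.rpow_one]

theorem lq_add_le {q : ℝ} (hq : 1 ≤ q) (c d : ℤ → ℝ≥0∞) :
    lq q (fun k => c k + d k) ≤ lq q c + lq q d := by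
  simp_rw [lq_eq_lintegral]
  exact ENNReal.lintegral_Lp_add_le (measurable_of_countable c).aemeasurable
    (measurable_of_countable d).aemeasurable hq

theorem lq_sum_le {ι : Type*} {q : ℝ} (hq : 1 ≤ q) (s : Finset ι) (c : ι → ℤ → ℝ≥0∞) :
    lq q (fun k => ∑ i ∈ s, c i k) ≤ ∑ i ∈ s, lq q (c i) := by
  classical
  induction s using Finset.induction_on with
  | empty =>
    have : 0 < q := by linarith
    simp [lq, this]
  | insert i s hi ih =>
    simp_rw [Finset.sum_insert hi]
    exact (lq_add_le hq _ _).trans (by gcongr)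

theorem lq_shift (q : ℝ) (c : ℤ → ℝ≥0∞) (l : ℤ) : lq q (fun k => c (k + l)) = lq q c := by
  rw [lq, lq, (Equiv.addRight l).tsum_eq (fun k => c k ^ q) |>.symm]
  rfl

theorem le_lq {q : ℝ} (hq : 0 < q) (c : ℤ → ℝ≥0∞) (k : ℤ) : c k ≤ lq q c := by
  calc c k = (c k ^ q) ^ (1 / q) := by
        rw [← ENNReal.rpow_mul, mul_one_div_cancel hq.ne', ENNReal.rpow_one]
    _ ≤ lq q c := ENNReal.rpow_le_rpow (ENNReal.le_tsum k) (by positivity)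

/-- The convolution of two sequences. -/
def sconv (c d : ℤ → ℝ≥0∞) (k : ℤ) : ℝ≥0∞ := ∑' l, c (k - l) * d l

theorem sconv_comm (c d : ℤ → ℝ≥0∞) : sconv c d = sconv d c := by
  funext k
  rw [sconv, sconv, ← (Equiv.subLeft k).tsum_eq]
  simp [mul_comm]

theorem lq_sconv_le {q : ℝ} (hq : 1 ≤ q) (c d : ℤ → ℝ≥0∞) :
    lq q (sconv c d) ≤ (∑' k, c k) * lq q d := by
  have := lintegral_conv_rpow_le (Measure.count (α := ℤ)) (measurable_of_countable c)
    (measurable_of_countable d) (a := 1) (b := q) (r := q) one_pos (by linarith) hq le_rfl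
    (by norm_num)
  simp only [lintegral_count, ENNReal.rpow_one, one_div, inv_one] at this
  simpa [lq, sconv] using this

/-- The weight `⟨k⟩ = 1 + |k|`. -/
def wt (k : ℤ) : ℝ≥0∞ := ENNReal.ofReal (1 + |(k : ℝ)|)

theorem one_le_wt (k : ℤ) : 1 ≤ wt k := by
  rw [wt, ← ENNReal.ofReal_one]
  exact ENNReal.ofReal_le_ofReal (by linarith [abs_nonneg (k : ℝ)])

theorem wt_ne_zero (k : ℤ) : wt k ≠ 0 := (zero_lt_one.trans_le (one_le_wt k)).ne'

theorem wt_ne_top (k : ℤ) : wt k ≠ ⊤ := ENNReal.ofReal_ne_top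

theorem wt_add_le (k l : ℤ) : wt (k + l) ≤ wt k + wt l := by
  rw [wt, wt, wt, ← ENNReal.ofReal_add (by positivity) (by positivity)]
  refine ENNReal.ofReal_le_ofReal ?_
  push_cast
  linarith [abs_add_le (k : ℝ) l]

theorem wt_add_le_mul (k l : ℤ) : wt (k + l) ≤ wt k * wt l := by
  rw [wt, wt, wt, ← ENNReal.ofReal_mul (by positivity)]
  refine ENNReal.ofReal_le_ofReal ?_
  push_cast
  nlinarith [abs_add_le (k : ℝ) l, abs_nonneg (k : ℝ), abs_nonneg (l : ℝ),
    mul_nonneg (abs_nonneg (k : ℝ)) (abs_nonneg (l : ℝ))]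

theorem wt_neg (k : ℤ) : wt (-k) = wt k := by simp [wt]

theorem wt_rpow_ne_top (k : ℤ) (s : ℝ) : wt k ^ s ≠ ⊤ :=
  ENNReal.rpow_ne_top_of_ne_zero (wt_ne_zero k) (wt_ne_top k)

theorem wt_rpow_add (k : ℤ) (s t : ℝ) : wt k ^ (s + t) = wt k ^ s * wt k ^ t :=
  ENNReal.rpow_add _ _ (wt_ne_zero k) (wt_ne_top k)

/-- The weight changes at most by a factor when the frequency is shifted. -/
theorem wt_rpow_add_le (s : ℝ) (k l : ℤ) : wt (k + l) ^ s ≤ wt l ^ |s| * wt k ^ s := by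
  rcases le_total 0 s with hs | hs
  · rw [abs_of_nonneg hs, ← ENNReal.mul_rpow_of_nonneg _ _ hs, mul_comm]
    exact ENNReal.rpow_le_rpow (wt_add_le_mul k l) hs
  · rw [abs_of_nonpos hs]
    have h1 : wt k ≤ wt (k + l) * wt l := by
      simpa [wt_neg] using wt_add_le_mul (k + l) (-l)
    have h2 : wt k ^ (-s) ≤ wt (k + l) ^ (-s) * wt l ^ (-s) := by
      rw [← ENNReal.mul_rpow_of_nonneg _ _ (by linarith)]
      exact ENNReal.rpow_le_rpow h1 (by linarith)
    calc wt (k + l) ^ s = wt (k + l) ^ s * (wt k ^ (-s) * wt k ^ s) := by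
          rw [← wt_rpow_add]; simp
      _ ≤ wt (k + l) ^ s * ((wt (k + l) ^ (-s) * wt l ^ (-s)) * wt k ^ s) := by gcongr
      _ = (wt (k + l) ^ s * wt (k + l) ^ (-s)) * (wt l ^ (-s) * wt k ^ s) := by ring
      _ = wt l ^ (-s) * wt k ^ s := by rw [← wt_rpow_add]; simp

theorem tsum_wt_rpow_lt_top {κ : ℝ} (hκ : 1 < κ) : ∑' k, wt k ^ (-κ) < ⊤ := by
  have h1 : Summable fun k : ℤ => (1 + |(k : ℝ)|) ^ (-κ) := by
    have h0 := (Real.summable_one_div_int_add_rpow 0 κ).2 hκ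
    have h0' : Summable fun k : ℤ => |(k : ℝ)| ^ (-κ) + if k = 0 then 1 else 0 := by
      refine Summable.add ?_ ?_
      · simpa [Real.rpow_neg (abs_nonneg _)] using h0
      · exact summable_of_ne_finset_zero (s := {0}) (by intro b hb; simp at hb; simp [hb])
    refine h0'.of_nonneg_of_le (fun k => by positivity) fun k => ?_
    by_cases hk : k = 0
    · subst hk
      simp only [Int.cast_zero, abs_zero, add_zero, Real.one_rpow, if_true]
      have : (0 : ℝ) ≤ 0 ^ (-κ) := Real.zero_rpow_nonneg _
      linarith
    · simp only [hk, if_false, add_zero]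
      exact Real.rpow_le_rpow_of_nonpos (by positivity) (by linarith) (by linarith)
  have : ∀ k : ℤ, wt k ^ (-κ) = ENNReal.ofReal ((1 + |(k : ℝ)|) ^ (-κ)) := by
    intro k
    rw [wt, ENNReal.ofReal_rpow_of_pos (by positivity)]
  simp_rw [this]
  rw [← ENNReal.ofReal_tsum_of_nonneg (fun k => by positivity) h1]
  exact ENNReal.ofReal_lt_top

/-- The sequences in `ℓ^q` become summable after division by `⟨k⟩^κ`, `κ > 1 - 1 / q`
(and `κ ≥ 0` for `q = 1`). -/
theorem exists_tsum_wt_mul_le {q κ : ℝ} (hq : 1 ≤ q)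
    (hκ : 1 - 1 / q < κ ∨ (q = 1 ∧ 0 ≤ κ)) :
    ∃ C : ℝ≥0∞, C ≠ ⊤ ∧ ∀ d : ℤ → ℝ≥0∞, ∑' k, wt k ^ (-κ) * d k ≤ C * lq q d := by
  by_cases hq1 : q = 1
  · subst hq1
    have h0 : 0 ≤ κ := by
      rcases hκ with h | h
      · norm_num at h; exact h.le
      · exact h.2
    refine ⟨1, by simp, fun d => ?_⟩
    simp only [lq, ENNReal.rpow_one, one_div, inv_one, one_mul]
    refine ENNReal.tsum_le_tsum fun k => ?_
    calc wt k ^ (-κ) * d k ≤ 1 * d k := by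
          gcongr
          rw [ENNReal.rpow_neg, ENNReal.inv_le_one]
          simpa using ENNReal.rpow_le_rpow (one_le_wt k) h0
      _ = d k := one_mul _
  · have hq2 : 1 < q := lt_of_le_of_ne hq (Ne.symm hq1)
    have h0 : 1 - 1 / q < κ := by
      rcases hκ with h | h
      · exact h
      · exact absurd h.1 hq1
    have hc := (Real.HolderConjugate.conjExponent hq2).symm
    set q' := q.conjExponent
    have hq' : 0 < q' := hc.pos
    have hval : 1 / q' = 1 - 1 / q := by
      have := hc.inv_add_inv_eq_one
      simp only [one_div]; linarith
    have h1 : 1 < κ * q' := by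
      have : 1 / q' * q' < κ * q' := by rw [hval]; gcongr
      rwa [one_div_mul_cancel hq'.ne'] at this
    refine ⟨(∑' k, wt k ^ (-(κ * q'))) ^ (1 / q'),
      ENNReal.rpow_ne_top_of_nonneg (by positivity) (tsum_wt_rpow_lt_top h1).ne, fun d => ?_⟩
    have := ENNReal.lintegral_mul_le_Lp_mul_Lq (Measure.count (α := ℤ)) hc
      (f := fun k => wt k ^ (-κ)) (g := d) (measurable_of_countable _).aemeasurable
      (measurable_of_countable _).aemeasurable
    simp only [lintegral_count, Pi.mul_apply, ← ENNReal.rpow_mul, neg_mul] at this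
    exact this

theorem lq_wt_sconv_le {q s η : ℝ} (hq : 1 ≤ q) (hη : 0 ≤ η)
    (hκ : 1 - 1 / q < s + η ∨ (q = 1 ∧ 0 ≤ s + η)) :
    ∃ C : ℝ≥0∞, C ≠ ⊤ ∧ ∀ s₁ : ℝ, s₁ ≤ s → η ≤ s₁ → ∀ c d : ℤ → ℝ≥0∞,
      lq q (fun k => wt k ^ (s₁ - η) * sconv c d k) ≤
        C * (lq q (fun k => wt k ^ s₁ * c k) * lq q (fun k => wt k ^ s * d k)) := by
  obtain ⟨K, hK, hle⟩ := exists_tsum_wt_mul_le hq hκ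
  have hq0 : 0 < q := by linarith
  refine ⟨2 ^ s * (2 * K), ENNReal.mul_ne_top (by
    by_cases h : 0 ≤ s
    · exact ENNReal.rpow_ne_top_of_nonneg h (by simp)
    · exact ENNReal.rpow_ne_top_of_ne_zero (by simp) (by simp)) (ENNReal.mul_ne_top (by simp) hK),
    fun s₁ hs₁ hs₁' c d => ?_⟩
  have hσ : 0 ≤ s₁ - η := by linarith
  have hdec : ∀ (k : ℤ) (x y : ℝ), 0 ≤ y → wt k ^ (x - y) = wt k ^ x * wt k ^ (-y) := by
    intro k x y _
    rw [sub_eq_add_neg, wt_rpow_add]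
  have hmono : ∀ (k l : ℤ) (y : ℝ), 0 ≤ y → wt k ≤ wt l → wt l ^ (-y) ≤ wt k ^ (-y) := by
    intro k l y hy h
    rw [ENNReal.rpow_neg, ENNReal.rpow_neg, ENNReal.inv_le_inv]
    exact ENNReal.rpow_le_rpow h hy
  have hpt : ∀ k l : ℤ, wt (k + l) ^ (s₁ - η) ≤ 2 ^ s *
      (wt k ^ s₁ * wt l ^ (-η) + wt l ^ s * wt k ^ (-(s - (s₁ - η)))) := by
    intro k l
    have h2 : (2 : ℝ≥0∞) ^ (s₁ - η) ≤ 2 ^ s :=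
      ENNReal.rpow_le_rpow_of_exponent_le (by norm_num) (by linarith)
    rcases le_total (wt l) (wt k) with h | h
    · calc wt (k + l) ^ (s₁ - η) ≤ (2 * wt k) ^ (s₁ - η) := by
            refine ENNReal.rpow_le_rpow ((wt_add_le k l).trans ?_) hσ
            rw [two_mul]; gcongr
        _ = 2 ^ (s₁ - η) * (wt k ^ s₁ * wt k ^ (-η)) := by
            rw [ENNReal.mul_rpow_of_nonneg _ _ hσ, hdec _ _ _ hη]
        _ ≤ 2 ^ s * (wt k ^ s₁ * wt l ^ (-η)) := by
            exact mul_le_mul' h2 (mul_le_mul_right (hmono l k η hη h) _)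
        _ ≤ _ := by gcongr; exact le_self_add
    · calc wt (k + l) ^ (s₁ - η) ≤ (2 * wt l) ^ (s₁ - η) := by
            refine ENNReal.rpow_le_rpow ((wt_add_le k l).trans ?_) hσ
            rw [two_mul]; gcongr
        _ = 2 ^ (s₁ - η) * (wt l ^ s * wt l ^ (-(s - (s₁ - η)))) := by
            rw [ENNReal.mul_rpow_of_nonneg _ _ hσ, ← wt_rpow_add]
            congr 2; ring
        _ ≤ 2 ^ s * (wt l ^ s * wt k ^ (-(s - (s₁ - η)))) := by
            exact mul_le_mul' h2 (mul_le_mul_right (hmono k l _ (by linarith) h) _)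
        _ ≤ _ := by gcongr; exact le_add_self
  have hpt2 : ∀ k, wt k ^ (s₁ - η) * sconv c d k ≤ 2 ^ s *
      (sconv (fun k => wt k ^ (-η) * d k) (fun k => wt k ^ s₁ * c k) k +
        sconv (fun k => wt k ^ (-(s - (s₁ - η))) * c k) (fun k => wt k ^ s * d k) k) := by
    intro k
    rw [sconv_comm (fun k => wt k ^ (-η) * d k), sconv, sconv, sconv, ← ENNReal.tsum_add,
      ← ENNReal.tsum_mul_left, ← ENNReal.tsum_mul_left]
    refine ENNReal.tsum_le_tsum fun l => ?_
    have := hpt (k - l) l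
    rw [sub_add_cancel] at this
    calc wt k ^ (s₁ - η) * (c (k - l) * d l) ≤ (2 ^ s *
      (wt (k - l) ^ s₁ * wt l ^ (-η) + wt l ^ s * wt (k - l) ^ (-(s - (s₁ - η))))) *
          (c (k - l) * d l) := by gcongr
      _ = _ := by ring
  have e1 : ∑' k, wt k ^ (-η) * d k ≤ K * lq q (fun k => wt k ^ s * d k) := by
    refine le_trans (le_of_eq ?_) (hle _)
    congr 1; funext k
    rw [← mul_assoc, ← wt_rpow_add]; congr 2; ring
  have e2 : ∑' k, wt k ^ (-(s - (s₁ - η))) * c k ≤ K * lq q (fun k => wt k ^ s₁ * c k) := by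
    refine le_trans (le_of_eq ?_) (hle _)
    congr 1; funext k
    rw [← mul_assoc, ← wt_rpow_add]; congr 2; ring
  calc lq q (fun k => wt k ^ (s₁ - η) * sconv c d k)
      ≤ 2 ^ s * (lq q (sconv (fun k => wt k ^ (-η) * d k) (fun k => wt k ^ s₁ * c k)) +
        lq q (sconv (fun k => wt k ^ (-(s - (s₁ - η))) * c k) (fun k => wt k ^ s * d k))) := by
        refine (lq_mono hq0 hpt2).trans ?_
        rw [lq_const_mul hq0]
        gcongr
        exact lq_add_le hq _ _
    _ ≤ 2 ^ s * ((K * lq q (fun k => wt k ^ s * d k)) * lq q (fun k => wt k ^ s₁ * c k) +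
        (K * lq q (fun k => wt k ^ s₁ * c k)) * lq q (fun k => wt k ^ s * d k)) := by
        gcongr
        · exact (lq_sconv_le hq _ _).trans (by gcongr)
        · exact (lq_sconv_le hq _ _).trans (by gcongr)
    _ = _ := by ring

/-! ### Fourier multipliers on Schwartz functions -/

/-- The symbol `m` has temperate growth (in the variable of Mathlib's Fourier transform). -/
def TG (m : ℝ → ℂ) : Prop := (fun ξ : ℝ => m (2 * Real.pi * ξ)).HasTemperateGrowth

theorem TG.mul {m n : ℝ → ℂ} (hm : TG m) (hn : TG n) : TG (fun ξ => m ξ * n ξ) :=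
  Function.HasTemperateGrowth.mul hm hn

/-- `m(D)` on Schwartz functions. -/
def mulS (m : ℝ → ℂ) : 𝓢(ℝ, ℂ) →L[ℂ] 𝓢(ℝ, ℂ) :=
  SchwartzMap.fourierMultiplierCLM ℂ (fun ξ : ℝ => m (2 * Real.pi * ξ))

theorem fourier_mulS {m : ℝ → ℂ} (hm : TG m) (f : 𝓢(ℝ, ℂ)) (ξ : ℝ) :
    𝓕 (mulS m f) ξ = m (2 * Real.pi * ξ) * 𝓕 f ξ := by
  rw [mulS, SchwartzMap.fourierMultiplierCLM_apply, FourierTransform.fourier_fourierInv_eq,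
    SchwartzMap.smulLeftCLM_apply_apply hm, smul_eq_mul]

theorem schwartz_ext_fourier {f g : 𝓢(ℝ, ℂ)} (h : ∀ ξ, 𝓕 f ξ = 𝓕 g ξ) : f = g := by
  have : 𝓕 f = 𝓕 g := SchwartzMap.ext h
  have h2 : 𝓕⁻ (𝓕 f) = 𝓕⁻ (𝓕 g) := by rw [this]
  simpa using h2

theorem mulS_mulS {m n : ℝ → ℂ} (hm : TG m) (hn : TG n) (f : 𝓢(ℝ, ℂ)) :
    mulS m (mulS n f) = mulS (fun ξ => m ξ * n ξ) f := by
  refine schwartz_ext_fourier fun ξ => ?_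
  rw [fourier_mulS hm, fourier_mulS hn, fourier_mulS (hm.mul hn)]
  ring

theorem multiplier_multiplier {m n : ℝ → ℂ} (hm : TG m) (hn : TG n) (T : 𝓢'(ℝ, ℂ)) :
    multiplier m (multiplier n T) = multiplier (fun ξ => m ξ * n ξ) T := by
  rw [multiplier, multiplier, multiplier,
    TemperedDistribution.fourierMultiplierCLM_fourierMultiplierCLM_apply hn hm]
  congr 2
  funext ξ
  exact mul_comm _ _

theorem multiplier_comm {m n : ℝ → ℂ} (hm : TG m) (hn : TG n) (T : 𝓢'(ℝ, ℂ)) :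
    multiplier m (multiplier n T) = multiplier n (multiplier m T) := by
  rw [multiplier_multiplier hm hn, multiplier_multiplier hn hm]
  congr 2
  funext ξ
  exact mul_comm _ _

theorem multiplier_coe {m : ℝ → ℂ} (hm : TG m) (f : 𝓢(ℝ, ℂ)) :
    multiplier m (SchwartzMap.toTemperedDistributionCLM ℝ ℂ volume f) =
      SchwartzMap.toTemperedDistributionCLM ℝ ℂ volume (mulS m f) :=
  TemperedDistribution.fourierMultiplierCLM_toTemperedDistributionCLM_eq hm f

theorem multiplier_sum {ι : Type*} (s : Finset ι) {m : ι → ℝ → ℂ} (hm : ∀ i ∈ s, TG (m i))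
    (T : 𝓢'(ℝ, ℂ)) :
    multiplier (fun ξ => ∑ i ∈ s, m i ξ) T = ∑ i ∈ s, multiplier (m i) T := by
  have := TemperedDistribution.fourierMultiplierCLM_sum ℂ
    (g := fun i (ξ : ℝ) => m i (2 * Real.pi * ξ)) (s := s) hm
  simp only [multiplier]
  rw [this]
  ext f
  simp

theorem mulS_sum {ι : Type*} (s : Finset ι) {m : ι → ℝ → ℂ} (hm : ∀ i ∈ s, TG (m i))
    (f : 𝓢(ℝ, ℂ)) :
    mulS (fun ξ => ∑ i ∈ s, m i ξ) f = ∑ i ∈ s, mulS (m i) f := by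
  have := SchwartzMap.fourierMultiplierCLM_sum ℂ
    (g := fun i (ξ : ℝ) => m i (2 * Real.pi * ξ)) (s := s) hm
  simp only [mulS]
  rw [this]
  simp

/-- A smooth compactly supported symbol. -/
structure Sym (m : ℝ → ℂ) : Prop where
  smooth : ContDiff ℝ ∞ m
  compact : HasCompactSupport m

namespace Sym

variable {m : ℝ → ℂ}

theorem scaled_smooth (h : Sym m) : ContDiff ℝ ∞ (fun ξ : ℝ => m (2 * Real.pi * ξ)) :=
  h.smooth.comp (contDiff_const.mul contDiff_id)

theorem scaled_compact (h : Sym m) : HasCompactSupport (fun ξ : ℝ => m (2 * Real.pi * ξ)) :=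
  h.compact.comp_homeomorph (Homeomorph.mulLeft₀ (2 * Real.pi) Real.two_pi_pos.ne')

theorem tg (h : Sym m) : TG m := h.scaled_compact.hasTemperateGrowth h.scaled_smooth

/-- The symbol as a Schwartz function. -/
def toS (h : Sym m) : 𝓢(ℝ, ℂ) := h.scaled_compact.toSchwartzMap h.scaled_smooth

/-- The convolution kernel of `m(D)`. -/
def ker (h : Sym m) : 𝓢(ℝ, ℂ) := 𝓕⁻ h.toS

theorem toS_apply (h : Sym m) (ξ : ℝ) : h.toS ξ = m (2 * Real.pi * ξ) := rfl

theorem mulS_apply (h : Sym m) (f : 𝓢(ℝ, ℂ)) (x : ℝ) :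
    mulS m f x = ∫ y, h.ker (x - y) * f y := by
  have h1 : mulS m f = SchwartzMap.convolution (ContinuousLinearMap.mul ℂ ℂ) h.ker f := by
    refine schwartz_ext_fourier fun ξ => ?_
    rw [fourier_mulS h.tg, SchwartzMap.fourier_convolution, SchwartzMap.pairing_apply_apply, ker,
      FourierTransform.fourier_fourierInv_eq, toS_apply]
    rfl
  rw [h1, SchwartzMap.convolution_apply, MeasureTheory.convolution_def]
  rw [← integral_sub_left_eq_self _ _ x]
  simp

end Sym

theorem Sym.mul_right {m n : ℝ → ℂ} (hm : Sym m) (hn : ContDiff ℝ ∞ n) :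
    Sym (fun ξ => m ξ * n ξ) :=
  ⟨hm.smooth.mul hn, hm.compact.mul_right⟩

theorem enorm_mulS_le {m : ℝ → ℂ} (h : Sym m) (f : 𝓢(ℝ, ℂ)) (x : ℝ) :
    ‖mulS m f x‖ₑ ≤ ∫⁻ y, ‖h.ker (x - y)‖ₑ * ‖f y‖ₑ := by
  rw [h.mulS_apply]
  refine (enorm_integral_le_lintegral_enorm _).trans_eq ?_
  simp_rw [enorm_mul]

theorem eLpNorm_mulS_le {m : ℝ → ℂ} (h : Sym m) (f : 𝓢(ℝ, ℂ)) {p : ℝ≥0∞} (hp : 1 ≤ p)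
    (hp' : p ≠ ⊤) : eLpNorm (mulS m f) p ≤ eLpNorm h.ker 1 * eLpNorm f p := by
  have hp0 : p ≠ 0 := (zero_lt_one.trans_le hp).ne'
  have hpr : 1 ≤ p.toReal := by
    simpa using ENNReal.toReal_mono hp' hp
  rw [eLpNorm_eq_lintegral_rpow_enorm_toReal hp0 hp', eLpNorm_eq_lintegral_rpow_enorm_toReal hp0 hp',
    eLpNorm_one_eq_lintegral_enorm]
  have := lintegral_conv_rpow_le (volume : Measure ℝ) (f := fun x => ‖h.ker x‖ₑ)
    (g := fun x => ‖f x‖ₑ) h.ker.continuous.measurable.enorm f.continuous.measurable.enorm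
    (a := 1) (b := p.toReal) (r := p.toReal) one_pos (by linarith) hpr le_rfl (by norm_num)
  simp only [ENNReal.rpow_one, one_div, inv_one] at this
  rw [one_div]
  refine le_trans ?_ this
  gcongr with x
  exact enorm_mulS_le h f x

theorem norm_mulS_le_of_norm_ker_le {m : ℝ → ℂ} (h : Sym m) {A : ℝ} (hA : ∀ x, ‖h.ker x‖ ≤ A)
    (f : 𝓢(ℝ, ℂ)) (x : ℝ) : ‖mulS m f x‖ ≤ A * ∫ y, ‖f y‖ := by
  rw [h.mulS_apply, ← integral_const_mul]
  refine norm_integral_le_of_norm_le (f.integrable.norm.const_mul A) (ae_of_all _ fun y => ?_)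
  rw [norm_mul]
  gcongr
  exact hA _

theorem norm_mulS_le_of_norm_le {m : ℝ → ℂ} (h : Sym m) {M : ℝ} (f : 𝓢(ℝ, ℂ))
    (hM : ∀ x, ‖f x‖ ≤ M) (x : ℝ) : ‖mulS m f x‖ ≤ (∫ y, ‖h.ker y‖) * M := by
  rw [h.mulS_apply, ← integral_sub_left_eq_self (fun y => ‖h.ker y‖) volume x,
    ← integral_mul_const]
  refine norm_integral_le_of_norm_le
    (((integrable_comp_sub_left _ x).2 h.ker.integrable.norm).mul_const M) (ae_of_all _ fun y => ?_)
  rw [norm_mul]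
  gcongr
  exact hM _

theorem norm_ker_le {m : ℝ → ℂ} (h : Sym m) (x : ℝ) :
    ‖h.ker x‖ ≤ ‖∫ ξ, m ξ * Complex.exp (Complex.I * (x * ξ))‖ := by
  have h1 : h.ker x = ∫ ξ : ℝ, m (2 * Real.pi * ξ) * Complex.exp (Complex.I * (x * (2 * Real.pi * ξ : ℝ))) := by
    rw [Sym.ker, SchwartzMap.fourierInv_coe, Real.fourierInv_eq']
    refine integral_congr_ae (ae_of_all _ fun ξ => ?_)
    simp only [Sym.toS_apply, smul_eq_mul]
    rw [mul_comm]
    congr 2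
    simp only [RCLike.inner_apply, conj_trivial]
    push_cast
    ring
  rw [h1, Measure.integral_comp_mul_left (fun ξ : ℝ => m ξ * Complex.exp (Complex.I * (x * (ξ : ℝ)))),
    norm_smul]
  refine mul_le_of_le_one_left (norm_nonneg _) ?_
  rw [Real.norm_eq_abs, abs_abs, abs_inv, abs_of_pos Real.two_pi_pos]
  exact inv_le_one_of_one_le₀ (by linarith [Real.pi_gt_three])

theorem integral_norm_sq_le_of_support {g : ℝ → ℂ} {a b B : ℝ} (hab : a ≤ b)
    (hs : ∀ x, x ∉ Set.Icc a b → g x = 0) (hB : ∀ x, ‖g x‖ ≤ B) :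
    ∫ x, ‖g x‖ ^ 2 ≤ B ^ 2 * (b - a) := by
  have h1 : ∫ x, ‖g x‖ ^ 2 = ∫ x in Set.Icc a b, ‖g x‖ ^ 2 := by
    rw [setIntegral_eq_integral_of_forall_compl_eq_zero]
    intro x hx
    simp [hs x hx]
  have h2 := norm_setIntegral_le_of_norm_le_const (μ := volume) (s := Set.Icc a b)
    (f := fun x => ‖g x‖ ^ 2) (C := B ^ 2) (by simp) (fun x _ => by
      rw [norm_pow, norm_norm]
      exact pow_le_pow_left₀ (norm_nonneg _) (hB x) 2)
  rw [h1]
  refine (le_abs_self _).trans (h2.trans_eq ?_)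
  rw [Measure.real, Real.volume_Icc, ENNReal.toReal_ofReal (by linarith)]

theorem schwartz_lineDeriv_one (f : 𝓢(ℝ, ℂ)) (x : ℝ) :
    LineDeriv.lineDerivOp (1 : ℝ) f x = deriv f x := by
  rw [SchwartzMap.lineDerivOp_apply, DifferentiableAt.lineDeriv_eq_fderiv f.differentiableAt,
    fderiv_apply_one_eq_deriv]

theorem norm_fourierInv_deriv (f : 𝓢(ℝ, ℂ)) (x : ℝ) :
    ‖𝓕⁻ (LineDeriv.lineDerivOp (1 : ℝ) f) x‖ = 2 * Real.pi * (|x| * ‖𝓕⁻ f x‖) := by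
  rw [SchwartzMap.fourierInv_lineDerivOp_eq]
  have hg : Function.HasTemperateGrowth (fun x : ℝ => inner ℝ x (1 : ℝ)) := by fun_prop
  rw [smul_apply, SchwartzMap.smulLeftCLM_apply_apply hg, norm_smul, norm_smul]
  simp [abs_of_pos Real.pi_pos]

theorem integral_norm_sq_fourierInv (f : 𝓢(ℝ, ℂ)) : ∫ x, ‖𝓕⁻ f x‖ ^ 2 = ∫ x, ‖f x‖ ^ 2 := by
  rw [← SchwartzMap.integral_norm_sq_fourier (𝓕⁻ f), FourierTransform.fourier_fourierInv_eq]

theorem integrable_sq (f : 𝓢(ℝ, ℂ)) : Integrable fun x => ‖f x‖ ^ 2 :=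
  (f.memLp 2).integrable_norm_pow two_ne_zero

theorem integral_norm_ker_le {m : ℝ → ℂ} (h : Sym m) {c B : ℝ} (hB0 : 0 < B)
    (hs : ∀ ξ, m ξ ≠ 0 → |ξ - c| ≤ 2) (hB : ∀ ξ, ‖m ξ‖ ≤ B) (hB' : ∀ ξ, ‖deriv m ξ‖ ≤ B) :
    ∫ x, ‖h.ker x‖ ≤ 3 * B := by
  have hpi := Real.pi_gt_three
  have hpi' := Real.pi_lt_d2
  set a := (c - 2) / (2 * Real.pi)
  set b := (c + 2) / (2 * Real.pi)
  have hab : b - a ≤ 1 := by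
    rw [← sub_div, div_le_one (by positivity)]; linarith
  have hab' : a ≤ b := by
    simp only [a, b]; gcongr; linarith
  have hout : ∀ x, x ∉ Set.Icc a b → 2 < |2 * Real.pi * x - c| := by
    intro x hx
    by_contra! hcon
    rw [abs_le] at hcon
    apply hx
    simp only [a, b]
    constructor
    · rw [div_le_iff₀ (by positivity)]; linarith
    · rw [le_div_iff₀ (by positivity)]; linarith
  have hz : ∀ ξ, 2 < |ξ - c| → m ξ = 0 := by
    intro ξ hξ
    by_contra hne
    linarith [hs ξ hne]
  have hz' : ∀ ξ, 2 < |ξ - c| → deriv m ξ = 0 := by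
    intro ξ hξ
    have : m =ᶠ[𝓝 ξ] fun _ => 0 := by
      have hc : Continuous fun ξ : ℝ => |ξ - c| := by fun_prop
      filter_upwards [hc.continuousAt.eventually_const_lt hξ] with y hy
      exact hz y hy
    rw [this.deriv_eq]
    simp
  have hder : ∀ ξ, LineDeriv.lineDerivOp (1 : ℝ) h.toS ξ =
      (2 * Real.pi : ℝ) • deriv m (2 * Real.pi * ξ) := by
    intro ξ
    rw [schwartz_lineDeriv_one]
    have : (h.toS : ℝ → ℂ) = fun ξ => m (2 * Real.pi * ξ) := rfl
    have hm : HasDerivAt m (deriv m (2 * Real.pi * ξ)) (2 * Real.pi * ξ) :=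
      (h.smooth.differentiable (by simp)).differentiableAt.hasDerivAt
    have hl : HasDerivAt (fun ξ : ℝ => 2 * Real.pi * ξ) (2 * Real.pi) ξ := by
      simpa using (hasDerivAt_id ξ).const_mul (2 * Real.pi)
    rw [this]
    exact (hm.scomp ξ hl).deriv
  have e1 : ∫ x, ‖h.ker x‖ ^ 2 ≤ B ^ 2 := by
    rw [Sym.ker, integral_norm_sq_fourierInv]
    refine (integral_norm_sq_le_of_support hab' (fun x hx => ?_) (fun x => hB _)).trans ?_
    · exact hz _ (hout x hx)
    · nlinarith [sq_nonneg B]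
  have e2 : ∫ x, (x ^ 2 * ‖h.ker x‖ ^ 2) ≤ B ^ 2 := by
    have h3 : ∫ x, ‖𝓕⁻ (LineDeriv.lineDerivOp (1 : ℝ) h.toS) x‖ ^ 2 ≤ (2 * Real.pi * B) ^ 2 := by
      rw [integral_norm_sq_fourierInv]
      refine (integral_norm_sq_le_of_support (B := 2 * Real.pi * B) hab' (fun x hx => ?_)
        (fun x => ?_)).trans ?_
      · rw [hder, hz' _ (hout x hx), smul_zero]
      · rw [hder, norm_smul, Real.norm_eq_abs, abs_of_pos Real.two_pi_pos]
        gcongr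
        exact hB' _
      · nlinarith [sq_nonneg (2 * Real.pi * B)]
    simp_rw [norm_fourierInv_deriv, mul_pow, integral_const_mul, sq_abs] at h3
    have h4 : (0 : ℝ) < 2 ^ 2 * Real.pi ^ 2 := by positivity
    exact le_of_mul_le_mul_left h3 h4
  have i2 : Integrable fun x => x ^ 2 * ‖h.ker x‖ ^ 2 := by
    have := integrable_sq (𝓕⁻ (LineDeriv.lineDerivOp (1 : ℝ) h.toS))
    simp_rw [norm_fourierInv_deriv, mul_pow, sq_abs] at this
    have h5 := this.const_mul ((2 ^ 2 * Real.pi ^ 2)⁻¹)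
    refine h5.congr (ae_of_all _ fun x => ?_)
    have h4 : (2 : ℝ) ^ 2 * Real.pi ^ 2 ≠ 0 := by positivity
    simp only [Sym.ker]
    field_simp
  calc ∫ x, ‖h.ker x‖ ≤ ∫ x, ((B / 2) * (1 + x ^ 2)⁻¹ +
        (2 * B)⁻¹ * (‖h.ker x‖ ^ 2 + x ^ 2 * ‖h.ker x‖ ^ 2)) := by
        refine integral_mono h.ker.integrable.norm
          ((integrable_inv_one_add_sq.const_mul _).add
            (((integrable_sq h.ker).add i2).const_mul _)) fun x => ?_
        simp only
        set y := ‖h.ker x‖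
        have hx : 0 < 1 + x ^ 2 := by positivity
        have : (B / 2) * (1 + x ^ 2)⁻¹ + (2 * B)⁻¹ * (y ^ 2 + x ^ 2 * y ^ 2) - y =
            (B - (1 + x ^ 2) * y) ^ 2 / (2 * B * (1 + x ^ 2)) := by
          field_simp
          ring
        have h6 : 0 ≤ (B - (1 + x ^ 2) * y) ^ 2 / (2 * B * (1 + x ^ 2)) := by positivity
        linarith
    _ = (B / 2) * Real.pi + (2 * B)⁻¹ * ((∫ x, ‖h.ker x‖ ^ 2) + ∫ x, x ^ 2 * ‖h.ker x‖ ^ 2) := by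
        have i3 : Integrable fun x => ‖h.ker x‖ ^ 2 + x ^ 2 * ‖h.ker x‖ ^ 2 :=
          (integrable_sq h.ker).add i2
        rw [integral_add (integrable_inv_one_add_sq.const_mul _) (i3.const_mul _),
          integral_const_mul, integral_const_mul,
          integral_univ_inv_one_add_sq, integral_add (integrable_sq h.ker) i2]
    _ ≤ (B / 2) * Real.pi + (2 * B)⁻¹ * (B ^ 2 + B ^ 2) := by gcongr
    _ = B * (Real.pi / 2 + 1) := by field_simp; ring
    _ ≤ 3 * B := by nlinarith

theorem eLpNorm_ker_one_le {m : ℝ → ℂ} (h : Sym m) {c B : ℝ} (hB0 : 0 < B)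
    (hs : ∀ ξ, m ξ ≠ 0 → |ξ - c| ≤ 2) (hB : ∀ ξ, ‖m ξ‖ ≤ B) (hB' : ∀ ξ, ‖deriv m ξ‖ ≤ B) :
    eLpNorm h.ker 1 ≤ ENNReal.ofReal (3 * B) := by
  rw [eLpNorm_one_eq_lintegral_enorm, ← ofReal_integral_norm_eq_lintegral_enorm h.ker.integrable]
  exact ENNReal.ofReal_le_ofReal (integral_norm_ker_le h hB0 hs hB hB')

/-- Almost orthogonality. -/
theorem integral_norm_sq_sum_mulS_le {ι : Type*} (s : Finset ι) {m : ι → ℝ → ℂ} {M : ℝ}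
    (hm : ∀ i ∈ s, TG (m i)) (hM : ∀ ξ, ∑ i ∈ s, ‖m i ξ‖ ^ 2 ≤ M) (g : ι → 𝓢(ℝ, ℂ)) :
    ∫ x, ‖(∑ i ∈ s, mulS (m i) (g i)) x‖ ^ 2 ≤ M * ∑ i ∈ s, ∫ x, ‖g i x‖ ^ 2 := by
  have h1 : ∀ ξ, 𝓕 (∑ i ∈ s, mulS (m i) (g i)) ξ =
      ∑ i ∈ s, m i (2 * Real.pi * ξ) * 𝓕 (g i) ξ := by
    intro ξ
    have : 𝓕 (∑ i ∈ s, mulS (m i) (g i)) = ∑ i ∈ s, 𝓕 (mulS (m i) (g i)) :=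
      map_sum (FourierTransform.fourierCLM ℂ 𝓢(ℝ, ℂ)) _ _
    rw [this, sum_apply]
    exact Finset.sum_congr rfl fun i hi => fourier_mulS (hm i hi) _ _
  rw [← SchwartzMap.integral_norm_sq_fourier]
  calc ∫ ξ, ‖𝓕 (∑ i ∈ s, mulS (m i) (g i)) ξ‖ ^ 2
      ≤ ∫ ξ, M * ∑ i ∈ s, ‖𝓕 (g i) ξ‖ ^ 2 := by
        refine integral_mono (integrable_sq _)
          ((integrable_finsetSum _ fun i _ => integrable_sq (𝓕 (g i))).const_mul M) fun ξ => ?_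
        simp only
        rw [h1]
        calc ‖∑ i ∈ s, m i (2 * Real.pi * ξ) * 𝓕 (g i) ξ‖ ^ 2
            ≤ (∑ i ∈ s, ‖m i (2 * Real.pi * ξ)‖ * ‖𝓕 (g i) ξ‖) ^ 2 := by
              gcongr
              refine (norm_sum_le _ _).trans_eq ?_
              simp
          _ ≤ (∑ i ∈ s, ‖m i (2 * Real.pi * ξ)‖ ^ 2) * ∑ i ∈ s, ‖𝓕 (g i) ξ‖ ^ 2 :=
              Finset.sum_mul_sq_le_sq_mul_sq _ _ _
          _ ≤ _ := by
              gcongr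
              exact hM _
    _ = M * ∑ i ∈ s, ∫ x, ‖g i x‖ ^ 2 := by
        rw [integral_const_mul, integral_finsetSum _ fun i _ => integrable_sq (𝓕 (g i))]
        congr 1
        exact Finset.sum_congr rfl fun i _ => SchwartzMap.integral_norm_sq_fourier (g i)

/-! ### Real interpolation on Schwartz functions -/

theorem lintegral_Ioi_indicator_rpow {p L : ℝ} (hp : 2 < p) (hL : 0 ≤ L) :
    ∫⁻ h in Set.Ioi (0 : ℝ), (Set.Iic L).indicator (fun h => ENNReal.ofReal (h ^ (p - 3))) h =
      ENNReal.ofReal (L ^ (p - 2) / (p - 2)) := by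
  rw [lintegral_indicator measurableSet_Iic, Measure.restrict_restrict measurableSet_Iic,
    Set.inter_comm, Set.Ioi_inter_Iic]
  have hint : IntervalIntegrable (fun h : ℝ => h ^ (p - 3)) volume 0 L :=
    intervalIntegral.intervalIntegrable_rpow' (by linarith)
  rw [← ofReal_integral_eq_lintegral_ofReal
    ((intervalIntegrable_iff_integrableOn_Ioc_of_le hL).1 hint)
    ((ae_restrict_iff' measurableSet_Ioc).2 (ae_of_all _ fun h hh => Real.rpow_nonneg hh.1.le _)),
    ← intervalIntegral.integral_of_le hL, integral_rpow (Or.inl (by linarith))]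
  congr 1
  rw [show p - 3 + 1 = p - 2 by ring, Real.zero_rpow (by linarith), sub_zero]

theorem lintegral_rpow_le_of_meas_le {ι : Type*} (s : Finset ι) {p : ℝ} (hp : 2 < p) {H : ℝ → ℂ}
    (hH : Continuous H) {M : ℝ≥0∞} {w : ι → ℝ → ℝ≥0∞} {L : ι → ℝ → ℝ}
    (hw : ∀ i, Measurable (w i)) (hL : ∀ i, Measurable (L i)) (hL0 : ∀ i x, 0 ≤ L i x)
    (hle : ∀ h : ℝ, 0 < h → volume {x | h < ‖H x‖} ≤ ENNReal.ofReal (4 / h ^ 2) *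
      (M * ∑ i ∈ s, ∫⁻ x, {x | h ≤ L i x}.indicator (w i) x)) :
    ∫⁻ x, ‖H x‖ₑ ^ p ≤ ENNReal.ofReal (4 * p / (p - 2)) *
      (M * ∑ i ∈ s, ∫⁻ x, w i x * ENNReal.ofReal (L i x ^ (p - 2))) := by
  have hp0 : 0 < p := by linarith
  have hp2 : 0 < p - 2 := by linarith
  have h1 : ∫⁻ x, ‖H x‖ₑ ^ p = ∫⁻ x, ENNReal.ofReal (‖H x‖ ^ p) := by
    refine lintegral_congr fun x => ?_
    rw [← ofReal_norm, ENNReal.ofReal_rpow_of_nonneg (norm_nonneg _) hp0.le]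
  rw [h1, lintegral_rpow_eq_lintegral_meas_lt_mul volume (ae_of_all _ fun x => norm_nonneg _)
    hH.norm.measurable.aemeasurable hp0]
  have hmeas : ∀ i, Measurable fun z : ℝ × ℝ =>
      (Set.Iic (L i z.2)).indicator (fun h => ENNReal.ofReal (h ^ (p - 3))) z.1 * w i z.2 := by
    intro i
    refine Measurable.mul ?_ ((hw i).comp measurable_snd)
    have : (fun z : ℝ × ℝ => (Set.Iic (L i z.2)).indicator
        (fun h => ENNReal.ofReal (h ^ (p - 3))) z.1) =
        {z : ℝ × ℝ | z.1 ≤ L i z.2}.indicator (fun z => ENNReal.ofReal (z.1 ^ (p - 3))) := by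
      funext z; rfl
    rw [this]
    exact Measurable.indicator (measurable_fst.pow_const _).ennreal_ofReal
      (measurableSet_le measurable_fst ((hL i).comp measurable_snd))
  have h2 : ∀ h ∈ Set.Ioi (0 : ℝ), volume {x | h < ‖H x‖} * ENNReal.ofReal (h ^ (p - 1)) ≤
      4 * M * ∑ i ∈ s, ∫⁻ x,
        (Set.Iic (L i x)).indicator (fun h => ENNReal.ofReal (h ^ (p - 3))) h * w i x := by
    intro h hh
    have hh0 : 0 < h := hh
    calc volume {x | h < ‖H x‖} * ENNReal.ofReal (h ^ (p - 1))
        ≤ (ENNReal.ofReal (4 / h ^ 2) *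
          (M * ∑ i ∈ s, ∫⁻ x, {x | h ≤ L i x}.indicator (w i) x)) *
            ENNReal.ofReal (h ^ (p - 1)) := by
          gcongr; exact hle h hh0
      _ = (ENNReal.ofReal (4 / h ^ 2) * ENNReal.ofReal (h ^ (p - 1))) *
          (M * ∑ i ∈ s, ∫⁻ x, {x | h ≤ L i x}.indicator (w i) x) := by ring
      _ = (4 * ENNReal.ofReal (h ^ (p - 3))) *
          (M * ∑ i ∈ s, ∫⁻ x, {x | h ≤ L i x}.indicator (w i) x) := by
          congr 1
          rw [← ENNReal.ofReal_mul (by positivity), show (4 : ℝ≥0∞) = ENNReal.ofReal 4 by simp,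
            ← ENNReal.ofReal_mul (by norm_num)]
          congr 1
          rw [show p - 3 = p - 1 - 2 by ring, Real.rpow_sub hh0 (p - 1) 2]
          norm_num
          ring
      _ = 4 * M * (ENNReal.ofReal (h ^ (p - 3)) *
          ∑ i ∈ s, ∫⁻ x, {x | h ≤ L i x}.indicator (w i) x) := by ring
      _ = _ := by
          rw [Finset.mul_sum]
          congr 1
          refine Finset.sum_congr rfl fun i _ => ?_
          rw [← lintegral_const_mul _ ((hw i).indicator (measurableSet_le measurable_const (hL i)))]
          refine lintegral_congr fun x => ?_
          by_cases hx : h ≤ L i x <;> simp [Set.indicator, hx]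
  calc ENNReal.ofReal p * ∫⁻ h in Set.Ioi (0 : ℝ),
        volume {x | h < ‖H x‖} * ENNReal.ofReal (h ^ (p - 1))
      ≤ ENNReal.ofReal p * ∫⁻ h in Set.Ioi (0 : ℝ), 4 * M * ∑ i ∈ s, ∫⁻ x,
        (Set.Iic (L i x)).indicator (fun h => ENNReal.ofReal (h ^ (p - 3))) h * w i x := by
        gcongr 1
        exact setLIntegral_mono' measurableSet_Ioi h2
    _ = ENNReal.ofReal p * (4 * M * ∑ i ∈ s, ∫⁻ x, w i x *
          ENNReal.ofReal (L i x ^ (p - 2) / (p - 2))) := by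
        congr 1
        rw [lintegral_const_mul _ (Finset.measurable_sum _ fun i _ =>
          (hmeas i).lintegral_prod_right'),
          lintegral_finsetSum _ fun i _ => (hmeas i).lintegral_prod_right']
        congr 1
        refine Finset.sum_congr rfl fun i _ => ?_
        rw [lintegral_lintegral_swap (hmeas i).aemeasurable]
        refine lintegral_congr fun x => ?_
        change ∫⁻ h in Set.Ioi (0 : ℝ), (Set.Iic (L i x)).indicator
          (fun h => ENNReal.ofReal (h ^ (p - 3))) h * w i x = _
        rw [lintegral_mul_const, lintegral_Ioi_indicator_rpow hp (hL0 i x), mul_comm]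
        exact (Measurable.indicator (by fun_prop) measurableSet_Iic)
    _ = _ := by
        have e1 : ∀ i x, ENNReal.ofReal (L i x ^ (p - 2) / (p - 2)) =
            ENNReal.ofReal (1 / (p - 2)) * ENNReal.ofReal (L i x ^ (p - 2)) := by
          intro i x
          rw [← ENNReal.ofReal_mul (by positivity)]
          congr 1; ring
        have e2 : ∀ i, ∫⁻ x, w i x * ENNReal.ofReal (L i x ^ (p - 2) / (p - 2)) =
            ENNReal.ofReal (1 / (p - 2)) * ∫⁻ x, w i x * ENNReal.ofReal (L i x ^ (p - 2)) := by
          intro i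
          have hme : Measurable fun x => w i x * ENNReal.ofReal (L i x ^ (p - 2)) :=
            (hw i).mul ((hL i).pow_const _).ennreal_ofReal
          rw [← lintegral_const_mul _ hme]
          refine lintegral_congr fun x => ?_
          rw [e1]; ring
        simp_rw [e2]
        rw [← Finset.mul_sum]
        have e3 : ENNReal.ofReal (4 * p / (p - 2)) =
            ENNReal.ofReal p * 4 * ENNReal.ofReal (1 / (p - 2)) := by
          rw [show (4 : ℝ≥0∞) = ENNReal.ofReal 4 by simp, ← ENNReal.ofReal_mul hp0.le,
            ← ENNReal.ofReal_mul (by positivity)]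
          congr 1; ring
        rw [e3]; ring

/-- A smooth cutoff on the half line, as a function of `|y|`. -/
def cutBump : ContDiffBump (0 : ℝ) := ⟨1, 4, by norm_num, by norm_num⟩

theorem hasTemperateGrowth_trunc (f : 𝓢(ℝ, ℂ)) (c : ℝ) :
    (fun x => ((cutBump (‖f x‖ ^ 2 / c ^ 2) : ℝ) : ℂ)).HasTemperateGrowth := by
  have h1 : (fun y : ℝ => (cutBump y : ℝ)).HasTemperateGrowth :=
    cutBump.hasCompactSupport.hasTemperateGrowth cutBump.contDiff
  have hre : (fun x => (f x).re).HasTemperateGrowth :=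
    Complex.reCLM.hasTemperateGrowth.comp f.hasTemperateGrowth
  have him : (fun x => (f x).im).HasTemperateGrowth :=
    Complex.imCLM.hasTemperateGrowth.comp f.hasTemperateGrowth
  have h2 : (fun x => ‖f x‖ ^ 2 / c ^ 2).HasTemperateGrowth := by
    have : (fun x => ‖f x‖ ^ 2 / c ^ 2) =
        fun x => ((f x).re * (f x).re + (f x).im * (f x).im) * (c ^ 2)⁻¹ := by
      funext x
      rw [Complex.sq_norm, Complex.normSq_apply, div_eq_mul_inv]
    rw [this]
    exact ((hre.mul hre).add (him.mul him)).mul (Function.HasTemperateGrowth.const _)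
  exact Function.Complex.hasTemperateGrowth_ofReal.comp (h1.comp h2)

/-- Smooth truncation of a Schwartz function at the height `c`. -/
def trunc (f : 𝓢(ℝ, ℂ)) (c : ℝ) : 𝓢(ℝ, ℂ) :=
  SchwartzMap.smulLeftCLM ℂ (fun x => ((cutBump (‖f x‖ ^ 2 / c ^ 2) : ℝ) : ℂ)) f

theorem trunc_apply (f : 𝓢(ℝ, ℂ)) (c x : ℝ) :
    trunc f c x = ((cutBump (‖f x‖ ^ 2 / c ^ 2) : ℝ) : ℂ) * f x := by
  rw [trunc, SchwartzMap.smulLeftCLM_apply_apply (hasTemperateGrowth_trunc f c), smul_eq_mul]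

theorem norm_trunc_le_norm (f : 𝓢(ℝ, ℂ)) (c x : ℝ) : ‖trunc f c x‖ ≤ ‖f x‖ := by
  rw [trunc_apply, norm_mul, Complex.norm_real, Real.norm_eq_abs, abs_of_nonneg cutBump.nonneg]
  exact mul_le_of_le_one_left (norm_nonneg _) cutBump.le_one

theorem trunc_eq_zero (f : 𝓢(ℝ, ℂ)) {c x : ℝ} (hc : 0 < c) (h : 2 * c < ‖f x‖) :
    trunc f c x = 0 := by
  rw [trunc_apply, cutBump.zero_of_le_dist, Complex.ofReal_zero, zero_mul]
  have : (4 : ℝ) ≤ ‖f x‖ ^ 2 / c ^ 2 := by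
    rw [le_div_iff₀ (by positivity)]
    nlinarith
  rw [Real.dist_eq, sub_zero, abs_of_nonneg (by positivity)]
  exact this

theorem norm_trunc_le (f : 𝓢(ℝ, ℂ)) {c : ℝ} (hc : 0 < c) (x : ℝ) : ‖trunc f c x‖ ≤ 2 * c := by
  rcases lt_or_ge (2 * c) ‖f x‖ with h | h
  · rw [trunc_eq_zero f hc h, norm_zero]; positivity
  · exact (norm_trunc_le_norm f c x).trans h

theorem sub_trunc_eq_zero (f : 𝓢(ℝ, ℂ)) {c x : ℝ} (hc : 0 < c) (h : ‖f x‖ < c) :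
    (f - trunc f c) x = 0 := by
  rw [sub_apply, trunc_apply, cutBump.one_of_mem_closedBall, Complex.ofReal_one, one_mul,
    sub_self]
  rw [mem_closedBall_zero_iff, Real.norm_eq_abs, abs_of_nonneg (by positivity)]
  change ‖f x‖ ^ 2 / c ^ 2 ≤ 1
  rw [div_le_one (by positivity)]
  exact pow_le_pow_left₀ (norm_nonneg _) h.le 2

theorem norm_sub_trunc_le (f : 𝓢(ℝ, ℂ)) (c x : ℝ) : ‖(f - trunc f c) x‖ ≤ ‖f x‖ := by
  have h : (f - trunc f c) x = ((1 - cutBump (‖f x‖ ^ 2 / c ^ 2) : ℝ) : ℂ) * f x := by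
    rw [sub_apply, trunc_apply]; push_cast; ring
  rw [h, norm_mul, Complex.norm_real, Real.norm_eq_abs, abs_of_nonneg (by
    linarith [cutBump.le_one (x := ‖f x‖ ^ 2 / c ^ 2)])]
  exact mul_le_of_le_one_left (norm_nonneg _) (by
    linarith [cutBump.nonneg (x := ‖f x‖ ^ 2 / c ^ 2)])

theorem meas_lt_le_of_split {H₁ H₂ : 𝓢(ℝ, ℂ)} {h : ℝ} (hh : 0 < h)
    (h1 : ∀ x, ‖H₁ x‖ ≤ h / 2) :
    volume {x | h < ‖(H₁ + H₂) x‖} ≤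
      ENNReal.ofReal (4 / h ^ 2) * ENNReal.ofReal (∫ x, ‖H₂ x‖ ^ 2) := by
  have hsub : {x | h < ‖(H₁ + H₂) x‖} ⊆ {x | ENNReal.ofReal (h ^ 2 / 4) ≤ ENNReal.ofReal (‖H₂ x‖ ^ 2)} := by
    intro x hx
    simp only [Set.mem_ofPred_eq, add_apply] at hx ⊢
    refine ENNReal.ofReal_le_ofReal ?_
    have := norm_add_le (H₁ x) (H₂ x)
    have h3 : h / 2 ≤ ‖H₂ x‖ := by linarith [h1 x]
    calc h ^ 2 / 4 = (h / 2) ^ 2 := by ring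
      _ ≤ _ := pow_le_pow_left₀ (by positivity) h3 2
  refine (measure_mono hsub).trans ?_
  have hcheb := mul_meas_ge_le_lintegral₀ (μ := volume)
    (f := fun x => ENNReal.ofReal (‖H₂ x‖ ^ 2))
    (H₂.continuous.norm.pow 2).measurable.ennreal_ofReal.aemeasurable (ENNReal.ofReal (h ^ 2 / 4))
  rw [← ofReal_integral_eq_lintegral_ofReal (integrable_sq H₂)
    (ae_of_all _ fun x => by positivity)] at hcheb
  calc volume {x | ENNReal.ofReal (h ^ 2 / 4) ≤ ENNReal.ofReal (‖H₂ x‖ ^ 2)}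
      = ENNReal.ofReal (4 / h ^ 2) * (ENNReal.ofReal (h ^ 2 / 4) *
        volume {x | ENNReal.ofReal (h ^ 2 / 4) ≤ ENNReal.ofReal (‖H₂ x‖ ^ 2)}) := by
        rw [← mul_assoc, ← ENNReal.ofReal_mul (by positivity)]
        rw [show 4 / h ^ 2 * (h ^ 2 / 4) = 1 by field_simp]
        simp
    _ ≤ _ := by gcongr

/-- Interpolation between `ℓ²L²` and `ℓ¹L^∞` for a finite family of multipliers. -/
theorem lintegral_sum_mulS_rpow_le {ι : Type*} (s : Finset ι) {p : ℝ} (hp : 2 < p)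
    {m : ι → ℝ → ℂ} (hm : ∀ i, Sym (m i)) {C M : ℝ} (hC : 0 < C)
    (hker : ∀ i ∈ s, ∫ x, ‖(hm i).ker x‖ ≤ C) (hM : ∀ ξ, ∑ i ∈ s, ‖m i ξ‖ ^ 2 ≤ M)
    (f : ι → 𝓢(ℝ, ℂ)) {b : ι → ℝ} (hb : ∀ i, 0 < b i)
    (hf : ∀ i ∈ s, ∫⁻ x, ‖f i x‖ₑ ^ p ≤ ENNReal.ofReal (b i ^ p)) :
    ∫⁻ x, ‖(∑ i ∈ s, mulS (m i) (f i)) x‖ₑ ^ p ≤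
      ENNReal.ofReal (4 * p / (p - 2) * M * (4 * C) ^ (p - 2) *
        ((∑ i ∈ s, b i) ^ (p - 2) * ∑ i ∈ s, b i ^ 2)) := by
  rcases s.eq_empty_or_nonempty with rfl | hs
  · have : 0 < p := by linarith
    simp [this]
  have hp0 : 0 < p := by linarith
  have hM0 : 0 ≤ M := (Finset.sum_nonneg fun i _ => by positivity).trans (hM 0)
  set Sb := ∑ i ∈ s, b i
  have hSb : 0 < Sb := Finset.sum_pos (fun i _ => hb i) hs
  have key := lintegral_rpow_le_of_meas_le s hp (H := (∑ i ∈ s, mulS (m i) (f i) : 𝓢(ℝ, ℂ)))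
    (SchwartzMap.continuous _) (M := ENNReal.ofReal M)
    (w := fun i x => ENNReal.ofReal (‖f i x‖ ^ 2)) (L := fun i x => 4 * C * Sb / b i * ‖f i x‖)
    (fun i => ((f i).continuous.norm.pow 2).measurable.ennreal_ofReal)
    (fun i => ((f i).continuous.norm.measurable.const_mul _))
    (fun i x => by have := hb i; positivity) (by
      intro h hh
      set c : ι → ℝ := fun i => h * b i / (4 * C * Sb)
      have hc : ∀ i, 0 < c i := fun i => by have := hb i; positivity
      have hsplit : (∑ i ∈ s, mulS (m i) (f i) : 𝓢(ℝ, ℂ)) =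
          (∑ i ∈ s, mulS (m i) (trunc (f i) (c i))) +
            ∑ i ∈ s, mulS (m i) (f i - trunc (f i) (c i)) := by
        rw [← Finset.sum_add_distrib]
        refine Finset.sum_congr rfl fun i _ => ?_
        rw [← map_add]; congr 1; abel
      rw [hsplit]
      refine (meas_lt_le_of_split hh fun x => ?_).trans ?_
      · rw [sum_apply]
        calc ‖∑ i ∈ s, mulS (m i) (trunc (f i) (c i)) x‖
            ≤ ∑ i ∈ s, ‖mulS (m i) (trunc (f i) (c i)) x‖ := norm_sum_le _ _
          _ ≤ ∑ i ∈ s, C * (2 * c i) := by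
              refine Finset.sum_le_sum fun i hi => ?_
              refine (norm_mulS_le_of_norm_le (hm i) _ (norm_trunc_le (f i) (hc i)) x).trans ?_
              have := hc i
              gcongr
              exact hker i hi
          _ = h / 2 := by
              have : ∀ i, C * (2 * c i) = (h / (2 * Sb)) * b i := by
                intro i; simp only [c]; field_simp; ring
              simp_rw [this]
              rw [← Finset.mul_sum]
              change h / (2 * Sb) * Sb = h / 2
              field_simp
      · gcongr
        calc ENNReal.ofReal (∫ x, ‖(∑ i ∈ s, mulS (m i) (f i - trunc (f i) (c i))) x‖ ^ 2)
            ≤ ENNReal.ofReal (M * ∑ i ∈ s, ∫ x, ‖(f i - trunc (f i) (c i)) x‖ ^ 2) :=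
              ENNReal.ofReal_le_ofReal
                (integral_norm_sq_sum_mulS_le s (fun i _ => (hm i).tg) hM _)
          _ = ENNReal.ofReal M * ∑ i ∈ s, ENNReal.ofReal (∫ x, ‖(f i - trunc (f i) (c i)) x‖ ^ 2) := by
              rw [ENNReal.ofReal_mul hM0, ENNReal.ofReal_sum_of_nonneg
                fun i _ => integral_nonneg fun x => by positivity]
          _ ≤ _ := by
              gcongr with i hi
              rw [ofReal_integral_eq_lintegral_ofReal (integrable_sq _)
                (ae_of_all _ fun x => by positivity)]
              refine lintegral_mono fun x => ?_
              simp only [Set.indicator, Set.mem_ofPred_eq]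
              split_ifs with hx
              · exact ENNReal.ofReal_le_ofReal
                  (pow_le_pow_left₀ (norm_nonneg _) (norm_sub_trunc_le _ _ _) 2)
              · rw [sub_trunc_eq_zero (f i) (hc i)]
                · simp
                · push Not at hx
                  have hbi := hb i
                  simp only [c]
                  rw [lt_div_iff₀ (by positivity)]
                  rw [div_mul_eq_mul_div, div_lt_iff₀ hbi] at hx
                  linarith)
  refine key.trans ?_
  have e1 : ∀ i ∈ s, ∫⁻ x, ENNReal.ofReal (‖f i x‖ ^ 2) *
      ENNReal.ofReal ((4 * C * Sb / b i * ‖f i x‖) ^ (p - 2)) ≤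
      ENNReal.ofReal ((4 * C) ^ (p - 2) * Sb ^ (p - 2) * b i ^ 2) := by
    intro i hi
    have hbi := hb i
    have : ∀ x, ENNReal.ofReal (‖f i x‖ ^ 2) *
      ENNReal.ofReal ((4 * C * Sb / b i * ‖f i x‖) ^ (p - 2)) =
        ENNReal.ofReal ((4 * C * Sb / b i) ^ (p - 2)) * ‖f i x‖ₑ ^ p := by
      intro x
      rw [← ofReal_norm, ENNReal.ofReal_rpow_of_nonneg (norm_nonneg _) hp0.le,
        ← ENNReal.ofReal_mul (by positivity), ← ENNReal.ofReal_mul (by positivity)]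
      congr 1
      rw [Real.mul_rpow (by positivity) (norm_nonneg _)]
      have h2 : ‖f i x‖ ^ p = ‖f i x‖ ^ 2 * ‖f i x‖ ^ (p - 2) := by
        rw [← Real.rpow_natCast, ← Real.rpow_add_of_nonneg (norm_nonneg _) (by norm_num)
          (by linarith)]
        congr 1; norm_num
      rw [h2]; ring
    simp_rw [this]
    rw [lintegral_const_mul _ ((f i).continuous.measurable.enorm.pow_const _)]
    refine (mul_le_mul_right (hf i hi) _).trans ?_
    rw [← ENNReal.ofReal_mul (by positivity)]
    refine ENNReal.ofReal_le_ofReal (le_of_eq ?_)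
    rw [Real.div_rpow (by positivity) hbi.le, Real.mul_rpow (by positivity) hSb.le]
    have h2 : b i ^ p = b i ^ 2 * b i ^ (p - 2) := by
      rw [← Real.rpow_natCast, ← Real.rpow_add hbi]
      congr 1; norm_num
    rw [h2]
    have : b i ^ (p - 2) ≠ 0 := by positivity
    field_simp
  calc _ ≤ ENNReal.ofReal (4 * p / (p - 2)) * (ENNReal.ofReal M * ∑ i ∈ s,
        ENNReal.ofReal ((4 * C) ^ (p - 2) * Sb ^ (p - 2) * b i ^ 2)) := by
        gcongr with i hi
        exact e1 i hi
    _ = _ := by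
        have hp2 : 0 < p - 2 := by linarith
        rw [← ENNReal.ofReal_sum_of_nonneg fun i _ => by positivity, ← ENNReal.ofReal_mul hM0,
          ← ENNReal.ofReal_mul (by positivity), ← Finset.mul_sum]
        congr 1
        ring

/-- Interpolation between `L² → L²` and `L¹ → L^∞`. -/
theorem lintegral_mulS_rpow_le {p : ℝ} (hp : 2 < p) {m : ℝ → ℂ} (hm : Sym m) {A : ℝ} (hA0 : 0 < A)
    (hA : ∀ x, ‖hm.ker x‖ ≤ A) (hM : ∀ ξ, ‖m ξ‖ ≤ 1) (f : 𝓢(ℝ, ℂ)) {N : ℝ} (hN : 0 < N)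
    (hf : ∫⁻ x, ‖f x‖ₑ ^ (p / (p - 1)) ≤ ENNReal.ofReal (N ^ (p / (p - 1)))) :
    ∫⁻ x, ‖mulS m f x‖ₑ ^ p ≤
      ENNReal.ofReal (4 * p / (p - 2) * 4 ^ (p - 2) * (A ^ (p - 2) * N ^ p)) := by
  have hp0 : 0 < p := by linarith
  have hp1 : 0 < p - 1 := by linarith
  have hp2 : 0 < p - 2 := by linarith
  set p' := p / (p - 1) with hp'
  have hp'0 : 0 < p' := by positivity
  have hp'1 : p' - 1 = 1 / (p - 1) := by rw [hp']; field_simp; ring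
  set B := 2 * A * N ^ p' with hB
  have hB0 : 0 < B := by positivity
  have key := lintegral_rpow_le_of_meas_le {()} hp (H := mulS m f)
    (SchwartzMap.continuous _) (M := 1)
    (w := fun _ x => ENNReal.ofReal (‖f x‖ ^ 2)) (L := fun _ x => B * (2 / ‖f x‖) ^ (1 / (p - 1)))
    (fun _ => (f.continuous.norm.pow 2).measurable.ennreal_ofReal)
    (fun _ => ((f.continuous.norm.measurable.const_div _).pow_const _).const_mul _)
    (fun _ x => by positivity) (by
      intro h hh
      set c := (B / h) ^ (p - 1)
      have hc : 0 < c := by positivity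
      have hsplit : mulS m f = mulS m (f - trunc f c) + mulS m (trunc f c) := by
        rw [← map_add]; congr 1; abel
      rw [hsplit]
      refine (meas_lt_le_of_split hh fun x => ?_).trans ?_
      · refine (norm_mulS_le_of_norm_ker_le hm hA _ x).trans ?_
        have h3 : ∫ y, ‖(f - trunc f c) y‖ ≤ c ^ (-(p' - 1)) * N ^ p' := by
          have h4 : ENNReal.ofReal (∫ y, ‖(f - trunc f c) y‖) ≤
              ENNReal.ofReal (c ^ (-(p' - 1)) * N ^ p') := by
            rw [ofReal_integral_eq_lintegral_ofReal (SchwartzMap.integrable _).norm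
              (ae_of_all _ fun x => norm_nonneg _), ENNReal.ofReal_mul (by positivity)]
            calc ∫⁻ x, ENNReal.ofReal ‖(f - trunc f c) x‖
                ≤ ∫⁻ x, ENNReal.ofReal (c ^ (-(p' - 1))) * ‖f x‖ₑ ^ p' := by
                  refine lintegral_mono fun y => ?_
                  simp only
                  rw [← ofReal_norm, ENNReal.ofReal_rpow_of_nonneg (norm_nonneg _) hp'0.le,
                    ← ENNReal.ofReal_mul (by positivity)]
                  refine ENNReal.ofReal_le_ofReal ?_
                  rcases lt_or_ge ‖f y‖ c with hy | hy
                  · rw [sub_trunc_eq_zero f hc hy, norm_zero]; positivity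
                  · refine (norm_sub_trunc_le f c y).trans ?_
                    have hfy : 0 < ‖f y‖ := hc.trans_le hy
                    calc ‖f y‖ = ‖f y‖ ^ (-(p' - 1)) * ‖f y‖ ^ p' := by
                          rw [← Real.rpow_add hfy]; simp
                      _ ≤ c ^ (-(p' - 1)) * ‖f y‖ ^ p' := by
                          gcongr 1
                          refine Real.rpow_le_rpow_of_nonpos hc hy ?_
                          have : 0 < 1 / (p - 1) := by positivity
                          linarith
              _ ≤ _ := by
                  rw [lintegral_const_mul _ (f.continuous.measurable.enorm.pow_const _)]
                  gcongr
          exact (ENNReal.ofReal_le_ofReal_iff (by positivity)).1 h4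
        calc A * ∫ y, ‖(f - trunc f c) y‖ ≤ A * (c ^ (-(p' - 1)) * N ^ p') := by gcongr
          _ = h / 2 := by
              have : c ^ (-(p' - 1)) = h / B := by
                simp only [c]
                rw [← Real.rpow_mul (by positivity), hp'1]
                rw [show (p - 1) * -(1 / (p - 1)) = -1 by field_simp, Real.rpow_neg_one, inv_div]
              rw [this, hB]
              have : N ^ p' ≠ 0 := by positivity
              field_simp
      · gcongr
        rw [one_mul, Finset.sum_singleton]
        have h5 := integral_norm_sq_sum_mulS_le {()} (m := fun _ => m) (M := 1) (fun _ _ => hm.tg)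
          (fun ξ => by simpa using hM ξ) (fun _ => trunc f c)
        simp only [Finset.sum_singleton, one_mul] at h5
        refine (ENNReal.ofReal_le_ofReal h5).trans ?_
        rw [ofReal_integral_eq_lintegral_ofReal (integrable_sq _)
          (ae_of_all _ fun x => by positivity)]
        refine lintegral_mono fun x => ?_
        simp only [Set.indicator, Set.mem_ofPred_eq]
        split_ifs with hx
        · exact ENNReal.ofReal_le_ofReal
            (pow_le_pow_left₀ (norm_nonneg _) (norm_trunc_le_norm _ _ _) 2)
        · rcases eq_or_lt_of_le (norm_nonneg (f x)) with hfx | hfx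
          · have := norm_trunc_le_norm f c x
            rw [← hfx] at this
            have h6 : ‖trunc f c x‖ = 0 := le_antisymm this (norm_nonneg _)
            rw [h6]; simp
          · rw [trunc_eq_zero f hc]
            · simp
            · push Not at hx
              have h7 : (2 / ‖f x‖) ^ (1 / (p - 1)) < h / B := by
                rw [lt_div_iff₀ hB0]; linarith
              have h8 : 2 / ‖f x‖ < (h / B) ^ (p - 1) := by
                have := Real.rpow_lt_rpow (by positivity) h7 hp1
                rwa [← Real.rpow_mul (by positivity), one_div_mul_cancel hp1.ne',
                  Real.rpow_one] at this
              have h9 : c = ((h / B) ^ (p - 1))⁻¹ := by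
                simp only [c]
                rw [← Real.inv_rpow (by positivity), inv_div]
              rw [h9, ← div_eq_mul_inv, div_lt_iff₀ (by positivity)]
              rw [div_lt_iff₀ hfx] at h8
              linarith)
  refine key.trans ?_
  rw [one_mul, Finset.sum_singleton]
  have e1 : ∫⁻ x, ENNReal.ofReal (‖f x‖ ^ 2) *
      ENNReal.ofReal ((B * (2 / ‖f x‖) ^ (1 / (p - 1))) ^ (p - 2)) ≤
      ENNReal.ofReal (4 ^ (p - 2) * (A ^ (p - 2) * N ^ p)) := by
    have : ∀ x, ENNReal.ofReal (‖f x‖ ^ 2) *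
      ENNReal.ofReal ((B * (2 / ‖f x‖) ^ (1 / (p - 1))) ^ (p - 2)) ≤
        ENNReal.ofReal (B ^ (p - 2) * 2 ^ (p - 2)) * ‖f x‖ₑ ^ p' := by
      intro x
      rw [← ofReal_norm, ENNReal.ofReal_rpow_of_nonneg (norm_nonneg _) hp'0.le,
        ← ENNReal.ofReal_mul (by positivity), ← ENNReal.ofReal_mul (by positivity)]
      refine ENNReal.ofReal_le_ofReal ?_
      rcases eq_or_lt_of_le (norm_nonneg (f x)) with hfx | hfx
      · rw [← hfx, Real.zero_rpow hp'0.ne']; simp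
      · rw [Real.mul_rpow hB0.le (by positivity), ← Real.rpow_mul (by positivity),
          Real.div_rpow (by norm_num) hfx.le]
        have h2 : ‖f x‖ ^ 2 = ‖f x‖ ^ p' * ‖f x‖ ^ (1 / (p - 1) * (p - 2)) := by
          rw [← Real.rpow_natCast, ← Real.rpow_add hfx]
          congr 1; rw [hp']; field_simp; push_cast; ring
        rw [h2]
        have h3 : (2 : ℝ) ^ (1 / (p - 1) * (p - 2)) ≤ 2 ^ (p - 2) := by
          refine Real.rpow_le_rpow_of_exponent_le (by norm_num) ?_
          refine mul_le_of_le_one_left hp2.le ?_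
          rw [div_le_one hp1]; linarith
        have h4 : ‖f x‖ ^ (1 / (p - 1) * (p - 2)) ≠ 0 := by positivity
        calc _ = B ^ (p - 2) * 2 ^ (1 / (p - 1) * (p - 2)) * ‖f x‖ ^ p' := by field_simp
          _ ≤ _ := by gcongr
    refine (lintegral_mono this).trans ?_
    rw [lintegral_const_mul _ (f.continuous.measurable.enorm.pow_const _)]
    refine (mul_le_mul_right hf _).trans ?_
    rw [← ENNReal.ofReal_mul (by positivity)]
    refine ENNReal.ofReal_le_ofReal (le_of_eq ?_)
    rw [hB, Real.mul_rpow (by positivity) (by positivity), Real.mul_rpow (by norm_num) hA0.le,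
      ← Real.rpow_mul hN.le]
    have h2 : N ^ p = N ^ (p' * (p - 2)) * N ^ p' := by
      rw [← Real.rpow_add hN]; congr 1; rw [hp']; field_simp; ring
    rw [h2, show (4 : ℝ) = 2 * 2 by norm_num, Real.mul_rpow (by norm_num) (by norm_num)]
    ring
  refine (mul_le_mul_right e1 _).trans_eq ?_
  rw [← ENNReal.ofReal_mul (by positivity)]
  congr 1
  ring

/-! ### Oscillatory integrals -/

/-- A real phase with its first two derivatives. -/
structure IsPhase (Ψ Ψ₁ Ψ₂ : ℝ → ℝ) : Prop where
  deriv1 : ∀ x, HasDerivAt Ψ (Ψ₁ x) x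
  deriv2 : ∀ x, HasDerivAt Ψ₁ (Ψ₂ x) x
  cont : Continuous Ψ₂

namespace IsPhase

variable {Ψ Ψ₁ Ψ₂ : ℝ → ℝ}

theorem continuous₁ (h : IsPhase Ψ Ψ₁ Ψ₂) : Continuous Ψ₁ :=
  continuous_iff_continuousAt.2 fun x => (h.deriv2 x).continuousAt

theorem continuous (h : IsPhase Ψ Ψ₁ Ψ₂) : Continuous Ψ :=
  continuous_iff_continuousAt.2 fun x => (h.deriv1 x).continuousAt

theorem continuous_cexp (h : IsPhase Ψ Ψ₁ Ψ₂) : Continuous fun x => Complex.exp (Complex.I * Ψ x) :=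
  (continuous_const.mul (Complex.continuous_ofReal.comp h.continuous)).cexp

theorem norm_cexp (x : ℝ) : ‖Complex.exp (Complex.I * Ψ x)‖ = 1 := by
  rw [mul_comm, Complex.norm_exp_ofReal_mul_I]

theorem norm_integral_le_integral (h : IsPhase Ψ Ψ₁ Ψ₂) {a b ν : ℝ} (hab : a ≤ b) (hν : 0 < ν)
    (h1 : ∀ x ∈ Set.Icc a b, ν ≤ |Ψ₁ x|) :
    ‖∫ x in a..b, Complex.exp (Complex.I * Ψ x)‖ ≤
      2 / ν + ∫ x in a..b, |Ψ₂ x| / Ψ₁ x ^ 2 := by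
  have hne : ∀ x ∈ Set.Icc a b, Ψ₁ x ≠ 0 := by
    intro x hx h0
    have := h1 x hx
    rw [h0, abs_zero] at this
    linarith
  have hneC : ∀ x ∈ Set.Icc a b, (Ψ₁ x : ℂ) ≠ 0 := fun x hx => by exact_mod_cast hne x hx
  set u : ℝ → ℂ := fun x => -Complex.I * (Ψ₁ x : ℂ)⁻¹
  set u' : ℝ → ℂ := fun x => -Complex.I * (-(Ψ₂ x : ℂ) / (Ψ₁ x : ℂ) ^ 2)
  set v : ℝ → ℂ := fun x => Complex.exp (Complex.I * Ψ x)
  set v' : ℝ → ℂ := fun x => Complex.exp (Complex.I * Ψ x) * (Complex.I * Ψ₁ x)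
  have hu : ∀ x ∈ Set.uIcc a b, HasDerivAt u (u' x) x := by
    intro x hx
    rw [Set.uIcc_of_le hab] at hx
    exact ((h.deriv2 x).ofReal_comp.inv (hneC x hx)).const_mul _
  have hv : ∀ x ∈ Set.uIcc a b, HasDerivAt v (v' x) x := by
    intro x _
    exact ((h.deriv1 x).ofReal_comp.const_mul Complex.I).cexp
  have cu' : ContinuousOn u' (Set.uIcc a b) := by
    rw [Set.uIcc_of_le hab]
    refine continuousOn_const.mul (ContinuousOn.div ?_ ?_ fun x hx => pow_ne_zero 2 (hneC x hx))
    · exact (Complex.continuous_ofReal.comp h.cont).neg.continuousOn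
    · exact ((Complex.continuous_ofReal.comp h.continuous₁).pow 2).continuousOn
  have cv' : ContinuousOn v' (Set.uIcc a b) :=
    (h.continuous_cexp.mul (continuous_const.mul
      (Complex.continuous_ofReal.comp h.continuous₁))).continuousOn
  have key := intervalIntegral.integral_mul_deriv_eq_deriv_mul hu hv cu'.intervalIntegrable
    cv'.intervalIntegrable
  have e1 : ∫ x in a..b, v x = ∫ x in a..b, u x * v' x := by
    refine intervalIntegral.integral_congr fun x hx => ?_
    rw [Set.uIcc_of_le hab] at hx
    simp only [u, v', v]
    have := hneC x hx
    field_simp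
    rw [Complex.I_sq, neg_neg]
  have nv : ∀ x, ‖v x‖ = 1 := fun x => norm_cexp x
  have nu : ∀ x ∈ Set.Icc a b, ‖u x‖ ≤ 1 / ν := by
    intro x hx
    simp only [u]
    rw [norm_mul, norm_neg, Complex.norm_I, one_mul, norm_inv, Complex.norm_real, Real.norm_eq_abs,
      ← one_div]
    exact one_div_le_one_div_of_le hν (h1 x hx)
  have nb := nu b (Set.right_mem_Icc.2 hab)
  have na := nu a (Set.left_mem_Icc.2 hab)
  have e2 : ‖∫ x in a..b, u' x * v x‖ ≤ ∫ x in a..b, |Ψ₂ x| / Ψ₁ x ^ 2 := by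
    refine (intervalIntegral.norm_integral_le_integral_norm hab).trans_eq ?_
    refine intervalIntegral.integral_congr fun x _ => ?_
    simp only [u']
    rw [norm_mul, nv, mul_one, norm_mul, norm_neg, Complex.norm_I, one_mul, norm_div, norm_neg,
      norm_pow, Complex.norm_real, Complex.norm_real, Real.norm_eq_abs, Real.norm_eq_abs, sq_abs]
  rw [e1, key]
  calc ‖u b * v b - u a * v a - ∫ x in a..b, u' x * v x‖
      ≤ ‖u b * v b‖ + ‖u a * v a‖ + ‖∫ x in a..b, u' x * v x‖ :=
        (norm_sub_le _ _).trans (by gcongr; exact norm_sub_le _ _)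
    _ ≤ 1 / ν + 1 / ν + ∫ x in a..b, |Ψ₂ x| / Ψ₁ x ^ 2 := by
        rw [norm_mul (u b), norm_mul (u a), nv, nv, mul_one, mul_one]
        gcongr
    _ = _ := by ring

/-- The first derivative test, for a phase with bounded second derivative. -/
theorem norm_integral_le_of_bound (h : IsPhase Ψ Ψ₁ Ψ₂) {a b ν M : ℝ} (hab : a ≤ b) (hν : 0 < ν)
    (h1 : ∀ x ∈ Set.Icc a b, ν ≤ |Ψ₁ x|) (h2 : ∀ x ∈ Set.Icc a b, |Ψ₂ x| ≤ M) :
    ‖∫ x in a..b, Complex.exp (Complex.I * Ψ x)‖ ≤ 2 / ν + M / ν ^ 2 * (b - a) := by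
  refine (h.norm_integral_le_integral hab hν h1).trans ?_
  gcongr
  refine (le_abs_self _).trans ?_
  have := intervalIntegral.norm_integral_le_of_norm_le_const (a := a) (b := b) (C := M / ν ^ 2)
    (f := fun x => |Ψ₂ x| / Ψ₁ x ^ 2) (by
      intro x hx
      rw [Set.uIoc_of_le hab] at hx
      have hx' := Set.Ioc_subset_Icc_self hx
      rw [Real.norm_eq_abs, abs_div, abs_abs, abs_of_nonneg (sq_nonneg (Ψ₁ x)), ← sq_abs (Ψ₁ x)]
      have := h1 x hx'
      have hM : 0 ≤ M := (abs_nonneg _).trans (h2 x hx')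
      gcongr
      exact h2 x hx')
  rwa [abs_of_nonneg (sub_nonneg.2 hab)] at this

/-- The first derivative test, for a monotone derivative. -/
theorem norm_integral_le_of_sign (h : IsPhase Ψ Ψ₁ Ψ₂) {a b ν : ℝ} (hab : a ≤ b) (hν : 0 < ν)
    (h1 : ∀ x ∈ Set.Icc a b, ν ≤ |Ψ₁ x|)
    (h2 : (∀ x ∈ Set.Icc a b, 0 ≤ Ψ₂ x) ∨ (∀ x ∈ Set.Icc a b, Ψ₂ x ≤ 0)) :
    ‖∫ x in a..b, Complex.exp (Complex.I * Ψ x)‖ ≤ 4 / ν := by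
  have hne : ∀ x ∈ Set.Icc a b, Ψ₁ x ≠ 0 := by
    intro x hx h0
    have := h1 x hx
    rw [h0, abs_zero] at this
    linarith
  have hder : ∀ x ∈ Set.uIcc a b, HasDerivAt (fun x => (Ψ₁ x)⁻¹) (-Ψ₂ x / Ψ₁ x ^ 2) x := by
    intro x hx
    rw [Set.uIcc_of_le hab] at hx
    exact (h.deriv2 x).inv (hne x hx)
  have hc : ContinuousOn (fun x => -Ψ₂ x / Ψ₁ x ^ 2) (Set.uIcc a b) := by
    rw [Set.uIcc_of_le hab]
    exact h.cont.neg.continuousOn.div (h.continuous₁.pow 2).continuousOn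
      fun x hx => pow_ne_zero 2 (hne x hx)
  have key := intervalIntegral.integral_eq_sub_of_hasDerivAt hder hc.intervalIntegrable
  have hi : ∀ x ∈ Set.Icc a b, |(Ψ₁ x)⁻¹| ≤ 1 / ν := by
    intro x hx
    rw [abs_inv, ← one_div]
    exact one_div_le_one_div_of_le hν (h1 x hx)
  have hi1 := hi b (Set.right_mem_Icc.2 hab)
  have hi2 := hi a (Set.left_mem_Icc.2 hab)
  have habs : |(Ψ₁ b)⁻¹ - (Ψ₁ a)⁻¹| ≤ 2 / ν := by
    refine (abs_sub _ _).trans ?_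
    rw [show 2 / ν = 1 / ν + 1 / ν by ring]
    gcongr
  have hint : ∫ x in a..b, |Ψ₂ x| / Ψ₁ x ^ 2 ≤ 2 / ν := by
    refine le_trans (le_of_eq ?_) habs
    rw [← key]
    rcases h2 with h2 | h2
    · rw [← abs_neg, ← intervalIntegral.integral_neg]
      rw [abs_of_nonneg]
      · refine intervalIntegral.integral_congr fun x hx => ?_
        rw [Set.uIcc_of_le hab] at hx
        simp only [abs_of_nonneg (h2 x hx)]
        ring
      · refine intervalIntegral.integral_nonneg hab fun x hx => ?_
        have := h2 x hx
        rw [neg_div, neg_neg]; positivity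
    · rw [abs_of_nonneg]
      · refine intervalIntegral.integral_congr fun x hx => ?_
        rw [Set.uIcc_of_le hab] at hx
        simp only [abs_of_nonpos (h2 x hx)]
      · refine intervalIntegral.integral_nonneg hab fun x hx => ?_
        have : 0 ≤ -Ψ₂ x := neg_nonneg.2 (h2 x hx)
        positivity
  calc _ ≤ _ := h.norm_integral_le_integral hab hν h1
    _ ≤ 2 / ν + 2 / ν := by gcongr
    _ = _ := by ring

/-- The second derivative test. -/
theorem norm_integral_le_of_deriv2 (h : IsPhase Ψ Ψ₁ Ψ₂) {a b μ : ℝ} (hab : a ≤ b) (hμ : 0 < μ)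
    (h2 : (∀ x ∈ Set.Icc a b, μ ≤ Ψ₂ x) ∨ (∀ x ∈ Set.Icc a b, Ψ₂ x ≤ -μ)) :
    ‖∫ x in a..b, Complex.exp (Complex.I * Ψ x)‖ ≤ 18 / √μ := by
  obtain ⟨x₀, hx₀, hmin⟩ := (isCompact_Icc (a := a) (b := b)).exists_isMinOn
    ⟨a, Set.left_mem_Icc.2 hab⟩ h.continuous₁.abs.continuousOn
  have hsign : (∀ x ∈ Set.Icc a b, 0 ≤ Ψ₂ x) ∨ (∀ x ∈ Set.Icc a b, Ψ₂ x ≤ 0) :=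
    h2.imp (fun h x hx => hμ.le.trans (h x hx)) fun h x hx => (h x hx).trans (by linarith)
  have hmvt : ∀ x ∈ Set.Icc a b, ∀ y ∈ Set.Icc a b, x < y → μ * (y - x) ≤ |Ψ₁ y - Ψ₁ x| := by
    intro x hx y hy hxy
    obtain ⟨c, hc, he⟩ := exists_hasDerivAt_eq_slope Ψ₁ Ψ₂ hxy h.continuous₁.continuousOn
      fun z _ => h.deriv2 z
    have hc' : c ∈ Set.Icc a b := ⟨hx.1.trans hc.1.le, hc.2.le.trans hy.2⟩
    have hyx : 0 < y - x := by linarith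
    rw [eq_div_iff hyx.ne'] at he
    rw [← he, abs_mul, abs_of_pos hyx]
    gcongr
    rcases h2 with h2 | h2
    · exact (h2 c hc').trans (le_abs_self _)
    · have := h2 c hc'
      rw [abs_of_nonpos (by linarith)]; linarith
  have hlow : ∀ x ∈ Set.Icc a b, μ * |x - x₀| / 2 ≤ |Ψ₁ x| := by
    intro x hx
    have hm : |Ψ₁ x₀| ≤ |Ψ₁ x| := hmin hx
    have hd : μ * |x - x₀| ≤ |Ψ₁ x| + |Ψ₁ x₀| := by
      rcases lt_trichotomy x x₀ with hlt | heq | hlt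
      · have := hmvt x hx x₀ hx₀ hlt
        rw [abs_of_neg (sub_neg.2 hlt), neg_sub]
        refine this.trans ((abs_sub _ _).trans_eq (add_comm _ _))
      · rw [heq]; simp
      · have := hmvt x₀ hx₀ x hx hlt
        rw [abs_of_pos (sub_pos.2 hlt)]
        exact this.trans (abs_sub _ _)
    linarith
  set δ := 1 / √μ with hδ
  have hsq : 0 < √μ := Real.sqrt_pos.2 hμ
  have hδ0 : 0 < δ := by positivity
  have hμδ : μ * δ = √μ := by
    rw [hδ]
    field_simp
    exact (Real.sq_sqrt hμ.le).symm
  set c := max a (x₀ - δ)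
  set d := min b (x₀ + δ)
  have hac : a ≤ c := le_max_left _ _
  have hdb : d ≤ b := min_le_left _ _
  have hcx : c ≤ x₀ := max_le hx₀.1 (by linarith)
  have hxd : x₀ ≤ d := le_min hx₀.2 (by linarith)
  have hint : ∀ u v, IntervalIntegrable (fun x => Complex.exp (Complex.I * Ψ x)) volume u v :=
    fun u v => h.continuous_cexp.intervalIntegrable _ _
  have hside : ∀ u v, a ≤ u → v ≤ b → u ≤ v → (∀ x ∈ Set.Icc u v, u = v ∨ δ ≤ |x - x₀|) →
      ‖∫ x in u..v, Complex.exp (Complex.I * Ψ x)‖ ≤ 8 / √μ := by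
    intro u v hau hvb huv hfar
    by_cases heq : u = v
    · rw [heq]; simp; positivity
    have hsub : ∀ x ∈ Set.Icc u v, x ∈ Set.Icc a b := fun x hx => ⟨hau.trans hx.1, hx.2.trans hvb⟩
    have := h.norm_integral_le_of_sign (ν := √μ / 2) huv (by positivity) (by
        intro x hx
        refine le_trans ?_ (hlow x (hsub x hx))
        rcases hfar x hx with h' | h'
        · exact absurd h' heq
        · rw [← hμδ]; gcongr)
      (hsign.imp (fun h x hx => h x (hsub x hx)) fun h x hx => h x (hsub x hx))
    refine this.trans_eq ?_
    field_simp; norm_num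
  have b1 : ‖∫ x in a..c, Complex.exp (Complex.I * Ψ x)‖ ≤ 8 / √μ := by
    refine hside a c le_rfl (hcx.trans hx₀.2) hac fun x hx => ?_
    rcases max_choice a (x₀ - δ) with hc | hc
    · exact Or.inl hc.symm
    · right
      have : x ≤ x₀ - δ := hx.2.trans_eq hc
      rw [abs_of_nonpos (by linarith)]; linarith
  have b3 : ‖∫ x in d..b, Complex.exp (Complex.I * Ψ x)‖ ≤ 8 / √μ := by
    refine hside d b (hx₀.1.trans hxd) le_rfl hdb fun x hx => ?_
    rcases min_choice b (x₀ + δ) with hc | hc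
    · exact Or.inl hc
    · right
      have : x₀ + δ ≤ x := hc.symm.le.trans hx.1
      rw [abs_of_nonneg (by linarith)]; linarith
  have b2 : ‖∫ x in c..d, Complex.exp (Complex.I * Ψ x)‖ ≤ 2 / √μ := by
    have := intervalIntegral.norm_integral_le_of_norm_le_const (a := c) (b := d) (C := 1)
      (f := fun x => Complex.exp (Complex.I * Ψ x)) fun x _ => (norm_cexp x).le
    refine this.trans ?_
    rw [one_mul, abs_of_nonneg (by linarith)]
    have h1 : x₀ - δ ≤ c := le_max_right _ _
    have h2 : d ≤ x₀ + δ := min_le_right _ _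
    have : 2 / √μ = 2 * δ := by rw [hδ]; ring
    linarith
  rw [← intervalIntegral.integral_add_adjacent_intervals (hint a c) (hint c b),
    ← intervalIntegral.integral_add_adjacent_intervals (hint c d) (hint d b)]
  calc _ ≤ 8 / √μ + (2 / √μ + 8 / √μ) :=
        (norm_add_le _ _).trans (add_le_add b1 ((norm_add_le _ _).trans (add_le_add b2 b3)))
    _ = _ := by ring

/-- Insertion of an amplitude. -/
theorem norm_integral_mul_le (h : IsPhase Ψ Ψ₁ Ψ₂) {m : ℝ → ℂ} (hm : ContDiff ℝ ∞ m) {a b B K : ℝ}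
    (hab : a ≤ b) (hB : ∀ ξ, ‖m ξ‖ ≤ B) (hB' : ∀ ξ, ‖deriv m ξ‖ ≤ B)
    (hK : ∀ x ∈ Set.Icc a b, ‖∫ y in a..x, Complex.exp (Complex.I * Ψ y)‖ ≤ K) :
    ‖∫ x in a..b, m x * Complex.exp (Complex.I * Ψ x)‖ ≤ B * K * (1 + (b - a)) := by
  set v : ℝ → ℂ := fun x => ∫ y in a..x, Complex.exp (Complex.I * Ψ y)
  have hv : ∀ x ∈ Set.uIcc a b, HasDerivAt v (Complex.exp (Complex.I * Ψ x)) x := fun x _ =>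
    intervalIntegral.integral_hasDerivAt_right (h.continuous_cexp.intervalIntegrable _ _)
      (h.continuous_cexp.stronglyMeasurableAtFilter _ _) h.continuous_cexp.continuousAt
  have hu : ∀ x ∈ Set.uIcc a b, HasDerivAt m (deriv m x) x := fun x _ =>
    (hm.differentiable (by simp)).differentiableAt.hasDerivAt
  have cm : Continuous (deriv m) := hm.continuous_deriv (by simp)
  rw [intervalIntegral.integral_mul_deriv_eq_deriv_mul hu hv (cm.intervalIntegrable _ _)
    (h.continuous_cexp.intervalIntegrable _ _)]
  have hB0 : 0 ≤ B := (norm_nonneg _).trans (hB 0)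
  have hK0 : 0 ≤ K := (norm_nonneg _).trans (hK a (Set.left_mem_Icc.2 hab))
  have e1 : ‖∫ x in a..b, deriv m x * v x‖ ≤ B * K * (b - a) := by
    have := intervalIntegral.norm_integral_le_of_norm_le_const (a := a) (b := b) (C := B * K)
      (f := fun x => deriv m x * v x) (by
        intro x hx
        rw [Set.uIoc_of_le hab] at hx
        rw [norm_mul]
        gcongr
        · exact hB' x
        · exact hK x (Set.Ioc_subset_Icc_self hx))
    rwa [abs_of_nonneg (sub_nonneg.2 hab)] at this
  have va : v a = 0 := intervalIntegral.integral_same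
  rw [va, mul_zero, sub_zero]
  calc _ ≤ ‖m b * v b‖ + ‖∫ x in a..b, deriv m x * v x‖ := norm_sub_le _ _
    _ ≤ B * K + B * K * (b - a) := by
        gcongr
        rw [norm_mul]
        gcongr
        · exact hB b
        · exact hK b (Set.right_mem_Icc.2 hab)
    _ = _ := by ring

theorem norm_integral_mul_le_of_deriv2 (h : IsPhase Ψ Ψ₁ Ψ₂) {m : ℝ → ℂ} (hm : ContDiff ℝ ∞ m)
    {a b B μ : ℝ} (hab : a ≤ b) (hμ : 0 < μ) (hB : ∀ ξ, ‖m ξ‖ ≤ B) (hB' : ∀ ξ, ‖deriv m ξ‖ ≤ B)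
    (h2 : (∀ x ∈ Set.Icc a b, μ ≤ Ψ₂ x) ∨ (∀ x ∈ Set.Icc a b, Ψ₂ x ≤ -μ)) :
    ‖∫ x in a..b, m x * Complex.exp (Complex.I * Ψ x)‖ ≤ B * (18 / √μ) * (1 + (b - a)) := by
  refine h.norm_integral_mul_le hm hab hB hB' fun x hx => ?_
  have hs : ∀ y ∈ Set.Icc a x, y ∈ Set.Icc a b := fun y hy => ⟨hy.1, hy.2.trans hx.2⟩
  exact h.norm_integral_le_of_deriv2 hx.1 hμ
    (h2.imp (fun h y hy => h y (hs y hy)) fun h y hy => h y (hs y hy))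

theorem norm_integral_mul_le_of_bound (h : IsPhase Ψ Ψ₁ Ψ₂) {m : ℝ → ℂ} (hm : ContDiff ℝ ∞ m)
    {a b B ν M : ℝ} (hab : a ≤ b) (hν : 0 < ν) (hB : ∀ ξ, ‖m ξ‖ ≤ B) (hB' : ∀ ξ, ‖deriv m ξ‖ ≤ B)
    (h1 : ∀ x ∈ Set.Icc a b, ν ≤ |Ψ₁ x|) (h2 : ∀ x ∈ Set.Icc a b, |Ψ₂ x| ≤ M) :
    ‖∫ x in a..b, m x * Complex.exp (Complex.I * Ψ x)‖ ≤
      B * (2 / ν + M / ν ^ 2 * (b - a)) * (1 + (b - a)) := by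
  refine h.norm_integral_mul_le hm hab hB hB' fun x hx => ?_
  have hs : ∀ y ∈ Set.Icc a x, y ∈ Set.Icc a b := fun y hy => ⟨hy.1, hy.2.trans hx.2⟩
  have hM : 0 ≤ M := (abs_nonneg _).trans (h2 a (Set.left_mem_Icc.2 hab))
  refine (h.norm_integral_le_of_bound hx.1 hν (fun y hy => h1 y (hs y hy))
    fun y hy => h2 y (hs y hy)).trans ?_
  have := hx.2
  gcongr

end IsPhase

/-! ### The dispersive estimate -/

/-- The first derivative of `phi`. -/
def phi₁ (ξ : ℝ) : ℝ := (1 - ξ ^ 2) / (1 + ξ ^ 2) ^ 2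

/-- The second derivative of `phi`. -/
def phi₂ (ξ : ℝ) : ℝ := 2 * (ξ * (ξ ^ 2 - 3)) / (1 + ξ ^ 2) ^ 3

theorem isPhase_phi (x t : ℝ) :
    IsPhase (fun ξ => x * ξ - t * phi ξ) (fun ξ => x - t * phi₁ ξ) (fun ξ => -(t * phi₂ ξ)) := by
  have hsq : ∀ y : ℝ, HasDerivAt (fun ξ : ℝ => 1 + ξ ^ 2) (2 * y) y := by
    intro y
    simpa using (hasDerivAt_pow 2 y).const_add 1
  have hpos : ∀ y : ℝ, 0 < 1 + y ^ 2 := fun y => by positivity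
  refine ⟨fun y => ?_, fun y => ?_, ?_⟩
  · have h := (hasDerivAt_id y).div (hsq y) (hpos y).ne'
    have h2 : HasDerivAt phi (phi₁ y) y := by
      have e : phi₁ y = (1 * (1 + y ^ 2) - id y * (2 * y)) / (1 + y ^ 2) ^ 2 := by
        simp only [phi₁, id]; ring
      rw [e]
      exact h
    have h3 : HasDerivAt (fun ξ : ℝ => x * ξ) x y := by
      simpa using (hasDerivAt_id y).const_mul x
    exact h3.sub (h2.const_mul t)
  · have h1 : HasDerivAt (fun ξ : ℝ => 1 - ξ ^ 2) (-(2 * y)) y := by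
      simpa using (hasDerivAt_pow 2 y).const_sub 1
    have h := h1.div ((hsq y).pow 2) (pow_ne_zero 2 (hpos y).ne')
    have h2 : HasDerivAt phi₁ (phi₂ y) y := by
      have e : phi₂ y = (-(2 * y) * (1 + y ^ 2) ^ 2 -
          (1 - y ^ 2) * (((2 : ℕ) : ℝ) * (1 + y ^ 2) ^ (2 - 1) * (2 * y))) / ((1 + y ^ 2) ^ 2) ^ 2 := by
        have := (hpos y).ne'
        simp only [phi₂]
        field_simp
        norm_num
        ring
      rw [e]
      exact h
    simpa using (h2.const_mul t).const_sub x
  · unfold phi₂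
    refine (continuous_const.mul (Continuous.div (by fun_prop) (by fun_prop) fun y => ?_)).neg
    exact pow_ne_zero 3 (hpos y).ne'

theorem abs_phi₁_le (ξ : ℝ) : |phi₁ ξ| ≤ 1 := by
  have h : 0 ≤ ξ ^ 2 := sq_nonneg ξ
  rw [phi₁, abs_div, abs_of_pos (show (0 : ℝ) < (1 + ξ ^ 2) ^ 2 by positivity),
    div_le_one (by positivity), abs_le]
  constructor <;> nlinarith

theorem abs_phi₂_le (ξ : ℝ) : |phi₂ ξ| ≤ 3 := by
  have h : 0 ≤ ξ ^ 2 := sq_nonneg ξ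
  rw [phi₂, abs_div, abs_of_pos (show (0 : ℝ) < (1 + ξ ^ 2) ^ 3 by positivity),
    div_le_iff₀ (by positivity), abs_mul, abs_mul, abs_two]
  have h1 : 2 * |ξ| ≤ 1 + ξ ^ 2 := by rw [← sq_abs ξ]; nlinarith [sq_nonneg (|ξ| - 1)]
  have h2 : |ξ ^ 2 - 3| ≤ 3 * (1 + ξ ^ 2) := by
    rw [abs_le]; constructor <;> nlinarith
  calc 2 * (|ξ| * |ξ ^ 2 - 3|) = (2 * |ξ|) * |ξ ^ 2 - 3| := by ring
    _ ≤ (1 + ξ ^ 2) * (3 * (1 + ξ ^ 2)) := by gcongr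
    _ ≤ 3 * (1 + ξ ^ 2) ^ 3 := by nlinarith [sq_nonneg (1 + ξ ^ 2)]

/-- The inflection points of `phi`. -/
def IsInflection (z : ℝ) : Prop := z * (z ^ 2 - 3) = 0

theorem abs_phi₂_le_mul {z : ℝ} (hz : IsInflection z) (ξ : ℝ) : |phi₂ ξ| ≤ 6 * |ξ - z| := by
  have h : 0 ≤ ξ ^ 2 := sq_nonneg ξ
  have h1 : 2 * |ξ| ≤ 1 + ξ ^ 2 := by rw [← sq_abs ξ]; nlinarith [sq_nonneg (|ξ| - 1)]
  rw [phi₂, abs_div, abs_of_pos (show (0 : ℝ) < (1 + ξ ^ 2) ^ 3 by positivity),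
    div_le_iff₀ (by positivity)]
  have h3 : (1 + ξ ^ 2) ≤ (1 + ξ ^ 2) ^ 3 := by nlinarith [sq_nonneg (1 + ξ ^ 2)]
  rcases mul_eq_zero.1 hz with h0 | h0
  · subst h0
    rw [abs_mul, abs_mul, abs_two, sub_zero]
    have h2 : |ξ ^ 2 - 3| ≤ 3 * (1 + ξ ^ 2) := by
      rw [abs_le]; constructor <;> nlinarith
    calc 2 * (|ξ| * |ξ ^ 2 - 3|) ≤ 2 * (|ξ| * (3 * (1 + ξ ^ 2) ^ 3)) := by
          gcongr; linarith
      _ = _ := by ring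
  · have hz2 : z ^ 2 = 3 := by linarith
    have e : 2 * (ξ * (ξ ^ 2 - 3)) = 2 * ξ * (ξ + z) * (ξ - z) := by rw [← hz2]; ring
    have hz3 : |z| ≤ 2 := abs_le_of_sq_le_sq (by linarith) (by norm_num)
    rw [e, abs_mul, abs_mul, abs_mul, abs_two]
    calc 2 * |ξ| * |ξ + z| * |ξ - z| ≤ 2 * |ξ| * (|ξ| + 2) * |ξ - z| := by
          gcongr; exact (abs_add_le _ _).trans (by linarith)
      _ = (2 * |ξ| ^ 2 + 2 * (2 * |ξ|)) * |ξ - z| := by ring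
      _ ≤ (2 * ξ ^ 2 + 2 * (1 + ξ ^ 2)) * |ξ - z| := by rw [sq_abs]; gcongr
      _ ≤ 6 * (1 + ξ ^ 2) ^ 3 * |ξ - z| := by gcongr; linarith
      _ = _ := by ring

theorem abs_phi₁_sub_le {z : ℝ} (hz : IsInflection z) (ξ : ℝ) :
    |phi₁ ξ - phi₁ z| ≤ 6 * |ξ - z| ^ 2 := by
  have hd : ∀ y, HasDerivAt phi₁ (phi₂ y) y := by
    intro y
    have := (isPhase_phi 0 (-1)).deriv2 y
    simpa using this
  have := Convex.norm_image_sub_le_of_norm_hasDerivWithin_le (f := phi₁) (f' := phi₂)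
    (s := Set.uIcc z ξ) (x := z) (y := ξ) (C := 6 * |ξ - z|)
    (fun y _ => (hd y).hasDerivWithinAt) (fun y hy => by
      rw [Real.norm_eq_abs]
      refine (abs_phi₂_le_mul hz y).trans ?_
      gcongr 6 * ?_
      have := Set.abs_sub_left_of_mem_uIcc hy
      exact this)
    (convex_uIcc z ξ) Set.left_mem_uIcc Set.right_mem_uIcc
  rw [Real.norm_eq_abs, Real.norm_eq_abs] at this
  refine this.trans_eq (by ring)

/-- The oscillatory integral which is the kernel of `a(D) S(t)`. -/
def osc (a : ℝ → ℂ) (t x : ℝ) : ℂ :=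
  ∫ ξ, a ξ * Complex.exp (Complex.I * ((x * ξ - t * phi ξ : ℝ) : ℂ))

/-- The symbol of `a(D) S(t)`. -/
def grp (a : ℝ → ℂ) (t : ℝ) (ξ : ℝ) : ℂ := a ξ * Complex.exp (-(Complex.I * t * phi ξ))

theorem contDiff_phi : ContDiff ℝ ∞ phi := by
  unfold phi
  exact contDiff_id.div (contDiff_const.add (contDiff_id.pow 2)) fun y => by positivity

theorem contDiff_cexp_phi (t : ℝ) :
    ContDiff ℝ ∞ fun ξ : ℝ => Complex.exp (-(Complex.I * t * phi ξ)) :=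
  (contDiff_const.mul (Complex.ofRealCLM.contDiff.comp contDiff_phi)).neg.cexp

theorem Sym.grp {a : ℝ → ℂ} (ha : Sym a) (t : ℝ) : Sym (grp a t) :=
  ha.mul_right (contDiff_cexp_phi t)

theorem norm_grp (a : ℝ → ℂ) (t ξ : ℝ) : ‖grp a t ξ‖ = ‖a ξ‖ := by
  have : -(Complex.I * t * phi ξ) = ((-(t * phi ξ) : ℝ) : ℂ) * Complex.I := by push_cast; ring
  rw [grp, norm_mul, this, Complex.norm_exp_ofReal_mul_I, mul_one]

theorem norm_ker_grp_le {a : ℝ → ℂ} (ha : Sym a) (t x : ℝ) :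
    ‖(ha.grp t).ker x‖ ≤ ‖osc a t x‖ := by
  refine (norm_ker_le (ha.grp t) x).trans_eq ?_
  rw [osc]
  congr 2
  funext ξ
  rw [grp, mul_assoc, ← Complex.exp_add]
  congr 2
  push_cast
  ring

/-- A smooth amplitude supported near `c`, of size `B` together with its derivative. -/
structure IsAmp (a : ℝ → ℂ) (c B : ℝ) : Prop where
  smooth : ContDiff ℝ ∞ a
  supp : ∀ ξ, a ξ ≠ 0 → |ξ - c| < 2
  le : ∀ ξ, ‖a ξ‖ ≤ B
  deriv_le : ∀ ξ, ‖deriv a ξ‖ ≤ B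

namespace IsAmp

variable {a : ℝ → ℂ} {c B : ℝ}

theorem nonneg (h : IsAmp a c B) : 0 ≤ B := (norm_nonneg _).trans (h.le 0)

theorem sym (h : IsAmp a c B) : Sym a := by
  refine ⟨h.smooth, HasCompactSupport.of_support_subset_isCompact
    (isCompact_Icc (a := c - 2) (b := c + 2)) fun ξ hξ => ?_⟩
  have := abs_lt.1 (h.supp ξ hξ)
  constructor <;> linarith

theorem osc_eq (h : IsAmp a c B) {u v : ℝ} (hu : u ≤ c - 2) (hv : c + 2 ≤ v) (t x : ℝ) :
    osc a t x = ∫ ξ in u..v, a ξ * Complex.exp (Complex.I * ((x * ξ - t * phi ξ : ℝ) : ℂ)) := by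
  rw [osc, intervalIntegral.integral_eq_integral_of_support_subset]
  intro ξ hξ
  have hne : a ξ ≠ 0 := fun h0 => hξ (by simp [h0])
  have := abs_lt.1 (h.supp ξ hne)
  constructor <;> linarith

theorem norm_osc_le (h : IsAmp a c B) (t x : ℝ) : ‖osc a t x‖ ≤ 4 * B := by
  rw [h.osc_eq (u := c - 2) (v := c + 2) le_rfl le_rfl]
  have := intervalIntegral.norm_integral_le_of_norm_le_const (a := c - 2) (b := c + 2) (C := B)
    (f := fun ξ => a ξ * Complex.exp (Complex.I * ((x * ξ - t * phi ξ : ℝ) : ℂ))) fun ξ _ => by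
      rw [norm_mul, mul_comm Complex.I, Complex.norm_exp_ofReal_mul_I, mul_one]
      exact h.le ξ
  refine this.trans_eq ?_
  rw [show c + 2 - (c - 2) = 4 by ring]
  norm_num
  ring

theorem norm_osc_le_of_deriv2 (h : IsAmp a c B) {t μ : ℝ} (hμ : 0 < μ) (x : ℝ)
    (h2 : (∀ ξ ∈ Set.Icc (c - 2) (c + 2), μ ≤ -(t * phi₂ ξ)) ∨
      (∀ ξ ∈ Set.Icc (c - 2) (c + 2), -(t * phi₂ ξ) ≤ -μ)) :
    ‖osc a t x‖ ≤ 90 * B / √μ := by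
  rw [h.osc_eq (u := c - 2) (v := c + 2) le_rfl le_rfl]
  refine ((isPhase_phi x t).norm_integral_mul_le_of_deriv2 h.smooth (by linarith) hμ h.le h.deriv_le
    h2).trans_eq ?_
  ring

end IsAmp

theorem phi₂_neg (ξ : ℝ) : phi₂ (-ξ) = -phi₂ ξ := by
  simp only [phi₂]; ring

/-- A two-sided lower bound for `t φ''` from one for `φ''`. -/
theorem phase_sign {s : Set ℝ} {m t : ℝ} (ht : t ≠ 0)
    (h : (∀ ξ ∈ s, m ≤ phi₂ ξ) ∨ (∀ ξ ∈ s, phi₂ ξ ≤ -m)) :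
    (∀ ξ ∈ s, |t| * m ≤ -(t * phi₂ ξ)) ∨ (∀ ξ ∈ s, -(t * phi₂ ξ) ≤ -(|t| * m)) := by
  rcases lt_or_gt_of_ne ht with h0 | h0
  · rw [abs_of_neg h0]
    rcases h with h | h
    · exact Or.inl fun ξ hξ => by nlinarith [h ξ hξ]
    · exact Or.inr fun ξ hξ => by nlinarith [h ξ hξ]
  · rw [abs_of_pos h0]
    rcases h with h | h
    · exact Or.inr fun ξ hξ => by nlinarith [h ξ hξ]
    · exact Or.inl fun ξ hξ => by nlinarith [h ξ hξ]

theorem phi₂_high {c ξ : ℝ} (hc : 4 ≤ c) (h1 : c / 2 ≤ ξ) (h2 : ξ ≤ 3 / 2 * c) :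
    1 / (27 * c ^ 3) ≤ phi₂ ξ := by
  have hc0 : 0 < c := by linarith
  have k3 : 0 < ξ := by linarith
  have k1 : 1 + ξ ^ 2 ≤ 5 / 4 * ξ ^ 2 := by nlinarith
  have k2 : (1 + ξ ^ 2) ^ 3 ≤ (5 / 4 * ξ ^ 2) ^ 3 := by gcongr
  have k4 : ξ ^ 3 ≤ (3 / 2 * c) ^ 3 := by gcongr
  have k5 : ξ ^ 2 / 4 ≤ ξ ^ 2 - 3 := by nlinarith
  have k6 : ξ * (ξ ^ 2 / 4) ≤ ξ * (ξ ^ 2 - 3) := by gcongr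
  rw [phi₂, div_le_div_iff₀ (by positivity) (by positivity), one_mul]
  calc (1 + ξ ^ 2) ^ 3 ≤ (5 / 4 * ξ ^ 2) ^ 3 := k2
    _ = 125 / 64 * (ξ ^ 3 * ξ ^ 3) := by ring
    _ ≤ 125 / 64 * (ξ ^ 3 * (3 / 2 * c) ^ 3) := by gcongr
    _ = (125 / 64 * (27 / 8)) * (ξ ^ 3 * c ^ 3) := by ring
    _ ≤ (2 * (27 / 4)) * (ξ ^ 3 * c ^ 3) := mul_le_mul_of_nonneg_right (by norm_num) (by positivity)
    _ = 2 * (ξ * (ξ ^ 2 / 4)) * (27 * c ^ 3) := by ring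
    _ ≤ _ := by gcongr

theorem IsAmp.norm_osc_high {a : ℝ → ℂ} {c B : ℝ} (h : IsAmp a c B) (hc : 4 ≤ |c|) {t : ℝ}
    (ht : t ≠ 0) (x : ℝ) : ‖osc a t x‖ ≤ 600 * B * √(|c| ^ 3 / |t|) := by
  have hB := h.nonneg
  have ht' : 0 < |t| := abs_pos.2 ht
  have hc0 : 0 < |c| := by linarith
  have hμ : 0 < |t| * (1 / (27 * |c| ^ 3)) := by positivity
  have hs : (∀ ξ ∈ Set.Icc (c - 2) (c + 2), 1 / (27 * |c| ^ 3) ≤ phi₂ ξ) ∨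
      (∀ ξ ∈ Set.Icc (c - 2) (c + 2), phi₂ ξ ≤ -(1 / (27 * |c| ^ 3))) := by
    rcases le_total 0 c with h0 | h0
    · rw [abs_of_nonneg h0] at *
      exact Or.inl fun ξ hξ => phi₂_high hc (by linarith [hξ.1]) (by linarith [hξ.2])
    · rw [abs_of_nonpos h0] at *
      refine Or.inr fun ξ hξ => ?_
      have := phi₂_high (ξ := -ξ) hc (by linarith [hξ.2]) (by linarith [hξ.1])
      rw [phi₂_neg] at this
      linarith
  refine (h.norm_osc_le_of_deriv2 hμ x (phase_sign ht hs)).trans ?_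
  have e : |t| * (1 / (27 * |c| ^ 3)) = (|c| ^ 3 / |t|)⁻¹ * (27)⁻¹ := by
    field_simp
  rw [e, Real.sqrt_mul (by positivity), Real.sqrt_inv, Real.sqrt_inv]
  have h27 : √(27 : ℝ) ≤ 6 := Real.sqrt_le_iff.2 ⟨by norm_num, by norm_num⟩
  have hy : 0 < √(|c| ^ 3 / |t|) := Real.sqrt_pos.2 (by positivity)
  calc 90 * B / ((√(|c| ^ 3 / |t|))⁻¹ * (√27)⁻¹) = 90 * B * √(|c| ^ 3 / |t|) * √27 := by
        field_simp
    _ ≤ 90 * B * √(|c| ^ 3 / |t|) * 6 := by gcongr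
    _ ≤ _ := by nlinarith [mul_nonneg hB hy.le]

theorem IsAmp.norm_osc_high_cbrt {a : ℝ → ℂ} {c B : ℝ} (h : IsAmp a c B) (hc : 4 ≤ |c|) {t : ℝ}
    (ht : t ≠ 0) (x : ℝ) : ‖osc a t x‖ ≤ 600 * B * |c| * |t| ^ (-(1 / 3) : ℝ) := by
  have hB := h.nonneg
  have ht' : 0 < |t| := abs_pos.2 ht
  have hc0 : 0 < |c| := by linarith
  set y := |c| ^ 3 / |t| with hy
  have hy0 : 0 < y := by positivity
  have e : |c| * |t| ^ (-(1 / 3) : ℝ) = y ^ (1 / 3 : ℝ) := by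
    rw [hy, Real.div_rpow (by positivity) ht'.le, Real.rpow_neg ht'.le, ← Real.rpow_natCast,
      ← Real.rpow_mul hc0.le]
    norm_num
    rfl
  rw [mul_assoc, e]
  rcases le_total 1 y with h1 | h1
  · refine (h.norm_osc_le t x).trans ?_
    have : 1 ≤ y ^ (1 / 3 : ℝ) := Real.one_le_rpow h1 (by norm_num)
    nlinarith
  · refine (h.norm_osc_high hc ht x).trans ?_
    gcongr
    rw [Real.sqrt_eq_rpow]
    exact Real.rpow_le_rpow_of_exponent_ge hy0 h1 (by norm_num)

/-! Low frequencies -/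

theorem phi₂_lower {n δ ξ : ℝ} (hξ : |ξ| ≤ 6) (hδ : 0 ≤ δ) (hn : n = ξ * (ξ ^ 2 - 3)) (h : δ ≤ n) :
    δ / 25600 ≤ phi₂ ξ := by
  have h2 : ξ ^ 2 ≤ 36 := by
    rw [← sq_abs]; nlinarith [abs_nonneg ξ]
  have h3 : (1 + ξ ^ 2) ^ 3 ≤ (1 + 36) ^ 3 := by gcongr
  rw [phi₂, ← hn, div_le_div_iff₀ (by norm_num) (by positivity)]
  have hn0 : 0 ≤ n := hδ.trans h
  calc δ * (1 + ξ ^ 2) ^ 3 ≤ n * (1 + 36) ^ 3 := by gcongr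
    _ ≤ _ := by linarith

theorem sqrt_three_bounds : 17 / 10 < √(3 : ℝ) ∧ √(3 : ℝ) < 18 / 10 :=
  ⟨Real.lt_sqrt_of_sq_lt (by norm_num), (Real.sqrt_lt' (by norm_num)).2 (by norm_num)⟩

theorem phi₂_outer {δ ξ : ℝ} (hδ : 0 < δ) (hδ' : δ ≤ 1 / 2) (h1 : √3 + δ ≤ ξ) (h2 : ξ ≤ 6) :
    δ / 25600 ≤ phi₂ ξ := by
  obtain ⟨w1, w2⟩ := sqrt_three_bounds
  have w3 : √(3 : ℝ) ^ 2 = 3 := Real.sq_sqrt (by norm_num)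
  refine phi₂_lower (n := ξ * ((ξ - √3) * (ξ + √3))) (abs_le.2 ⟨by linarith, h2⟩) hδ.le
    (by
      have : ξ * ((ξ - √3) * (ξ + √3)) = ξ * (ξ ^ 2 - √3 ^ 2) := by ring
      rw [this, w3]) ?_
  have k1 : δ ≤ (ξ - √3) * (ξ + √3) := by nlinarith
  nlinarith

theorem phi₂_inner {δ ξ : ℝ} (hδ : 0 < δ) (hδ' : δ ≤ 1 / 2) (h1 : δ ≤ ξ) (h2 : ξ ≤ √3 - δ) :
    phi₂ ξ ≤ -(δ / 25600) := by
  obtain ⟨w1, w2⟩ := sqrt_three_bounds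
  have w3 : √(3 : ℝ) ^ 2 = 3 := Real.sq_sqrt (by norm_num)
  have := phi₂_lower (ξ := -ξ) (n := ξ * (√3 - ξ) * (√3 + ξ)) (δ := δ)
    (by rw [abs_neg]; exact abs_le.2 ⟨by linarith, by linarith⟩) hδ.le
    (by
      have : ξ * (√3 - ξ) * (√3 + ξ) = ξ * (√3 ^ 2 - ξ ^ 2) := by ring
      rw [this, w3]; ring) (by
      have k1 : δ * (√3 - δ) ≤ ξ * (√3 - ξ) := by nlinarith
      have k2 : δ ≤ δ * (√3 - δ) := by nlinarith
      nlinarith)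
  rw [phi₂_neg] at this
  linarith

namespace IsAmp

variable {a : ℝ → ℂ} {c B : ℝ}

/-- The contributions of the neighbourhoods of the inflection points are kept. -/
theorem norm_osc_low_le (h : IsAmp a c B) (hc : |c| < 4) {t δ : ℝ} (ht : t ≠ 0) (hδ : 0 < δ)
    (hδ' : δ ≤ 1 / 2) (x : ℝ) {K : ℝ}
    (hK : ∀ z, IsInflection z → ‖∫ ξ in (z - δ)..(z + δ),
      a ξ * Complex.exp (Complex.I * ((x * ξ - t * phi ξ : ℝ) : ℂ))‖ ≤ K) :
    ‖osc a t x‖ ≤ 150000 * B / √(|t| * δ) + 3 * K := by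
  obtain ⟨w1, w2⟩ := sqrt_three_bounds
  have w3 : √(3 : ℝ) ^ 2 = 3 := Real.sq_sqrt (by norm_num)
  have ht' : 0 < |t| := abs_pos.2 ht
  have hB := h.nonneg
  have hμ : 0 < |t| * (δ / 25600) := by positivity
  have hc' := abs_lt.1 hc
  rw [h.osc_eq (u := -6) (v := 6) (by linarith) (by linarith)]
  set f : ℝ → ℂ := fun ξ => a ξ * Complex.exp (Complex.I * ((x * ξ - t * phi ξ : ℝ) : ℂ))
  have hcont : Continuous f :=
    h.smooth.continuous.mul (isPhase_phi x t).continuous_cexp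
  have hint : ∀ u v, IntervalIntegrable f volume u v := fun u v => hcont.intervalIntegrable _ _
  have hpiece : ∀ u v, u ≤ v → v - u ≤ 12 → ((∀ ξ ∈ Set.Icc u v, δ / 25600 ≤ phi₂ ξ) ∨
      (∀ ξ ∈ Set.Icc u v, phi₂ ξ ≤ -(δ / 25600))) → ‖∫ ξ in u..v, f ξ‖ ≤ 37500 * B / √(|t| * δ) := by
    intro u v huv hl hs
    refine ((isPhase_phi x t).norm_integral_mul_le_of_deriv2 h.smooth huv hμ h.le h.deriv_le
      (phase_sign ht hs)).trans ?_
    have e : √(|t| * (δ / 25600)) = √(|t| * δ) / 160 := by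
      rw [show |t| * (δ / 25600) = (|t| * δ) / 160 ^ 2 by ring, Real.sqrt_div (by positivity),
        Real.sqrt_sq (by norm_num)]
    rw [e]
    calc B * (18 / (√(|t| * δ) / 160)) * (1 + (v - u)) ≤ B * (18 / (√(|t| * δ) / 160)) * 13 := by
          gcongr; linarith
      _ = 37440 * B / √(|t| * δ) := by ring
      _ ≤ _ := by gcongr; norm_num
  have p1 := hpiece (-6) (-√3 - δ) (by linarith) (by linarith) (Or.inr fun ξ hξ => by
    have := phi₂_outer hδ hδ' (ξ := -ξ) (by linarith [hξ.2]) (by linarith [hξ.1])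
    rw [phi₂_neg] at this; linarith)
  have p2 := hpiece (-√3 + δ) (0 - δ) (by linarith) (by linarith) (Or.inl fun ξ hξ => by
    have := phi₂_inner hδ hδ' (ξ := -ξ) (by linarith [hξ.2]) (by linarith [hξ.1])
    rw [phi₂_neg] at this; linarith)
  have p3 := hpiece (0 + δ) (√3 - δ) (by linarith) (by linarith) (Or.inr fun ξ hξ =>
    phi₂_inner hδ hδ' (by linarith [hξ.1]) hξ.2)
  have p4 := hpiece (√3 + δ) 6 (by linarith) (by linarith) (Or.inl fun ξ hξ =>
    phi₂_outer hδ hδ' hξ.1 hξ.2)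
  have k1 := hK (-√3) (by rw [IsInflection, neg_sq, w3]; simp)
  have k2 := hK 0 (by simp [IsInflection])
  have k3 := hK √3 (by rw [IsInflection, w3]; simp)
  rw [← intervalIntegral.integral_add_adjacent_intervals (hint (-6) (-√3 - δ)) (hint _ 6),
    ← intervalIntegral.integral_add_adjacent_intervals (hint _ (-√3 + δ)) (hint _ 6),
    ← intervalIntegral.integral_add_adjacent_intervals (hint _ (0 - δ)) (hint _ 6),
    ← intervalIntegral.integral_add_adjacent_intervals (hint _ (0 + δ)) (hint _ 6),
    ← intervalIntegral.integral_add_adjacent_intervals (hint _ (√3 - δ)) (hint _ 6),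
    ← intervalIntegral.integral_add_adjacent_intervals (hint _ (√3 + δ)) (hint _ 6)]
  calc _ ≤ 37500 * B / √(|t| * δ) + (K + (37500 * B / √(|t| * δ) + (K + (37500 * B / √(|t| * δ) +
        (K + 37500 * B / √(|t| * δ)))))) :=
        norm_add_le_of_le p1 (norm_add_le_of_le k1 (norm_add_le_of_le p2 (norm_add_le_of_le k2
          (norm_add_le_of_le p3 (norm_add_le_of_le k3 p4)))))
    _ = _ := by ring

theorem norm_osc_low_cbrt (h : IsAmp a c B) (hc : |c| < 4) {t : ℝ} (ht : t ≠ 0) (x : ℝ) :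
    ‖osc a t x‖ ≤ 200000 * B * |t| ^ (-(1 / 3) : ℝ) := by
  have hB := h.nonneg
  have ht' : 0 < |t| := abs_pos.2 ht
  set δ := |t| ^ (-(1 / 3) : ℝ) with hδ
  have hδ0 : 0 < δ := by positivity
  have h3 : |t| * δ = (δ⁻¹) ^ 2 := by
    rw [hδ, ← Real.rpow_neg ht'.le, neg_neg, ← Real.rpow_natCast, ← Real.rpow_mul ht'.le]
    nth_rw 1 [← Real.rpow_one |t|]
    rw [← Real.rpow_add ht']
    norm_num
  rcases le_total δ (1 / 2) with hle | hle
  · have := h.norm_osc_low_le hc ht hδ0 hle x (K := 2 * δ * B) (by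
      intro z _
      have := intervalIntegral.norm_integral_le_of_norm_le_const (a := z - δ) (b := z + δ) (C := B)
        (f := fun ξ => a ξ * Complex.exp (Complex.I * ((x * ξ - t * phi ξ : ℝ) : ℂ))) fun ξ _ => by
          rw [norm_mul, mul_comm Complex.I, Complex.norm_exp_ofReal_mul_I, mul_one]
          exact h.le ξ
      refine this.trans_eq ?_
      rw [show z + δ - (z - δ) = 2 * δ by ring, abs_of_pos (by positivity)]
      ring)
    refine this.trans ?_
    rw [h3, Real.sqrt_sq (by positivity), div_inv_eq_mul]
    nlinarith [mul_nonneg hB hδ0.le]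
  · refine (h.norm_osc_le t x).trans ?_
    nlinarith

/-- The pointwise decay of the kernel away from the caustics. -/
theorem norm_osc_low_caustic (h : IsAmp a c B) (hc : |c| < 4) {t Y : ℝ} (ht : 1 ≤ |t|) (hY : 0 ≤ Y)
    (x : ℝ) (hxY : ∀ z, IsInflection z → Y ≤ |x - phi₁ z * t|) :
    ‖osc a t x‖ ≤ 1000000 * B * (|t| * (1 + Y)) ^ (-(1 / 4) : ℝ) := by
  have hB := h.nonneg
  have ht' : 0 < |t| := by linarith
  have ht0 : t ≠ 0 := abs_pos.1 ht'
  set T := |t| with hT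
  have hroot : ∀ y : ℝ, 0 < y → y ^ (-(1 / 4) : ℝ) = 1 / √√y := by
    intro y hy
    rw [Real.rpow_neg hy.le, Real.sqrt_eq_rpow, Real.sqrt_eq_rpow, ← Real.rpow_mul hy.le, one_div]
    norm_num
  rcases le_total (Y ^ 3) T with hle | hge
  · refine (h.norm_osc_low_cbrt hc ht0 x).trans ?_
    have key : T ^ (-(1 / 3) : ℝ) ≤ 2 * (T * (1 + Y)) ^ (-(1 / 4) : ℝ) := by
      have hYT : Y ≤ T ^ (1 / 3 : ℝ) := by
        calc Y = (Y ^ 3) ^ (1 / 3 : ℝ) := by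
              rw [← Real.rpow_natCast, ← Real.rpow_mul hY]; norm_num
          _ ≤ _ := by gcongr
      have h1T : 1 ≤ T ^ (1 / 3 : ℝ) := Real.one_le_rpow ht (by norm_num)
      have h2 : T * (1 + Y) ≤ 2 * T ^ (4 / 3 : ℝ) := by
        have : T ^ (4 / 3 : ℝ) = T * T ^ (1 / 3 : ℝ) := by
          nth_rw 2 [← Real.rpow_one T]
          rw [← Real.rpow_add ht']; norm_num
        rw [this]
        nlinarith
      have h3 : (2 * T ^ (4 / 3 : ℝ)) ^ (-(1 / 4) : ℝ) ≤ (T * (1 + Y)) ^ (-(1 / 4) : ℝ) :=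
        Real.rpow_le_rpow_of_nonpos (by positivity) h2 (by norm_num)
      rw [Real.mul_rpow (by norm_num) (by positivity), ← Real.rpow_mul ht'.le] at h3
      norm_num at h3
      have h4 : (1 / 2 : ℝ) ≤ 2 ^ (-(1 / 4) : ℝ) := by
        calc (1 / 2 : ℝ) = 2 ^ (-1 : ℝ) := by rw [Real.rpow_neg_one]; norm_num
          _ ≤ _ := Real.rpow_le_rpow_of_exponent_le (by norm_num) (by norm_num)
      have h5 : 0 < T ^ (-(1 / 3) : ℝ) := by positivity
      norm_num at h4 h5 ⊢
      nlinarith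
    calc 200000 * B * T ^ (-(1 / 3) : ℝ) ≤
        200000 * B * (2 * (T * (1 + Y)) ^ (-(1 / 4) : ℝ)) := by gcongr
      _ = 400000 * B * (T * (1 + Y)) ^ (-(1 / 4) : ℝ) := by ring
      _ ≤ _ := by gcongr; norm_num
  have hY1 : 1 ≤ Y := by
    by_contra! hlt
    have : Y ^ 3 < 1 := pow_lt_one₀ hY hlt (by norm_num)
    linarith
  have hY0 : 0 < Y := by linarith
  have hTY : 0 < T * Y := by positivity
  set R := √√(T * Y) with hR
  have hR0 : 0 < R := Real.sqrt_pos.2 (Real.sqrt_pos.2 hTY)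
  have hR2 : R ^ 2 = √(T * Y) := Real.sq_sqrt (Real.sqrt_nonneg _)
  have hR4 : R ^ 4 = T * Y := by
    rw [show R ^ 4 = (R ^ 2) ^ 2 by ring, hR2, Real.sq_sqrt hTY.le]
  have hRY : R ≤ Y := by
    have : R ^ 4 ≤ Y ^ 4 := by rw [hR4]; nlinarith
    exact le_of_pow_le_pow_left₀ (by norm_num) hY0.le this
  have hYR : 1 / Y ≤ 1 / R := one_div_le_one_div_of_le hR0 hRY
  have hfin : 1 / R ≤ 2 * (T * (1 + Y)) ^ (-(1 / 4) : ℝ) := by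
    rw [hroot _ (by positivity)]
    have : √√(T * (1 + Y)) ≤ 2 * R := by
      rw [hR, Real.sqrt_le_left (by positivity), mul_pow, Real.sq_sqrt (Real.sqrt_nonneg _),
        Real.sqrt_le_left (by positivity), mul_pow, Real.sq_sqrt hTY.le]
      nlinarith
    have h0 : 0 < √√(T * (1 + Y)) := Real.sqrt_pos.2 (Real.sqrt_pos.2 (by positivity))
    rw [mul_one_div, div_le_div_iff₀ hR0 h0]
    linarith
  suffices hs : ‖osc a t x‖ ≤ 400000 * B * (1 / R) by
    refine hs.trans ?_
    calc 400000 * B * (1 / R) ≤ 400000 * B * (2 * (T * (1 + Y)) ^ (-(1 / 4) : ℝ)) := by gcongr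
      _ = 800000 * B * (T * (1 + Y)) ^ (-(1 / 4) : ℝ) := by ring
      _ ≤ _ := by gcongr; norm_num
  rcases le_total Y (4 * T) with hle | hbig
  · set δ := √(Y / T) / 4 with hδ
    have hδ0 : 0 < δ := by positivity
    have hδ2 : δ ^ 2 = Y / T / 16 := by
      rw [hδ, div_pow, Real.sq_sqrt (by positivity)]; norm_num
    have hδ' : δ ≤ 1 / 2 := by
      have : √(Y / T) ≤ 2 := Real.sqrt_le_iff.2 ⟨by norm_num, by
        rw [div_le_iff₀ ht']; linarith⟩
      rw [hδ]; linarith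
    have hTδ2 : T * δ ^ 2 = Y / 16 := by rw [hδ2]; field_simp
    have hTδ : √(T * δ) = R / 2 := by
      have : T * δ = (R / 2) ^ 2 := by
        rw [div_pow, hR2, hδ]
        have : √(T * Y) = T * √(Y / T) := by
          rw [show T * Y = T ^ 2 * (Y / T) by field_simp, Real.sqrt_mul (by positivity),
            Real.sqrt_sq ht'.le]
        rw [this]; ring
      rw [this, Real.sqrt_sq (by positivity)]
    have := h.norm_osc_low_le hc ht0 hδ0 hδ' x (K := 20 * B * (1 / Y)) (by
      intro z hz
      have hb := (isPhase_phi x t).norm_integral_mul_le_of_bound h.smooth (a := z - δ) (b := z + δ)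
        (ν := Y / 2) (M := 6 * T * δ) (by linarith) (by positivity) h.le h.deriv_le
        (fun ξ hξ => by
          have hd : |ξ - z| ≤ δ := abs_le.2 ⟨by linarith [hξ.1], by linarith [hξ.2]⟩
          have h1 := abs_phi₁_sub_le hz ξ
          have h2 : |t * (phi₁ ξ - phi₁ z)| ≤ T * (6 * δ ^ 2) := by
            rw [abs_mul]
            have : |ξ - z| ^ 2 ≤ δ ^ 2 := by gcongr
            gcongr
            linarith
          have h3 := hxY z hz
          have h4 : x - phi₁ z * t = (x - t * phi₁ ξ) + t * (phi₁ ξ - phi₁ z) := by ring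
          rw [h4] at h3
          have h5 := abs_add_le (x - t * phi₁ ξ) (t * (phi₁ ξ - phi₁ z))
          nlinarith)
        (fun ξ hξ => by
          have hd : |ξ - z| ≤ δ := abs_le.2 ⟨by linarith [hξ.1], by linarith [hξ.2]⟩
          rw [abs_neg, abs_mul]
          have := abs_phi₂_le_mul hz ξ
          calc T * |phi₂ ξ| ≤ T * (6 * δ) := by gcongr; linarith
            _ = _ := by ring)
      refine hb.trans ?_
      have e1 : 2 / (Y / 2) + 6 * T * δ / (Y / 2) ^ 2 * (z + δ - (z - δ)) = 7 * (1 / Y) := by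
        rw [show 6 * T * δ / (Y / 2) ^ 2 * (z + δ - (z - δ)) = 48 * (T * δ ^ 2) / Y ^ 2 by
          field_simp; ring, hTδ2]
        field_simp
        norm_num
      rw [e1]
      have : 1 + (z + δ - (z - δ)) ≤ 2 := by linarith
      calc B * (7 * (1 / Y)) * (1 + (z + δ - (z - δ))) ≤ B * (7 * (1 / Y)) * 2 := by gcongr
        _ = 14 * B * (1 / Y) := by ring
        _ ≤ _ := by gcongr; norm_num)
    refine this.trans ?_
    rw [hTδ]
    calc 150000 * B / (R / 2) + 3 * (20 * B * (1 / Y)) ≤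
        150000 * B / (R / 2) + 3 * (20 * B * (1 / R)) := by gcongr
      _ = 300060 * B * (1 / R) := by field_simp; ring
      _ ≤ _ := by gcongr; norm_num
  · have hb := (isPhase_phi x t).norm_integral_mul_le_of_bound h.smooth (a := c - 2) (b := c + 2)
      (ν := Y / 2) (M := 3 * T) (by linarith) (by positivity) h.le h.deriv_le
      (fun ξ _ => by
        have h3 := hxY 0 (by simp [IsInflection])
        have h4 : x - phi₁ 0 * t = (x - t * phi₁ ξ) + (t * phi₁ ξ - t * phi₁ 0) := by ring
        rw [h4] at h3
        have h5 := abs_add_le (x - t * phi₁ ξ) (t * phi₁ ξ - t * phi₁ 0)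
        have h6 := abs_sub (t * phi₁ ξ) (t * phi₁ 0)
        rw [abs_mul, abs_mul] at h6
        have h7 := abs_phi₁_le ξ
        have h8 := abs_phi₁_le 0
        nlinarith)
      (fun ξ _ => by
        rw [abs_neg, abs_mul]
        have := abs_phi₂_le ξ
        nlinarith)
    rw [h.osc_eq (u := c - 2) (v := c + 2) le_rfl le_rfl]
    refine hb.trans ?_
    have e1 : 2 / (Y / 2) + 3 * T / (Y / 2) ^ 2 * (c + 2 - (c - 2)) ≤ 16 * (1 / Y) := by
      have : 3 * T / (Y / 2) ^ 2 * (c + 2 - (c - 2)) ≤ 12 * (1 / Y) := by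
        rw [show 3 * T / (Y / 2) ^ 2 * (c + 2 - (c - 2)) = 12 * (4 * T) / Y / Y by field_simp; ring]
        rw [mul_one_div]
        gcongr
        rw [div_le_iff₀ hY0]; linarith
      have h2 : 2 / (Y / 2) = 4 * (1 / Y) := by field_simp; norm_num
      linarith
    calc _ ≤ B * (16 * (1 / R)) * (1 + (c + 2 - (c - 2))) := by
          have : 0 ≤ 1 + (c + 2 - (c - 2)) := by linarith
          gcongr
          linarith
      _ = 80 * B * (1 / R) := by ring
      _ ≤ _ := by gcongr; norm_num

end IsAmp

/-! ### Tempered distributions given by functions -/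

/-- The embedding of the Schwartz functions into the tempered distributions. -/
abbrev emb : 𝓢(ℝ, ℂ) →L[ℂ] 𝓢'(ℝ, ℂ) := SchwartzMap.toTemperedDistributionCLM ℝ ℂ volume

theorem emb_apply (f g : 𝓢(ℝ, ℂ)) : emb f g = ∫ x, g x * f x := by
  exact SchwartzMap.toTemperedDistributionCLM_apply_apply volume f g

/-- A smooth compactly supported real function as a Schwartz function. -/
def ofCompact {φ : ℝ → ℝ} (h1 : ContDiff ℝ ∞ φ) (h2 : HasCompactSupport φ) : 𝓢(ℝ, ℂ) :=
  HasCompactSupport.toSchwartzMap (f := fun x => (φ x : ℂ))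
    (h2.comp_left (g := fun y : ℝ => (y : ℂ)) Complex.ofReal_zero)
    (Complex.ofRealCLM.contDiff.comp h1)

theorem ofCompact_apply {φ : ℝ → ℝ} (h1 : ContDiff ℝ ∞ φ) (h2 : HasCompactSupport φ) (x : ℝ) :
    ofCompact h1 h2 x = φ x := rfl

namespace IsFunction

variable {T U : 𝓢'(ℝ, ℂ)} {g h : ℝ → ℂ}

theorem locallyIntegrable (hT : IsFunction T g) : LocallyIntegrable g := by
  intro x
  let b : ContDiffBump x := ⟨1, 2, by norm_num, by norm_num⟩
  have h1 := (hT (ofCompact b.contDiff b.hasCompactSupport)).1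
  refine ⟨Metric.closedBall x 1, Metric.closedBall_mem_nhds x one_pos, ?_⟩
  refine (h1.integrableOn (s := Metric.closedBall x 1)).congr_fun (fun y hy => ?_)
    Metric.isClosed_closedBall.measurableSet
  simp only [ofCompact_apply]
  rw [b.one_of_mem_closedBall hy]
  simp

theorem aestronglyMeasurable (hT : IsFunction T g) : AEStronglyMeasurable g :=
  hT.locallyIntegrable.aestronglyMeasurable

theorem add (hT : IsFunction T g) (hU : IsFunction U h) : IsFunction (T + U) (g + h) := by
  intro f
  obtain ⟨i1, e1⟩ := hT f
  obtain ⟨i2, e2⟩ := hU f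
  have e : (fun x => f x * (g + h) x) = fun x => f x * g x + f x * h x := by
    funext x; simp [mul_add]
  rw [e]
  refine ⟨i1.add i2, ?_⟩
  rw [integral_add i1 i2, ← e1, ← e2]
  rfl

theorem smul (c : ℂ) (hT : IsFunction T g) : IsFunction (c • T) (c • g) := by
  intro f
  obtain ⟨i1, e1⟩ := hT f
  have e : (fun x => f x * (c • g) x) = fun x => c * (f x * g x) := by
    funext x; simp; ring
  rw [e]
  refine ⟨i1.const_mul c, ?_⟩
  rw [integral_const_mul, ← e1]
  rfl

theorem neg (hT : IsFunction T g) : IsFunction (-T) (-g) := by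
  have := hT.smul (-1)
  rwa [neg_one_smul ℂ T, neg_one_smul ℂ g] at this

theorem sub (hT : IsFunction T g) (hU : IsFunction U h) : IsFunction (T - U) (g - h) := by
  simpa [sub_eq_add_neg] using hT.add hU.neg

theorem zero : IsFunction 0 0 := by
  intro f
  simp

theorem congr (hT : IsFunction T g) (hgh : g =ᵐ[volume] h) : IsFunction T h := by
  intro f
  obtain ⟨i1, e1⟩ := hT f
  have e : (fun x => f x * g x) =ᵐ[volume] fun x => f x * h x := by
    filter_upwards [hgh] with x hx
    rw [hx]
  exact ⟨i1.congr e, e1.trans (integral_congr_ae e)⟩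

theorem ae_eq_zero (hT : IsFunction 0 g) : g =ᵐ[volume] 0 := by
  refine ae_eq_zero_of_integral_contDiff_smul_eq_zero hT.locallyIntegrable fun φ h1 h2 => ?_
  have := (hT (ofCompact h1 h2)).2
  simp only [ofCompact_apply] at this
  simp only [Complex.real_smul]
  rw [← this]
  rfl

theorem ae_eq (hT : IsFunction T g) (hU : IsFunction T h) : g =ᵐ[volume] h := by
  have := (hT.sub hU)
  rw [sub_self] at this
  filter_upwards [this.ae_eq_zero] with x hx
  exact sub_eq_zero.1 hx

theorem unique (hT : IsFunction T g) (hU : IsFunction U g) : T = U := by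
  ext f
  rw [(hT f).2, (hU f).2]

theorem lpNorm_eq (hT : IsFunction T g) (p : ℝ≥0∞) : lpNorm p T = eLpNorm g p volume := by
  refine le_antisymm (iInf₂_le g hT) (le_iInf₂ fun h hh => ?_)
  rw [eLpNorm_congr_ae (hT.ae_eq hh)]

end IsFunction

theorem isFunction_Lp {p : ℝ≥0∞} [hp : Fact (1 ≤ p)] (F : Lp ℂ p (volume : Measure ℝ)) :
    IsFunction (Lp.toTemperedDistributionCLM ℂ volume p F) F := by
  intro f
  refine ⟨?_, ?_⟩
  · have : ENNReal.HolderConjugate p (ENNReal.conjExponent p) :=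
      ENNReal.HolderConjugate.conjExponent hp.out
    exact (f.memLp (ENNReal.conjExponent p)).integrable_mul (Lp.memLp F)
  · rw [Lp.toTemperedDistributionCLM_apply, Lp.toTemperedDistribution_apply]
    rfl

theorem lpNorm_Lp {p : ℝ≥0∞} [hp : Fact (1 ≤ p)] (F : Lp ℂ p (volume : Measure ℝ)) :
    lpNorm p (Lp.toTemperedDistributionCLM ℂ volume p F) = ‖F‖ₑ := by
  rw [(isFunction_Lp F).lpNorm_eq, Lp.enorm_def]

theorem exists_isFunction {p : ℝ≥0∞} {T : 𝓢'(ℝ, ℂ)} (h : lpNorm p T ≠ ⊤) :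
    ∃ g, IsFunction T g ∧ MemLp g p volume := by
  have : ∃ g, IsFunction T g := by
    by_contra! hno
    apply h
    simp [lpNorm, hno]
  obtain ⟨g, hg⟩ := this
  refine ⟨g, hg, hg.aestronglyMeasurable, ?_⟩
  rw [← hg.lpNorm_eq]
  exact h.lt_top

theorem exists_Lp {p : ℝ≥0∞} [hp : Fact (1 ≤ p)] {T : 𝓢'(ℝ, ℂ)} (h : lpNorm p T ≠ ⊤) :
    ∃ F : Lp ℂ p (volume : Measure ℝ), Lp.toTemperedDistributionCLM ℂ volume p F = T := by
  obtain ⟨g, hg, hgp⟩ := exists_isFunction h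
  exact ⟨hgp.toLp, ((isFunction_Lp _).congr hgp.coeFn_toLp).unique hg⟩

theorem exists_isFunction_of_memLp {p : ℝ≥0∞} (hp : 1 ≤ p) {g : ℝ → ℂ} (hg : MemLp g p volume) :
    ∃ T, IsFunction T g :=
  have : Fact (1 ≤ p) := ⟨hp⟩
  ⟨_, (isFunction_Lp hg.toLp).congr hg.coeFn_toLp⟩

theorem isFunction_emb (f : 𝓢(ℝ, ℂ)) : IsFunction (emb f) f := by
  intro g
  refine ⟨?_, emb_apply f g⟩
  exact (g.memLp 2).integrable_mul (f.memLp 2)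

theorem lpNorm_emb (p : ℝ≥0∞) (f : 𝓢(ℝ, ℂ)) : lpNorm p (emb f) = eLpNorm f p volume :=
  (isFunction_emb f).lpNorm_eq p

theorem lpNorm_zero (p : ℝ≥0∞) : lpNorm p 0 = 0 := by
  rw [IsFunction.zero.lpNorm_eq, eLpNorm_zero]

theorem lpNorm_add_le {p : ℝ≥0∞} (hp : 1 ≤ p) (T U : 𝓢'(ℝ, ℂ)) :
    lpNorm p (T + U) ≤ lpNorm p T + lpNorm p U := by
  by_cases hT : lpNorm p T = ⊤
  · simp [hT]
  by_cases hU : lpNorm p U = ⊤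
  · simp [hU]
  obtain ⟨g, hg, -⟩ := exists_isFunction hT
  obtain ⟨h, hh, -⟩ := exists_isFunction hU
  rw [(hg.add hh).lpNorm_eq, hg.lpNorm_eq, hh.lpNorm_eq]
  exact eLpNorm_add_le hg.aestronglyMeasurable hh.aestronglyMeasurable hp

theorem lpNorm_smul (p : ℝ≥0∞) {c : ℂ} (hc : c ≠ 0) (T : 𝓢'(ℝ, ℂ)) :
    lpNorm p (c • T) = ‖c‖ₑ * lpNorm p T := by
  by_cases h : ∃ g, IsFunction T g
  · obtain ⟨g, hg⟩ := h
    rw [(hg.smul c).lpNorm_eq, hg.lpNorm_eq, eLpNorm_const_smul]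
  · have h2 : ¬ ∃ g, IsFunction (c • T) g := by
      rintro ⟨g, hg⟩
      apply h
      have := hg.smul c⁻¹
      rw [smul_smul, inv_mul_cancel₀ hc, one_smul] at this
      exact ⟨_, this⟩
    have e : ∀ U : 𝓢'(ℝ, ℂ), (¬ ∃ g, IsFunction U g) → lpNorm p U = ⊤ := by
      intro U hU
      push Not at hU
      simp [lpNorm, hU]
    rw [e _ h, e _ h2, ENNReal.mul_top (by simpa using hc)]

theorem lpNorm_neg (p : ℝ≥0∞) (T : 𝓢'(ℝ, ℂ)) : lpNorm p (-T) = lpNorm p T := by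
  have := lpNorm_smul p (c := -1) (by norm_num) T
  rw [neg_one_smul ℂ T] at this
  simpa using this

theorem lpNorm_sub_comm (p : ℝ≥0∞) (T U : 𝓢'(ℝ, ℂ)) : lpNorm p (T - U) = lpNorm p (U - T) := by
  rw [← lpNorm_neg, neg_sub]

theorem lpNorm_sum_le {ι : Type*} {p : ℝ≥0∞} (hp : 1 ≤ p) (s : Finset ι) (T : ι → 𝓢'(ℝ, ℂ)) :
    lpNorm p (∑ i ∈ s, T i) ≤ ∑ i ∈ s, lpNorm p (T i) := by
  classical
  induction s using Finset.induction_on with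
  | empty => simp [lpNorm_zero]
  | insert i s hi ih =>
    rw [Finset.sum_insert hi, Finset.sum_insert hi]
    exact (lpNorm_add_le hp _ _).trans (by gcongr)

theorem lpNorm_eq_zero {p : ℝ≥0∞} (hp : p ≠ 0) {T : 𝓢'(ℝ, ℂ)} (h : lpNorm p T = 0) : T = 0 := by
  obtain ⟨g, hg, -⟩ := exists_isFunction (p := p) (T := T) (by simp [h])
  rw [hg.lpNorm_eq, eLpNorm_eq_zero_iff hg.aestronglyMeasurable hp] at h
  exact (hg.congr h).unique IsFunction.zero

theorem eLpNorm_schwartz_ne_top (f : 𝓢(ℝ, ℂ)) (p : ℝ≥0∞) : eLpNorm f p volume ≠ ⊤ := by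
  have := (f.memLp p (volume : Measure ℝ)).2
  exact this.ne

/-- Hölder's inequality for the pairing with a Schwartz function. -/
theorem enorm_apply_le {p : ℝ≥0∞} (hp : 1 ≤ p) (f : 𝓢(ℝ, ℂ)) (T : 𝓢'(ℝ, ℂ)) (hT : lpNorm p T ≠ ⊤) :
    ‖T f‖ₑ ≤ eLpNorm f (ENNReal.conjExponent p) volume * lpNorm p T := by
  obtain ⟨g, hg, -⟩ := exists_isFunction hT
  have : ENNReal.HolderConjugate p (ENNReal.conjExponent p) :=
    ENNReal.HolderConjugate.conjExponent hp
  rw [(hg f).2, hg.lpNorm_eq]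
  refine (enorm_integral_le_lintegral_enorm _).trans ?_
  rw [← eLpNorm_one_eq_lintegral_enorm]
  have := eLpNorm_smul_le_mul_eLpNorm (p := ENNReal.conjExponent p) (q := p) (r := 1) (μ := volume)
    hg.aestronglyMeasurable (f.continuous.aestronglyMeasurable (μ := volume))
  exact this

theorem tendsto_apply_of_lpNorm {p : ℝ≥0∞} (hp : 1 ≤ p) {T : ℕ → 𝓢'(ℝ, ℂ)} {U : 𝓢'(ℝ, ℂ)}
    (h : Tendsto (fun n => lpNorm p (T n - U)) atTop (𝓝 0)) (f : 𝓢(ℝ, ℂ)) :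
    Tendsto (fun n => T n f) atTop (𝓝 (U f)) := by
  have hc : eLpNorm f (ENNReal.conjExponent p) volume ≠ ⊤ := eLpNorm_schwartz_ne_top f _
  have h1 : Tendsto (fun n => eLpNorm f (ENNReal.conjExponent p) volume * lpNorm p (T n - U)) atTop
      (𝓝 0) := by
    simpa using ENNReal.Tendsto.const_mul h (Or.inr hc)
  rw [tendsto_iff_edist_tendsto_0]
  refine tendsto_of_tendsto_of_tendsto_of_le_of_le' tendsto_const_nhds h1
    (Eventually.of_forall fun _ => zero_le) ?_
  filter_upwards [h.eventually_lt_const (show (0 : ℝ≥0∞) < ⊤ by simp)] with n hn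
  rw [edist_eq_enorm_sub]
  exact enorm_apply_le hp f (T n - U) hn.ne

theorem exists_tendsto_emb {p : ℝ≥0∞} (hp : 1 ≤ p) (hp' : p ≠ ⊤) {T : 𝓢'(ℝ, ℂ)}
    (hT : lpNorm p T ≠ ⊤) :
    ∃ f : ℕ → 𝓢(ℝ, ℂ), Tendsto (fun n => lpNorm p (emb (f n) - T)) atTop (𝓝 0) := by
  have : Fact (1 ≤ p) := ⟨hp⟩
  obtain ⟨F, rfl⟩ := exists_Lp hT
  have hd := SchwartzMap.denseRange_toLpCLM (E := ℝ) (F := ℂ) hp' (μ := volume)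
  obtain ⟨u, hu, hlim⟩ := mem_closure_iff_seq_limit.1 (hd F)
  choose f hf using hu
  refine ⟨f, ?_⟩
  have e : ∀ n, lpNorm p (emb (f n) - Lp.toTemperedDistributionCLM ℂ volume p F) = edist (u n) F := by
    intro n
    have h1 : emb (f n) = Lp.toTemperedDistributionCLM ℂ volume p (u n) := by
      rw [← hf n]
      refine (isFunction_emb _).unique ((isFunction_Lp _).congr ?_)
      exact SchwartzMap.coeFn_toLp (f n) p volume
    rw [h1, ← map_sub, lpNorm_Lp, edist_eq_enorm_sub]
  simp_rw [e]
  exact tendsto_iff_edist_tendsto_0.1 hlim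

theorem exists_tendsto_of_cauchy {p : ℝ≥0∞} (hp : 1 ≤ p) {T : ℕ → 𝓢'(ℝ, ℂ)}
    (hT : ∀ n, lpNorm p (T n) ≠ ⊤)
    (hc : ∀ ε > 0, ∃ N, ∀ m ≥ N, ∀ n ≥ N, lpNorm p (T m - T n) < ε) :
    ∃ U, lpNorm p U ≠ ⊤ ∧ Tendsto (fun n => lpNorm p (T n - U)) atTop (𝓝 0) := by
  have : Fact (1 ≤ p) := ⟨hp⟩
  choose F hF using fun n => exists_Lp (hT n)
  have e : ∀ (A B : Lp ℂ p (volume : Measure ℝ)), lpNorm p (Lp.toTemperedDistributionCLM ℂ volume p A -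
      Lp.toTemperedDistributionCLM ℂ volume p B) = edist A B := by
    intro A B
    rw [← map_sub, lpNorm_Lp, edist_eq_enorm_sub]
  have hcs : CauchySeq F := by
    rw [EMetric.cauchySeq_iff]
    intro ε hε
    obtain ⟨N, hN⟩ := hc ε hε
    refine ⟨N, fun m hm n hn => ?_⟩
    rw [← e, hF, hF]
    exact hN m hm n hn
  obtain ⟨G, hG⟩ := cauchySeq_tendsto_of_complete hcs
  refine ⟨Lp.toTemperedDistributionCLM ℂ volume p G, ?_, ?_⟩
  · rw [lpNorm_Lp]; exact enorm_ne_top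
  · have := tendsto_iff_edist_tendsto_0.1 hG
    refine this.congr fun n => ?_
    rw [← e, hF]

theorem tendsto_lpNorm {p : ℝ≥0∞} (hp : 1 ≤ p) {T : ℕ → 𝓢'(ℝ, ℂ)} {U : 𝓢'(ℝ, ℂ)}
    (h : Tendsto (fun n => lpNorm p (T n - U)) atTop (𝓝 0)) :
    Tendsto (fun n => lpNorm p (T n)) atTop (𝓝 (lpNorm p U)) := by
  have h1 : ∀ n, lpNorm p (T n) ≤ lpNorm p U + lpNorm p (T n - U) := fun n => by
    have := lpNorm_add_le hp U (T n - U)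
    rwa [add_sub_cancel] at this
  have h2 : ∀ n, lpNorm p U ≤ lpNorm p (T n) + lpNorm p (T n - U) := fun n => by
    have := lpNorm_add_le hp (T n) (U - T n)
    rwa [add_sub_cancel, lpNorm_sub_comm] at this
  by_cases hU : lpNorm p U = ⊤
  · refine tendsto_const_nhds.congr' ?_
    filter_upwards [h.eventually_lt_const (show (0 : ℝ≥0∞) < ⊤ by simp)] with n hn
    rw [hU]
    by_contra hne
    have := h2 n
    rw [hU, top_le_iff, ENNReal.add_eq_top] at this
    rcases this with h' | h'
    · exact hne h'.symm
    · exact hn.ne h'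
  · have l1 : Tendsto (fun n => lpNorm p U + lpNorm p (T n - U)) atTop (𝓝 (lpNorm p U)) := by
      simpa using tendsto_const_nhds.add h
    have l2 : Tendsto (fun n => lpNorm p U - lpNorm p (T n - U)) atTop (𝓝 (lpNorm p U)) := by
      simpa using ENNReal.Tendsto.sub tendsto_const_nhds h (Or.inl hU)
    exact tendsto_of_tendsto_of_tendsto_of_le_of_le l2 l1
      (fun n => tsub_le_iff_right.2 (h2 n)) h1

/-- The transpose of `m(D)`. -/
def mulT (m : ℝ → ℂ) (f : 𝓢(ℝ, ℂ)) : 𝓢(ℝ, ℂ) :=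
  𝓕 (SchwartzMap.smulLeftCLM ℂ (fun ξ : ℝ => m (2 * Real.pi * ξ)) (𝓕⁻ f))

theorem multiplier_apply (m : ℝ → ℂ) (T : 𝓢'(ℝ, ℂ)) (f : 𝓢(ℝ, ℂ)) :
    multiplier m T f = T (mulT m f) :=
  TemperedDistribution.fourierMultiplierCLM_apply_apply _ _ _

theorem mulS_sub (m : ℝ → ℂ) (f g : 𝓢(ℝ, ℂ)) : mulS m (f - g) = mulS m f - mulS m g :=
  map_sub _ _ _

/-- A multiplier bound on Schwartz functions extends to distributions. -/
theorem lpNorm_multiplier_le {m : ℝ → ℂ} (hm : TG m) {p₁ p₂ C : ℝ≥0∞} (hp₁ : 1 ≤ p₁) (hp₁' : p₁ ≠ ⊤)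
    (hp₂ : 1 ≤ p₂) (hC : C ≠ ⊤)
    (hb : ∀ f : 𝓢(ℝ, ℂ), eLpNorm (mulS m f) p₂ volume ≤ C * eLpNorm f p₁ volume) (T : 𝓢'(ℝ, ℂ))
    (hT : lpNorm p₁ T ≠ ⊤) : lpNorm p₂ (multiplier m T) ≤ C * lpNorm p₁ T := by
  obtain ⟨f, hf⟩ := exists_tendsto_emb hp₁ hp₁' hT
  have hsub : ∀ a b, lpNorm p₂ (emb (mulS m (f a)) - emb (mulS m (f b))) ≤
      C * (lpNorm p₁ (emb (f a) - T) + lpNorm p₁ (emb (f b) - T)) := by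
    intro a b
    rw [← map_sub, ← mulS_sub, lpNorm_emb]
    refine (hb _).trans ?_
    gcongr
    rw [← lpNorm_emb, map_sub, lpNorm_sub_comm p₁ (emb (f b))]
    have := lpNorm_add_le hp₁ (emb (f a) - T) (T - emb (f b))
    rwa [sub_add_sub_cancel] at this
  obtain ⟨U, hU, hlim⟩ := exists_tendsto_of_cauchy hp₂ (T := fun n => emb (mulS m (f n)))
    (fun n => by rw [lpNorm_emb]; exact eLpNorm_schwartz_ne_top _ _) (by
      intro ε hε
      have h2 : Tendsto (fun n => C * lpNorm p₁ (emb (f n) - T)) atTop (𝓝 0) := by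
        simpa using ENNReal.Tendsto.const_mul hf (Or.inr hC)
      obtain ⟨N, hN⟩ := eventually_atTop.1 (h2.eventually_lt_const (ENNReal.half_pos hε.ne'))
      refine ⟨N, fun a ha b hb' => (hsub a b).trans_lt ?_⟩
      rw [mul_add, ← ENNReal.add_halves ε]
      exact ENNReal.add_lt_add (hN a ha) (hN b hb'))
  have hUT : U = multiplier m T := by
    ext g
    have l1 := tendsto_apply_of_lpNorm hp₂ hlim g
    have l2 := tendsto_apply_of_lpNorm hp₁ hf (mulT m g)
    rw [multiplier_apply]
    refine tendsto_nhds_unique l1 (l2.congr fun n => ?_)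
    rw [← multiplier_apply, multiplier_coe hm]
  rw [← hUT]
  have l1 := tendsto_lpNorm hp₂ hlim
  have l2 : Tendsto (fun n => C * lpNorm p₁ (emb (f n))) atTop (𝓝 (C * lpNorm p₁ T)) :=
    ENNReal.Tendsto.const_mul (tendsto_lpNorm hp₁ hf) (Or.inr hC)
  refine le_of_tendsto_of_tendsto' l1 l2 fun n => ?_
  rw [lpNorm_emb, lpNorm_emb]
  exact hb _

theorem lpNorm_multiplier_sym_le {m : ℝ → ℂ} (hm : Sym m) {p : ℝ≥0∞} (hp : 1 ≤ p) (hp' : p ≠ ⊤)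
    (T : 𝓢'(ℝ, ℂ)) (hT : lpNorm p T ≠ ⊤) :
    lpNorm p (multiplier m T) ≤ eLpNorm hm.ker 1 volume * lpNorm p T :=
  lpNorm_multiplier_le hm.tg hp hp' hp (eLpNorm_schwartz_ne_top _ _)
    (fun f => eLpNorm_mulS_le hm f hp hp') T hT

theorem IsAmp.lpNorm_multiplier_le {m : ℝ → ℂ} {c B : ℝ} (h : IsAmp m c B) (hB : 0 < B)
    {p : ℝ≥0∞} (hp : 1 ≤ p) (hp' : p ≠ ⊤) (T : 𝓢'(ℝ, ℂ)) :
    lpNorm p (multiplier m T) ≤ ENNReal.ofReal (3 * B) * lpNorm p T := by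
  by_cases hT : lpNorm p T = ⊤
  · rw [hT, ENNReal.mul_top (by simpa using hB)]
    exact le_top
  refine (lpNorm_multiplier_sym_le h.sym hp hp' T hT).trans ?_
  gcongr
  exact eLpNorm_ker_one_le h.sym hB (fun ξ hξ => (h.supp ξ hξ).le) h.le h.deriv_le

/-! ### Windows and the block operators -/

theorem tg_window {ρ : ℝ → ℝ} (hρ : IsCutoff ρ) (k : ℤ) : TG fun ξ => (window ρ k ξ : ℂ) :=
  hasTemperateGrowth_window hρ k

theorem tg_group (t : ℝ) : TG fun ξ => Complex.exp (-(Complex.I * t * phi ξ)) :=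
  hasTemperateGrowth_group t

theorem tg_phi : TG fun ξ => (phi ξ : ℂ) := hasTemperateGrowth_phi

theorem window_ne_zero {ρ : ℝ → ℝ} (hρ : IsCutoff ρ) {k : ℤ} {ξ : ℝ} (h : window ρ k ξ ≠ 0) :
    |ξ - k| < 1 := by
  by_contra! hlt
  apply h
  rw [window, hρ.eq_zero _ hlt, zero_mul]

theorem window_sub (ρ : ℝ → ℝ) (k : ℤ) (ξ : ℝ) : window ρ k ξ = window ρ 0 (ξ - k) := by
  rw [window, window]
  congr 2
  · simp
  · rw [← (Equiv.addRight k).tsum_eq]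
    congr 1
    funext l
    simp only [Equiv.coe_addRight]
    congr 1
    push_cast
    ring

theorem contDiff_window {ρ : ℝ → ℝ} (hρ : IsCutoff ρ) (k : ℤ) : ContDiff ℝ ∞ (window ρ k) := by
  have h1 := (tg_window hρ k).1
  have h2 : window ρ k = fun ξ => Complex.re (window ρ k (2 * Real.pi * ((2 * Real.pi)⁻¹ * ξ)) : ℂ) := by
    funext ξ
    rw [mul_inv_cancel_left₀ Real.two_pi_pos.ne', Complex.ofReal_re]
  rw [h2]
  exact Complex.reCLM.contDiff.comp (h1.comp (contDiff_const.mul contDiff_id))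

theorem sum_window {ρ : ℝ → ℝ} (hρ : IsCutoff ρ) {s : Finset ℤ} {ξ : ℝ}
    (hs : ∀ k : ℤ, |ξ - k| < 1 → k ∈ s) : ∑ k ∈ s, window ρ k ξ = 1 := by
  have h0 : ∀ l ∉ s, ρ (ξ - l) = 0 := by
    intro l hl
    refine hρ.eq_zero _ ?_
    by_contra! h
    exact hl (hs l h)
  have h1 : ∑' l : ℤ, ρ (ξ - l) = ∑ l ∈ s, ρ (ξ - l) := tsum_eq_sum fun l hl => h0 l hl
  have h2 : 0 < ∑ l ∈ s, ρ (ξ - l) := by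
    have hr : |ξ - round ξ| ≤ 1 / 2 := abs_sub_round ξ
    refine Finset.sum_pos' (fun l _ => hρ.nonneg _) ⟨round ξ, hs _ (by linarith), ?_⟩
    rw [hρ.eq_one _ hr]; exact one_pos
  simp only [window, h1]
  rw [← Finset.sum_mul, mul_inv_cancel₀ h2.ne']

/-- The smooth bump from which the fattened windows are built. -/
def bmp : ContDiffBump (0 : ℝ) := ⟨1, 2, by norm_num, by norm_num⟩

/-- The fattened windows. -/
def chi (k : ℤ) (ξ : ℝ) : ℂ := (bmp (ξ - k) : ℝ)

theorem chi_eq_one {k : ℤ} {ξ : ℝ} (h : |ξ - k| ≤ 1) : chi k ξ = 1 := by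
  rw [chi, bmp.one_of_mem_closedBall (by simpa [bmp] using h), Complex.ofReal_one]

theorem chi_ne_zero {k : ℤ} {ξ : ℝ} (h : chi k ξ ≠ 0) : |ξ - k| < 2 := by
  by_contra! hlt
  apply h
  rw [chi, bmp.zero_of_le_dist (by simpa [bmp] using hlt), Complex.ofReal_zero]

/-- Uniform amplitude bounds for the translates of a function. -/
theorem exists_isAmp_translates {g : ℝ → ℝ} (hg : ContDiff ℝ ∞ g)
    (hs : ∀ ξ, g ξ ≠ 0 → |ξ| < 2) :
    ∃ B : ℝ, 1 ≤ B ∧ ∀ k : ℤ, IsAmp (fun ξ => (g (ξ - k) : ℂ)) k B := by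
  have hc : HasCompactSupport g := HasCompactSupport.of_support_subset_isCompact
    (isCompact_Icc (a := -2) (b := 2)) fun ξ hξ => by
      have := abs_lt.1 (hs ξ hξ)
      exact ⟨this.1.le, this.2.le⟩
  obtain ⟨B₁, hB₁⟩ := hc.exists_bound_of_continuous hg.continuous
  obtain ⟨B₂, hB₂⟩ := hc.deriv.exists_bound_of_continuous (hg.continuous_deriv (by simp))
  refine ⟨max 1 (max B₁ B₂), le_max_left _ _, fun k => ⟨?_, ?_, ?_, ?_⟩⟩
  · exact Complex.ofRealCLM.contDiff.comp (hg.comp (contDiff_id.sub contDiff_const))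
  · intro ξ hξ
    exact hs _ (by simpa using hξ)
  · intro ξ
    rw [Complex.norm_real]
    exact (hB₁ _).trans ((le_max_left _ _).trans (le_max_right _ _))
  · intro ξ
    have h1 : HasDerivAt g (deriv g (ξ - k)) (ξ - k) :=
      (hg.differentiable (by simp)).differentiableAt.hasDerivAt
    have h2 : HasDerivAt (fun ξ : ℝ => ξ - (k : ℝ)) 1 ξ := (hasDerivAt_id ξ).sub_const _
    have h3 := (h1.comp ξ h2).ofReal_comp
    rw [mul_one] at h3
    have h4 : deriv (fun ξ : ℝ => (g (ξ - k) : ℂ)) ξ = (deriv g (ξ - k) : ℝ) := h3.deriv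
    rw [h4, Complex.norm_real]
    exact (hB₂ _).trans ((le_max_right _ _).trans (le_max_right _ _))

theorem exists_isAmp_chi : ∃ B : ℝ, 1 ≤ B ∧ ∀ k : ℤ, IsAmp (chi k) k B :=
  exists_isAmp_translates bmp.contDiff fun ξ hξ => by
    by_contra! hlt
    exact hξ (bmp.zero_of_le_dist (by simpa [bmp] using hlt))

/-- A common bound for the fattened windows. -/
def chiB : ℝ := exists_isAmp_chi.choose

theorem one_le_chiB : 1 ≤ chiB := exists_isAmp_chi.choose_spec.1

theorem isAmp_chi (k : ℤ) : IsAmp (chi k) k chiB := exists_isAmp_chi.choose_spec.2 k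

theorem exists_isAmp_window {ρ : ℝ → ℝ} (hρ : IsCutoff ρ) :
    ∃ B : ℝ, 1 ≤ B ∧ ∀ k : ℤ, IsAmp (fun ξ => (window ρ k ξ : ℂ)) k B := by
  obtain ⟨B, h1, h2⟩ := exists_isAmp_translates (contDiff_window hρ 0) fun ξ hξ => by
    have := window_ne_zero hρ hξ
    simp only [Int.cast_zero, sub_zero] at this
    linarith
  refine ⟨B, h1, fun k => ?_⟩
  have := h2 k
  simp_rw [← window_sub] at this
  exact this

/-- A common bound for the windows. -/
def winB {ρ : ℝ → ℝ} (hρ : IsCutoff ρ) : ℝ := (exists_isAmp_window hρ).choose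

theorem one_le_winB {ρ : ℝ → ℝ} (hρ : IsCutoff ρ) : 1 ≤ winB hρ :=
  (exists_isAmp_window hρ).choose_spec.1

theorem isAmp_window {ρ : ℝ → ℝ} (hρ : IsCutoff ρ) (k : ℤ) :
    IsAmp (fun ξ => (window ρ k ξ : ℂ)) k (winB hρ) :=
  (exists_isAmp_window hρ).choose_spec.2 k

theorem IsAmp.mul {a n : ℝ → ℂ} {c B M : ℝ} (h : IsAmp a c B) (hn : ContDiff ℝ ∞ n)
    (h1 : ∀ ξ, |ξ - c| ≤ 2 → ‖n ξ‖ ≤ M) (h2 : ∀ ξ, |ξ - c| ≤ 2 → ‖deriv n ξ‖ ≤ M) :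
    IsAmp (fun ξ => a ξ * n ξ) c (2 * B * M) := by
  have hB := h.nonneg
  have hM : 0 ≤ M := (norm_nonneg _).trans (h1 c (by simp))
  have hz : ∀ ξ, 2 ≤ |ξ - c| → a ξ = 0 := by
    intro ξ hξ
    by_contra hne
    linarith [h.supp ξ hne]
  refine ⟨h.smooth.mul hn, ?_, ?_, ?_⟩
  · intro ξ hξ
    exact h.supp ξ fun h0 => hξ (by rw [h0, zero_mul])
  · intro ξ
    rw [norm_mul]
    rcases le_total |ξ - c| 2 with hle | hge
    · have := mul_le_mul (h.le ξ) (h1 ξ hle) (norm_nonneg _) hB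
      nlinarith [mul_nonneg hB hM]
    · rw [hz ξ hge, norm_zero, zero_mul]; positivity
  · intro ξ
    have da : HasDerivAt a (deriv a ξ) ξ := (h.smooth.differentiable (by simp)).differentiableAt.hasDerivAt
    have dn : HasDerivAt n (deriv n ξ) ξ := (hn.differentiable (by simp)).differentiableAt.hasDerivAt
    have hd : deriv (fun ξ => a ξ * n ξ) ξ = deriv a ξ * n ξ + a ξ * deriv n ξ := (da.mul dn).deriv
    rw [hd]
    rcases le_or_gt |ξ - c| 2 with hle | hgt
    · refine (norm_add_le _ _).trans ?_
      rw [norm_mul, norm_mul]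
      have k1 := mul_le_mul (h.deriv_le ξ) (h1 ξ hle) (norm_nonneg _) hB
      have k2 := mul_le_mul (h.le ξ) (h2 ξ hle) (norm_nonneg _) hB
      linarith
    · have he : a =ᶠ[𝓝 ξ] fun _ => 0 := by
        have hc : Continuous fun ξ : ℝ => |ξ - c| := by fun_prop
        filter_upwards [hc.continuousAt.eventually_const_lt hgt] with y hy
        exact hz y hy.le
      rw [he.deriv_eq, he.eq_of_nhds]
      simp
      positivity

theorem box_eq_chi_box {ρ : ℝ → ℝ} (hρ : IsCutoff ρ) (k : ℤ) (T : 𝓢'(ℝ, ℂ)) :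
    box ρ k T = multiplier (chi k) (box ρ k T) := by
  rw [box, multiplier_multiplier (isAmp_chi k).sym.tg (tg_window hρ k)]
  congr 2
  funext ξ
  by_cases h : window ρ k ξ = 0
  · simp [h]
  · rw [chi_eq_one (window_ne_zero hρ h).le, one_mul]

theorem box_multiplier {ρ : ℝ → ℝ} (hρ : IsCutoff ρ) {n : ℝ → ℂ} (hn : TG n) (k : ℤ)
    (T : 𝓢'(ℝ, ℂ)) :
    box ρ k (multiplier n T) = multiplier (fun ξ => chi k ξ * n ξ) (box ρ k T) := by
  rw [← multiplier_multiplier (isAmp_chi k).sym.tg hn, box, multiplier_comm (tg_window hρ k) hn,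
    multiplier_comm (isAmp_chi k).sym.tg hn]
  congr 1
  exact box_eq_chi_box hρ k T

/-- A multiplier acts on a block with the size of its symbol near the block. -/
theorem lpNorm_box_multiplier_le {ρ : ℝ → ℝ} (hρ : IsCutoff ρ) {n : ℝ → ℂ} (hn : TG n)
    (hn' : ContDiff ℝ ∞ n) {p : ℝ≥0∞} (hp : 1 ≤ p) (hp' : p ≠ ⊤) {k : ℤ} {M : ℝ} (hM : 0 < M)
    (h1 : ∀ ξ : ℝ, |ξ - k| ≤ 2 → ‖n ξ‖ ≤ M) (h2 : ∀ ξ : ℝ, |ξ - k| ≤ 2 → ‖deriv n ξ‖ ≤ M)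
    (T : 𝓢'(ℝ, ℂ)) :
    lpNorm p (box ρ k (multiplier n T)) ≤ ENNReal.ofReal (6 * chiB * M) * lpNorm p (box ρ k T) := by
  have hc := one_le_chiB
  rw [box_multiplier hρ hn]
  refine (((isAmp_chi k).mul hn' h1 h2).lpNorm_multiplier_le (by positivity) hp hp' _).trans_eq ?_
  congr 2
  ring

/-! ### Dispersive decay of the blocks -/

theorem eLpNorm_ofReal {p : ℝ} (hp : 0 < p) (f : ℝ → ℂ) :
    eLpNorm f (ENNReal.ofReal p) volume = (∫⁻ x, ‖f x‖ₑ ^ p) ^ (1 / p) := by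
  rw [eLpNorm_eq_lintegral_rpow_enorm_toReal (by simpa using hp) ENNReal.ofReal_ne_top,
    ENNReal.toReal_ofReal hp.le]

/-- The constant of the interpolated dispersive estimate. -/
def dispC (p : ℝ) : ℝ := (4 * p / (p - 2) * 4 ^ (p - 2)) ^ (1 / p)

theorem eLpNorm_mulS_disp_le {p : ℝ} (hp : 2 < p) {m : ℝ → ℂ} (hm : Sym m) {A : ℝ} (hA0 : 0 < A)
    (hA : ∀ x, ‖hm.ker x‖ ≤ A) (hM : ∀ ξ, ‖m ξ‖ ≤ 1) (f : 𝓢(ℝ, ℂ)) :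
    eLpNorm (mulS m f) (ENNReal.ofReal p) volume ≤
      ENNReal.ofReal (dispC p * A ^ ((p - 2) / p)) *
        eLpNorm f (ENNReal.ofReal (p / (p - 1))) volume := by
  have hp0 : 0 < p := by linarith
  have hp1 : 0 < p - 1 := by linarith
  have hp2 : 0 < p - 2 := by linarith
  have hp' : 0 < p / (p - 1) := by positivity
  set Nf := eLpNorm f (ENNReal.ofReal (p / (p - 1))) volume with hNf
  have hfin : Nf ≠ ⊤ := eLpNorm_schwartz_ne_top _ _
  have main : ∀ N : ℝ, 0 < N → Nf ≤ ENNReal.ofReal N → eLpNorm (mulS m f) (ENNReal.ofReal p) volume ≤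
      ENNReal.ofReal (dispC p * A ^ ((p - 2) / p)) * ENNReal.ofReal N := by
    intro N hN hle
    have hf : ∫⁻ x, ‖f x‖ₑ ^ (p / (p - 1)) ≤ ENNReal.ofReal (N ^ (p / (p - 1))) := by
      rw [hNf, eLpNorm_ofReal hp', one_div, ENNReal.rpow_inv_le_iff hp',
        ENNReal.ofReal_rpow_of_pos hN] at hle
      exact hle
    have := lintegral_mulS_rpow_le hp hm hA0 hA hM f hN hf
    rw [eLpNorm_ofReal hp0, one_div, ENNReal.rpow_inv_le_iff hp0, ← ENNReal.ofReal_mul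
      (by unfold dispC; positivity), ENNReal.ofReal_rpow_of_pos (by unfold dispC; positivity)]
    refine this.trans_eq ?_
    congr 1
    rw [Real.mul_rpow (by unfold dispC; positivity) hN.le, Real.mul_rpow (by unfold dispC; positivity)
      (by positivity), dispC, ← Real.rpow_mul (by positivity), ← Real.rpow_mul hA0.le,
      one_div_mul_cancel hp0.ne', div_mul_cancel₀ _ hp0.ne', Real.rpow_one]
    ring
  have hlim : Tendsto (fun n : ℕ => ENNReal.ofReal (dispC p * A ^ ((p - 2) / p)) *
      ENNReal.ofReal (Nf.toReal + 1 / ((n : ℝ) + 1))) atTop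
      (𝓝 (ENNReal.ofReal (dispC p * A ^ ((p - 2) / p)) * Nf)) := by
    refine ENNReal.Tendsto.const_mul ?_ (Or.inr ENNReal.ofReal_ne_top)
    have h1 : Tendsto (fun n : ℕ => Nf.toReal + 1 / ((n : ℝ) + 1)) atTop (𝓝 (Nf.toReal + 0)) :=
      tendsto_const_nhds.add tendsto_one_div_add_atTop_nhds_zero_nat
    have h2 := (ENNReal.continuous_ofReal.tendsto _).comp h1
    rw [add_zero, ENNReal.ofReal_toReal hfin] at h2
    exact h2
  refine ge_of_tendsto' hlim fun n => main _ (by positivity) ?_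
  refine ENNReal.le_ofReal_iff_toReal_le hfin (by positivity) |>.2 ?_
  have : (0 : ℝ) < 1 / ((n : ℝ) + 1) := by positivity
  linarith

theorem IsAmp.const_mul {a : ℝ → ℂ} {c B : ℝ} (h : IsAmp a c B) {b : ℝ} (hb : 0 < b) :
    IsAmp (fun ξ => (b : ℂ) * a ξ) c (b * B) := by
  refine ⟨contDiff_const.mul h.smooth, fun ξ hξ => h.supp ξ (right_ne_zero_of_mul hξ), fun ξ => ?_,
    fun ξ => ?_⟩
  · rw [norm_mul, Complex.norm_real, Real.norm_of_nonneg hb.le]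
    have := h.le ξ
    gcongr
  · have da : HasDerivAt a (deriv a ξ) ξ := (h.smooth.differentiable (by simp)).differentiableAt.hasDerivAt
    have hd : deriv (fun ξ => (b : ℂ) * a ξ) ξ = b * deriv a ξ := (da.const_mul _).deriv
    rw [hd, norm_mul, Complex.norm_real, Real.norm_of_nonneg hb.le]
    have := h.deriv_le ξ
    gcongr

theorem osc_const_mul (a : ℝ → ℂ) (b : ℂ) (t x : ℝ) : osc (fun ξ => b * a ξ) t x = b * osc a t x := by
  simp only [osc, mul_assoc]
  exact integral_const_mul _ _

theorem tg_const (c : ℂ) : TG fun _ => c := Function.HasTemperateGrowth.const c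

theorem multiplier_const_mul {m : ℝ → ℂ} (hm : TG m) (c : ℂ) (T : 𝓢'(ℝ, ℂ)) :
    multiplier (fun ξ => c * m ξ) T = c • multiplier m T := by
  rw [← multiplier_multiplier (tg_const c) hm]
  change TemperedDistribution.fourierMultiplierCLM ℂ (fun _ : ℝ => c) (multiplier m T) = _
  rw [TemperedDistribution.fourierMultiplierCLM_const]
  rfl

theorem IsAmp.lpNorm_disp_le {p : ℝ} (hp : 2 < p) {a : ℝ → ℂ} {c B : ℝ} (h : IsAmp a c B) (hB : 0 < B)
    {t A : ℝ} (hA0 : 0 < A) (hA : ∀ x, ‖osc a t x‖ ≤ B * A) (T : 𝓢'(ℝ, ℂ)) :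
    lpNorm (ENNReal.ofReal p) (multiplier (grp a t) T) ≤
      ENNReal.ofReal (dispC p * B * A ^ ((p - 2) / p)) *
        lpNorm (ENNReal.ofReal (p / (p - 1))) T := by
  have hp0 : 0 < p := by linarith
  have hp1 : 0 < p - 1 := by linarith
  have hp2 : 0 < p - 2 := by linarith
  have hd : 0 < dispC p := by unfold dispC; positivity
  by_cases hT : lpNorm (ENNReal.ofReal (p / (p - 1))) T = ⊤
  · rw [hT, ENNReal.mul_top (by simp; positivity)]
    exact le_top
  set a' : ℝ → ℂ := fun ξ => ((B⁻¹ : ℝ) : ℂ) * a ξ with ha'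
  have h' : IsAmp a' c (B⁻¹ * B) := h.const_mul (by positivity)
  rw [inv_mul_cancel₀ hB.ne'] at h'
  have e : grp a t = fun ξ => (B : ℂ) * grp a' t ξ := by
    funext ξ
    simp only [grp, ha']
    push_cast
    have : (B : ℂ) ≠ 0 := by exact_mod_cast hB.ne'
    field_simp
  have hk : ∀ x, ‖(h'.sym.grp t).ker x‖ ≤ A := by
    intro x
    refine (norm_ker_grp_le h'.sym t x).trans ?_
    rw [ha', osc_const_mul, norm_mul, Complex.norm_real, Real.norm_of_nonneg (by positivity),
      inv_mul_le_iff₀ hB]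
    exact hA x
  rw [e, multiplier_const_mul (h'.sym.grp t).tg, lpNorm_smul _ (by exact_mod_cast hB.ne')]
  have h1 : (1 : ℝ≥0∞) ≤ ENNReal.ofReal (p / (p - 1)) := by
    rw [ENNReal.one_le_ofReal, le_div_iff₀ hp1]; linarith
  have h2 : (1 : ℝ≥0∞) ≤ ENNReal.ofReal p := by
    rw [ENNReal.one_le_ofReal]; linarith
  have := GBBM.lpNorm_multiplier_le (h'.sym.grp t).tg h1 ENNReal.ofReal_ne_top h2 ENNReal.ofReal_ne_top
    (fun f => eLpNorm_mulS_disp_le hp (h'.sym.grp t) hA0 hk (fun ξ => by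
      rw [norm_grp]; exact h'.le ξ) f) T hT
  calc ‖(B : ℂ)‖ₑ * lpNorm (ENNReal.ofReal p) (multiplier (grp a' t) T)
      ≤ ‖(B : ℂ)‖ₑ * (ENNReal.ofReal (dispC p * A ^ ((p - 2) / p)) *
        lpNorm (ENNReal.ofReal (p / (p - 1))) T) := by gcongr
    _ = _ := by
        rw [← ofReal_norm, Complex.norm_real, Real.norm_of_nonneg hB.le, ← mul_assoc,
          ← ENNReal.ofReal_mul hB.le]
        congr 2
        ring

theorem IsAmp.norm_osc_uniform {a : ℝ → ℂ} {k : ℤ} {B : ℝ} (h : IsAmp a k B) (t x : ℝ) :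
    ‖osc a t x‖ ≤ B * (400000 * (1 + |(k : ℝ)|) * (1 + |t|) ^ (-(1 / 3) : ℝ)) := by
  have hB := h.nonneg
  have hk : 0 ≤ |(k : ℝ)| := abs_nonneg _
  have h2 : (2 : ℝ) ^ (1 / 3 : ℝ) ≤ 2 := by
    calc (2 : ℝ) ^ (1 / 3 : ℝ) ≤ 2 ^ (1 : ℝ) :=
          Real.rpow_le_rpow_of_exponent_le (by norm_num) (by norm_num)
      _ = 2 := Real.rpow_one 2
  rcases le_total |t| 1 with ht | ht
  · have h3 : 1 ≤ 2 * (1 + |t|) ^ (-(1 / 3) : ℝ) := by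
      have h4 : (1 + |t|) ^ (1 / 3 : ℝ) ≤ 2 := by
        refine le_trans ?_ h2
        have := abs_nonneg t
        gcongr
        linarith
      have h5 : 0 < (1 + |t|) ^ (1 / 3 : ℝ) := by positivity
      rw [Real.rpow_neg (by positivity), ← div_eq_mul_inv, le_div_iff₀ h5]
      linarith
    calc ‖osc a t x‖ ≤ 4 * B := h.norm_osc_le t x
      _ ≤ 4 * B * (2 * (1 + |t|) ^ (-(1 / 3) : ℝ)) := le_mul_of_one_le_right (by positivity) h3
      _ = B * (8 * 1 * (1 + |t|) ^ (-(1 / 3) : ℝ)) := by ring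
      _ ≤ _ := by gcongr <;> linarith
  · have ht0 : t ≠ 0 := abs_pos.1 (by linarith)
    have htp : 0 < |t| := by linarith
    have h3 : |t| ^ (-(1 / 3) : ℝ) ≤ 2 * (1 + |t|) ^ (-(1 / 3) : ℝ) := by
      have h4 : (2 * |t|) ^ (-(1 / 3) : ℝ) ≤ (1 + |t|) ^ (-(1 / 3) : ℝ) :=
        Real.rpow_le_rpow_of_nonpos (by positivity) (by linarith) (by norm_num)
      rw [Real.mul_rpow (by norm_num) htp.le, Real.rpow_neg (by norm_num : (0 : ℝ) ≤ 2)] at h4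
      have h5 : (0 : ℝ) < 2 ^ (1 / 3 : ℝ) := by positivity
      rw [inv_mul_le_iff₀ h5] at h4
      exact h4.trans (by gcongr)
    have main : ‖osc a t x‖ ≤ 200000 * B * (1 + |(k : ℝ)|) * |t| ^ (-(1 / 3) : ℝ) := by
      rcases lt_or_ge |(k : ℝ)| 4 with hlt | hge
      · refine (h.norm_osc_low_cbrt hlt ht0 x).trans ?_
        refine mul_le_mul_of_nonneg_right ?_ (by positivity)
        exact le_mul_of_one_le_right (by positivity) (by linarith)
      · refine (h.norm_osc_high_cbrt hge ht0 x).trans ?_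
        gcongr <;> linarith
    calc ‖osc a t x‖ ≤ 200000 * B * (1 + |(k : ℝ)|) * |t| ^ (-(1 / 3) : ℝ) := main
      _ ≤ 200000 * B * (1 + |(k : ℝ)|) * (2 * (1 + |t|) ^ (-(1 / 3) : ℝ)) := by gcongr
      _ = _ := by ring

theorem abs_phi_le_of_near {k : ℤ} {ξ : ℝ} (h : |ξ - k| ≤ 2) : |phi ξ| ≤ 6 / (1 + |(k : ℝ)|) := by
  have h1 : |(k : ℝ)| ≤ |ξ| + 2 := by
    have := abs_sub_abs_le_abs_sub (k : ℝ) ξ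
    rw [abs_sub_comm] at this
    linarith
  have hξ := abs_nonneg ξ
  rw [phi, abs_div, abs_of_pos (show (0 : ℝ) < 1 + ξ ^ 2 by positivity),
    div_le_div_iff₀ (by positivity) (by positivity), ← sq_abs ξ]
  nlinarith [sq_nonneg (|ξ| - 1)]

theorem deriv_phi (ξ : ℝ) : HasDerivAt phi (phi₁ ξ) ξ := by
  have := (isPhase_phi 0 (-1)).deriv1 ξ
  simpa using this

theorem abs_phi₁_le_of_near {k : ℤ} {ξ : ℝ} (h : |ξ - k| ≤ 2) : |phi₁ ξ| ≤ 6 / (1 + |(k : ℝ)|) := by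
  have h1 : |(k : ℝ)| ≤ |ξ| + 2 := by
    have := abs_sub_abs_le_abs_sub (k : ℝ) ξ
    rw [abs_sub_comm] at this
    linarith
  have hξ := abs_nonneg ξ
  have h2 : |1 - ξ ^ 2| ≤ 1 + ξ ^ 2 := by
    rw [abs_le]; constructor <;> nlinarith [sq_nonneg ξ]
  have h3 : |phi₁ ξ| ≤ 1 / (1 + ξ ^ 2) := by
    rw [phi₁, abs_div, abs_of_pos (show (0 : ℝ) < (1 + ξ ^ 2) ^ 2 by positivity),
      div_le_div_iff₀ (by positivity) (by positivity)]
    nlinarith [sq_nonneg ξ]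
  refine h3.trans ?_
  rw [div_le_div_iff₀ (by positivity) (by positivity), ← sq_abs ξ]
  nlinarith [sq_nonneg (|ξ| - 1)]

theorem isAmp_chi_phi (k : ℤ) :
    IsAmp (fun ξ => chi k ξ * (phi ξ : ℂ)) k (12 * chiB / (1 + |(k : ℝ)|)) := by
  have := (isAmp_chi k).mul (n := fun ξ => (phi ξ : ℂ)) (M := 6 / (1 + |(k : ℝ)|))
    (Complex.ofRealCLM.contDiff.comp contDiff_phi)
    (fun ξ h => by rw [Complex.norm_real]; exact abs_phi_le_of_near h)
    (fun ξ h => by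
      rw [(deriv_phi ξ).ofReal_comp.deriv, Complex.norm_real]; exact abs_phi₁_le_of_near h)
  convert this using 1
  ring

theorem box_group_phi {ρ : ℝ → ℝ} (hρ : IsCutoff ρ) (k : ℤ) (t : ℝ) (W : 𝓢'(ℝ, ℂ)) :
    box ρ k (S t (phiD W)) = multiplier (grp (fun ξ => chi k ξ * (phi ξ : ℂ)) t) (box ρ k W) := by
  rw [S, phiD, multiplier_multiplier (tg_group t) tg_phi, box_multiplier hρ ((tg_group t).mul tg_phi)]
  congr 2
  funext ξ
  rw [grp]
  ring

theorem lpNorm_box_group_phi_le {ρ : ℝ → ℝ} (hρ : IsCutoff ρ) {p : ℝ} (hp : 2 < p) :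
    ∃ C : ℝ≥0∞, C ≠ ⊤ ∧ ∀ (k : ℤ) (t : ℝ) (W : 𝓢'(ℝ, ℂ)),
      lpNorm (ENNReal.ofReal p) (box ρ k (S t (phiD W))) ≤
        C * ENNReal.ofReal ((1 + |t|) ^ (-((p - 2) / p / 3))) *
          (wt k ^ (-(2 / p)) * lpNorm (ENNReal.ofReal (p / (p - 1))) (box ρ k W)) := by
  have hc := one_le_chiB
  have hp0 : 0 < p := by linarith
  have hp2 : 0 < p - 2 := by linarith
  refine ⟨ENNReal.ofReal (dispC p * (12 * chiB) * 400000 ^ ((p - 2) / p)), ENNReal.ofReal_ne_top,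
    fun k t W => ?_⟩
  have hd : 0 < dispC p := by have : 0 < p := by linarith
                              have : 0 < p - 2 := by linarith
                              unfold dispC; positivity
  rw [box_group_phi hρ]
  refine ((isAmp_chi_phi k).lpNorm_disp_le hp (by positivity) (A := 400000 * (1 + |(k : ℝ)|) *
    (1 + |t|) ^ (-(1 / 3) : ℝ)) (by positivity)
    (fun x => (isAmp_chi_phi k).norm_osc_uniform t x) _).trans_eq ?_
  rw [← mul_assoc, ← mul_assoc]
  congr 1
  rw [wt, ENNReal.ofReal_rpow_of_pos (by positivity), ← ENNReal.ofReal_mul (by positivity),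
    ← ENNReal.ofReal_mul (by positivity)]
  congr 1
  rw [Real.mul_rpow (by positivity) (by positivity), Real.mul_rpow (by positivity) (by positivity),
    ← Real.rpow_mul (by positivity)]
  have e1 : -(1 / 3) * ((p - 2) / p) = -((p - 2) / p / 3) := by ring
  have e2 : (1 + |(k : ℝ)|) ^ (-(2 / p)) = (1 + |(k : ℝ)|) ^ ((p - 2) / p) / (1 + |(k : ℝ)|) := by
    rw [show -(2 / p) = (p - 2) / p - 1 by field_simp; ring, Real.rpow_sub (by positivity),
      Real.rpow_one]
  rw [e1, e2]
  field_simp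

section

/-! ### Distributions without frequencies vanish -/

theorem exists_bound_iteratedFDeriv_bmp (i : ℕ) :
    ∃ C : ℝ, 0 ≤ C ∧ ∀ ε : ℝ, 0 ≤ ε → ε ≤ 1 → ∀ x,
      ‖iteratedFDeriv ℝ i (fun x : ℝ => (bmp (ε * x) : ℝ)) x‖ ≤ C := by
  have hs : ContDiff ℝ ∞ (fun x : ℝ => (bmp x : ℝ)) := bmp.contDiff
  have hc : HasCompactSupport (iteratedFDeriv ℝ i (fun x : ℝ => (bmp x : ℝ))) :=
    bmp.hasCompactSupport.iteratedFDeriv i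
  obtain ⟨C, hC⟩ := hc.exists_bound_of_continuous (hs.continuous_iteratedFDeriv (by exact_mod_cast le_top))
  refine ⟨C, (norm_nonneg _).trans (hC 0), fun ε h0 h1 x => ?_⟩
  rw [norm_iteratedFDeriv_eq_norm_iteratedDeriv, iteratedDeriv_comp_const_mul
    (hs.of_le (by exact_mod_cast le_top)), norm_mul, norm_pow, Real.norm_of_nonneg h0]
  calc ε ^ i * ‖iteratedDeriv i (fun x : ℝ => (bmp x : ℝ)) (ε * x)‖ ≤ 1 * C := by
        gcongr
        · exact pow_le_one₀ h0 h1
        · rw [← norm_iteratedFDeriv_eq_norm_iteratedDeriv]; exact hC _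
    _ = C := one_mul C

/-- The multiplication by a dilated cutoff. -/
def cutS (n : ℕ) : 𝓢(ℝ, ℂ) →L[ℂ] 𝓢(ℝ, ℂ) :=
  SchwartzMap.smulLeftCLM ℂ (fun x : ℝ => ((bmp ((1 / ((n : ℝ) + 1)) * x) : ℝ) : ℂ))

theorem cutS_apply (n : ℕ) (g : 𝓢(ℝ, ℂ)) (x : ℝ) :
    cutS n g x = (bmp ((1 / ((n : ℝ) + 1)) * x) : ℝ) * g x := by
  have hε : (1 / ((n : ℝ) + 1)) ≠ 0 := by positivity
  have hc : HasCompactSupport (fun x : ℝ => ((bmp ((1 / ((n : ℝ) + 1)) * x) : ℝ) : ℂ)) :=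
    (bmp.hasCompactSupport.comp_homeomorph (Homeomorph.mulLeft₀ _ hε)).comp_left
      (g := fun y : ℝ => (y : ℂ)) Complex.ofReal_zero
  rw [cutS, SchwartzMap.smulLeftCLM_apply_apply, smul_eq_mul]
  exact hc.hasTemperateGrowth (Complex.ofRealCLM.contDiff.comp
    (bmp.contDiff.comp (contDiff_const.mul contDiff_id)))

theorem tendsto_cutS (g : 𝓢(ℝ, ℂ)) : Tendsto (fun n => cutS n g) atTop (𝓝 g) := by
  rw [(schwartz_withSeminorms ℂ ℝ ℂ).tendsto_nhds _ _]
  rintro ⟨k, l⟩ ε hε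
  choose C hC0 hC using exists_bound_iteratedFDeriv_bmp
  set M := SchwartzMap.seminorm ℂ (k + 1) l g + ∑ i ∈ Finset.range (l + 1),
    (l.choose i : ℝ) * C i * SchwartzMap.seminorm ℂ (k + 1) (l - i) g with hM
  have hM0 : 0 ≤ M := by
    have : ∀ i, 0 ≤ C i := hC0
    refine add_nonneg (apply_nonneg _ _) (Finset.sum_nonneg fun i _ => ?_)
    have := hC0 i
    positivity
  have key : ∀ n : ℕ, SchwartzMap.seminorm ℂ k l (cutS n g - g) ≤ (1 / ((n : ℝ) + 1)) * M := by
    intro n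
    set δ := 1 / ((n : ℝ) + 1) with hδ
    have hδ0 : 0 < δ := by positivity
    have hδ1 : δ ≤ 1 := by
      rw [hδ, div_le_one (by positivity)]; linarith [(n.cast_nonneg : (0 : ℝ) ≤ n)]
    refine SchwartzMap.seminorm_le_bound ℂ k l _ (by positivity) fun x => ?_
    rcases lt_or_ge (δ * |x|) 1 with hx | hx
    · have he : ((cutS n g - g : 𝓢(ℝ, ℂ)) : ℝ → ℂ) =ᶠ[𝓝 x] fun _ => 0 := by
        have hcont : Continuous fun y : ℝ => δ * |y| := by fun_prop
        filter_upwards [hcont.continuousAt.eventually_lt_const hx] with y hy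
        rw [sub_apply, cutS_apply, bmp.one_of_mem_closedBall]
        · simp
        · rw [mem_closedBall_zero_iff, Real.norm_eq_abs, abs_mul, abs_of_pos hδ0]
          exact hy.le
      rw [(he.iteratedFDeriv ℝ l).eq_of_nhds]
      have : iteratedFDeriv ℝ l (fun _ : ℝ => (0 : ℂ)) x = 0 := by
        simp
      rw [this, norm_zero, mul_zero]
      positivity
    · have hb : ContDiff ℝ ∞ fun x : ℝ => (bmp (δ * x) : ℝ) :=
        bmp.contDiff.comp (contDiff_const.mul contDiff_id)
      have hfun : ((cutS n g - g : 𝓢(ℝ, ℂ)) : ℝ → ℂ) =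
          (fun y => (bmp (δ * y) : ℝ) • g y) - (g : ℝ → ℂ) := by
        funext y
        rw [sub_apply, cutS_apply, Pi.sub_apply, Complex.real_smul]
      have hl : ((l : ℕ∞) : WithTop ℕ∞) ≤ (∞ : WithTop ℕ∞) := by exact_mod_cast le_top
      have h1 : ‖iteratedFDeriv ℝ l ((fun y => (bmp (δ * y) : ℝ) • g y) - (g : ℝ → ℂ)) x‖ ≤
          ∑ i ∈ Finset.range (l + 1), (l.choose i : ℝ) * C i * ‖iteratedFDeriv ℝ (l - i) g x‖ +
            ‖iteratedFDeriv ℝ l g x‖ := by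
        have hsm : ContDiff ℝ ∞ fun y : ℝ => (bmp (δ * y) : ℝ) • g y := hb.smul (g.smooth ⊤)
        rw [iteratedFDeriv_sub_apply ((hsm.of_le hl).contDiffAt)
          (((g.smooth ⊤).of_le hl).contDiffAt)]
        refine (norm_sub_le _ _).trans ?_
        gcongr
        refine (norm_iteratedFDeriv_smul_le hb (g.smooth ⊤) x hl).trans ?_
        gcongr with i
        exact hC i δ hδ0.le hδ1 x
      have hk : ‖x‖ ^ k ≤ δ * ‖x‖ ^ (k + 1) := by
        rw [pow_succ, Real.norm_eq_abs]
        have := mul_le_mul_of_nonneg_left hx (pow_nonneg (abs_nonneg x) k)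
        nlinarith
      rw [hfun]
      calc ‖x‖ ^ k * ‖iteratedFDeriv ℝ l ((fun y => (bmp (δ * y) : ℝ) • g y) - (g : ℝ → ℂ)) x‖
          ≤ (δ * ‖x‖ ^ (k + 1)) * (∑ i ∈ Finset.range (l + 1), (l.choose i : ℝ) * C i *
              ‖iteratedFDeriv ℝ (l - i) g x‖ + ‖iteratedFDeriv ℝ l g x‖) := by gcongr
        _ = δ * (‖x‖ ^ (k + 1) * ‖iteratedFDeriv ℝ l g x‖ + ∑ i ∈ Finset.range (l + 1),
              (l.choose i : ℝ) * C i * (‖x‖ ^ (k + 1) * ‖iteratedFDeriv ℝ (l - i) g x‖)) := by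
            rw [mul_assoc, mul_add, Finset.mul_sum, add_comm]
            congr 2
            refine Finset.sum_congr rfl fun i _ => ?_
            ring
        _ ≤ δ * M := by
            rw [hM]
            have := hC0
            gcongr with i
            · exact SchwartzMap.le_seminorm ℂ (k + 1) l g x
            · exact mul_nonneg (Nat.cast_nonneg _) (hC0 i)
            · exact SchwartzMap.le_seminorm ℂ (k + 1) (l - i) g x
  have hlim : Tendsto (fun n : ℕ => (1 / ((n : ℝ) + 1)) * M) atTop (𝓝 (0 * M)) :=
    tendsto_one_div_add_atTop_nhds_zero_nat.mul_const M
  rw [zero_mul] at hlim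
  filter_upwards [hlim.eventually_lt_const hε] with n hn
  exact (key n).trans_lt hn

theorem eq_zero_of_box {ρ : ℝ → ℝ} (hρ : IsCutoff ρ) {T : 𝓢'(ℝ, ℂ)} (h : ∀ k, box ρ k T = 0) :
    T = 0 := by
  have h1 : ∀ (n : ℕ) (g : 𝓢(ℝ, ℂ)), T (𝓕 (cutS n g)) = 0 := by
    intro n g
    set N : ℕ := 2 * (n + 1) * 7 + 2 with hN
    set K := Finset.Icc (-(N : ℤ)) N
    have hsum : multiplier (fun ξ => ∑ k ∈ K, (window ρ k ξ : ℂ)) T = 0 := by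
      rw [multiplier_sum K fun k _ => tg_window hρ k]
      exact Finset.sum_eq_zero fun k _ => h k
    have h2 := multiplier_apply (fun ξ => ∑ k ∈ K, (window ρ k ξ : ℂ)) T (𝓕 (cutS n g))
    rw [hsum] at h2
    have htg : (fun ξ : ℝ => ∑ k ∈ K, (window ρ k (2 * Real.pi * ξ) : ℂ)).HasTemperateGrowth :=
      Function.HasTemperateGrowth.sum fun k _ => tg_window hρ k
    have h3 : mulT (fun ξ => ∑ k ∈ K, (window ρ k ξ : ℂ)) (𝓕 (cutS n g)) = 𝓕 (cutS n g) := by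
      rw [mulT, FourierTransform.fourierInv_fourier_eq]
      congr 1
      ext x
      rw [SchwartzMap.smulLeftCLM_apply_apply htg, cutS_apply, smul_eq_mul]
      by_cases hx : bmp ((1 / ((n : ℝ) + 1)) * x) = 0
      · rw [hx]; simp
      · have hlt : |x| < 2 * (n + 1) := by
          by_contra! hge
          apply hx
          refine bmp.zero_of_le_dist ?_
          rw [dist_zero_right, Real.norm_eq_abs, abs_mul, abs_of_pos (by positivity)]
          change (2 : ℝ) ≤ _
          rw [one_div, ← div_eq_inv_mul, le_div_iff₀ (by positivity)]
          exact hge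
        have hone : ∑ k ∈ K, (window ρ k (2 * Real.pi * x) : ℂ) = 1 := by
          rw [← Complex.ofReal_sum, sum_window hρ, Complex.ofReal_one]
          intro k hk
          have hb : |2 * Real.pi * x| ≤ 2 * (n + 1) * 7 := by
            rw [abs_mul, abs_of_pos Real.two_pi_pos]
            have := Real.pi_lt_d2
            nlinarith [abs_nonneg x]
          have hk2 : |(k : ℝ)| ≤ N := by
            have := abs_sub_abs_le_abs_sub (k : ℝ) (2 * Real.pi * x)
            rw [abs_sub_comm] at this
            rw [hN]
            push_cast
            linarith
          rw [abs_le] at hk2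
          rw [Finset.mem_Icc]
          exact ⟨by exact_mod_cast hk2.1, by exact_mod_cast hk2.2⟩
        rw [hone, one_mul]
    rw [h3] at h2
    exact h2.symm
  ext f
  have hl : Tendsto (fun n => T (𝓕 (cutS n (𝓕⁻ f)))) atTop (𝓝 (T (𝓕 (𝓕⁻ f)))) := by
    have hc : Continuous fun g : 𝓢(ℝ, ℂ) => T (𝓕 g) :=
      T.continuous.comp (FourierTransform.fourierCLM ℂ 𝓢(ℝ, ℂ)).continuous
    exact (hc.tendsto _).comp (tendsto_cutS _)
  rw [FourierTransform.fourier_fourierInv_eq] at hl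
  refine tendsto_nhds_unique hl ?_
  simp_rw [h1]
  exact tendsto_const_nhds

/-! ### The modulation norms -/

variable {ρ : ℝ → ℝ} {s q : ℝ} {p : ℝ≥0∞}

theorem modNorm_eq (hq : 1 ≤ q) (T : 𝓢'(ℝ, ℂ)) :
    modNorm ρ s p q T = lq q fun k => wt k ^ s * lpNorm p (box ρ k T) := by
  have hq0 : 0 < q := by linarith
  rw [modNorm, lq]
  congr 1
  refine tsum_congr fun k => ?_
  rw [ENNReal.mul_rpow_of_nonneg _ _ hq0.le, ← ENNReal.rpow_mul, wt,
    ENNReal.ofReal_rpow_of_pos (by positivity)]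

theorem modNorm_add_le (hq : 1 ≤ q) (hp : 1 ≤ p) (T U : 𝓢'(ℝ, ℂ)) :
    modNorm ρ s p q (T + U) ≤ modNorm ρ s p q T + modNorm ρ s p q U := by
  rw [modNorm_eq hq, modNorm_eq hq, modNorm_eq hq]
  refine (lq_mono (by linarith) fun k => ?_).trans (lq_add_le hq _ _)
  rw [map_add, ← mul_add]
  gcongr
  exact lpNorm_add_le hp _ _

theorem modNorm_zero (hq : 1 ≤ q) : modNorm ρ s p q 0 = 0 := by
  have hq0 : 0 < q := by linarith
  rw [modNorm_eq hq, lq]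
  simp [lpNorm_zero, hq0]

theorem modNorm_smul (hq : 1 ≤ q) {c : ℂ} (hc : c ≠ 0) (T : 𝓢'(ℝ, ℂ)) :
    modNorm ρ s p q (c • T) = ‖c‖ₑ * modNorm ρ s p q T := by
  rw [modNorm_eq hq, modNorm_eq hq, ← lq_const_mul (by linarith)]
  congr 1
  funext k
  rw [map_smul, lpNorm_smul _ hc]
  ring

theorem modNorm_neg (hq : 1 ≤ q) (T : 𝓢'(ℝ, ℂ)) : modNorm ρ s p q (-T) = modNorm ρ s p q T := by
  rw [modNorm_eq hq, modNorm_eq hq]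
  simp only [map_neg, lpNorm_neg]

theorem modNorm_sub_comm (hq : 1 ≤ q) (T U : 𝓢'(ℝ, ℂ)) :
    modNorm ρ s p q (T - U) = modNorm ρ s p q (U - T) := by
  rw [← modNorm_neg hq, neg_sub]

theorem modNorm_sub_le (hq : 1 ≤ q) (hp : 1 ≤ p) (T U : 𝓢'(ℝ, ℂ)) :
    modNorm ρ s p q (T - U) ≤ modNorm ρ s p q T + modNorm ρ s p q U := by
  rw [sub_eq_add_neg, ← modNorm_neg hq U]
  exact modNorm_add_le hq hp _ _

theorem modNorm_sum_le {ι : Type*} (hq : 1 ≤ q) (hp : 1 ≤ p) (K : Finset ι) (T : ι → 𝓢'(ℝ, ℂ)) :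
    modNorm ρ s p q (∑ i ∈ K, T i) ≤ ∑ i ∈ K, modNorm ρ s p q (T i) := by
  classical
  induction K using Finset.induction_on with
  | empty => simp [modNorm_zero hq]
  | insert i K hi ih =>
    rw [Finset.sum_insert hi, Finset.sum_insert hi]
    exact (modNorm_add_le hq hp _ _).trans (by gcongr)

theorem lpNorm_box_le_modNorm (hq : 1 ≤ q) (k : ℤ) (T : 𝓢'(ℝ, ℂ)) :
    lpNorm p (box ρ k T) ≤ wt k ^ (-s) * modNorm ρ s p q T := by
  have h := le_lq (show 0 < q by linarith) (fun k => wt k ^ s * lpNorm p (box ρ k T)) k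
  rw [← modNorm_eq hq] at h
  calc lpNorm p (box ρ k T) = wt k ^ (-s) * (wt k ^ s * lpNorm p (box ρ k T)) := by
        rw [← mul_assoc, ← wt_rpow_add, neg_add_cancel, ENNReal.rpow_zero, one_mul]
    _ ≤ _ := by gcongr

theorem lpNorm_box_ne_top (hq : 1 ≤ q) {T : 𝓢'(ℝ, ℂ)} (h : modNorm ρ s p q T ≠ ⊤) (k : ℤ) :
    lpNorm p (box ρ k T) ≠ ⊤ :=
  ne_top_of_le_ne_top (ENNReal.mul_ne_top (wt_rpow_ne_top _ _) h) (lpNorm_box_le_modNorm hq k T)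

theorem eq_zero_of_modNorm (hρ : IsCutoff ρ) (hq : 1 ≤ q) (hp : 1 ≤ p) {T : 𝓢'(ℝ, ℂ)}
    (h : modNorm ρ s p q T = 0) : T = 0 := by
  refine eq_zero_of_box hρ fun k => ?_
  refine lpNorm_eq_zero (p := p) (zero_lt_one.trans_le hp).ne' ?_
  have := lpNorm_box_le_modNorm (ρ := ρ) (s := s) (p := p) hq k T
  rw [h, mul_zero] at this
  exact le_antisymm this zero_le

/-- Lower semicontinuity of the modulation norm. -/
theorem modNorm_le_of_tendsto (hq : 1 ≤ q) (hp : 1 ≤ p) {T : ℕ → 𝓢'(ℝ, ℂ)} {U : 𝓢'(ℝ, ℂ)}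
    (h : ∀ k, Tendsto (fun n => lpNorm p (box ρ k (T n) - box ρ k U)) atTop (𝓝 0)) {C : ℝ≥0∞}
    (hb : ∀ᶠ n in atTop, modNorm ρ s p q (T n) ≤ C) : modNorm ρ s p q U ≤ C := by
  have hq0 : 0 < q := by linarith
  have hb' : ∀ᶠ n in atTop, ∑' k, (wt k ^ s * lpNorm p (box ρ k (T n))) ^ q ≤ C ^ q := by
    filter_upwards [hb] with n hn
    rwa [modNorm_eq hq, lq, one_div, ENNReal.rpow_inv_le_iff hq0] at hn
  rw [modNorm_eq hq, lq, one_div, ENNReal.rpow_inv_le_iff hq0, ENNReal.tsum_eq_iSup_sum]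
  refine iSup_le fun K => ?_
  have hl : Tendsto (fun n => ∑ k ∈ K, (wt k ^ s * lpNorm p (box ρ k (T n))) ^ q) atTop
      (𝓝 (∑ k ∈ K, (wt k ^ s * lpNorm p (box ρ k U)) ^ q)) := by
    refine tendsto_finsetSum _ fun k _ => ?_
    have h1 := tendsto_lpNorm hp (h k)
    have h2 := ENNReal.Tendsto.const_mul (a := wt k ^ s) h1 (Or.inr (wt_rpow_ne_top _ _))
    exact (ENNReal.continuous_rpow_const.tendsto _).comp h2
  refine le_of_tendsto hl ?_
  filter_upwards [hb'] with n hn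
  exact (ENNReal.sum_le_tsum K).trans hn

theorem lpNorm_box_le (hρ : IsCutoff ρ) (hp : 1 ≤ p) (hp' : p ≠ ⊤) (k : ℤ) (T : 𝓢'(ℝ, ℂ)) :
    lpNorm p (box ρ k T) ≤ ENNReal.ofReal (3 * winB hρ) * lpNorm p T :=
  (isAmp_window hρ k).lpNorm_multiplier_le (by linarith [one_le_winB hρ]) hp hp' T

theorem tendsto_box (hρ : IsCutoff ρ) (hp : 1 ≤ p) (hp' : p ≠ ⊤) {T : ℕ → 𝓢'(ℝ, ℂ)} {U : 𝓢'(ℝ, ℂ)}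
    (h : Tendsto (fun n => lpNorm p (T n - U)) atTop (𝓝 0)) (k : ℤ) :
    Tendsto (fun n => lpNorm p (box ρ k (T n) - box ρ k U)) atTop (𝓝 0) := by
  have h1 : Tendsto (fun n => ENNReal.ofReal (3 * winB hρ) * lpNorm p (T n - U)) atTop (𝓝 0) := by
    have := ENNReal.Tendsto.const_mul (a := ENNReal.ofReal (3 * winB hρ)) h (Or.inr ENNReal.ofReal_ne_top)
    rwa [mul_zero] at this
  refine tendsto_of_tendsto_of_tendsto_of_le_of_le tendsto_const_nhds h1 (fun _ => zero_le)
    fun n => ?_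
  simp only
  rw [← map_sub]
  exact lpNorm_box_le hρ hp hp' k _

theorem modNorm_multiplier_le (hρ : IsCutoff ρ) (hq : 1 ≤ q) (hp : 1 ≤ p) (hp' : p ≠ ⊤) {n : ℝ → ℂ}
    (hn : TG n) (hn' : ContDiff ℝ ∞ n) {M : ℝ} (hM : 0 < M) (h1 : ∀ ξ, ‖n ξ‖ ≤ M)
    (h2 : ∀ ξ, ‖deriv n ξ‖ ≤ M) (T : 𝓢'(ℝ, ℂ)) :
    modNorm ρ s p q (multiplier n T) ≤ ENNReal.ofReal (6 * chiB * M) * modNorm ρ s p q T := by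
  rw [modNorm_eq hq, modNorm_eq hq, ← lq_const_mul (by linarith)]
  refine lq_mono (by linarith) fun k => ?_
  rw [mul_left_comm]
  gcongr
  exact lpNorm_box_multiplier_le hρ hn hn' hp hp' hM (fun ξ _ => h1 ξ) (fun ξ _ => h2 ξ) T

theorem norm_cexp_phi (t ξ : ℝ) : ‖Complex.exp (-(Complex.I * t * phi ξ))‖ = 1 := by
  have : -(Complex.I * t * phi ξ) = ((-(t * phi ξ) : ℝ) : ℂ) * Complex.I := by push_cast; ring
  rw [this, Complex.norm_exp_ofReal_mul_I]

theorem hasDerivAt_cexp_phi (t ξ : ℝ) :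
    HasDerivAt (fun ξ : ℝ => Complex.exp (-(Complex.I * t * phi ξ)))
      (Complex.exp (-(Complex.I * t * phi ξ)) * (-(Complex.I * t * phi₁ ξ))) ξ :=
  (((deriv_phi ξ).ofReal_comp.const_mul (Complex.I * t)).neg).cexp

theorem norm_deriv_cexp_phi_le (t ξ : ℝ) :
    ‖Complex.exp (-(Complex.I * t * phi ξ)) * (-(Complex.I * t * phi₁ ξ))‖ ≤ |t| := by
  rw [norm_mul, norm_cexp_phi, one_mul, norm_neg, norm_mul, norm_mul, Complex.norm_I, one_mul,
    Complex.norm_real, Complex.norm_real, Real.norm_eq_abs, Real.norm_eq_abs]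
  exact mul_le_of_le_one_right (abs_nonneg _) (abs_phi₁_le ξ)

theorem modNorm_S_le (hρ : IsCutoff ρ) (hq : 1 ≤ q) (hp : 1 ≤ p) (hp' : p ≠ ⊤) (t : ℝ)
    (T : 𝓢'(ℝ, ℂ)) :
    modNorm ρ s p q (S t T) ≤ ENNReal.ofReal (6 * chiB * (1 + |t|)) * modNorm ρ s p q T := by
  refine modNorm_multiplier_le hρ hq hp hp' (tg_group t) (contDiff_cexp_phi t) (by positivity)
    (fun ξ => ?_) (fun ξ => ?_) T
  · rw [norm_cexp_phi]; linarith [abs_nonneg t]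
  · rw [(hasDerivAt_cexp_phi t ξ).deriv]
    linarith [norm_deriv_cexp_phi_le t ξ]

theorem abs_phi_le (ξ : ℝ) : |phi ξ| ≤ 1 := by
  rw [phi, abs_div, abs_of_pos (show (0 : ℝ) < 1 + ξ ^ 2 by positivity), div_le_one (by positivity),
    ← sq_abs ξ]
  nlinarith [sq_nonneg (|ξ| - 1), abs_nonneg ξ]

theorem multiplier_one (T : 𝓢'(ℝ, ℂ)) : multiplier (fun _ => (1 : ℂ)) T = T := by
  have := TemperedDistribution.fourierMultiplierCLM_const (E := ℝ) (F := ℂ) 1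
  rw [multiplier, this]
  simp

theorem S_zero (T : 𝓢'(ℝ, ℂ)) : S 0 T = T := by
  have e : S 0 = multiplier (fun _ => 1) := by
    rw [S]; congr 1; funext ξ; simp
  rw [e, multiplier_one]

theorem TG.add {m n : ℝ → ℂ} (hm : TG m) (hn : TG n) : TG fun ξ => m ξ + n ξ :=
  Function.HasTemperateGrowth.add hm hn

theorem multiplier_add {m n : ℝ → ℂ} (hm : TG m) (hn : TG n) (T : 𝓢'(ℝ, ℂ)) :
    multiplier (fun ξ => m ξ + n ξ) T = multiplier m T + multiplier n T := by
  have := multiplier_sum (Finset.univ : Finset Bool) (m := fun b => if b then m else n)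
    (fun b _ => by cases b <;> simpa) T
  simpa using this

theorem S_sub_eq (t : ℝ) (T : 𝓢'(ℝ, ℂ)) :
    S t T - T = multiplier (fun ξ => Complex.exp (-(Complex.I * t * phi ξ)) - 1) T := by
  have h := multiplier_add (tg_group t) (tg_const (-1)) T
  have h1 : multiplier (fun _ => (-1 : ℂ)) T = -T := by
    have := multiplier_const_mul (tg_const 1) (-1) T
    rw [multiplier_one, neg_one_smul ℂ T] at this
    simpa using this
  rw [h1] at h
  simp only [sub_eq_add_neg]
  exact h.symm

theorem modNorm_S_sub_le (hρ : IsCutoff ρ) (hq : 1 ≤ q) (hp : 1 ≤ p) (hp' : p ≠ ⊤) (t : ℝ)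
    (T : 𝓢'(ℝ, ℂ)) :
    modNorm ρ s p q (S t T - T) ≤ ENNReal.ofReal (6 * chiB * |t|) * modNorm ρ s p q T := by
  rw [S_sub_eq]
  by_cases ht : t = 0
  · subst ht
    rw [← S_sub_eq, S_zero, sub_self, modNorm_zero hq]
    exact zero_le
  refine modNorm_multiplier_le hρ hq hp hp' (by
      simpa only [sub_eq_add_neg] using (tg_group t).add (tg_const (-1)))
    ((contDiff_cexp_phi t).sub contDiff_const) (abs_pos.2 ht) (fun ξ => ?_) (fun ξ => ?_) T
  · have e : -(Complex.I * t * phi ξ) = Complex.I * ((-(t * phi ξ) : ℝ) : ℂ) := by push_cast; ring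
    rw [e]
    refine (Real.norm_exp_I_mul_ofReal_sub_one_le).trans ?_
    rw [norm_neg, Real.norm_eq_abs, abs_mul]
    exact mul_le_of_le_one_right (abs_nonneg _) (abs_phi_le ξ)
  · rw [((hasDerivAt_cexp_phi t ξ).sub_const 1).deriv]
    exact norm_deriv_cexp_phi_le t ξ

theorem S_S (t u : ℝ) (T : 𝓢'(ℝ, ℂ)) : S t (S u T) = S (t + u) T := by
  rw [S, S, S, multiplier_multiplier (tg_group t) (tg_group u)]
  congr 2
  funext ξ
  rw [← Complex.exp_add]
  congr 1
  push_cast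
  ring

end

section

/-! ### Density of band-limited Schwartz functions -/

variable {ρ : ℝ → ℝ} {s q : ℝ} {p : ℝ≥0∞}

/-- A Schwartz function with finitely many blocks. -/
def IsBL (ρ : ℝ → ℝ) (f : 𝓢(ℝ, ℂ)) : Prop :=
  ∃ K : Finset ℤ, ∀ K', K ⊆ K' → f = ∑ k ∈ K', mulS (fun ξ => (window ρ k ξ : ℂ)) f

theorem IsBL.sub {f g : 𝓢(ℝ, ℂ)} (hf : IsBL ρ f) (hg : IsBL ρ g) : IsBL ρ (f - g) := by
  obtain ⟨K, hK⟩ := hf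
  obtain ⟨L, hL⟩ := hg
  refine ⟨K ∪ L, fun K' h => ?_⟩
  simp only [mulS_sub]
  rw [Finset.sum_sub_distrib, ← hK K' (Finset.union_subset_left h),
    ← hL K' (Finset.union_subset_right h)]

theorem mulS_add (m : ℝ → ℂ) (f g : 𝓢(ℝ, ℂ)) : mulS m (f + g) = mulS m f + mulS m g :=
  map_add _ _ _

theorem IsBL.sum {ι : Type*} {K : Finset ι} {f : ι → 𝓢(ℝ, ℂ)} (hf : ∀ i ∈ K, IsBL ρ (f i)) :
    IsBL ρ (∑ i ∈ K, f i) := by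
  classical
  induction K using Finset.induction_on with
  | empty => exact ⟨∅, fun K' _ => by simp⟩
  | insert i K hi ih =>
    rw [Finset.sum_insert hi]
    obtain ⟨K₁, h₁⟩ := hf i (Finset.mem_insert_self i K)
    obtain ⟨K₂, h₂⟩ := ih fun j hj => hf j (Finset.mem_insert_of_mem hj)
    refine ⟨K₁ ∪ K₂, fun K' h => ?_⟩
    simp only [mulS_add]
    rw [Finset.sum_add_distrib, ← h₁ K' (Finset.union_subset_left h),
      ← h₂ K' (Finset.union_subset_right h)]

theorem near_index {k j : ℤ} {ξ a b : ℝ} {n : ℤ} (h1 : |ξ - k| < a) (h2 : |ξ - j| < b)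
    (h : a + b ≤ n) : k ∈ Finset.Icc (j - n) (j + n) := by
  have h3 : |(k : ℝ) - j| < n := by
    have := abs_sub_le (k : ℝ) ξ j
    rw [abs_sub_comm (k : ℝ) ξ] at this
    linarith
  have h4 : |k - j| < n := by exact_mod_cast h3
  rw [abs_lt] at h4
  rw [Finset.mem_Icc]
  constructor <;> omega

theorem isBL_mulS_chi (hρ : IsCutoff ρ) (j : ℤ) (g : 𝓢(ℝ, ℂ)) : IsBL ρ (mulS (chi j) g) := by
  refine ⟨Finset.Icc (j - 3) (j + 3), fun K' hK' => ?_⟩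
  rw [← mulS_sum K' fun k _ => tg_window hρ k]
  have htg : TG fun ξ => ∑ k ∈ K', (window ρ k ξ : ℂ) :=
    Function.HasTemperateGrowth.sum fun k _ => tg_window hρ k
  rw [mulS_mulS htg (isAmp_chi j).sym.tg]
  congr 2
  funext ξ
  by_cases h : chi j ξ = 0
  · rw [h, mul_zero]
  · rw [← Complex.ofReal_sum, sum_window hρ, Complex.ofReal_one, one_mul]
    intro k hk
    exact hK' (near_index hk (chi_ne_zero h) (by norm_num))

theorem box_box_eq_zero (hρ : IsCutoff ρ) {k j : ℤ} (h : k ∉ Finset.Icc (j - 2) (j + 2))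
    (T : 𝓢'(ℝ, ℂ)) : box ρ k (box ρ j T) = 0 := by
  rw [box, box, multiplier_multiplier (tg_window hρ k) (tg_window hρ j)]
  have : (fun ξ => (window ρ k ξ : ℂ) * (window ρ j ξ : ℂ)) = fun _ => (0 : ℂ) * 1 := by
    funext ξ
    by_contra hne
    rw [zero_mul] at hne
    have h1 : window ρ k ξ ≠ 0 := fun h0 => hne (by simp [h0])
    have h2 : window ρ j ξ ≠ 0 := fun h0 => hne (by simp [h0])
    exact h (near_index (window_ne_zero hρ h1) (window_ne_zero hρ h2) (by norm_num))
  rw [this, multiplier_const_mul (tg_const 1)]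
  exact zero_smul ℂ (multiplier (fun _ => (1 : ℂ)) T)

theorem box_chi_eq_zero (hρ : IsCutoff ρ) {k j : ℤ} (h : k ∉ Finset.Icc (j - 3) (j + 3))
    (T : 𝓢'(ℝ, ℂ)) : box ρ k (multiplier (chi j) T) = 0 := by
  rw [box, multiplier_multiplier (tg_window hρ k) (isAmp_chi j).sym.tg]
  have : (fun ξ => (window ρ k ξ : ℂ) * chi j ξ) = fun _ => (0 : ℂ) * 1 := by
    funext ξ
    by_contra hne
    rw [zero_mul] at hne
    have h1 : window ρ k ξ ≠ 0 := fun h0 => hne (by simp [h0])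
    have h2 : chi j ξ ≠ 0 := fun h0 => hne (by simp [h0])
    exact h (near_index (window_ne_zero hρ h1) (chi_ne_zero h2) (by norm_num))
  rw [this, multiplier_const_mul (tg_const 1)]
  exact zero_smul ℂ (multiplier (fun _ => (1 : ℂ)) T)

theorem sum_box_box (hρ : IsCutoff ρ) {k : ℤ} {K : Finset ℤ} (h : Finset.Icc (k - 2) (k + 2) ⊆ K)
    (T : 𝓢'(ℝ, ℂ)) : box ρ k (∑ j ∈ K, box ρ j T) = box ρ k T := by
  have e : ∑ j ∈ K, box ρ j T = multiplier (fun ξ => ∑ j ∈ K, (window ρ j ξ : ℂ)) T :=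
    (multiplier_sum K (fun j _ => tg_window hρ j) T).symm
  have htg : TG fun ξ => ∑ k ∈ K, (window ρ k ξ : ℂ) :=
    Function.HasTemperateGrowth.sum fun k _ => tg_window hρ k
  rw [e, box, multiplier_multiplier (tg_window hρ k) htg]
  congr 2
  funext ξ
  by_cases h0 : window ρ k ξ = 0
  · simp [h0]
  · rw [← Complex.ofReal_sum, sum_window hρ, Complex.ofReal_one, mul_one]
    intro j hj
    exact h (near_index hj (window_ne_zero hρ h0) (by norm_num))

theorem exists_sum_box_near (hρ : IsCutoff ρ) (hq : 1 ≤ q) (hp : 1 ≤ p) (hp' : p ≠ ⊤) {T : 𝓢'(ℝ, ℂ)}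
    (hT : modNorm ρ s p q T ≠ ⊤) {ε : ℝ≥0∞} (hε : 0 < ε) :
    ∃ K : Finset ℤ, modNorm ρ s p q (∑ j ∈ K, box ρ j T - T) ≤ ε := by
  classical
  have hq0 : 0 < q := by linarith
  set C : ℝ≥0∞ := 5 * ENNReal.ofReal (3 * winB hρ) + 1 with hC
  have hC' : C ≠ ⊤ := by
    rw [hC]
    exact ENNReal.add_ne_top.2 ⟨ENNReal.mul_ne_top (by norm_num) ENNReal.ofReal_ne_top, by norm_num⟩
  set c : ℤ → ℝ≥0∞ := fun k => wt k ^ s * lpNorm p (box ρ k T) with hc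
  have hsum : ∑' k, (C * c k) ^ q ≠ ⊤ := by
    have h1 : lq q (fun k => C * c k) ≠ ⊤ := by
      rw [lq_const_mul hq0, hc, ← modNorm_eq hq]
      exact ENNReal.mul_ne_top hC' hT
    intro h
    apply h1
    rw [lq, h, ENNReal.top_rpow_of_pos (by positivity)]
  have htail := ENNReal.tendsto_tsum_compl_atTop_zero hsum
  obtain ⟨K₀, hK₀⟩ := eventually_atTop.1 (htail.eventually_lt_const
    (ENNReal.rpow_pos_of_nonneg hε hq0.le : 0 < ε ^ q))
  have h0 := hK₀ K₀ le_rfl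
  set K := K₀.biUnion fun k => Finset.Icc (k - 2) (k + 2)
  refine ⟨K, ?_⟩
  rw [modNorm_eq hq, lq, one_div, ENNReal.rpow_inv_le_iff hq0]
  refine le_trans ?_ h0.le
  have e := tsum_subtype {x : ℤ | x ∉ K₀} (fun k => (C * c k) ^ q)
  change _ ≤ ∑' b : {x : ℤ | x ∉ K₀}, (C * c b) ^ q
  rw [e]
  refine ENNReal.tsum_le_tsum fun k => ?_
  by_cases hk : k ∈ K₀
  · have hz : box ρ k (∑ j ∈ K, box ρ j T - T) = 0 := by
      rw [map_sub, sum_box_box hρ, sub_self]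
      exact Finset.subset_biUnion_of_mem (fun k => Finset.Icc (k - 2) (k + 2)) hk
    rw [hz, lpNorm_zero, mul_zero, ENNReal.zero_rpow_of_pos hq0]
    exact zero_le
  · rw [Set.indicator_of_mem (show k ∈ {x : ℤ | x ∉ K₀} from hk)]
    refine ENNReal.rpow_le_rpow ?_ hq0.le
    rw [hc, mul_left_comm]
    gcongr
    have h1 : lpNorm p (box ρ k (∑ j ∈ K, box ρ j T)) ≤
        5 * ENNReal.ofReal (3 * winB hρ) * lpNorm p (box ρ k T) := by
      rw [map_sum]
      have hsub : ∑ j ∈ K, box ρ k (box ρ j T) =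
          ∑ j ∈ K with j ∈ Finset.Icc (k - 2) (k + 2), box ρ k (box ρ j T) := by
        rw [Finset.sum_filter]
        refine Finset.sum_congr rfl fun j _ => ?_
        split_ifs with hj
        · rfl
        · refine box_box_eq_zero hρ ?_ T
          intro hcon
          apply hj
          rw [Finset.mem_Icc] at hcon ⊢
          constructor <;> omega
      rw [hsub]
      refine (lpNorm_sum_le hp _ _).trans ?_
      have hle : ∀ j ∈ K.filter (fun j => j ∈ Finset.Icc (k - 2) (k + 2)),
          lpNorm p (box ρ k (box ρ j T)) ≤ ENNReal.ofReal (3 * winB hρ) * lpNorm p (box ρ k T) := by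
        intro j _
        have : box ρ k (box ρ j T) = box ρ j (box ρ k T) :=
          multiplier_comm (tg_window hρ k) (tg_window hρ j) T
        rw [this]
        exact lpNorm_box_le hρ hp hp' j _
      refine (Finset.sum_le_card_nsmul _ _ _ hle).trans ?_
      rw [nsmul_eq_mul, mul_assoc]
      gcongr
      have hcard : (K.filter fun j => j ∈ Finset.Icc (k - 2) (k + 2)).card ≤ 5 := by
        calc _ ≤ (Finset.Icc (k - 2) (k + 2)).card :=
              Finset.card_le_card fun j hj => (Finset.mem_filter.1 hj).2
          _ = 5 := by rw [Int.card_Icc]; omega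
      exact_mod_cast hcard
    rw [map_sub, sub_eq_add_neg, hC, add_mul, one_mul]
    refine (lpNorm_add_le hp _ _).trans ?_
    rw [lpNorm_neg]
    gcongr

theorem exists_modNorm_chi_le (hρ : IsCutoff ρ) (hq : 1 ≤ q) (hp : 1 ≤ p) (hp' : p ≠ ⊤) (s : ℝ)
    (j : ℤ) : ∃ C : ℝ≥0∞, C ≠ ⊤ ∧ ∀ U : 𝓢'(ℝ, ℂ), modNorm ρ s p q (multiplier (chi j) U) ≤
      C * lpNorm p U := by
  classical
  have hq0 : 0 < q := by linarith
  set D := ENNReal.ofReal (3 * winB hρ) * ENNReal.ofReal (3 * chiB) with hD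
  set d : ℤ → ℝ≥0∞ := fun k => if k ∈ Finset.Icc (j - 3) (j + 3) then wt k ^ s * D else 0 with hd
  refine ⟨lq q d, ?_, fun U => ?_⟩
  · rw [lq, tsum_eq_sum (s := Finset.Icc (j - 3) (j + 3)) fun k hk => by
      rw [hd]; simp only [if_neg hk]; exact ENNReal.zero_rpow_of_pos hq0]
    refine ENNReal.rpow_ne_top_of_nonneg (by positivity) (ENNReal.sum_ne_top.2 fun k _ => ?_)
    refine ENNReal.rpow_ne_top_of_nonneg hq0.le ?_
    rw [hd]
    simp only
    split_ifs
    · exact ENNReal.mul_ne_top (wt_rpow_ne_top _ _)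
        (ENNReal.mul_ne_top ENNReal.ofReal_ne_top ENNReal.ofReal_ne_top)
  · rw [modNorm_eq hq, mul_comm, ← lq_const_mul hq0]
    refine lq_mono hq0 fun k => ?_
    rw [hd]
    simp only
    split_ifs with hk
    · rw [mul_left_comm]
      gcongr
      refine (lpNorm_box_le hρ hp hp' k _).trans ?_
      rw [hD, mul_comm (lpNorm p U), mul_assoc]
      gcongr
      exact (isAmp_chi j).lpNorm_multiplier_le (by linarith [one_le_chiB]) hp hp' U
    · rw [box_chi_eq_zero hρ hk, lpNorm_zero, mul_zero]
      exact zero_le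

theorem exists_isBL_near (hρ : IsCutoff ρ) (hq : 1 ≤ q) (hp : 1 ≤ p) (hp' : p ≠ ⊤) {T : 𝓢'(ℝ, ℂ)}
    (hT : modNorm ρ s p q T ≠ ⊤) {ε : ℝ≥0∞} (hε : 0 < ε) (hε' : ε ≠ ⊤) :
    ∃ f : 𝓢(ℝ, ℂ), IsBL ρ f ∧ modNorm ρ s p q (emb f - T) < ε := by
  have hε2 := ENNReal.half_pos hε.ne'
  obtain ⟨K, hK⟩ := exists_sum_box_near hρ hq hp hp' hT (ENNReal.half_pos hε2.ne')
  choose C hC hCle using fun j => exists_modNorm_chi_le hρ hq hp hp' s j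
  choose g hg using fun j => exists_tendsto_emb hp hp' (lpNorm_box_ne_top hq hT j)
  have hl : Tendsto (fun n => ∑ j ∈ K, C j * lpNorm p (emb (g j n) - box ρ j T)) atTop (𝓝 0) := by
    have : Tendsto (fun n => ∑ j ∈ K, C j * lpNorm p (emb (g j n) - box ρ j T)) atTop
        (𝓝 (∑ j ∈ K, C j * 0)) := tendsto_finsetSum _ fun j _ =>
      ENNReal.Tendsto.const_mul (hg j) (Or.inr (hC j))
    simpa using this
  obtain ⟨n, hn⟩ := (hl.eventually_lt_const hε2).exists
  refine ⟨∑ j ∈ K, mulS (chi j) (g j n), IsBL.sum fun j _ => isBL_mulS_chi hρ j _, ?_⟩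
  have e : emb (∑ j ∈ K, mulS (chi j) (g j n)) - T =
      (∑ j ∈ K, multiplier (chi j) (emb (g j n) - box ρ j T)) + (∑ j ∈ K, box ρ j T - T) := by
    rw [map_sum, ← add_sub_assoc, ← Finset.sum_add_distrib]
    congr 1
    refine Finset.sum_congr rfl fun j _ => ?_
    rw [map_sub, ← box_eq_chi_box hρ, sub_add_cancel, multiplier_coe (isAmp_chi j).sym.tg]
  rw [e]
  refine (modNorm_add_le hq hp _ _).trans_lt ?_
  rw [← ENNReal.add_halves ε]
  refine ENNReal.add_lt_add_of_lt_of_le (ne_top_of_le_ne_top ?_ hK) ?_ (hK.trans ENNReal.half_le_self)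
  · exact (ENNReal.div_lt_top (ENNReal.div_lt_top hε' (by norm_num)).ne (by norm_num)).ne
  · refine (modNorm_sum_le hq hp _ _).trans_lt (lt_of_le_of_lt ?_ hn)
    exact Finset.sum_le_sum fun j _ => hCle j _

end

/-! ### The embedding into `L^p` -/

theorem sum_norm_chi_sq_le (K : Finset ℤ) (ξ : ℝ) : ∑ k ∈ K, ‖chi k ξ‖ ^ 2 ≤ 4 := by
  classical
  have h1 : ∀ k, ‖chi k ξ‖ ≤ 1 := by
    intro k
    rw [chi, Complex.norm_real, Real.norm_of_nonneg bmp.nonneg]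
    exact bmp.le_one
  set I := Finset.Icc (⌊ξ⌋ - 1) (⌊ξ⌋ + 2)
  have h2 : ∀ k, chi k ξ ≠ 0 → k ∈ I := by
    intro k hk
    have h := abs_lt.1 (chi_ne_zero hk)
    have f1 := Int.floor_le ξ
    have f2 := Int.lt_floor_add_one ξ
    rw [Finset.mem_Icc]
    constructor
    · have : (⌊ξ⌋ : ℝ) - 2 < k := by linarith
      have : ⌊ξ⌋ - 2 < k := by exact_mod_cast this
      omega
    · have : (k : ℝ) < ⌊ξ⌋ + 3 := by linarith
      have : k < ⌊ξ⌋ + 3 := by exact_mod_cast this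
      omega
  calc ∑ k ∈ K, ‖chi k ξ‖ ^ 2 ≤ ∑ k ∈ K, if k ∈ I then (1 : ℝ) else 0 := by
        refine Finset.sum_le_sum fun k _ => ?_
        split_ifs with hk
        · exact pow_le_one₀ (norm_nonneg _) (h1 k)
        · have : chi k ξ = 0 := by
            by_contra h
            exact hk (h2 k h)
          simp [this]
    _ = ((K.filter (fun k => k ∈ I)).card : ℝ) := by
        rw [← Finset.sum_filter]; simp
    _ ≤ (I.card : ℝ) := by
        exact_mod_cast Finset.card_le_card fun j hj => (Finset.mem_filter.1 hj).2
    _ = 4 := by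
        rw [Int.card_Icc, show ⌊ξ⌋ + 2 + 1 - (⌊ξ⌋ - 1) = 4 by ring]; simp

/-- The constant of the block estimate. -/
def blockC (p : ℝ) : ℝ := (4 * p / (p - 2) * 4 * (12 * chiB) ^ (p - 2)) ^ (1 / p)

theorem eLpNorm_sum_block_le {p : ℝ} (hp : 2 < p) (K : Finset ℤ) (g : ℤ → 𝓢(ℝ, ℂ)) {a : ℤ → ℝ}
    (ha0 : ∀ k, 0 ≤ a k)
    (ha : ∀ k, eLpNorm (g k) (ENNReal.ofReal p) volume ≤ ENNReal.ofReal (a k)) :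
    eLpNorm (∑ k ∈ K, mulS (chi k) (g k) : 𝓢(ℝ, ℂ)) (ENNReal.ofReal p) volume ≤
      ENNReal.ofReal (blockC p * ((∑ k ∈ K, a k) ^ (p - 2) * ∑ k ∈ K, a k ^ 2) ^ (1 / p)) := by
  have hc := one_le_chiB
  have hp0 : 0 < p := by linarith
  have hp2 : 0 < p - 2 := by linarith
  have hC : 0 ≤ 4 * p / (p - 2) * 4 * (12 * chiB) ^ (p - 2) := by positivity
  have main : ∀ δ : ℝ, 0 < δ → eLpNorm (∑ k ∈ K, mulS (chi k) (g k) : 𝓢(ℝ, ℂ)) (ENNReal.ofReal p)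
      volume ≤ ENNReal.ofReal (blockC p *
        ((∑ k ∈ K, (a k + δ)) ^ (p - 2) * ∑ k ∈ K, (a k + δ) ^ 2) ^ (1 / p)) := by
    intro δ hδ
    have h := lintegral_sum_mulS_rpow_le K hp (m := chi) (fun k => (isAmp_chi k).sym)
      (C := 3 * chiB) (M := 4) (by positivity)
      (fun k _ => integral_norm_ker_le (isAmp_chi k).sym (by linarith)
        (fun ξ hξ => (chi_ne_zero hξ).le) (isAmp_chi k).le (isAmp_chi k).deriv_le)
      (sum_norm_chi_sq_le K) g (b := fun k => a k + δ) (fun k => by have := ha0 k; positivity)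
      (fun k _ => by
        have h1 : eLpNorm (g k) (ENNReal.ofReal p) volume ≤ ENNReal.ofReal (a k + δ) :=
          (ha k).trans (ENNReal.ofReal_le_ofReal (by linarith))
        have := ha0 k
        rwa [eLpNorm_ofReal hp0, one_div, ENNReal.rpow_inv_le_iff hp0,
          ENNReal.ofReal_rpow_of_pos (by positivity)] at h1)
    rw [eLpNorm_ofReal hp0, one_div, ENNReal.rpow_inv_le_iff hp0, ENNReal.ofReal_rpow_of_nonneg _ hp0.le]
    · refine h.trans_eq ?_
      congr 1
      have hX : 0 ≤ (∑ k ∈ K, (a k + δ)) ^ (p - 2) * ∑ k ∈ K, (a k + δ) ^ 2 := by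
        have : 0 ≤ ∑ k ∈ K, (a k + δ) := Finset.sum_nonneg fun k _ => by have := ha0 k; positivity
        have : 0 ≤ ∑ k ∈ K, (a k + δ) ^ 2 := Finset.sum_nonneg fun k _ => by positivity
        positivity
      rw [show 4 * (3 * chiB) = 12 * chiB by ring, blockC, ← one_div,
        ← Real.mul_rpow (x := 4 * p / (p - 2) * 4 * (12 * chiB) ^ (p - 2)) hC hX,
        ← Real.rpow_mul (mul_nonneg hC hX), one_div_mul_cancel hp0.ne', Real.rpow_one]
    · have : 0 ≤ ∑ k ∈ K, (a k + δ) := Finset.sum_nonneg fun k _ => by have := ha0 k; positivity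
      have : 0 ≤ ∑ k ∈ K, (a k + δ) ^ 2 := Finset.sum_nonneg fun k _ => by positivity
      unfold blockC
      positivity
  have hcont : Continuous fun δ : ℝ => ENNReal.ofReal (blockC p *
      ((∑ k ∈ K, (a k + δ)) ^ (p - 2) * ∑ k ∈ K, (a k + δ) ^ 2) ^ (1 / p)) := by
    refine ENNReal.continuous_ofReal.comp (continuous_const.mul (Continuous.rpow_const ?_ fun _ =>
      Or.inr (by positivity)))
    refine Continuous.mul (Continuous.rpow_const (by fun_prop) fun _ => Or.inr hp2.le) (by fun_prop)
  have hl := (hcont.tendsto 0).comp tendsto_one_div_add_atTop_nhds_zero_nat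
  simp only [add_zero] at hl
  exact ge_of_tendsto' hl fun n => main _ (by positivity)

theorem mulS_window_chi {ρ : ℝ → ℝ} (hρ : IsCutoff ρ) (k : ℤ) (f : 𝓢(ℝ, ℂ)) :
    mulS (chi k) (mulS (fun ξ => (window ρ k ξ : ℂ)) f) = mulS (fun ξ => (window ρ k ξ : ℂ)) f := by
  rw [mulS_mulS (isAmp_chi k).sym.tg (tg_window hρ k)]
  congr 2
  funext ξ
  by_cases h : window ρ k ξ = 0
  · simp [h]
  · rw [chi_eq_one (window_ne_zero hρ h).le, one_mul]

theorem box_emb {ρ : ℝ → ℝ} (hρ : IsCutoff ρ) (k : ℤ) (f : 𝓢(ℝ, ℂ)) :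
    box ρ k (emb f) = emb (mulS (fun ξ => (window ρ k ξ : ℂ)) f) :=
  multiplier_coe (tg_window hρ k) f

/-- The sequence-space part of the embedding on one dyadic block of frequencies. -/
theorem dyadic_block_le {q s N x : ℝ} (hq : 1 ≤ q) (hq2 : q ≤ 2) (hs : 1 - 1 / q ≤ s) (hN : 0 ≤ N)
    (hx : 1 ≤ x) {K : Finset ℤ} (hcard : (K.card : ℝ) ≤ 8 * x) (hK : ∀ k ∈ K, x ≤ 1 + |(k : ℝ)|)
    {a : ℤ → ℝ} (ha : ∀ k, 0 ≤ a k)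
    (hsum : ∑ k ∈ K, ((1 + |(k : ℝ)|) ^ s * a k) ^ q ≤ N ^ q) :
    ∑ k ∈ K, a k ≤ 8 * N ∧ ∑ k ∈ K, a k ^ 2 ≤ (x ^ (-s) * N) ^ 2 := by
  have hq0 : 0 < q := by linarith
  have hx0 : 0 < x := by linarith
  have hs0 : 0 ≤ s := by
    have : 1 / q ≤ 1 := by rw [div_le_one hq0]; exact hq
    linarith
  set B := x ^ (-s) * N with hB
  have hB0 : 0 ≤ B := by positivity
  have h1 : ∑ k ∈ K, a k ^ q ≤ B ^ q := by
    have e : ∀ k ∈ K, (x ^ s) ^ q * a k ^ q ≤ ((1 + |(k : ℝ)|) ^ s * a k) ^ q := by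
      intro k hk
      rw [← Real.mul_rpow (by positivity) (ha k)]
      have := hK k hk
      have := ha k
      gcongr
    have e2 : (x ^ s) ^ q * ∑ k ∈ K, a k ^ q ≤ N ^ q := by
      rw [Finset.mul_sum]
      exact (Finset.sum_le_sum e).trans hsum
    rw [hB, Real.mul_rpow (by positivity) hN, Real.rpow_neg hx0.le, Real.inv_rpow (by positivity)]
    rw [← div_eq_inv_mul, le_div_iff₀ (by positivity), mul_comm]
    exact e2
  constructor
  · have h2 := Real.rpow_sum_le_const_mul_sum_rpow_of_nonneg K hq fun k _ => ha k
    have h3 : (∑ k ∈ K, a k) ^ q ≤ (8 * N) ^ q := by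
      calc (∑ k ∈ K, a k) ^ q ≤ (K.card : ℝ) ^ (q - 1) * ∑ k ∈ K, a k ^ q := h2
        _ ≤ (8 * x) ^ (q - 1) * B ^ q := by
            have : 0 ≤ ∑ k ∈ K, a k ^ q := Finset.sum_nonneg fun k _ => Real.rpow_nonneg (ha k) _
            have : 0 ≤ q - 1 := by linarith
            gcongr
        _ = 8 ^ (q - 1) * x ^ (q - 1 - s * q) * N ^ q := by
            rw [hB, Real.mul_rpow (by norm_num) hx0.le, Real.mul_rpow (by positivity) hN,
              ← Real.rpow_mul hx0.le, sub_eq_add_neg (q - 1), Real.rpow_add hx0, neg_mul]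
            ring
        _ ≤ 8 ^ q * 1 * N ^ q := by
            have e1 : (8 : ℝ) ^ (q - 1) ≤ 8 ^ q :=
              Real.rpow_le_rpow_of_exponent_le (by norm_num) (by linarith)
            have e2 : x ^ (q - 1 - s * q) ≤ 1 := by
              refine Real.rpow_le_one_of_one_le_of_nonpos hx ?_
              have := mul_le_mul_of_nonneg_right hs hq0.le
              rw [sub_mul, one_mul, one_div_mul_cancel hq0.ne'] at this
              linarith
            gcongr
        _ = (8 * N) ^ q := by rw [Real.mul_rpow (by norm_num) hN, mul_one]
    exact (Real.rpow_le_rpow_iff (Finset.sum_nonneg fun k _ => ha k) (by positivity) hq0).1 h3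
  · have h2 : ∀ k ∈ K, a k ≤ B := by
      intro k hk
      refine (Real.rpow_le_rpow_iff (ha k) hB0 hq0).1 (le_trans ?_ h1)
      exact Finset.single_le_sum (f := fun k => a k ^ q) (fun k _ => Real.rpow_nonneg (ha k) _) hk
    rcases hB0.eq_or_lt with h0 | h0
    · have : ∀ k ∈ K, a k ^ 2 = 0 := by
        intro k hk
        have : a k = 0 := le_antisymm (h0 ▸ h2 k hk) (ha k)
        rw [this]; norm_num
      rw [Finset.sum_congr rfl this]
      simp
      positivity
    · calc ∑ k ∈ K, a k ^ 2 ≤ ∑ k ∈ K, B ^ (2 - q) * a k ^ q := by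
            refine Finset.sum_le_sum fun k hk => ?_
            rcases (ha k).eq_or_lt with hz | hz
            · rw [← hz, Real.zero_rpow hq0.ne']; norm_num
            · have : a k ^ 2 = a k ^ (2 - q) * a k ^ q := by
                rw [← Real.rpow_add hz, sub_add_cancel]; norm_num
              rw [this]
              have := h2 k hk
              have : 0 ≤ 2 - q := by linarith
              gcongr
        _ = B ^ (2 - q) * ∑ k ∈ K, a k ^ q := by rw [Finset.mul_sum]
        _ ≤ B ^ (2 - q) * B ^ q := by gcongr
        _ = B ^ 2 := by rw [← Real.rpow_add h0, sub_add_cancel]; norm_num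

theorem exists_eLpNorm_le_modNorm {ρ : ℝ → ℝ} (hρ : IsCutoff ρ) {q s p : ℝ} (hq : 1 ≤ q)
    (hs : 1 - 1 / q ≤ s) (hs' : s < 1 / q) (hp : 2 < p) :
    ∃ C : ℝ, 0 < C ∧ ∀ f : 𝓢(ℝ, ℂ), IsBL ρ f →
      eLpNorm f (ENNReal.ofReal p) volume ≤
        ENNReal.ofReal C * modNorm ρ s (ENNReal.ofReal p) q (emb f) := by
  classical
  have hq0 : 0 < q := by linarith
  have hp0 : 0 < p := by linarith
  have hp2 : 0 < p - 2 := by linarith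
  have hp1 : (1 : ℝ≥0∞) ≤ ENNReal.ofReal p := by
    rw [ENNReal.one_le_ofReal]; linarith
  have hs0 : 0 ≤ s := by
    have : 1 / q ≤ 1 := by rw [div_le_one hq0]; exact hq
    linarith
  have hq2 : q ≤ 2 := by
    have : 1 / 2 < 1 / q := by linarith
    rw [div_lt_div_iff_of_pos_left one_pos (by norm_num) hq0] at this
    linarith
  rcases hs0.eq_or_lt with h0 | h0
  · -- here `q = 1` and the triangle inequality suffices
    have hq1 : q = 1 := by
      have : 1 ≤ 1 / q := by linarith
      rw [le_div_iff₀ hq0] at this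
      linarith
    refine ⟨1, one_pos, ?_⟩
    rintro f ⟨K, hK⟩
    have hf := hK K subset_rfl
    rw [← lpNorm_emb, ENNReal.ofReal_one, one_mul]
    calc lpNorm (ENNReal.ofReal p) (emb f)
        = lpNorm (ENNReal.ofReal p) (∑ k ∈ K, box ρ k (emb f)) := by
          conv_lhs => rw [hf, map_sum]
          simp_rw [box_emb hρ]
      _ ≤ ∑ k ∈ K, lpNorm (ENNReal.ofReal p) (box ρ k (emb f)) := lpNorm_sum_le hp1 _ _
      _ ≤ ∑' k, lpNorm (ENNReal.ofReal p) (box ρ k (emb f)) := ENNReal.sum_le_tsum _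
      _ = _ := by
          rw [modNorm_eq hq, ← h0, hq1, lq]
          simp
  · set R : ℝ := 2 ^ (-(2 * s / p)) with hR
    have hR0 : 0 < R := by positivity
    have hR1 : R < 1 := Real.rpow_lt_one_of_one_lt_of_neg (by norm_num) (by
      have : 0 < 2 * s / p := by positivity
      linarith)
    have hc := one_le_chiB
    have hbC : 0 < blockC p := by unfold blockC; positivity
    refine ⟨blockC p * 8 * (1 - R)⁻¹, by
      have : 0 < 1 - R := by linarith
      positivity, ?_⟩
    rintro f ⟨K, hK⟩
    have hf := hK K subset_rfl
    set Q := modNorm ρ s (ENNReal.ofReal p) q (emb f) with hQ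
    by_cases htop : Q = ⊤
    · rw [htop, ENNReal.mul_top]
      · exact le_top
      · have : 0 < 1 - R := by linarith
        have : 0 < blockC p * 8 * (1 - R)⁻¹ := by positivity
        simpa using this
    set N := Q.toReal with hN
    have hN0 : 0 ≤ N := ENNReal.toReal_nonneg
    set g : ℤ → 𝓢(ℝ, ℂ) := fun k => mulS (fun ξ => (window ρ k ξ : ℂ)) f with hg
    set a : ℤ → ℝ := fun k => (eLpNorm (g k) (ENNReal.ofReal p) volume).toReal with ha
    have ha0 : ∀ k, 0 ≤ a k := fun k => ENNReal.toReal_nonneg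
    have haE : ∀ k, ENNReal.ofReal (a k) = eLpNorm (g k) (ENNReal.ofReal p) volume := fun k =>
      ENNReal.ofReal_toReal (eLpNorm_schwartz_ne_top _ _)
    have hsumAll : ∀ K' : Finset ℤ, ∑ k ∈ K', ((1 + |(k : ℝ)|) ^ s * a k) ^ q ≤ N ^ q := by
      intro K'
      have h1 : ∑ k ∈ K', (wt k ^ s * lpNorm (ENNReal.ofReal p) (box ρ k (emb f))) ^ q ≤ Q ^ q := by
        refine (ENNReal.sum_le_tsum K').trans ?_
        rw [hQ, modNorm_eq hq, lq, ← ENNReal.rpow_mul, one_div_mul_cancel hq0.ne', ENNReal.rpow_one]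
      have h2 : ∀ k, (wt k ^ s * lpNorm (ENNReal.ofReal p) (box ρ k (emb f))) ^ q =
          ENNReal.ofReal (((1 + |(k : ℝ)|) ^ s * a k) ^ q) := by
        intro k
        have := ha0 k
        rw [box_emb hρ, lpNorm_emb, ← haE, wt, ENNReal.ofReal_rpow_of_pos (by positivity),
          ← ENNReal.ofReal_mul (by positivity), ENNReal.ofReal_rpow_of_nonneg (by positivity) hq0.le]
      simp_rw [h2] at h1
      rw [← ENNReal.ofReal_sum_of_nonneg fun k _ => by have := ha0 k; positivity,
        ← ENNReal.ofReal_toReal htop, ENNReal.ofReal_rpow_of_nonneg hN0 hq0.le,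
        ENNReal.ofReal_le_ofReal_iff (by positivity)] at h1
      exact h1
    set J : ℤ → ℕ := fun k => Nat.log 2 (1 + k.natAbs) with hJ
    have hblock : ∀ j : ℕ, eLpNorm (∑ k ∈ K with J k = j, mulS (chi k) (g k) : 𝓢(ℝ, ℂ))
        (ENNReal.ofReal p) volume ≤ ENNReal.ofReal (blockC p * 8 * N * R ^ j) := by
      intro j
      have hlow : ∀ k ∈ K.filter (fun k => J k = j), (2 : ℝ) ^ j ≤ 1 + |(k : ℝ)| := by
        intro k hk
        have h1 := Nat.pow_log_le_self 2 (x := 1 + k.natAbs) (by omega)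
        have hkj : Nat.log 2 (1 + k.natAbs) = j := (Finset.mem_filter.1 hk).2
        rw [hkj] at h1
        have h2 : ((2 ^ j : ℕ) : ℝ) ≤ ((1 + k.natAbs : ℕ) : ℝ) := by exact_mod_cast h1
        push_cast at h2
        rwa [Nat.cast_natAbs, Int.cast_abs] at h2
      have hcard : ((K.filter (fun k => J k = j)).card : ℝ) ≤ 8 * 2 ^ j := by
        have hsub : K.filter (fun k => J k = j) ⊆ Finset.Icc (-(2 ^ (j + 1) : ℤ)) (2 ^ (j + 1)) := by
          intro k hk
          have h1 := Nat.lt_pow_succ_log_self (b := 2) (by norm_num) (1 + k.natAbs)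
          have hkj : Nat.log 2 (1 + k.natAbs) = j := (Finset.mem_filter.1 hk).2
          rw [hkj] at h1
          have h2 : ((1 + k.natAbs : ℕ) : ℤ) < ((2 ^ j.succ : ℕ) : ℤ) := by exact_mod_cast h1
          push_cast at h2
          rw [Nat.succ_eq_add_one] at h2
          rw [Finset.mem_Icc, ← abs_le]
          omega
        have h3 := Finset.card_le_card hsub
        rw [Int.card_Icc] at h3
        have h4 : ((2 : ℤ) ^ (j + 1) + 1 - -(2 : ℤ) ^ (j + 1)).toNat ≤ 8 * 2 ^ j := by
          rw [pow_succ]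
          have : (1 : ℤ) ≤ 2 ^ j := one_le_pow₀ (by norm_num)
          have e : ((2 ^ j : ℕ) : ℤ) = 2 ^ j := by push_cast; rfl
          omega
        exact_mod_cast h3.trans h4
      obtain ⟨b1, b2⟩ := dyadic_block_le hq hq2 hs hN0 (one_le_pow₀ (by norm_num)) hcard hlow ha0
        (hsumAll _)
      refine (eLpNorm_sum_block_le hp _ g ha0 fun k => (haE k).ge).trans ?_
      refine ENNReal.ofReal_le_ofReal ?_
      have hS0 : 0 ≤ ∑ k ∈ K with J k = j, a k := Finset.sum_nonneg fun k _ => ha0 k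
      have hS2 : 0 ≤ ∑ k ∈ K with J k = j, a k ^ 2 := Finset.sum_nonneg fun k _ => by positivity
      set x : ℝ := 2 ^ j with hx
      have hx0 : 0 < x := by positivity
      calc blockC p * ((∑ k ∈ K with J k = j, a k) ^ (p - 2) * ∑ k ∈ K with J k = j, a k ^ 2) ^ (1 / p)
          ≤ blockC p * ((8 * N) ^ (p - 2) * (x ^ (-s) * N) ^ 2) ^ (1 / p) := by gcongr
        _ ≤ blockC p * ((8 * N) ^ (p - 2) * (x ^ (-s) * (8 * N)) ^ 2) ^ (1 / p) := by
            gcongr; linarith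
        _ = blockC p * (8 * N * R ^ j) := by
            congr 1
            rcases hN0.eq_or_lt with hz | hz
            · rw [← hz]
              simp [hp2.ne', hp0.ne']
            · have e1 : (8 * N) ^ (p - 2) * (x ^ (-s) * (8 * N)) ^ 2 = (8 * N) ^ p * x ^ (-(2 * s)) := by
                rw [mul_pow, ← Real.rpow_natCast (x ^ (-s)), ← Real.rpow_mul hx0.le,
                  Real.rpow_sub (by positivity)]
                have : (8 * N) ^ (2 : ℝ) = (8 * N) ^ 2 := by norm_num
                rw [this]
                have e3 : -s * ((2 : ℕ) : ℝ) = -(2 * s) := by push_cast; ring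
                rw [e3]
                field_simp
              rw [e1, Real.mul_rpow (by positivity) (by positivity), ← Real.rpow_mul (by positivity),
                mul_one_div_cancel hp0.ne', Real.rpow_one, ← Real.rpow_mul hx0.le, hR,
                ← Real.rpow_natCast, ← Real.rpow_mul (by norm_num), hx, ← Real.rpow_natCast,
                ← Real.rpow_mul (by norm_num)]
              congr 2
              ring
        _ = _ := by ring
    have hdecomp : emb f = ∑ j ∈ K.image J, emb (∑ k ∈ K with J k = j, mulS (chi k) (g k)) := by
      rw [← map_sum, Finset.sum_fiberwise_of_maps_to fun k hk => Finset.mem_image_of_mem J hk]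
      congr 1
      conv_lhs => rw [hf]
      refine Finset.sum_congr rfl fun k _ => ?_
      rw [hg, mulS_window_chi hρ]
    rw [← lpNorm_emb, hdecomp]
    refine (lpNorm_sum_le hp1 _ _).trans ?_
    calc ∑ j ∈ K.image J, lpNorm (ENNReal.ofReal p) (emb (∑ k ∈ K with J k = j, mulS (chi k) (g k)))
        ≤ ∑ j ∈ K.image J, ENNReal.ofReal (blockC p * 8 * N * R ^ j) := by
          refine Finset.sum_le_sum fun j _ => ?_
          rw [lpNorm_emb]
          exact hblock j
      _ = ENNReal.ofReal (∑ j ∈ K.image J, blockC p * 8 * N * R ^ j) :=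
          (ENNReal.ofReal_sum_of_nonneg fun j _ => by positivity).symm
      _ ≤ ENNReal.ofReal (blockC p * 8 * N * (1 - R)⁻¹) := by
          refine ENNReal.ofReal_le_ofReal ?_
          rw [← Finset.mul_sum, ← tsum_geometric_of_lt_one hR0.le hR1]
          have := (summable_geometric_of_lt_one hR0.le hR1).sum_le_tsum (K.image J)
            fun j _ => by positivity
          gcongr
      _ = _ := by
          rw [show blockC p * 8 * N * (1 - R)⁻¹ = blockC p * 8 * (1 - R)⁻¹ * N by ring,
            ENNReal.ofReal_mul (by have : 0 < 1 - R := by linarith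
                                   positivity), hN, ENNReal.ofReal_toReal htop]

theorem eq_of_tendsto_lpNorm {p : ℝ≥0∞} (hp : 1 ≤ p) {T : ℕ → 𝓢'(ℝ, ℂ)} {U V : 𝓢'(ℝ, ℂ)}
    (hU : Tendsto (fun n => lpNorm p (T n - U)) atTop (𝓝 0))
    (hV : Tendsto (fun n => lpNorm p (T n - V)) atTop (𝓝 0)) : U = V := by
  have h : lpNorm p (U - V) = 0 := by
    refine le_antisymm (ge_of_tendsto' (by simpa using hU.add hV) fun n => ?_) zero_le
    rw [lpNorm_sub_comm p (T n) U]
    refine le_trans (le_of_eq ?_) (lpNorm_add_le hp _ _)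
    rw [sub_add_sub_cancel]
  exact sub_eq_zero.1 (lpNorm_eq_zero (by positivity) h)

section
variable {ρ : ℝ → ℝ} {q s p : ℝ}

theorem tendsto_box_of_modNorm {p : ℝ≥0∞} (hq : 1 ≤ q) {T : ℕ → 𝓢'(ℝ, ℂ)} {U : 𝓢'(ℝ, ℂ)}
    (h : Tendsto (fun n => modNorm ρ s p q (T n - U)) atTop (𝓝 0)) (k : ℤ) :
    Tendsto (fun n => lpNorm p (box ρ k (T n) - box ρ k U)) atTop (𝓝 0) := by
  have h1 := ENNReal.Tendsto.const_mul h (Or.inr (wt_rpow_ne_top k (-s)))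
  rw [mul_zero] at h1
  refine tendsto_of_tendsto_of_tendsto_of_le_of_le tendsto_const_nhds h1 (fun _ => zero_le)
    fun n => ?_
  rw [← map_sub]
  exact lpNorm_box_le_modNorm hq k _

theorem exists_lpNorm_le_modNorm (hρ : IsCutoff ρ) (hq : 1 ≤ q) (hs : 1 - 1 / q ≤ s)
    (hs' : s < 1 / q) (hp : 2 < p) : ∃ C : ℝ, 0 < C ∧ ∀ T : 𝓢'(ℝ, ℂ),
      modNorm ρ s (ENNReal.ofReal p) q T ≠ ⊤ →
      lpNorm (ENNReal.ofReal p) T ≤ ENNReal.ofReal C * modNorm ρ s (ENNReal.ofReal p) q T := by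
  obtain ⟨C, hC, hb⟩ := exists_eLpNorm_le_modNorm hρ hq hs hs' hp
  have hp1 : (1 : ℝ≥0∞) ≤ ENNReal.ofReal p := by
    rw [← ENNReal.ofReal_one]; exact ENNReal.ofReal_le_ofReal (by linarith)
  refine ⟨C, hC, fun T hT => ?_⟩
  have hex : ∀ n : ℕ, ∃ f : 𝓢(ℝ, ℂ), IsBL ρ f ∧
      modNorm ρ s (ENNReal.ofReal p) q (emb f - T) < ((n : ℝ≥0∞) + 1)⁻¹ := fun n =>
    exists_isBL_near hρ hq hp1 ENNReal.ofReal_ne_top hT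
      (ENNReal.inv_pos.2 (by finiteness)) (ENNReal.inv_ne_top.2 (by positivity))
  choose f hf hfT using hex
  have hlim0 : Tendsto (fun n : ℕ => ((n : ℝ≥0∞) + 1)⁻¹) atTop (𝓝 0) := by
    have := (tendsto_add_atTop_iff_nat 1).2 ENNReal.tendsto_inv_nat_nhds_zero
    simpa using this
  have hlim : Tendsto (fun n => modNorm ρ s (ENNReal.ofReal p) q (emb (f n) - T)) atTop (𝓝 0) :=
    tendsto_of_tendsto_of_tendsto_of_le_of_le tendsto_const_nhds hlim0 (fun _ => zero_le)
      fun n => (hfT n).le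
  have hCt : ENNReal.ofReal C ≠ 0 := by simpa using hC
  obtain ⟨U, -, hU⟩ := exists_tendsto_of_cauchy hp1 (T := fun n => emb (f n))
    (fun n => by rw [lpNorm_emb]; exact eLpNorm_schwartz_ne_top _ _) (by
      intro ε hε
      have h1 := (ENNReal.Tendsto.const_mul hlim (Or.inr (ENNReal.ofReal_ne_top (r := C))))
      rw [mul_zero] at h1
      obtain ⟨N, hN⟩ := eventually_atTop.1 (h1.eventually_lt_const (ENNReal.half_pos hε.ne'))
      refine ⟨N, fun m hm n hn => ?_⟩
      rw [← map_sub, lpNorm_emb]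
      refine (hb _ ((hf m).sub (hf n))).trans_lt ?_
      have h2 : modNorm ρ s (ENNReal.ofReal p) q (emb (f m - f n)) ≤
          modNorm ρ s (ENNReal.ofReal p) q (emb (f m) - T) +
          modNorm ρ s (ENNReal.ofReal p) q (emb (f n) - T) := by
        rw [map_sub, ← sub_sub_sub_cancel_right _ _ T]
        exact modNorm_sub_le hq hp1 _ _
      calc _ ≤ ENNReal.ofReal C * (_ + _) := by gcongr
        _ = _ := mul_add _ _ _
        _ < ε / 2 + ε / 2 := ENNReal.add_lt_add (hN m hm) (hN n hn)
        _ = ε := ENNReal.add_halves ε)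
  have hUT : U = T := by
    refine sub_eq_zero.1 (eq_zero_of_box hρ fun k => ?_)
    rw [map_sub, sub_eq_zero]
    exact eq_of_tendsto_lpNorm hp1 (tendsto_box hρ hp1 ENNReal.ofReal_ne_top hU k)
      (tendsto_box_of_modNorm hq hlim k)
  subst hUT
  have h1 := tendsto_lpNorm hp1 hU
  have h2 : Tendsto (fun n : ℕ => ENNReal.ofReal C * (modNorm ρ s (ENNReal.ofReal p) q U +
      modNorm ρ s (ENNReal.ofReal p) q (emb (f n) - U))) atTop
      (𝓝 (ENNReal.ofReal C * (modNorm ρ s (ENNReal.ofReal p) q U + 0))) :=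
    ENNReal.Tendsto.const_mul (tendsto_const_nhds.add hlim) (Or.inr ENNReal.ofReal_ne_top)
  rw [add_zero] at h2
  refine le_of_tendsto_of_tendsto' h1 h2 fun n => ?_
  rw [lpNorm_emb]
  refine (hb _ (hf n)).trans ?_
  gcongr
  conv_lhs => rw [← add_sub_cancel U (emb (f n))]
  exact modNorm_add_le hq hp1 _ _

theorem exists_tendsto_of_modNorm_cauchy (hρ : IsCutoff ρ) (hq : 1 ≤ q) (hs : 1 - 1 / q ≤ s)
    (hs' : s < 1 / q) (hp : 2 < p) {T : ℕ → 𝓢'(ℝ, ℂ)}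
    (hT : ∀ n, modNorm ρ s (ENNReal.ofReal p) q (T n) ≠ ⊤)
    (hc : ∀ ε > 0, ∃ N, ∀ m ≥ N, ∀ n ≥ N, modNorm ρ s (ENNReal.ofReal p) q (T m - T n) < ε) :
    ∃ U, modNorm ρ s (ENNReal.ofReal p) q U ≠ ⊤ ∧
      Tendsto (fun n => modNorm ρ s (ENNReal.ofReal p) q (T n - U)) atTop (𝓝 0) := by
  obtain ⟨C, hC, hb⟩ := exists_lpNorm_le_modNorm hρ hq hs hs' hp
  have hp1 : (1 : ℝ≥0∞) ≤ ENNReal.ofReal p := by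
    rw [← ENNReal.ofReal_one]; exact ENNReal.ofReal_le_ofReal (by linarith)
  have hsub : ∀ m n, modNorm ρ s (ENNReal.ofReal p) q (T m - T n) ≠ ⊤ := fun m n =>
    ne_top_of_le_ne_top (ENNReal.add_ne_top.2 ⟨hT m, hT n⟩) (modNorm_sub_le hq hp1 _ _)
  obtain ⟨U, -, hU⟩ := exists_tendsto_of_cauchy hp1 (T := T)
    (fun n => ne_top_of_le_ne_top (ENNReal.mul_ne_top ENNReal.ofReal_ne_top (hT n)) (hb _ (hT n)))
    (by
      intro ε hε
      obtain ⟨N, hN⟩ := hc (ε / ENNReal.ofReal C) (ENNReal.div_pos hε.ne' ENNReal.ofReal_ne_top)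
      refine ⟨N, fun m hm n hn => (hb _ (hsub m n)).trans_lt ?_⟩
      have hC0 : ENNReal.ofReal C ≠ 0 := by simpa using hC
      rw [mul_comm]
      exact (ENNReal.lt_div_iff_mul_lt (Or.inl hC0) (Or.inl ENNReal.ofReal_ne_top)).1
        (hN m hm n hn))
  have hlim : ∀ ε > 0, ∃ N, ∀ m ≥ N, modNorm ρ s (ENNReal.ofReal p) q (T m - U) ≤ ε := by
    intro ε hε
    obtain ⟨N, hN⟩ := hc ε hε
    refine ⟨N, fun m hm => modNorm_le_of_tendsto hq hp1 (T := fun n => T m - T n) (fun k => ?_)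
      (eventually_atTop.2 ⟨N, fun n hn => (hN m hm n hn).le⟩)⟩
    have h1 := tendsto_box hρ hp1 ENNReal.ofReal_ne_top hU k
    refine h1.congr fun n => ?_
    rw [map_sub, map_sub, sub_sub_sub_cancel_left, lpNorm_sub_comm]
  refine ⟨U, ?_, ENNReal.tendsto_atTop_zero.2 hlim⟩
  obtain ⟨N, hN⟩ := hlim 1 one_pos
  rw [← sub_sub_cancel (T N) U]
  exact ne_top_of_le_ne_top (ENNReal.add_ne_top.2 ⟨hT N, ne_top_of_le_ne_top ENNReal.one_ne_top
    (hN N le_rfl)⟩) (modNorm_sub_le hq hp1 _ _)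

end

/-- The data which determine the modulation space of the theorem. -/
structure Par where
  lam : ℕ
  q : ℝ
  s : ℝ
  ρ : ℝ → ℝ
  hlam : 1 ≤ lam
  hρ : IsCutoff ρ
  hq : 1 ≤ q
  hs : 1 - 1 / q ≤ s
  hs' : s < 1 / q

namespace Par
variable (P : Par)

/-- The integrability exponent in space. -/
def p : ℝ := P.lam + 2

/-- The norm of the modulation space. -/
def N (T : 𝓢'(ℝ, ℂ)) : ℝ≥0∞ := modNorm P.ρ P.s (ENNReal.ofReal P.p) P.q T

theorem one_le_lam : (1 : ℝ) ≤ P.lam := by exact_mod_cast P.hlam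

theorem two_lt_p : 2 < P.p := by
  have := P.one_le_lam
  unfold p
  linarith

theorem ofReal_p : ENNReal.ofReal P.p = (P.lam : ℝ≥0∞) + 2 := by
  rw [p, ENNReal.ofReal_add (by positivity) (by norm_num), ENNReal.ofReal_natCast,
    ENNReal.ofReal_ofNat]

theorem one_le_ofReal_p : 1 ≤ ENNReal.ofReal P.p := by
  rw [← ENNReal.ofReal_one]
  exact ENNReal.ofReal_le_ofReal (by have := P.two_lt_p; linarith)

theorem N_zero : P.N 0 = 0 := modNorm_zero P.hq

theorem N_add_le (T U : 𝓢'(ℝ, ℂ)) : P.N (T + U) ≤ P.N T + P.N U :=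
  modNorm_add_le P.hq P.one_le_ofReal_p T U

theorem N_sub_le (T U : 𝓢'(ℝ, ℂ)) : P.N (T - U) ≤ P.N T + P.N U :=
  modNorm_sub_le P.hq P.one_le_ofReal_p T U

theorem N_smul (c : ℂ) (T : 𝓢'(ℝ, ℂ)) : P.N (c • T) = ‖c‖ₑ * P.N T := by
  rcases eq_or_ne c 0 with rfl | hc
  · rw [zero_smul ℂ T, P.N_zero, enorm_zero, zero_mul]
  · exact modNorm_smul P.hq hc T

/-- The modulation space, as a subspace of the tempered distributions. -/
def sub : Submodule ℂ 𝓢'(ℝ, ℂ) where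
  carrier := {T | P.N T ≠ ⊤}
  zero_mem' := by
    change P.N 0 ≠ ⊤
    rw [P.N_zero]; exact ENNReal.zero_ne_top
  add_mem' {T U} hT hU := ne_top_of_le_ne_top (ENNReal.add_ne_top.2 ⟨hT, hU⟩) (P.N_add_le T U)
  smul_mem' c T hT := by
    change P.N (c • T) ≠ ⊤
    rw [P.N_smul]
    exact ENNReal.mul_ne_top enorm_ne_top hT

/-- The modulation space `M^s_{p,q}` as a normed space. -/
def Space : Type := P.sub

instance : AddCommGroup P.Space := inferInstanceAs (AddCommGroup P.sub)
instance : Module ℂ P.Space := inferInstanceAs (Module ℂ P.sub)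
instance : Norm P.Space := ⟨fun x => (P.N x.1).toReal⟩

variable {P}

/-- The inclusion in the tempered distributions. -/
def Space.val : P.Space →ₗ[ℂ] 𝓢'(ℝ, ℂ) := P.sub.subtype

theorem Space.N_ne_top (x : P.Space) : P.N x.val ≠ ⊤ := x.2

/-- The element of the space given by a distribution of finite norm. -/
def ofN (T : 𝓢'(ℝ, ℂ)) (h : P.N T ≠ ⊤) : P.Space := ⟨T, h⟩

@[simp] theorem val_ofN (T : 𝓢'(ℝ, ℂ)) (h : P.N T ≠ ⊤) : (ofN T h).val = T := rfl

theorem Space.val_injective : Function.Injective (Space.val : P.Space → 𝓢'(ℝ, ℂ)) :=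
  Subtype.val_injective

theorem norm_def (x : P.Space) : ‖x‖ = (P.N x.val).toReal := rfl

theorem core : NormedSpace.Core ℂ P.Space where
  norm_nonneg x := ENNReal.toReal_nonneg
  norm_smul c x := by
    rw [norm_def, norm_def, map_smul, P.N_smul, ENNReal.toReal_mul, toReal_enorm]
  norm_triangle x y := by
    rw [norm_def, norm_def, norm_def, map_add, ← ENNReal.toReal_add x.N_ne_top y.N_ne_top]
    exact ENNReal.toReal_mono (ENNReal.add_ne_top.2 ⟨x.N_ne_top, y.N_ne_top⟩) (P.N_add_le _ _)
  norm_eq_zero_iff x := by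
    constructor
    · intro h
      rw [norm_def, ENNReal.toReal_eq_zero_iff] at h
      have h1 := h.resolve_right x.N_ne_top
      exact Space.val_injective ((eq_zero_of_modNorm P.hρ P.hq P.one_le_ofReal_p h1).trans
        (map_zero _).symm)
    · rintro rfl
      rw [norm_def, map_zero, P.N_zero, ENNReal.toReal_zero]

instance : NormedAddCommGroup P.Space := NormedAddCommGroup.ofCore core
instance : NormedSpace ℂ P.Space := NormedSpace.ofCore core

theorem enorm_eq (x : P.Space) : ‖x‖ₑ = P.N x.val := by
  rw [← ofReal_norm, norm_def, ENNReal.ofReal_toReal x.N_ne_top]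

instance : CompleteSpace P.Space := by
  refine Metric.complete_of_cauchySeq_tendsto fun u hu => ?_
  have hN : ∀ x y : P.Space, P.N (x.val - y.val) = ENNReal.ofReal (dist x y) := fun x y => by
    rw [dist_eq_norm, ofReal_norm, enorm_eq, map_sub]
  obtain ⟨U, hU, hl⟩ := exists_tendsto_of_modNorm_cauchy P.hρ P.hq P.hs P.hs' P.two_lt_p
    (T := fun n => (u n).val) (fun n => (u n).N_ne_top) (by
      intro ε hε
      rcases eq_or_ne ε ⊤ with rfl | hεt
      · exact ⟨0, fun m _ n _ => lt_of_le_of_lt (P.N_sub_le _ _)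
          (ENNReal.add_lt_top.2 ⟨(u m).N_ne_top.lt_top, (u n).N_ne_top.lt_top⟩)⟩
      obtain ⟨M, hM⟩ := Metric.cauchySeq_iff.1 hu ε.toReal (ENNReal.toReal_pos hε.ne' hεt)
      refine ⟨M, fun m hm n hn => ?_⟩
      change P.N _ < ε
      rw [hN, ENNReal.ofReal_lt_iff_lt_toReal dist_nonneg hεt]
      exact hM m hm n hn)
  refine ⟨ofN U hU, ?_⟩
  rw [tendsto_iff_dist_tendsto_zero]
  have h1 : ∀ n, dist (u n) (ofN U hU) = (P.N ((u n).val - U)).toReal := fun n => by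
    rw [dist_eq_norm, norm_def, map_sub]
    rfl
  simp only [h1]
  have := (ENNReal.tendsto_toReal ENNReal.zero_ne_top).comp hl
  rwa [ENNReal.toReal_zero] at this

variable (P) in
theorem exists_lpNorm_le : ∃ C : ℝ, 0 < C ∧ ∀ T : 𝓢'(ℝ, ℂ), P.N T ≠ ⊤ →
    lpNorm (ENNReal.ofReal P.p) T ≤ ENNReal.ofReal C * P.N T :=
  exists_lpNorm_le_modNorm P.hρ P.hq P.hs P.hs' P.two_lt_p

theorem Space.lpNorm_ne_top (x : P.Space) : lpNorm (ENNReal.ofReal P.p) x.val ≠ ⊤ := by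
  obtain ⟨C, -, hC⟩ := P.exists_lpNorm_le
  exact ne_top_of_le_ne_top (ENNReal.mul_ne_top ENNReal.ofReal_ne_top x.N_ne_top)
    (hC _ x.N_ne_top)

/-- Evaluation at a Schwartz function is a bounded functional. -/
theorem exists_eval_le (f : 𝓢(ℝ, ℂ)) : ∃ C : ℝ, ∀ x : P.Space, ‖x.val f‖ ≤ C * ‖x‖ := by
  obtain ⟨C, hC0, hC⟩ := P.exists_lpNorm_le
  refine ⟨(eLpNorm f (ENNReal.conjExponent (ENNReal.ofReal P.p)) volume * ENNReal.ofReal C).toReal,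
    fun x => ?_⟩
  have h1 := (enorm_apply_le P.one_le_ofReal_p f x.val x.lpNorm_ne_top).trans
    (mul_le_mul_right (hC _ x.N_ne_top) _)
  rw [← mul_assoc] at h1
  have h2 := ENNReal.toReal_mono (ENNReal.mul_ne_top (ENNReal.mul_ne_top
    (eLpNorm_schwartz_ne_top _ _) ENNReal.ofReal_ne_top) x.N_ne_top) h1
  rwa [toReal_enorm, ENNReal.toReal_mul, ← norm_def] at h2

variable (P) in
/-- Evaluation at a Schwartz function. -/
def eval (f : 𝓢(ℝ, ℂ)) : P.Space →L[ℂ] ℂ :=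
  LinearMap.mkContinuous
    { toFun := fun x => x.val f
      map_add' := fun x y => by rw [map_add]; rfl
      map_smul' := fun c x => by rw [map_smul]; rfl }
    (exists_eval_le f).choose (exists_eval_le f).choose_spec

@[simp] theorem eval_apply (f : 𝓢(ℝ, ℂ)) (x : P.Space) : P.eval f x = x.val f := rfl

theorem ext_eval {x y : P.Space} (h : ∀ f, P.eval f x = P.eval f y) : x = y :=
  Space.val_injective (by ext f; exact h f)

theorem N_S_le (t : ℝ) (T : 𝓢'(ℝ, ℂ)) :
    P.N (GBBM.S t T) ≤ ENNReal.ofReal (6 * chiB * (1 + |t|)) * P.N T :=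
  modNorm_S_le P.hρ P.hq P.one_le_ofReal_p ENNReal.ofReal_ne_top t T

variable (P) in
/-- The group on the modulation space. -/
def grp (t : ℝ) : P.Space →L[ℂ] P.Space :=
  LinearMap.mkContinuous
    { toFun := fun x => ofN (GBBM.S t x.val)
        (ne_top_of_le_ne_top (ENNReal.mul_ne_top ENNReal.ofReal_ne_top x.N_ne_top) (N_S_le t x.val))
      map_add' := fun x y => Space.val_injective (by simp)
      map_smul' := fun c x => Space.val_injective (by simp) }
    (6 * chiB * (1 + |t|)) fun x => by
      have h0 : 0 ≤ 6 * chiB * (1 + |t|) := by have := one_le_chiB; positivity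
      have h2 := ENNReal.toReal_mono (ENNReal.mul_ne_top ENNReal.ofReal_ne_top x.N_ne_top)
        (N_S_le t x.val)
      rwa [ENNReal.toReal_mul, ENNReal.toReal_ofReal h0, ← norm_def] at h2

@[simp] theorem val_grp (t : ℝ) (x : P.Space) : (P.grp t x).val = GBBM.S t x.val := rfl

theorem norm_grp_le (t : ℝ) (x : P.Space) : ‖P.grp t x‖ ≤ 6 * chiB * (1 + |t|) * ‖x‖ :=
  ContinuousLinearMap.le_of_opNorm_le _
    (LinearMap.mkContinuous_norm_le _ (by have := one_le_chiB; positivity) _) x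

theorem norm_grp_sub_le (t : ℝ) (x : P.Space) : ‖P.grp t x - x‖ ≤ 6 * chiB * |t| * ‖x‖ := by
  have h0 : 0 ≤ 6 * chiB * |t| := by have := one_le_chiB; positivity
  have h2 := ENNReal.toReal_mono (ENNReal.mul_ne_top ENNReal.ofReal_ne_top x.N_ne_top)
    (modNorm_S_sub_le P.hρ P.hq P.one_le_ofReal_p ENNReal.ofReal_ne_top t x.val)
  rw [ENNReal.toReal_mul, ENNReal.toReal_ofReal h0] at h2
  rw [norm_def, norm_def, map_sub, val_grp]
  exact h2

theorem grp_zero (x : P.Space) : P.grp 0 x = x := Space.val_injective (S_zero _)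

theorem grp_grp (t u : ℝ) (x : P.Space) : P.grp t (P.grp u x) = P.grp (t + u) x :=
  Space.val_injective (S_S _ _ _)

end Par

/-- The pointwise product of Schwartz functions. -/
def mulSS (f g : 𝓢(ℝ, ℂ)) : 𝓢(ℝ, ℂ) := SchwartzMap.pairing (ContinuousLinearMap.mul ℂ ℂ) f g

@[simp] theorem mulSS_apply (f g : 𝓢(ℝ, ℂ)) (x : ℝ) : mulSS f g x = f x * g x := rfl

theorem fourier_mulSS (f g : 𝓢(ℝ, ℂ)) (ξ : ℝ) : 𝓕 (mulSS f g) ξ = ∫ t, 𝓕 f t * 𝓕 g (ξ - t) := by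
  have h : mulSS f g = 𝓕⁻ (SchwartzMap.convolution (ContinuousLinearMap.mul ℂ ℂ) (𝓕 f) (𝓕 g)) := by
    ext x
    have h0 : ∀ (h : 𝓢(ℝ, ℂ)) (y : ℝ), 𝓕⁻ h y = 𝓕 h (-y) := fun h y => by
      rw [SchwartzMap.fourierInv_coe, SchwartzMap.fourier_coe, Real.fourierInv_eq_fourier_neg]
    have h1 : ∀ (h : 𝓢(ℝ, ℂ)) (y : ℝ), 𝓕 (𝓕 h) (-y) = h y := fun h y => by
      rw [← h0, FourierTransform.fourierInv_fourier_eq]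
    rw [h0, SchwartzMap.fourier_convolution, SchwartzMap.pairing_apply_apply, h1, h1]
    rfl
  rw [h, FourierTransform.fourier_fourierInv_eq, SchwartzMap.convolution_apply]
  rfl

theorem fourier_mulSS_support {f g : 𝓢(ℝ, ℂ)} {m l v w : ℝ}
    (hf : ∀ ξ, 𝓕 f ξ ≠ 0 → |2 * Real.pi * ξ - m| < v)
    (hg : ∀ ξ, 𝓕 g ξ ≠ 0 → |2 * Real.pi * ξ - l| < w) {ξ : ℝ} (h : 𝓕 (mulSS f g) ξ ≠ 0) :
    |2 * Real.pi * ξ - (m + l)| < v + w := by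
  by_contra! hlt
  refine h ?_
  rw [fourier_mulSS]
  refine integral_eq_zero_of_ae (Eventually.of_forall fun t => ?_)
  by_contra h0
  obtain ⟨h1, h2⟩ := mul_ne_zero_iff.1 h0
  have h3 := abs_add_le (2 * Real.pi * t - m) (2 * Real.pi * (ξ - t) - l)
  rw [show 2 * Real.pi * t - m + (2 * Real.pi * (ξ - t) - l) = 2 * Real.pi * ξ - (m + l) by ring]
    at h3
  linarith [hf t h1, hg _ h2]

/-- `F` is a finite sum of functions with spectrum near the integers, whose norms are controlled
by the sequence `c`. -/
def HasDec (r : ℝ≥0∞) (w : ℝ) (c : ℤ → ℝ≥0∞) (F : 𝓢(ℝ, ℂ)) : Prop :=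
  ∃ (K : Finset ℤ) (G : ℤ → 𝓢(ℝ, ℂ)), F = ∑ m ∈ K, G m ∧
    ∀ m ∈ K, (∀ ξ, 𝓕 (G m) ξ ≠ 0 → |2 * Real.pi * ξ - m| < w) ∧ eLpNorm (G m) r volume ≤ c m

theorem fourier_sum {ι : Type*} (K : Finset ι) (G : ι → 𝓢(ℝ, ℂ)) (ξ : ℝ) :
    𝓕 (∑ i ∈ K, G i) ξ = ∑ i ∈ K, 𝓕 (G i) ξ := by
  have : 𝓕 (∑ i ∈ K, G i) = ∑ i ∈ K, 𝓕 (G i) :=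
    map_sum (FourierTransform.fourierCLE ℂ 𝓢(ℝ, ℂ)) G K
  rw [this, sum_apply]

theorem IsBL.hasDec {ρ : ℝ → ℝ} (hρ : IsCutoff ρ) {f : 𝓢(ℝ, ℂ)} (hf : IsBL ρ f) (p : ℝ≥0∞) :
    HasDec p 1 (fun k => lpNorm p (box ρ k (emb f))) f := by
  obtain ⟨K, hK⟩ := hf
  refine ⟨K, fun k => mulS (fun ξ => (window ρ k ξ : ℂ)) f, hK K subset_rfl, fun k _ => ⟨?_, ?_⟩⟩
  · intro ξ h
    rw [fourier_mulS (tg_window hρ k)] at h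
    exact window_ne_zero hρ fun h0 => h (by simp [h0])
  · change eLpNorm (mulS (fun ξ => (window ρ k ξ : ℂ)) f) p volume ≤ lpNorm p (box ρ k (emb f))
    rw [box_emb hρ, lpNorm_emb]

theorem eLpNorm_mulSS_le {r₁ r₂ r : ℝ≥0∞} [ENNReal.HolderTriple r₁ r₂ r] (f g : 𝓢(ℝ, ℂ)) :
    eLpNorm (mulSS f g) r volume ≤ eLpNorm f r₁ volume * eLpNorm g r₂ volume :=
  eLpNorm_smul_le_mul_eLpNorm (p := r₁) (q := r₂) (r := r) (μ := volume) (f := (g : ℝ → ℂ))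
    (φ := (f : ℝ → ℂ)) g.continuous.aestronglyMeasurable f.continuous.aestronglyMeasurable

theorem eLpNorm_schwartz_sum_le {ι : Type*} {r : ℝ≥0∞} (hr : 1 ≤ r) (K : Finset ι)
    (f : ι → 𝓢(ℝ, ℂ)) :
    eLpNorm (∑ i ∈ K, f i : 𝓢(ℝ, ℂ)) r volume ≤ ∑ i ∈ K, eLpNorm (f i) r volume := by
  have h := eLpNorm_sum_le (μ := volume) (p := r) (s := K) (f := fun i => (f i : ℝ → ℂ))
    (fun i _ => (f i).continuous.aestronglyMeasurable) hr
  have e : ((∑ i ∈ K, f i : 𝓢(ℝ, ℂ)) : ℝ → ℂ) = ∑ i ∈ K, (f i : ℝ → ℂ) := by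
    ext y
    rw [sum_apply, Finset.sum_apply]
  rwa [e]

theorem HasDec.mul {r₁ r₂ r : ℝ≥0∞} [ENNReal.HolderTriple r₁ r₂ r] (hr : 1 ≤ r) {v w : ℝ}
    {c d : ℤ → ℝ≥0∞} {F G : 𝓢(ℝ, ℂ)} (hF : HasDec r₁ v c F) (hG : HasDec r₂ w d G) :
    HasDec r (v + w) (sconv c d) (mulSS F G) := by
  obtain ⟨K, f, rfl, hf⟩ := hF
  obtain ⟨L, g, rfl, hg⟩ := hG
  refine ⟨(K ×ˢ L).image fun x => x.1 + x.2,
    fun n => ∑ x ∈ K ×ˢ L with x.1 + x.2 = n, mulSS (f x.1) (g x.2), ?_, fun n _ => ⟨?_, ?_⟩⟩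
  · rw [Finset.sum_fiberwise_of_maps_to fun x hx => Finset.mem_image_of_mem _ hx]
    ext x
    rw [mulSS_apply, sum_apply, sum_apply, sum_apply, Finset.sum_mul_sum, Finset.sum_product]
    rfl
  · intro ξ h
    rw [fourier_sum] at h
    obtain ⟨x, hx, h1⟩ := Finset.exists_ne_zero_of_sum_ne_zero h
    rw [Finset.mem_filter, Finset.mem_product] at hx
    have := fourier_mulSS_support (hf _ hx.1.1).1 (hg _ hx.1.2).1 h1
    rwa [← hx.2, Int.cast_add]
  · have h1 : ∀ x ∈ (K ×ˢ L).filter (fun x => x.1 + x.2 = n),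
        eLpNorm (mulSS (f x.1) (g x.2)) r volume ≤ c (n - x.2) * d x.2 := by
      intro x hx
      rw [Finset.mem_filter, Finset.mem_product] at hx
      have h2 : n - x.2 = x.1 := by omega
      rw [h2]
      have h3 := eLpNorm_mulSS_le (r₁ := r₁) (r₂ := r₂) (r := r) (f x.1) (g x.2)
      exact h3.trans (mul_le_mul' (hf _ hx.1.1).2 (hg _ hx.1.2).2)
    calc eLpNorm (∑ x ∈ K ×ˢ L with x.1 + x.2 = n, mulSS (f x.1) (g x.2) : 𝓢(ℝ, ℂ)) r volume
        ≤ ∑ x ∈ K ×ˢ L with x.1 + x.2 = n, eLpNorm (mulSS (f x.1) (g x.2)) r volume :=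
          eLpNorm_schwartz_sum_le hr _ _
      _ ≤ ∑ x ∈ K ×ˢ L with x.1 + x.2 = n, c (n - x.2) * d x.2 := Finset.sum_le_sum h1
      _ = ∑ l ∈ ((K ×ˢ L).filter (fun x => x.1 + x.2 = n)).image Prod.snd, c (n - l) * d l := by
          rw [Finset.sum_image]
          intro x hx y hy hxy
          simp only [Finset.coe_filter, Set.mem_ofPred_eq] at hx hy
          have h1 := hx.2
          have h2 := hy.2
          refine Prod.ext ?_ hxy
          rw [hxy] at h1
          omega
      _ ≤ sconv c d n := ENNReal.sum_le_tsum _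

theorem HasDec.lpNorm_box_le {ρ : ℝ → ℝ} (hρ : IsCutoff ρ) {r : ℝ≥0∞} (hr : 1 ≤ r) (hr' : r ≠ ⊤)
    {n : ℕ} {c : ℤ → ℝ≥0∞} {F : 𝓢(ℝ, ℂ)} (hF : HasDec r n c F) (k : ℤ) :
    lpNorm r (box ρ k (emb F)) ≤ ∑ i ∈ Finset.Icc (-(n + 1 : ℤ)) (n + 1),
      ENNReal.ofReal (3 * winB hρ) * c (k + i) := by
  obtain ⟨K, G, rfl, hG⟩ := hF
  rw [map_sum, map_sum]
  refine (lpNorm_sum_le hr _ _).trans ?_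
  have hz : ∀ m ∈ K, m ∉ Finset.Icc (k - (n + 1)) (k + (n + 1)) → box ρ k (emb (G m)) = 0 := by
    intro m hm hmk
    rw [box_emb hρ]
    have : mulS (fun ξ => (window ρ k ξ : ℂ)) (G m) = 0 := by
      refine schwartz_ext_fourier fun ξ => ?_
      rw [fourier_mulS (tg_window hρ k)]
      have h0 : 𝓕 (0 : 𝓢(ℝ, ℂ)) ξ = 0 := by
        rw [show 𝓕 (0 : 𝓢(ℝ, ℂ)) = 0 from map_zero (FourierTransform.fourierCLE ℂ 𝓢(ℝ, ℂ))]
        rfl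
      rw [h0]
      by_contra h
      obtain ⟨h1, h2⟩ := mul_ne_zero_iff.1 h
      have h3 := window_ne_zero hρ (fun h0 => h1 (by rw [h0, Complex.ofReal_zero]))
      have h4 := (hG m hm).1 ξ h2
      exact hmk (near_index h4 h3 (n := n + 1) (by push_cast; linarith))
    rw [this, map_zero]
  calc ∑ m ∈ K, lpNorm r (box ρ k (emb (G m)))
      = ∑ m ∈ K with m ∈ Finset.Icc (k - (n + 1)) (k + (n + 1)),
          lpNorm r (box ρ k (emb (G m))) := by
        rw [Finset.sum_filter]
        refine Finset.sum_congr rfl fun m hm => ?_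
        split_ifs with h
        · rfl
        · rw [hz m hm h, lpNorm_zero]
    _ ≤ ∑ m ∈ K with m ∈ Finset.Icc (k - (n + 1)) (k + (n + 1)),
          ENNReal.ofReal (3 * winB hρ) * c m := by
        refine Finset.sum_le_sum fun m hm => ?_
        refine (GBBM.lpNorm_box_le hρ hr hr' k _).trans ?_
        rw [lpNorm_emb]
        gcongr
        exact (hG m (Finset.mem_filter.1 hm).1).2
    _ ≤ ∑ m ∈ Finset.Icc (k - (n + 1)) (k + (n + 1)), ENNReal.ofReal (3 * winB hρ) * c m :=
        Finset.sum_le_sum_of_subset fun m hm => (Finset.mem_filter.1 hm).2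
    _ = _ := by
        refine Finset.sum_bij' (fun m _ => m - k) (fun i _ => k + i) ?_ ?_ ?_ ?_ ?_
        · intro m hm; rw [Finset.mem_Icc] at hm ⊢; omega
        · intro m hm; rw [Finset.mem_Icc] at hm ⊢; omega
        · intro m _; ring
        · intro m _; ring
        · intro m _; rw [add_sub_cancel]

theorem exists_modNorm_le_of_hasDec {ρ : ℝ → ℝ} (hρ : IsCutoff ρ) {q : ℝ} (hq : 1 ≤ q) {r : ℝ≥0∞}
    (hr : 1 ≤ r) (hr' : r ≠ ⊤) (σ : ℝ) (n : ℕ) : ∃ C : ℝ≥0∞, C ≠ ⊤ ∧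
      ∀ (c : ℤ → ℝ≥0∞) (F : 𝓢(ℝ, ℂ)), HasDec r n c F →
        modNorm ρ σ r q (emb F) ≤ C * lq q fun k => wt k ^ σ * c k := by
  have hq0 : 0 < q := by linarith
  refine ⟨∑ i ∈ Finset.Icc (-(n + 1 : ℤ)) (n + 1), ENNReal.ofReal (3 * winB hρ) * wt i ^ |σ|,
    (ENNReal.sum_lt_top.2 fun i _ => (ENNReal.mul_ne_top ENNReal.ofReal_ne_top
      (wt_rpow_ne_top i _)).lt_top).ne, fun c F hF => ?_⟩
  rw [modNorm_eq hq]
  calc lq q (fun k => wt k ^ σ * lpNorm r (box ρ k (emb F)))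
      ≤ lq q (fun k => ∑ i ∈ Finset.Icc (-(n + 1 : ℤ)) (n + 1),
          (ENNReal.ofReal (3 * winB hρ) * wt i ^ |σ|) * (wt (k + i) ^ σ * c (k + i))) := by
        refine lq_mono hq0 fun k => ?_
        refine (mul_le_mul_right (hF.lpNorm_box_le hρ hr hr' k) _).trans ?_
        rw [Finset.mul_sum]
        refine Finset.sum_le_sum fun i _ => ?_
        have h1 : wt k ^ σ ≤ wt i ^ |σ| * wt (k + i) ^ σ := by
          have := wt_rpow_add_le σ (k + i) (-i)
          rwa [wt_neg, add_neg_cancel_right] at this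
        calc wt k ^ σ * (ENNReal.ofReal (3 * winB hρ) * c (k + i))
            ≤ (wt i ^ |σ| * wt (k + i) ^ σ) * (ENNReal.ofReal (3 * winB hρ) * c (k + i)) := by gcongr
          _ = _ := by ring
    _ ≤ ∑ i ∈ Finset.Icc (-(n + 1 : ℤ)) (n + 1), lq q (fun k =>
          (ENNReal.ofReal (3 * winB hρ) * wt i ^ |σ|) * (wt (k + i) ^ σ * c (k + i))) :=
        lq_sum_le hq _ _
    _ = _ := by
        rw [Finset.sum_mul]
        refine Finset.sum_congr rfl fun i _ => ?_
        rw [lq_const_mul hq0]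
        congr 1
        exact lq_shift q (fun k => wt k ^ σ * c k) i

/-- The pointwise product of `f 0, …, f n`. -/
def prodS (f : ℕ → 𝓢(ℝ, ℂ)) : ℕ → 𝓢(ℝ, ℂ)
  | 0 => f 0
  | n + 1 => mulSS (prodS f n) (f (n + 1))

theorem holderTriple_div {p : ℝ} (hp : 0 < p) (n : ℕ) :
    ENNReal.HolderTriple (ENNReal.ofReal (p / (n + 1))) (ENNReal.ofReal p)
      (ENNReal.ofReal (p / ((n + 1 : ℕ) + 1))) := by
  constructor
  rw [← ENNReal.ofReal_inv_of_pos (by positivity), ← ENNReal.ofReal_inv_of_pos hp,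
    ← ENNReal.ofReal_inv_of_pos (by positivity), ← ENNReal.ofReal_add (by positivity)
    (by positivity)]
  congr 1
  push_cast
  field_simp

theorem exists_hasDec_prodS {ρ : ℝ → ℝ} (hρ : IsCutoff ρ) {p q s η : ℝ} (hp : 0 < p) (hq : 1 ≤ q)
    (hη : 0 ≤ η) (hκ : 1 - 1 / q < s + η ∨ (q = 1 ∧ 0 ≤ s + η)) (n : ℕ) (hn : n + 1 ≤ p)
    (hns : n * η ≤ s) : ∃ C : ℝ≥0∞, C ≠ ⊤ ∧ ∀ f : ℕ → 𝓢(ℝ, ℂ), (∀ i, IsBL ρ (f i)) →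
      ∃ c : ℤ → ℝ≥0∞, HasDec (ENNReal.ofReal (p / (n + 1))) ((n + 1 : ℕ) : ℝ) c (prodS f n) ∧
        lq q (fun k => wt k ^ (s - n * η) * c k) ≤
          C * ∏ i ∈ Finset.range (n + 1), modNorm ρ s (ENNReal.ofReal p) q (emb (f i)) := by
  induction n with
  | zero =>
    refine ⟨1, ENNReal.one_ne_top, fun f hf => ⟨fun k => lpNorm (ENNReal.ofReal p)
      (box ρ k (emb (f 0))), ?_, ?_⟩⟩
    · simpa [prodS] using (hf 0).hasDec hρ (ENNReal.ofReal p)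
    · simp [modNorm_eq hq]
  | succ n ih =>
    push_cast at hn hns
    obtain ⟨C, hC, h⟩ := ih (by linarith) (by nlinarith)
    obtain ⟨C', hC', h'⟩ := lq_wt_sconv_le hq hη hκ
    refine ⟨C' * C, ENNReal.mul_ne_top hC' hC, fun f hf => ?_⟩
    obtain ⟨c, hc, hcl⟩ := h f hf
    have := holderTriple_div hp n
    have hr : 1 ≤ ENNReal.ofReal (p / ((n + 1 : ℕ) + 1)) := by
      rw [← ENNReal.ofReal_one]
      refine ENNReal.ofReal_le_ofReal ?_
      push_cast
      rw [le_div_iff₀ (by positivity)]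
      linarith
    have h2 := HasDec.mul hr hc ((hf (n + 1)).hasDec hρ (ENNReal.ofReal p))
    refine ⟨_, by rw [Nat.cast_add_one (n + 1)]; exact h2, ?_⟩
    have h1 := h' (s - n * η) (by nlinarith [show (0:ℝ) ≤ n * η by positivity]) (by linarith) c
      (fun k => lpNorm (ENNReal.ofReal p) (box ρ k (emb (f (n + 1)))))
    rw [← modNorm_eq hq] at h1
    rw [show s - ((n + 1 : ℕ) : ℝ) * η = s - n * η - η by push_cast; ring]
    refine h1.trans ?_
    rw [Finset.prod_range_succ _ (n + 1)]
    calc _ ≤ C' * ((C * ∏ i ∈ Finset.range (n + 1), modNorm ρ s (ENNReal.ofReal p) q (emb (f i))) *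
          modNorm ρ s (ENNReal.ofReal p) q (emb (f (n + 1)))) := by gcongr
      _ = _ := by ring

theorem exists_modNorm_prodS_le {ρ : ℝ → ℝ} (hρ : IsCutoff ρ) {p q s η : ℝ} (hp : 0 < p)
    (hq : 1 ≤ q) (hη : 0 ≤ η) (hκ : 1 - 1 / q < s + η ∨ (q = 1 ∧ 0 ≤ s + η)) (n : ℕ)
    (hn : n + 1 ≤ p) (hns : n * η ≤ s) :
    ∃ C : ℝ≥0∞, C ≠ ⊤ ∧ ∀ f : ℕ → 𝓢(ℝ, ℂ), (∀ i, IsBL ρ (f i)) →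
      modNorm ρ (s - n * η) (ENNReal.ofReal (p / (n + 1))) q (emb (prodS f n)) ≤
        C * ∏ i ∈ Finset.range (n + 1), modNorm ρ s (ENNReal.ofReal p) q (emb (f i)) := by
  obtain ⟨C, hC, h⟩ := exists_hasDec_prodS hρ hp hq hη hκ n hn hns
  have hr : 1 ≤ ENNReal.ofReal (p / (n + 1)) := by
    rw [← ENNReal.ofReal_one]
    refine ENNReal.ofReal_le_ofReal ?_
    rwa [le_div_iff₀ (by positivity), one_mul]
  obtain ⟨C', hC', h'⟩ := exists_modNorm_le_of_hasDec hρ hq hr ENNReal.ofReal_ne_top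
    (s - n * η) (n + 1)
  refine ⟨C' * C, ENNReal.mul_ne_top hC' hC, fun f hf => ?_⟩
  obtain ⟨c, hc, hcl⟩ := h f hf
  refine (h' c _ hc).trans ?_
  rw [mul_assoc]
  gcongr

theorem tendsto_eLpNorm_mul {r₁ r₂ r : ℝ≥0∞} [ENNReal.HolderTriple r₁ r₂ r] (hr : 1 ≤ r)
    (hr₂ : 1 ≤ r₂) {F G : ℕ → ℝ → ℂ} {f g : ℝ → ℂ} (hF : ∀ n, AEStronglyMeasurable (F n) volume)
    (hG : ∀ n, AEStronglyMeasurable (G n) volume) (hf : MemLp f r₁ volume) (hg : MemLp g r₂ volume)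
    (h1 : Tendsto (fun n => eLpNorm (F n - f) r₁ volume) atTop (𝓝 0))
    (h2 : Tendsto (fun n => eLpNorm (G n - g) r₂ volume) atTop (𝓝 0)) :
    Tendsto (fun n => eLpNorm (F n * G n - f * g) r volume) atTop (𝓝 0) := by
  have hb : Tendsto (fun n => eLpNorm (F n - f) r₁ volume *
      (eLpNorm (G n - g) r₂ volume + eLpNorm g r₂ volume) +
      eLpNorm f r₁ volume * eLpNorm (G n - g) r₂ volume) atTop
      (𝓝 (0 * (0 + eLpNorm g r₂ volume) + eLpNorm f r₁ volume * 0)) :=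
    (ENNReal.Tendsto.mul h1 (Or.inr (by simpa using hg.2.ne)) (h2.add tendsto_const_nhds)
      (Or.inr ENNReal.zero_ne_top)).add (ENNReal.Tendsto.const_mul h2 (Or.inr hf.2.ne))
  rw [zero_mul, mul_zero, add_zero] at hb
  refine tendsto_of_tendsto_of_tendsto_of_le_of_le tendsto_const_nhds hb (fun _ => zero_le)
    fun n => ?_
  have hFf : AEStronglyMeasurable (F n - f) volume := (hF n).sub hf.1
  have hGg : AEStronglyMeasurable (G n - g) volume := (hG n).sub hg.1
  have e : F n * G n - f * g = (F n - f) • G n + f • (G n - g) := by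
    ext x; simp; ring
  rw [e]
  refine (eLpNorm_add_le (hFf.smul (hG n)) (hf.1.smul hGg) hr).trans (add_le_add ?_ ?_)
  · refine (eLpNorm_smul_le_mul_eLpNorm (p := r₁) (q := r₂) (hG n) hFf).trans ?_
    gcongr
    have := eLpNorm_add_le hGg hg.1 hr₂
    rwa [sub_add_cancel] at this
  · exact eLpNorm_smul_le_mul_eLpNorm (p := r₁) (q := r₂) hGg hf.1

theorem tendsto_eLpNorm_prod {p : ℝ} (hp : 1 ≤ p) {f : ℕ → ℕ → 𝓢(ℝ, ℂ)} {g : ℕ → ℝ → ℂ}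
    (hg : ∀ i, MemLp (g i) (ENNReal.ofReal p) volume)
    (h : ∀ i, Tendsto (fun k => eLpNorm ((f i k : ℝ → ℂ) - g i) (ENNReal.ofReal p) volume) atTop (𝓝 0))
    (n : ℕ) (hn : n + 1 ≤ p) :
    MemLp (fun x => ∏ i ∈ Finset.range (n + 1), g i x) (ENNReal.ofReal (p / (n + 1))) volume ∧
    Tendsto (fun k => eLpNorm (fun x => prodS (fun i => f i k) n x -
      ∏ i ∈ Finset.range (n + 1), g i x) (ENNReal.ofReal (p / (n + 1))) volume)
      atTop (𝓝 0) := by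
  induction n with
  | zero => simpa [prodS] using ⟨hg 0, h 0⟩
  | succ n ih =>
    push_cast at hn
    obtain ⟨h1, h2⟩ := ih (by linarith)
    have := holderTriple_div (by linarith : 0 < p) n
    have hr : 1 ≤ ENNReal.ofReal (p / ((n + 1 : ℕ) + 1)) := by
      rw [← ENNReal.ofReal_one]
      refine ENNReal.ofReal_le_ofReal ?_
      push_cast
      rw [le_div_iff₀ (by positivity)]
      linarith
    have hp1 : 1 ≤ ENNReal.ofReal p := by
      rw [← ENNReal.ofReal_one]; exact ENNReal.ofReal_le_ofReal hp
    simp only [Finset.prod_range_succ _ (n + 1)]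
    constructor
    · exact MemLp.mul (p := ENNReal.ofReal (p / (n + 1))) (q := ENNReal.ofReal p) (hg (n + 1)) h1
    · exact tendsto_eLpNorm_mul (F := fun k x => prodS (fun i => f i k) n x)
        (G := fun k x => f (n + 1) k x) hr hp1
        (fun k => (prodS (fun i => f i k) n).continuous.aestronglyMeasurable)
        (fun k => (f (n + 1) k).continuous.aestronglyMeasurable) h1 (hg (n + 1)) h2 (h (n + 1))

theorem IsFunction.sum {ι : Type*} (K : Finset ι) {T : ι → 𝓢'(ℝ, ℂ)} {g : ι → ℝ → ℂ}
    (h : ∀ i ∈ K, IsFunction (T i) (g i)) : IsFunction (∑ i ∈ K, T i) (∑ i ∈ K, g i) := by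
  classical
  induction K using Finset.induction_on with
  | empty => simpa using IsFunction.zero
  | insert i K hi ih =>
    rw [Finset.sum_insert hi, Finset.sum_insert hi]
    exact (h i (Finset.mem_insert_self i K)).add
      (ih fun j hj => h j (Finset.mem_insert_of_mem hj))

namespace Par
variable (P : Par)

/-- The loss of weight in the product estimate. -/
def η : ℝ := min P.s (1 / P.p)

/-- The decay exponent of the group. -/
def A : ℝ := (P.p - 2) / P.p / 3

theorem p_pos : 0 < P.p := by have := P.two_lt_p; linarith

theorem s_nonneg : 0 ≤ P.s := by
  have h1 : 1 / P.q ≤ 1 := by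
    rw [div_le_one (by linarith [P.hq])]
    exact P.hq
  linarith [P.hs]

theorem div_lam_add_one : P.p / (P.lam + 1) = P.p / (P.p - 1) := by
  congr 1
  rw [p]
  ring

theorem one_le_conj : 1 ≤ ENNReal.ofReal (P.p / (P.p - 1)) := by
  rw [← ENNReal.ofReal_one]
  refine ENNReal.ofReal_le_ofReal ?_
  have := P.two_lt_p
  rw [le_div_iff₀ (by linarith)]
  linarith

theorem exists_modNorm_prodS_le : ∃ C : ℝ≥0∞, C ≠ ⊤ ∧ ∀ f : ℕ → 𝓢(ℝ, ℂ), (∀ i, IsBL P.ρ (f i)) →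
    modNorm P.ρ (P.s - P.η) (ENNReal.ofReal (P.p / (P.p - 1))) P.q (emb (prodS f P.lam)) ≤
      C * ∏ i ∈ Finset.range (P.lam + 1), P.N (emb (f i)) := by
  have hl : (0 : ℝ) < P.lam := by have := P.one_le_lam; linarith
  have hp := P.p_pos
  have hη : 0 ≤ P.η := le_min P.s_nonneg (by positivity)
  have hmul : (P.lam : ℝ) * (P.η / P.lam) = P.η := by field_simp
  have h := GBBM.exists_modNorm_prodS_le P.hρ (p := P.p) (q := P.q) (s := P.s) (η := P.η / P.lam)
    hp P.hq (by positivity) ?_ P.lam (by rw [p]; linarith) (by rw [hmul]; exact min_le_left _ _)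
  · rwa [hmul, P.div_lam_add_one] at h
  · rcases P.s_nonneg.eq_or_lt with h0 | h0
    · right
      refine ⟨?_, by rw [← h0]; positivity⟩
      have h1 := P.hs
      have hq := P.hq
      rw [← h0, sub_nonpos, le_div_iff₀ (by linarith), one_mul] at h1
      linarith
    · left
      have : 0 < P.η / P.lam := div_pos (lt_min h0 (by positivity)) hl
      linarith [P.hs]

variable {P}

theorem Space.exists_isFunction (x : P.Space) : ∃ g, IsFunction x.val g ∧
    MemLp g (ENNReal.ofReal P.p) volume :=
  GBBM.exists_isFunction x.lpNorm_ne_top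

theorem Space.memLp {x : P.Space} {g : ℝ → ℂ} (hg : IsFunction x.val g) :
    MemLp g (ENNReal.ofReal P.p) volume := by
  obtain ⟨g', h1, h2⟩ := x.exists_isFunction
  exact (memLp_congr_ae (h1.ae_eq hg)).1 h2

theorem Space.exists_isBL_seq (x : P.Space) : ∃ f : ℕ → 𝓢(ℝ, ℂ), (∀ n, IsBL P.ρ (f n)) ∧
    Tendsto (fun n => P.N (emb (f n) - x.val)) atTop (𝓝 0) := by
  have hex : ∀ n : ℕ, ∃ f : 𝓢(ℝ, ℂ), IsBL P.ρ f ∧ P.N (emb f - x.val) < ((n : ℝ≥0∞) + 1)⁻¹ :=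
    fun n => exists_isBL_near P.hρ P.hq P.one_le_ofReal_p ENNReal.ofReal_ne_top x.N_ne_top
      (ENNReal.inv_pos.2 (by finiteness)) (ENNReal.inv_ne_top.2 (by positivity))
  choose f hf hfT using hex
  have hlim0 : Tendsto (fun n : ℕ => ((n : ℝ≥0∞) + 1)⁻¹) atTop (𝓝 0) := by
    have := (tendsto_add_atTop_iff_nat 1).2 ENNReal.tendsto_inv_nat_nhds_zero
    simpa using this
  exact ⟨f, hf, tendsto_of_tendsto_of_tendsto_of_le_of_le tendsto_const_nhds hlim0
    (fun _ => zero_le) fun n => (hfT n).le⟩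

theorem tendsto_N {T : ℕ → 𝓢'(ℝ, ℂ)} {U : 𝓢'(ℝ, ℂ)}
    (h : Tendsto (fun n => P.N (T n - U)) atTop (𝓝 0)) :
    ∀ ε > 0, ∀ᶠ n in atTop, P.N (T n) ≤ P.N U + ε := by
  intro ε hε
  filter_upwards [h.eventually_lt_const hε] with n hn
  calc P.N (T n) = P.N (U + (T n - U)) := by rw [add_sub_cancel]
    _ ≤ P.N U + P.N (T n - U) := P.N_add_le _ _
    _ ≤ P.N U + ε := by gcongr

/-- The product of `lam + 1` elements of the space. -/
theorem exists_prod_le (P : Par) : ∃ C : ℝ≥0∞, C ≠ ⊤ ∧ ∀ (x : ℕ → P.Space) (g : ℕ → ℝ → ℂ),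
    (∀ i, IsFunction (x i).val (g i)) → ∃ W : 𝓢'(ℝ, ℂ),
      IsFunction W (fun y => ∏ i ∈ Finset.range (P.lam + 1), g i y) ∧
      lpNorm (ENNReal.ofReal (P.p / (P.p - 1))) W ≠ ⊤ ∧
      modNorm P.ρ (P.s - P.η) (ENNReal.ofReal (P.p / (P.p - 1))) P.q W ≤
        C * ∏ i ∈ Finset.range (P.lam + 1), P.N (x i).val := by
  obtain ⟨C, hC, h⟩ := P.exists_modNorm_prodS_le
  obtain ⟨C₁, hC₁, hemb⟩ := P.exists_lpNorm_le
  refine ⟨C, hC, fun x g hg => ?_⟩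
  have hp := P.two_lt_p
  choose f hf hfx using fun i => (x i).exists_isBL_seq
  have hlim : ∀ i, Tendsto (fun k => eLpNorm ((f i k : ℝ → ℂ) - g i) (ENNReal.ofReal P.p) volume)
      atTop (𝓝 0) := by
    intro i
    have h1 := ENNReal.Tendsto.const_mul (hfx i) (Or.inr (ENNReal.ofReal_ne_top (r := C₁)))
    rw [mul_zero] at h1
    refine tendsto_of_tendsto_of_tendsto_of_le_of_le' tendsto_const_nhds h1
      (Eventually.of_forall fun _ => zero_le) ?_
    filter_upwards [(hfx i).eventually_lt_const one_pos] with k hk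
    rw [← ((isFunction_emb (f i k)).sub (hg i)).lpNorm_eq]
    exact hemb _ (hk.trans ENNReal.one_lt_top).ne
  obtain ⟨h1, h2⟩ := tendsto_eLpNorm_prod (by linarith) (fun i => Space.memLp (hg i)) hlim P.lam
    (by rw [p]; linarith)
  rw [P.div_lam_add_one] at h1 h2
  obtain ⟨W, hW⟩ := exists_isFunction_of_memLp P.one_le_conj h1
  refine ⟨W, hW, by rw [hW.lpNorm_eq]; exact h1.2.ne, ?_⟩
  have h3 : Tendsto (fun k => lpNorm (ENNReal.ofReal (P.p / (P.p - 1)))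
      (emb (prodS (fun i => f i k) P.lam) - W)) atTop (𝓝 0) := by
    refine h2.congr fun k => ?_
    rw [((isFunction_emb _).sub hW).lpNorm_eq]
    rfl
  have h4 : ∀ ε : ℝ≥0∞, 0 < ε → modNorm P.ρ (P.s - P.η) (ENNReal.ofReal (P.p / (P.p - 1))) P.q W ≤
      C * ∏ i ∈ Finset.range (P.lam + 1), (P.N (x i).val + ε) := by
    intro ε hε
    refine modNorm_le_of_tendsto P.hq P.one_le_conj
      (fun k => tendsto_box P.hρ P.one_le_conj ENNReal.ofReal_ne_top h3 k) ?_
    have h5 : ∀ᶠ k in atTop, ∀ i ∈ Finset.range (P.lam + 1),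
        P.N (emb (f i k)) ≤ P.N (x i).val + ε :=
      (Finset.eventually_all _).2 fun i _ => tendsto_N (hfx i) ε hε
    filter_upwards [h5] with k hk
    refine (h (fun i => f i k) fun i => hf i k).trans ?_
    gcongr with i hi
    exact hk i hi
  have h6 : Tendsto (fun n : ℕ => C * ∏ i ∈ Finset.range (P.lam + 1),
      (P.N (x i).val + ((n : ℝ≥0∞))⁻¹)) atTop
      (𝓝 (C * ∏ i ∈ Finset.range (P.lam + 1), (P.N (x i).val + 0))) := by
    refine ENNReal.Tendsto.const_mul ?_ (Or.inr hC)
    have : ∀ K : Finset ℕ, Tendsto (fun n : ℕ => ∏ i ∈ K, (P.N (x i).val + ((n : ℝ≥0∞))⁻¹)) atTop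
        (𝓝 (∏ i ∈ K, (P.N (x i).val + 0))) := by
      intro K
      induction K using Finset.induction_on with
      | empty => simp
      | insert i K hi ih =>
        simp only [Finset.prod_insert hi]
        refine ENNReal.Tendsto.mul (tendsto_const_nhds.add ENNReal.tendsto_inv_nat_nhds_zero)
          (Or.inr ?_) ih (Or.inr ?_)
        · exact ENNReal.prod_ne_top fun i _ => by simpa using (x i).N_ne_top
        · simpa using (x i).N_ne_top
    exact this _
  simp only [add_zero] at h6
  exact ge_of_tendsto' h6 fun n => h4 _ (ENNReal.inv_pos.2 (ENNReal.natCast_ne_top n))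

theorem exists_N_grp_phi_le (P : Par) : ∃ C : ℝ≥0∞, C ≠ ⊤ ∧ ∀ (t : ℝ) (W : 𝓢'(ℝ, ℂ)),
    P.N (GBBM.S t (phiD W)) ≤ C * ENNReal.ofReal ((1 + |t|) ^ (-P.A)) *
      modNorm P.ρ (P.s - P.η) (ENNReal.ofReal (P.p / (P.p - 1))) P.q W := by
  obtain ⟨C, hC, h⟩ := lpNorm_box_group_phi_le P.hρ P.two_lt_p
  refine ⟨C, hC, fun t W => ?_⟩
  have hq0 : 0 < P.q := by linarith [P.hq]
  rw [N, modNorm_eq P.hq, modNorm_eq P.hq, ← lq_const_mul hq0]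
  refine lq_mono hq0 fun k => ?_
  have hw : wt k ^ P.s * wt k ^ (-(2 / P.p)) ≤ wt k ^ (P.s - P.η) := by
    rw [← wt_rpow_add]
    refine ENNReal.rpow_le_rpow_of_exponent_le (one_le_wt k) ?_
    have h1 : P.η ≤ 1 / P.p := min_le_right _ _
    have h2 : 1 / P.p ≤ 2 / P.p := by have := P.p_pos; gcongr; norm_num
    linarith
  calc _ ≤ wt k ^ P.s * (C * ENNReal.ofReal ((1 + |t|) ^ (-P.A)) * (wt k ^ (-(2 / P.p)) *
        lpNorm (ENNReal.ofReal (P.p / (P.p - 1))) (box P.ρ k W))) :=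
        mul_le_mul_right (h k t W) _
    _ = C * ENNReal.ofReal ((1 + |t|) ^ (-P.A)) * ((wt k ^ P.s * wt k ^ (-(2 / P.p))) *
        lpNorm (ENNReal.ofReal (P.p / (P.p - 1))) (box P.ρ k W)) := by ring
    _ ≤ _ := by gcongr

theorem Space.isFunction_power {x : P.Space} {g : ℝ → ℂ} (hg : IsFunction x.val g) :
    IsFunction (power (P.lam + 1) x.val) (fun y => g y ^ (P.lam + 1)) := by
  obtain ⟨C, -, h⟩ := exists_prod_le P
  obtain ⟨W, hW, -⟩ := h (fun _ => x) (fun _ => g) (fun _ => hg)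
  simp only [Finset.prod_const, Finset.card_range] at hW
  have hex : ∃ W, IsPower (P.lam + 1) x.val W := ⟨W, g, hg, hW⟩
  rw [power, dif_pos hex]
  obtain ⟨g', h1, h2⟩ := hex.choose_spec
  refine h2.congr ?_
  filter_upwards [h1.ae_eq hg] with y hy
  rw [hy]

theorem exists_power_sub_le (P : Par) : ∃ C : ℝ≥0∞, C ≠ ⊤ ∧ ∀ (x y : P.Space) (M : ℝ≥0∞),
    P.N x.val ≤ M → P.N y.val ≤ M →
      modNorm P.ρ (P.s - P.η) (ENNReal.ofReal (P.p / (P.p - 1))) P.q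
        (power (P.lam + 1) x.val - power (P.lam + 1) y.val) ≤
        C * M ^ P.lam * P.N (x.val - y.val) := by
  obtain ⟨C, hC, h⟩ := exists_prod_le P
  refine ⟨(P.lam + 1 : ℕ) * C, ENNReal.mul_ne_top (ENNReal.natCast_ne_top _) hC,
    fun x y M hx hy => ?_⟩
  obtain ⟨g, hg, -⟩ := x.exists_isFunction
  obtain ⟨k, hk, -⟩ := y.exists_isFunction
  have hex := fun i : ℕ => h (fun j => if j < i then x else if j < P.lam then y else x - y)
    (fun j => if j < i then g else if j < P.lam then k else g - k) (fun j => by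
      split_ifs
      · exact hg
      · exact hk
      · rw [map_sub]; exact hg.sub hk)
  choose W hW _ hWb using hex
  have hsum : power (P.lam + 1) x.val - power (P.lam + 1) y.val =
      ∑ i ∈ Finset.range (P.lam + 1), W i := by
    refine IsFunction.unique ((Space.isFunction_power hg).sub (Space.isFunction_power hk)) ?_
    refine (IsFunction.sum _ fun i _ => hW i).congr (Eventually.of_forall fun z => ?_)
    rw [Finset.sum_apply, Pi.sub_apply, ← geom_sum₂_mul, Finset.sum_mul]
    refine Finset.sum_congr rfl fun i hi => ?_
    have hi' : i ≤ P.lam := Nat.lt_succ_iff.1 (Finset.mem_range.1 hi)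
    rw [Finset.prod_range_succ, if_neg (by omega), if_neg (lt_irrefl _)]
    change _ * (g z - k z) = _
    congr 1
    have e : ∀ j ∈ Finset.range P.lam, (if j < i then g else if j < P.lam then k else g - k) z =
        if j < i then g z else k z := by
      intro j hj
      rw [if_pos (Finset.mem_range.1 hj)]
      split_ifs <;> rfl
    rw [Finset.prod_congr rfl e, Finset.prod_ite, Finset.prod_const, Finset.prod_const]
    congr 2
    · rw [show (Finset.range P.lam).filter (fun j => j < i) = Finset.range i by
        ext j; simp only [Finset.mem_filter, Finset.mem_range]; omega, Finset.card_range]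
    · rw [show (Finset.range P.lam).filter (fun j => ¬ j < i) = Finset.Ico i P.lam by
        ext j; simp only [Finset.mem_filter, Finset.mem_range, Finset.mem_Ico]; omega, Nat.card_Ico]
      omega
  rw [hsum]
  refine (modNorm_sum_le P.hq P.one_le_conj _ _).trans ?_
  calc _ ≤ ∑ i ∈ Finset.range (P.lam + 1), C * (M ^ P.lam * P.N (x.val - y.val)) := by
        refine Finset.sum_le_sum fun i hi => (hWb i).trans ?_
        have hi' : i ≤ P.lam := Nat.lt_succ_iff.1 (Finset.mem_range.1 hi)
        rw [Finset.prod_range_succ, if_neg (by omega), if_neg (lt_irrefl _), map_sub]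
        gcongr
        refine (Finset.prod_le_prod' (g := fun _ => M) fun j hj => ?_).trans_eq ?_
        · rw [if_pos (Finset.mem_range.1 hj)]
          split_ifs
          · exact hx
          · exact hy
        · simp
    _ = _ := by
        rw [Finset.sum_const, Finset.card_range, nsmul_eq_mul]
        ring

theorem power_zero : power (P.lam + 1) 0 = 0 := by
  have h0 : IsFunction (0 : P.Space).val 0 := by rw [map_zero]; exact IsFunction.zero
  have h := Space.isFunction_power h0
  rw [map_zero] at h
  refine h.unique ?_
  convert IsFunction.zero using 1
  ext y
  simp

variable (P) in
/-- The constant of the nonlinear estimate. -/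
theorem exists_grp_power_sub_le : ∃ C : ℝ, 0 < C ∧ ∀ (t : ℝ) (x y : P.Space) (M : ℝ),
    ‖x‖ ≤ M → ‖y‖ ≤ M →
      P.N (GBBM.S t (phiD (power (P.lam + 1) x.val - power (P.lam + 1) y.val))) ≤
        ENNReal.ofReal (C * (1 + |t|) ^ (-P.A) * (M ^ P.lam * ‖x - y‖)) := by
  obtain ⟨C, hC, h⟩ := exists_N_grp_phi_le P
  obtain ⟨C', hC', h'⟩ := exists_power_sub_le P
  refine ⟨(C * C').toReal + 1, by positivity, fun t x y M hx hy => ?_⟩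
  have hM : 0 ≤ M := (norm_nonneg x).trans hx
  have hNM : ∀ z : P.Space, ‖z‖ ≤ M → P.N z.val ≤ ENNReal.ofReal M := fun z hz => by
    rw [← enorm_eq, ← ofReal_norm]; exact ENNReal.ofReal_le_ofReal hz
  calc _ ≤ C * ENNReal.ofReal ((1 + |t|) ^ (-P.A)) *
        (C' * ENNReal.ofReal M ^ P.lam * P.N (x.val - y.val)) := by
        refine (h t _).trans ?_
        gcongr
        exact h' x y _ (hNM x hx) (hNM y hy)
    _ = ENNReal.ofReal ((C * C').toReal * (1 + |t|) ^ (-P.A) * (M ^ P.lam * ‖x - y‖)) := by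
        rw [← map_sub, ← enorm_eq, ← ofReal_norm, ENNReal.ofReal_mul (by positivity),
          ENNReal.ofReal_mul (by positivity), ENNReal.ofReal_mul (by positivity),
          ENNReal.ofReal_toReal (ENNReal.mul_ne_top hC hC'), ENNReal.ofReal_pow hM]
        ring
    _ ≤ _ := by
        refine ENNReal.ofReal_le_ofReal ?_
        gcongr
        linarith

theorem N_phi_power_ne_top (x : P.Space) : P.N (phiD (power (P.lam + 1) x.val)) ≠ ⊤ := by
  obtain ⟨C, -, h⟩ := P.exists_grp_power_sub_le
  have := h 0 x 0 ‖x‖ le_rfl (by simp)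
  rw [map_zero, power_zero, sub_zero, S_zero] at this
  exact ne_top_of_le_ne_top ENNReal.ofReal_ne_top this

variable (P) in
/-- The nonlinearity `x ↦ φ(D) x^{lam+1}`. -/
def nonl (x : P.Space) : P.Space := ofN (phiD (power (P.lam + 1) x.val)) (N_phi_power_ne_top x)

@[simp] theorem val_nonl (x : P.Space) : (P.nonl x).val = phiD (power (P.lam + 1) x.val) := rfl

theorem nonl_zero : P.nonl 0 = 0 := Space.val_injective (by simp [power_zero])

variable (P) in
theorem exists_norm_grp_nonl_sub_le : ∃ C : ℝ, 0 < C ∧ ∀ (t : ℝ) (x y : P.Space) (M : ℝ),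
    ‖x‖ ≤ M → ‖y‖ ≤ M →
      ‖P.grp t (P.nonl x - P.nonl y)‖ ≤ C * (1 + |t|) ^ (-P.A) * (M ^ P.lam * ‖x - y‖) := by
  obtain ⟨C, hC, h⟩ := P.exists_grp_power_sub_le
  refine ⟨C, hC, fun t x y M hx hy => ?_⟩
  have hM : 0 ≤ M := (norm_nonneg x).trans hx
  have h1 := ENNReal.toReal_mono ENNReal.ofReal_ne_top (h t x y M hx hy)
  rw [ENNReal.toReal_ofReal (by positivity)] at h1
  rw [norm_def, val_grp, map_sub, val_nonl, val_nonl, ← map_sub]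
  exact h1

end Par

namespace Par
variable {P : Par}

/-! ### The integral equation in the modulation space -/

theorem grp_sub_grp (t t₀ : ℝ) (x : P.Space) :
    P.grp t x - P.grp t₀ x = P.grp t₀ (P.grp (t - t₀) x - x) := by
  rw [map_sub, grp_grp, add_sub_cancel]

theorem continuous_grp : Continuous fun z : ℝ × P.Space => P.grp z.1 z.2 := by
  rw [continuous_iff_continuousAt]
  rintro ⟨t₀, x₀⟩
  rw [ContinuousAt, tendsto_iff_norm_sub_tendsto_zero]
  have hc : Continuous fun z : ℝ × P.Space => 6 * chiB * (1 + |z.1|) * ‖z.2 - x₀‖ +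
      6 * chiB * (1 + |t₀|) * (6 * chiB * |z.1 - t₀| * ‖x₀‖) := by fun_prop
  have hl := hc.tendsto (t₀, x₀)
  simp only [sub_self, norm_zero, abs_zero, mul_zero, zero_mul, add_zero] at hl
  refine squeeze_zero (fun _ => norm_nonneg _) (fun z => ?_) hl
  have h0 : 0 ≤ 6 * chiB * (1 + |t₀|) := by have := one_le_chiB; positivity
  calc ‖P.grp z.1 z.2 - P.grp t₀ x₀‖ = ‖P.grp z.1 (z.2 - x₀) + (P.grp z.1 x₀ - P.grp t₀ x₀)‖ := by
        rw [map_sub]; congr 1; abel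
    _ ≤ ‖P.grp z.1 (z.2 - x₀)‖ + ‖P.grp z.1 x₀ - P.grp t₀ x₀‖ := norm_add_le _ _
    _ ≤ _ := by
        rw [grp_sub_grp]
        refine add_le_add (norm_grp_le _ _) ((norm_grp_le _ _).trans ?_)
        exact mul_le_mul_of_nonneg_left (norm_grp_sub_le _ _) h0

theorem continuous_grp_comp {X : Type*} [TopologicalSpace X] {a : X → ℝ} {u : X → P.Space}
    (ha : Continuous a) (hu : Continuous u) : Continuous fun z => P.grp (a z) (u z) :=
  Continuous.comp (g := fun z : ℝ × P.Space => P.grp z.1 z.2) (f := fun z => (a z, u z))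
    continuous_grp (ha.prodMk hu)

variable (P) in
theorem exists_norm_nonl_sub_le : ∃ C : ℝ, 0 < C ∧ ∀ (x y : P.Space) (M : ℝ),
    ‖x‖ ≤ M → ‖y‖ ≤ M → ‖P.nonl x - P.nonl y‖ ≤ C * (M ^ P.lam * ‖x - y‖) := by
  obtain ⟨C, hC, h⟩ := P.exists_norm_grp_nonl_sub_le
  refine ⟨C, hC, fun x y M hx hy => ?_⟩
  have := h 0 x y M hx hy
  rwa [grp_zero, abs_zero, add_zero, Real.one_rpow, mul_one] at this

theorem continuous_nonl : Continuous P.nonl := by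
  obtain ⟨C, hC, h⟩ := P.exists_norm_nonl_sub_le
  rw [continuous_iff_continuousAt]
  intro x₀
  rw [ContinuousAt, tendsto_iff_norm_sub_tendsto_zero]
  have hc : Continuous fun x : P.Space => C * ((‖x₀‖ + 1) ^ P.lam * ‖x - x₀‖) := by fun_prop
  have hl := hc.tendsto x₀
  simp only [sub_self, norm_zero, mul_zero] at hl
  refine squeeze_zero' (Eventually.of_forall fun _ => norm_nonneg _) ?_ hl
  filter_upwards [Metric.ball_mem_nhds x₀ one_pos] with x hx
  rw [mem_ball_iff_norm] at hx
  refine h x x₀ _ ?_ (by linarith)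
  have := norm_le_norm_add_norm_sub' x x₀
  linarith

variable (P) in
/-- The coefficient of the Duhamel term. -/
def cD : ℂ := -(Complex.I / ((P.lam : ℂ) + 1))

/-- `u` is a continuous solution of the integral equation with datum `x`. -/
structure IsMild (x : P.Space) (u : ℝ → P.Space) : Prop where
  continuous : Continuous u
  eq : ∀ t, u t = P.grp t x + P.cD • ∫ τ in (0 : ℝ)..t, P.grp (t - τ) (P.nonl (u τ))

theorem continuous_duhamel {u : ℝ → P.Space} (hu : Continuous u) (t : ℝ) :
    Continuous fun τ => P.grp (t - τ) (P.nonl (u τ)) :=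
  continuous_grp_comp (by fun_prop) (continuous_nonl.comp hu)

theorem duhamel_eq {h : ℝ → P.Space} {t : ℝ}
    (hh : IntervalIntegrable (fun τ => P.grp (-τ) (h τ)) volume 0 t) :
    ∫ τ in (0 : ℝ)..t, P.grp (t - τ) (h τ) = P.grp t (∫ τ in (0 : ℝ)..t, P.grp (-τ) (h τ)) := by
  rw [← ContinuousLinearMap.intervalIntegral_comp_comm _ hh]
  refine intervalIntegral.integral_congr fun τ _ => ?_
  rw [grp_grp, sub_eq_add_neg]

theorem IsMild.hasDerivAt {x : P.Space} {u : ℝ → P.Space} (h : IsMild x u) (t : ℝ) :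
    HasDerivAt (fun t => P.grp (-t) (u t))
      (P.cD • P.grp (-t) (P.nonl (P.grp t (P.grp (-t) (u t))))) t := by
  have hc : Continuous fun τ => P.grp (-τ) (P.nonl (u τ)) :=
    continuous_grp_comp continuous_neg (continuous_nonl.comp h.continuous)
  have e : (fun t => P.grp (-t) (u t)) =
      fun t => x + P.cD • ∫ τ in (0 : ℝ)..t, P.grp (-τ) (P.nonl (u τ)) := by
    funext t
    rw [h.eq t, duhamel_eq (hc.intervalIntegrable 0 t), map_add, map_smul, grp_grp, grp_grp,
      neg_add_cancel, grp_zero, grp_zero]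
  rw [e, grp_grp, add_neg_cancel, grp_zero]
  exact ((intervalIntegral.integral_hasDerivAt_right (hc.intervalIntegrable 0 t)
    (hc.stronglyMeasurableAtFilter _ _) hc.continuousAt).const_smul P.cD).const_add x

theorem IsMild.unique {x : P.Space} {u v : ℝ → P.Space} (hu : IsMild x u) (hv : IsMild x v) :
    u = v := by
  obtain ⟨C, hC, hN⟩ := P.exists_norm_nonl_sub_le
  have hB := one_le_chiB
  have key : ∀ t, P.grp (-t) (u t) = P.grp (-t) (v t) := by
    intro t₁
    set T := |t₁| + 1 with hT
    have hT0 : 0 ≤ T := by positivity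
    have hcu : Continuous fun t => P.grp (-t) (u t) := continuous_grp_comp continuous_neg hu.continuous
    have hcv : Continuous fun t => P.grp (-t) (v t) := continuous_grp_comp continuous_neg hv.continuous
    obtain ⟨M₁, hM₁⟩ := isCompact_Icc.exists_bound_of_continuousOn (s := Set.Icc (-T) T)
      hcu.continuousOn
    obtain ⟨M₂, hM₂⟩ := isCompact_Icc.exists_bound_of_continuousOn (s := Set.Icc (-T) T)
      hcv.continuousOn
    set M := max (max M₁ M₂) 0
    have hM0 : 0 ≤ M := le_max_right _ _
    set L := 6 * chiB * (1 + T)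
    have hL0 : 0 ≤ L := by positivity
    have hgrp : ∀ t ∈ Set.Ioo (-T) T, ∀ y : P.Space, ‖P.grp t y‖ ≤ L * ‖y‖ := by
      intro t ht y
      refine (norm_grp_le t y).trans ?_
      have := (abs_lt.2 ht).le
      exact mul_le_mul_of_nonneg_right
        (by change 6 * chiB * (1 + |t|) ≤ 6 * chiB * (1 + T); gcongr) (norm_nonneg y)
    have hgrp' : ∀ t ∈ Set.Ioo (-T) T, ∀ y : P.Space, ‖P.grp (-t) y‖ ≤ L * ‖y‖ := fun t ht =>
      hgrp (-t) ⟨by linarith [ht.2], by linarith [ht.1]⟩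
    have := ODE_solution_unique_of_mem_Ioo (a := -T) (b := T) (t₀ := 0)
      (v := fun t w => P.cD • P.grp (-t) (P.nonl (P.grp t w)))
      (s := fun _ => Metric.closedBall 0 M)
      (K := Real.toNNReal (‖P.cD‖ * (L * (C * ((L * M) ^ P.lam * L)))))
      (f := fun t => P.grp (-t) (u t)) (g := fun t => P.grp (-t) (v t)) ?_ ?_ ?_ ?_ ?_
    · exact this (abs_lt.1 (by rw [hT]; linarith))
    · intro t ht
      refine LipschitzOnWith.of_dist_le_mul fun y hy z hz => ?_
      rw [mem_closedBall_zero_iff] at hy hz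
      rw [Real.coe_toNNReal _ (by positivity), dist_eq_norm, dist_eq_norm, ← smul_sub, norm_smul,
        ← map_sub]
      calc _ ≤ ‖P.cD‖ * (L * ‖P.nonl (P.grp t y) - P.nonl (P.grp t z)‖) := by
            gcongr; exact hgrp' t ht _
        _ ≤ ‖P.cD‖ * (L * (C * ((L * M) ^ P.lam * ‖P.grp t y - P.grp t z‖))) := by
            gcongr
            refine hN _ _ _ ((hgrp t ht y).trans ?_) ((hgrp t ht z).trans ?_) <;> gcongr
        _ ≤ ‖P.cD‖ * (L * (C * ((L * M) ^ P.lam * (L * ‖y - z‖)))) := by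
            gcongr
            rw [← map_sub]; exact hgrp t ht _
        _ = _ := by ring
    · constructor <;> linarith [abs_nonneg t₁]
    · refine fun t ht => ⟨hu.hasDerivAt t, mem_closedBall_zero_iff.2 ?_⟩
      exact (hM₁ t (Set.Ioo_subset_Icc_self ht)).trans ((le_max_left _ _).trans (le_max_left _ _))
    · refine fun t ht => ⟨hv.hasDerivAt t, mem_closedBall_zero_iff.2 ?_⟩
      exact (hM₂ t (Set.Ioo_subset_Icc_self ht)).trans ((le_max_right _ _).trans (le_max_left _ _))
    · rw [hu.eq 0, hv.eq 0, intervalIntegral.integral_same, intervalIntegral.integral_same]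
  funext t
  have := congrArg (P.grp t) (key t)
  rwa [grp_grp, grp_grp, add_neg_cancel, grp_zero, grp_zero] at this

/-- A measurable solution coincides almost everywhere with a continuous one. -/
theorem exists_isMild_of_ae {x : P.Space} {v : ℝ → P.Space}
    (h : ∀ᵐ t : ℝ, IntervalIntegrable (fun τ => P.grp (t - τ) (P.nonl (v τ))) volume 0 t ∧
      v t = P.grp t x + P.cD • ∫ τ in (0 : ℝ)..t, P.grp (t - τ) (P.nonl (v τ))) :
    ∃ u, IsMild x u ∧ v =ᵐ[volume] u := by
  have hpull : ∀ t, IntervalIntegrable (fun τ => P.grp (t - τ) (P.nonl (v τ))) volume 0 t →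
      IntervalIntegrable (fun τ => P.grp (-τ) (P.nonl (v τ))) volume 0 t := by
    intro t ht
    have h1 : ∀ τ, P.grp (-τ) (P.nonl (v τ)) = P.grp (-t) (P.grp (t - τ) (P.nonl (v τ))) := by
      intro τ
      rw [grp_grp]
      congr 2
      ring
    simp only [h1]
    exact ⟨(P.grp (-t)).integrable_comp ht.1, (P.grp (-t)).integrable_comp ht.2⟩
  have hd := Measure.dense_of_ae h
  have hint0 : ∀ t, IntervalIntegrable (fun τ => P.grp (-τ) (P.nonl (v τ))) volume 0 t := by
    intro t
    rcases le_total 0 t with h0 | h0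
    · obtain ⟨t', ht', h1⟩ := hd.exists_between (show t < t + 1 by linarith)
      refine (hpull t' ht'.1).mono_set (Set.uIcc_subset_uIcc Set.left_mem_uIcc ?_)
      exact Set.mem_uIcc.2 (Or.inl ⟨h0, h1.1.le⟩)
    · obtain ⟨t', ht', h1⟩ := hd.exists_between (show t - 1 < t by linarith)
      refine (hpull t' ht'.1).mono_set (Set.uIcc_subset_uIcc Set.left_mem_uIcc ?_)
      exact Set.mem_uIcc.2 (Or.inr ⟨h1.2.le, h0⟩)
  have hint : ∀ a b, IntervalIntegrable (fun τ => P.grp (-τ) (P.nonl (v τ))) volume a b :=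
    fun a b => (hint0 a).symm.trans (hint0 b)
  set u : ℝ → P.Space := fun t =>
    P.grp t (x + P.cD • ∫ τ in (0 : ℝ)..t, P.grp (-τ) (P.nonl (v τ))) with hu
  have hvu : v =ᵐ[volume] u := by
    filter_upwards [h] with t ht
    rw [ht.2, duhamel_eq (hint0 t), hu]
    simp only [map_add, map_smul]
  refine ⟨u, ⟨?_, fun t => ?_⟩, hvu⟩
  · exact continuous_grp_comp continuous_id (continuous_const.add
      ((continuous_const_smul P.cD).comp (intervalIntegral.continuous_primitive hint 0)))
  · have e : ∫ τ in (0 : ℝ)..t, P.grp (t - τ) (P.nonl (u τ)) =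
        ∫ τ in (0 : ℝ)..t, P.grp (t - τ) (P.nonl (v τ)) := by
      refine intervalIntegral.integral_congr_ae ?_
      filter_upwards [hvu] with τ hτ _
      rw [hτ]
    rw [e, duhamel_eq (hint0 t), ← map_smul, ← map_add]

/-! ### Functions of time with values in the tempered distributions -/

open Classical in
variable (P) in
/-- The element of the space given by a distribution, and `0` if its norm is infinite. -/
def lift (T : 𝓢'(ℝ, ℂ)) : P.Space := if h : P.N T ≠ ⊤ then ofN T h else 0

theorem val_lift {T : 𝓢'(ℝ, ℂ)} (h : P.N T ≠ ⊤) : (P.lift T).val = T := by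
  rw [lift, dif_pos h, val_ofN]

theorem exists_of_measurable {u : ℝ → 𝓢'(ℝ, ℂ)} {μ : Measure ℝ}
    (h : ModStronglyMeasurable P.ρ P.s (ENNReal.ofReal P.p) P.q u μ) :
    AEStronglyMeasurable (fun t => P.lift (u t)) μ ∧ ∀ᵐ t ∂μ, (P.lift (u t)).val = u t := by
  obtain ⟨U, hU, hlim⟩ := h
  have hU' : ∀ n t, (P.lift (U n t)).val = U n t := fun n t => val_lift (hU n t).ne
  have hfin : ∀ᵐ t ∂μ, (P.lift (u t)).val = u t := by
    filter_upwards [hlim] with t ht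
    obtain ⟨n, hn⟩ := (ht.eventually_lt_const one_pos).exists
    refine val_lift ?_
    have h1 : P.N (u t) ≤ P.N (u t - U n t) + P.N (U n t) := by
      conv_lhs => rw [← sub_add_cancel (u t) (U n t)]
      exact P.N_add_le _ _
    exact ne_top_of_le_ne_top (ENNReal.add_ne_top.2
      ⟨(lt_of_lt_of_le hn le_top).ne, (hU n t).ne⟩) h1
  refine ⟨?_, hfin⟩
  refine aestronglyMeasurable_of_tendsto_ae atTop (f := fun n t => (U n).map P.lift t)
    (fun n => ((U n).map P.lift).aestronglyMeasurable) ?_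
  filter_upwards [hlim, hfin] with t ht hft
  rw [tendsto_iff_norm_sub_tendsto_zero]
  have e : ∀ n, ‖(U n).map P.lift t - P.lift (u t)‖ = (P.N (u t - U n t)).toReal := by
    intro n
    rw [norm_sub_rev, norm_def, map_sub, hft, SimpleFunc.map_apply, hU']
  simp only [e]
  have := (ENNReal.tendsto_toReal ENNReal.zero_ne_top).comp ht
  rwa [ENNReal.toReal_zero] at this

theorem measurable_val {u : ℝ → P.Space} {μ : Measure ℝ} (h : AEStronglyMeasurable u μ) :
    ModStronglyMeasurable P.ρ P.s (ENNReal.ofReal P.p) P.q (fun t => (u t).val) μ := by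
  refine ⟨fun n => (h.stronglyMeasurable_mk.approx n).map Space.val,
    fun n t => (Space.N_ne_top _).lt_top, ?_⟩
  filter_upwards [h.ae_eq_mk] with t ht
  have h1 := tendsto_iff_norm_sub_tendsto_zero.1 (h.stronglyMeasurable_mk.tendsto_approx t)
  have h2 := ENNReal.tendsto_ofReal h1
  rw [ENNReal.ofReal_zero] at h2
  refine h2.congr fun n => ?_
  rw [ofReal_norm, enorm_eq, map_sub, SimpleFunc.map_apply, ht]
  exact modNorm_sub_comm P.hq _ _

theorem timeNorm_val (u : ℝ → P.Space) (r : ℝ) :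
    timeNorm P.ρ r P.s (ENNReal.ofReal P.p) P.q (fun t => (u t).val) =
      (∫⁻ t, ‖u t‖ₑ ^ r) ^ (1 / r) := by
  simp only [enorm_eq]
  rfl

theorem modIntegrable_val {H : ℝ → P.Space} {a b : ℝ} (h : IntervalIntegrable H volume a b) :
    ModIntegrable P.ρ P.s (ENNReal.ofReal P.p) P.q (fun τ => (H τ).val) a b := by
  have h1 := intervalIntegrable_iff.1 h
  refine ⟨measurable_val h1.1, ?_⟩
  have h2 := h1.2
  rw [hasFiniteIntegral_iff_enorm] at h2
  refine lt_of_le_of_lt (le_of_eq (lintegral_congr fun τ => ?_)) h2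
  rw [enorm_eq]
  rfl

theorem eval_integral {H : ℝ → P.Space} {a b : ℝ} (h : IntervalIntegrable H volume a b)
    (f : 𝓢(ℝ, ℂ)) : (∫ τ in a..b, H τ).val f = ∫ τ in a..b, (H τ).val f :=
  ((P.eval f).intervalIntegral_comp_comm h).symm

theorem IsMild.isSolution {x : P.Space} {u : ℝ → P.Space} (h : IsMild x u) :
    IsSolution P.ρ P.s (ENNReal.ofReal P.p) P.q P.lam x.val fun t => (u t).val := by
  refine Eventually.of_forall fun t => ?_
  have hi := ((continuous_duhamel h.continuous t).intervalIntegrable (μ := volume) 0 t)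
  refine ⟨modIntegrable_val hi, fun f => ?_⟩
  have h1 := congrArg (fun y : P.Space => y.val f) (h.eq t)
  have h2 : (u t).val f = S t x.val f + P.cD * (∫ τ in (0 : ℝ)..t,
      P.grp (t - τ) (P.nonl (u τ))).val f := by
    refine h1.trans ?_
    simp only [map_add, map_smul]
    rfl
  rw [eval_integral hi] at h2
  rw [h2, cD, neg_mul, ← sub_eq_add_neg]
  rfl

theorem intervalIntegrable_lift {G : ℝ → 𝓢'(ℝ, ℂ)} {H : ℝ → P.Space} {a b : ℝ}
    (hG : ModIntegrable P.ρ P.s (ENNReal.ofReal P.p) P.q G a b) (h : ∀ᵐ τ, G τ = (H τ).val) :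
    IntervalIntegrable H volume a b := by
  have h' := ae_restrict_of_ae (s := Set.uIoc a b) h
  rw [intervalIntegrable_iff]
  refine ⟨(exists_of_measurable hG.measurable).1.congr ?_, ?_⟩
  · filter_upwards [h'] with τ hτ
    rw [hτ]
    exact Space.val_injective (val_lift (Space.N_ne_top _))
  · rw [hasFiniteIntegral_iff_enorm]
    have e : ∫⁻ τ in Set.uIoc a b, ‖H τ‖ₑ = ∫⁻ τ in Set.uIoc a b, P.N (G τ) := by
      refine lintegral_congr_ae ?_
      filter_upwards [h'] with τ hτ
      rw [hτ, enorm_eq]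
    rw [e]
    exact hG.finite

theorem eval_duhamel {v : ℝ → 𝓢'(ℝ, ℂ)} {G : ℝ → 𝓢'(ℝ, ℂ)} {H : ℝ → P.Space} {t : ℝ}
    {T : 𝓢'(ℝ, ℂ)} {x y : P.Space} (hi : IntervalIntegrable H volume 0 t)
    (h : ∀ᵐ τ, G τ = (H τ).val) (hy : y.val = v t) (hx : x.val = T)
    (he : ∀ f : 𝓢(ℝ, ℂ), v t f = T f - Complex.I / ((P.lam : ℂ) + 1) * ∫ τ in (0 : ℝ)..t, G τ f) :
    y = x + P.cD • ∫ τ in (0 : ℝ)..t, H τ := by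
  refine ext_eval fun f => ?_
  rw [map_add, map_smul, ← ContinuousLinearMap.intervalIntegral_comp_comm _ hi, eval_apply, hy,
    he f, cD, smul_eq_mul, eval_apply, hx]
  have e : ∫ τ in (0 : ℝ)..t, G τ f = ∫ τ in (0 : ℝ)..t, P.eval f (H τ) := by
    refine intervalIntegral.integral_congr_ae ?_
    filter_upwards [h] with τ hτ _
    rw [hτ, eval_apply]
  rw [e]
  ring

theorem exists_isMild_of_isSolution {x : P.Space} {v : ℝ → 𝓢'(ℝ, ℂ)}
    (hm : ModStronglyMeasurable P.ρ P.s (ENNReal.ofReal P.p) P.q v volume)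
    (h : IsSolution P.ρ P.s (ENNReal.ofReal P.p) P.q P.lam x.val v) :
    ∃ u, IsMild x u ∧ ∀ᵐ t, v t = (u t).val := by
  have h2 := (exists_of_measurable hm).2
  have hae : ∀ t, ∀ᵐ τ, duhamelIntegrand P.lam v t τ =
      (P.grp (t - τ) (P.nonl (P.lift (v τ)))).val := by
    intro t
    filter_upwards [h2] with τ hτ
    rw [val_grp, val_nonl, hτ, duhamelIntegrand]
  have h3 : ∀ᵐ t : ℝ, IntervalIntegrable (fun τ => P.grp (t - τ) (P.nonl (P.lift (v τ)))) volume
      0 t ∧ P.lift (v t) = P.grp t x +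
        P.cD • ∫ τ in (0 : ℝ)..t, P.grp (t - τ) (P.nonl (P.lift (v τ))) := by
    filter_upwards [h, h2] with t ht h2t
    have hi := intervalIntegrable_lift ht.1 (hae t)
    exact ⟨hi, eval_duhamel hi (hae t) h2t (val_grp t x) ht.2⟩
  obtain ⟨u, hu, hvu⟩ := exists_isMild_of_ae h3
  refine ⟨u, hu, ?_⟩
  filter_upwards [h2, hvu] with t h3 h4
  rw [← h3, ← h4]

end Par

namespace Par
variable {P : Par}

/-! ### The fixed point -/

variable (P) in
/-- The decay of the group. -/
def dk (t : ℝ) : ℝ≥0∞ := ENNReal.ofReal ((1 + |t|) ^ (-P.A))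

theorem measurable_dk : Measurable P.dk := by
  unfold dk
  fun_prop

theorem lintegral_decay_lt_top {a m : ℝ} (hm : 0 < m) (h : 1 < a * m) :
    ∫⁻ t : ℝ, ENNReal.ofReal ((1 + |t|) ^ (-a)) ^ m < ⊤ := by
  have h1 := finite_integral_one_add_norm (E := ℝ) (μ := volume) (r := a * m) (by simpa using h)
  refine lt_of_le_of_lt (le_of_eq (lintegral_congr fun t => ?_)) h1
  rw [ENNReal.ofReal_rpow_of_nonneg (by positivity) hm.le, ← Real.rpow_mul (by positivity),
    Real.norm_eq_abs, neg_mul]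

/-- The Duhamel term. -/
def duh (u : ℝ → P.Space) (t : ℝ) : P.Space :=
  P.cD • ∫ τ in (0 : ℝ)..t, P.grp (t - τ) (P.nonl (u τ))

theorem norm_cD_le : ‖P.cD‖ ≤ 1 := by
  rw [cD, norm_neg, norm_div, Complex.norm_I, div_le_one₀]
  · have : ((P.lam : ℂ) + 1) = ((P.lam + 1 : ℝ) : ℂ) := by push_cast; rfl
    rw [this, Complex.norm_real, Real.norm_eq_abs]
    exact le_trans (by simp) (le_abs_self _)
  · rw [norm_pos_iff]
    exact_mod_cast P.lam.succ_ne_zero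

theorem continuous_duh {u : ℝ → P.Space} (hu : Continuous u) : Continuous (duh u) := by
  have hc : Continuous fun τ => P.grp (-τ) (P.nonl (u τ)) :=
    continuous_grp_comp continuous_neg (continuous_nonl.comp hu)
  have e : duh u = fun t => P.cD • P.grp t (∫ τ in (0 : ℝ)..t, P.grp (-τ) (P.nonl (u τ))) := by
    funext t
    rw [duh, duhamel_eq (hc.intervalIntegrable 0 t)]
  rw [e]
  exact (continuous_const_smul P.cD).comp (continuous_grp_comp continuous_id
    (intervalIntegral.continuous_primitive (fun a b => hc.intervalIntegrable a b) 0))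

variable (P) in
theorem exists_enorm_duh_sub_le : ∃ C : ℝ, 0 < C ∧ ∀ (u v : ℝ → P.Space), Continuous u →
    Continuous v → ∀ t, ‖duh u t - duh v t‖ₑ ≤ ENNReal.ofReal C *
      ∫⁻ τ, P.dk (t - τ) * ((‖u τ‖ₑ ^ P.lam + ‖v τ‖ₑ ^ P.lam) * ‖u τ - v τ‖ₑ) := by
  obtain ⟨C, hC, h⟩ := P.exists_norm_grp_nonl_sub_le
  refine ⟨C, hC, fun u v hu hv t => ?_⟩
  have hui := (continuous_duhamel hu t).intervalIntegrable (μ := volume) 0 t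
  have hvi := (continuous_duhamel hv t).intervalIntegrable (μ := volume) 0 t
  rw [duh, duh, ← smul_sub, ← intervalIntegral.integral_sub hui hvi, enorm_smul]
  have h1 : ‖P.cD‖ₑ ≤ 1 := by
    rw [← ofReal_norm, ← ENNReal.ofReal_one]
    exact ENNReal.ofReal_le_ofReal norm_cD_le
  have h2 : ‖∫ τ in (0 : ℝ)..t, (P.grp (t - τ) (P.nonl (u τ)) - P.grp (t - τ) (P.nonl (v τ)))‖ₑ ≤
      ∫⁻ τ in Set.uIoc 0 t, ‖P.grp (t - τ) (P.nonl (u τ)) - P.grp (t - τ) (P.nonl (v τ))‖ₑ := by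
    rw [← ofReal_norm, intervalIntegral.norm_intervalIntegral_eq, ofReal_norm]
    exact enorm_integral_le_lintegral_enorm _
  refine (mul_le_mul' h1 (h2.trans (setLIntegral_le_lintegral _ _))).trans ?_
  rw [one_mul, ← lintegral_const_mul' _ _ ENNReal.ofReal_ne_top]
  refine lintegral_mono fun τ => ?_
  have h3 := h (t - τ) (u τ) (v τ) (max ‖u τ‖ ‖v τ‖) (le_max_left _ _) (le_max_right _ _)
  rw [map_sub] at h3
  have h4 : (max ‖u τ‖ ‖v τ‖) ^ P.lam ≤ ‖u τ‖ ^ P.lam + ‖v τ‖ ^ P.lam := by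
    rcases le_total ‖u τ‖ ‖v τ‖ with h | h
    · rw [max_eq_right h]; exact le_add_of_nonneg_left (by positivity)
    · rw [max_eq_left h]; exact le_add_of_nonneg_right (by positivity)
  rw [← ofReal_norm, ← ofReal_norm, ← ofReal_norm, ← ofReal_norm, dk,
    ← ENNReal.ofReal_pow (norm_nonneg _), ← ENNReal.ofReal_pow (norm_nonneg _),
    ← ENNReal.ofReal_add (by positivity) (by positivity), ← ENNReal.ofReal_mul (by positivity),
    ← ENNReal.ofReal_mul (by positivity), ← ENNReal.ofReal_mul hC.le]
  refine ENNReal.ofReal_le_ofReal (h3.trans ?_)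
  rw [mul_assoc]
  gcongr

theorem duh_zero (t : ℝ) : duh (fun _ => (0 : P.Space)) t = 0 := by
  simp [duh, nonl_zero]

variable (P) in
theorem exists_enorm_duh_le : ∃ C : ℝ, 0 < C ∧ ∀ u : ℝ → P.Space, Continuous u →
    ∀ t, ‖duh u t‖ₑ ≤ ENNReal.ofReal C * ∫⁻ τ, P.dk (t - τ) * ‖u τ‖ₑ ^ (P.lam + 1) := by
  obtain ⟨C, hC, h⟩ := P.exists_enorm_duh_sub_le
  refine ⟨C, hC, fun u hu t => ?_⟩
  have := h u (fun _ => 0) hu continuous_const t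
  have hl : P.lam ≠ 0 := by have := P.hlam; omega
  simpa [duh_zero, hl, pow_succ] using this

variable (P) in
/-- The norm of `L^r(ℝ; E)`. -/
def tn (r : ℝ) (u : ℝ → P.Space) : ℝ≥0∞ := (∫⁻ t, ‖u t‖ₑ ^ r) ^ (1 / r)

theorem rpow_tn {r : ℝ} (hr : 0 < r) (u : ℝ → P.Space) : P.tn r u ^ r = ∫⁻ t, ‖u t‖ₑ ^ r := by
  rw [tn, ← ENNReal.rpow_mul, one_div_mul_cancel hr.ne', ENNReal.rpow_one]

variable (P) in
/-- The norm of the decay in `L^m(ℝ)`. -/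
def dn (m : ℝ) : ℝ≥0∞ := (∫⁻ t, P.dk t ^ m) ^ (1 / m)

theorem dn_ne_top {m : ℝ} (hm : 0 < m) (h : 1 < P.A * m) : P.dn m ≠ ⊤ :=
  ENNReal.rpow_ne_top_of_nonneg (by positivity) (lintegral_decay_lt_top hm h).ne

theorem lintegral_dk_mul_le {r m : ℝ} (hr : P.lam < r) (hm : 0 < m) (h : 1 / m = 1 - P.lam / r)
    {u : ℝ → P.Space} (hu : Continuous u) (t : ℝ) :
    ∫⁻ τ, P.dk (t - τ) * ‖u τ‖ₑ ^ P.lam ≤ P.dn m * P.tn r u ^ P.lam := by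
  have hl := P.one_le_lam
  have hr0 : 0 < r := by linarith
  have hconj : m.HolderConjugate (r / P.lam) := by
    rw [Real.holderConjugate_iff]
    constructor
    · have h1 : 1 / m < 1 := by rw [h]; linarith [show 0 < (P.lam : ℝ) / r by positivity]
      rwa [div_lt_one hm] at h1
    · rw [← one_div, h, inv_div]; ring
  have h1 := ENNReal.lintegral_mul_le_Lp_mul_Lq volume hconj
    (f := fun τ => P.dk (t - τ)) (g := fun τ => ‖u τ‖ₑ ^ P.lam)
    (measurable_dk.comp (measurable_const.sub measurable_id)).aemeasurable
    (hu.enorm.measurable.pow_const _).aemeasurable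
  refine h1.trans (mul_le_mul' (le_of_eq ?_) (le_of_eq ?_))
  · rw [lintegral_sub_left_eq_self (fun τ => P.dk τ ^ m) t, dn]
  · rw [tn, ← ENNReal.rpow_natCast _ P.lam, ← ENNReal.rpow_mul]
    congr 1
    · refine lintegral_congr fun τ => ?_
      rw [← ENNReal.rpow_natCast, ← ENNReal.rpow_mul]
      congr 1
      field_simp
    · rw [one_div_div]; ring

theorem tn_conv_le {r a b : ℝ} (ha : 0 < a) (hb : 0 < b) (har : a ≤ r) (hbr : b ≤ r)
    (h : 1 + 1 / r = 1 / a + 1 / b) {u : ℝ → P.Space} (hu : Continuous u) :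
    (∫⁻ t, (∫⁻ τ, P.dk (t - τ) * ‖u τ‖ₑ ^ (P.lam + 1)) ^ r) ^ (1 / r) ≤
      P.dn a * P.tn ((P.lam + 1) * b) u ^ (P.lam + 1) := by
  have h1 := lintegral_conv_rpow_le volume (f := P.dk) (g := fun τ => ‖u τ‖ₑ ^ (P.lam + 1))
    measurable_dk (hu.enorm.measurable.pow_const _) ha hb har hbr h
  refine h1.trans (mul_le_mul' le_rfl (le_of_eq ?_))
  rw [tn, ← ENNReal.rpow_natCast _ (P.lam + 1), ← ENNReal.rpow_mul]
  congr 1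
  · refine lintegral_congr fun τ => ?_
    rw [← ENNReal.rpow_natCast, ← ENNReal.rpow_mul]
    push_cast
    rfl
  · push_cast
    field_simp

theorem tn_duh_le {C r a b : ℝ} (hC : ∀ u : ℝ → P.Space, Continuous u →
    ∀ t, ‖duh u t‖ₑ ≤ ENNReal.ofReal C * ∫⁻ τ, P.dk (t - τ) * ‖u τ‖ₑ ^ (P.lam + 1))
    (ha : 0 < a) (hb : 0 < b) (har : a ≤ r) (hbr : b ≤ r)
    (h : 1 + 1 / r = 1 / a + 1 / b) {u : ℝ → P.Space} (hu : Continuous u) :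
    P.tn r (duh u) ≤ ENNReal.ofReal C * (P.dn a * P.tn ((P.lam + 1) * b) u ^ (P.lam + 1)) := by
  have hr : 0 < r := ha.trans_le har
  calc P.tn r (duh u) ≤ (∫⁻ t, (ENNReal.ofReal C *
        ∫⁻ τ, P.dk (t - τ) * ‖u τ‖ₑ ^ (P.lam + 1)) ^ r) ^ (1 / r) := by
        unfold tn
        gcongr with t
        exact hC u hu t
    _ = ENNReal.ofReal C * (∫⁻ t, (∫⁻ τ, P.dk (t - τ) * ‖u τ‖ₑ ^ (P.lam + 1)) ^ r) ^ (1 / r) := by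
        simp only [ENNReal.mul_rpow_of_nonneg _ _ hr.le]
        rw [lintegral_const_mul' _ _ (ENNReal.rpow_ne_top_of_nonneg hr.le ENNReal.ofReal_ne_top),
          ENNReal.mul_rpow_of_nonneg _ _ (by positivity), ← ENNReal.rpow_mul,
          mul_one_div_cancel hr.ne', ENNReal.rpow_one]
    _ ≤ _ := by
        gcongr
        exact tn_conv_le ha hb har hbr h hu

theorem tn_add_le {r : ℝ} (hr : 1 ≤ r) {u v : ℝ → P.Space} (hu : Continuous u)
    (hv : Continuous v) : P.tn r (fun t => u t + v t) ≤ P.tn r u + P.tn r v := by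
  refine le_trans ?_ (ENNReal.lintegral_Lp_add_le hu.enorm.measurable.aemeasurable
    hv.enorm.measurable.aemeasurable hr)
  unfold tn
  gcongr with t
  exact enorm_add_le _ _

open BoundedContinuousFunction in
theorem isClosed_tn_le {r : ℝ} (hr : 0 < r) (c : ℝ≥0∞) :
    IsClosed {u : ℝ →ᵇ P.Space | P.tn r u ≤ c} := by
  refine IsSeqClosed.isClosed fun u v hu huv => ?_
  have hpt : ∀ t, Tendsto (fun n => ‖u n t‖ₑ ^ r) atTop (𝓝 (‖v t‖ₑ ^ r)) := fun t =>
    (ENNReal.continuous_rpow_const.tendsto _).comp ((continuous_enorm.tendsto _).comp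
      (((continuous_eval_const t).tendsto v).comp huv))
  have h1 : ∫⁻ t, ‖v t‖ₑ ^ r ≤ c ^ r := by
    calc ∫⁻ t, ‖v t‖ₑ ^ r = ∫⁻ t, liminf (fun n => ‖u n t‖ₑ ^ r) atTop :=
          lintegral_congr fun t => (hpt t).liminf_eq.symm
      _ ≤ liminf (fun n => ∫⁻ t, ‖u n t‖ₑ ^ r) atTop :=
          lintegral_liminf_le fun n => (u n).continuous.enorm.measurable.pow_const _
      _ ≤ liminf (fun _ : ℕ => c ^ r) atTop := by
          refine liminf_le_liminf (Eventually.of_forall fun n => ?_)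
          simp only [← rpow_tn hr]
          exact ENNReal.rpow_le_rpow (hu n) hr.le
      _ = c ^ r := by simp
  have h2 := ENNReal.rpow_le_rpow h1 (z := 1 / r) (by positivity)
  rwa [← ENNReal.rpow_mul, mul_one_div_cancel hr.ne', ENNReal.rpow_one] at h2

open BoundedContinuousFunction in
variable (P) in
theorem exists_isMild_of_small {r m : ℝ} (hr : P.lam + 1 ≤ r) (hm : 0 < m)
    (hmr : 1 / m = 1 - P.lam / r) (hA : 1 < P.A * m) :
    ∃ d : ℝ, 0 < d ∧ ∀ (x : P.Space) (K : Set P.Space), IsClosed K → 0 ∈ K →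
      (∀ u : ℝ → P.Space, Continuous u → (∀ t, u t ∈ K) → ∀ t, P.grp t x + duh u t ∈ K) →
      (∀ t, ‖P.grp t x‖ ≤ d / 2) → P.tn r (fun t => P.grp t x) ≤ ENNReal.ofReal (d / 2) →
      ∃ u, IsMild x u ∧ (∀ t, ‖u t‖ ≤ d) ∧ P.tn r u ≤ ENNReal.ofReal d ∧ ∀ t, u t ∈ K := by
  have hl := P.one_le_lam
  have hr0 : 0 < r := by linarith
  obtain ⟨C, hC, hsub⟩ := P.exists_enorm_duh_sub_le
  have hdn := dn_ne_top hm hA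
  set Q : ℝ := C * (P.dn m).toReal with hQ
  have hQ0 : 0 ≤ Q := by positivity
  set d : ℝ := 1 / (4 * (Q + 1)) with hd
  have hd0 : 0 < d := by positivity
  have hd1 : d ≤ 1 := by
    rw [hd, div_le_one (by positivity)]; linarith
  have hdl : d ^ P.lam ≤ d := pow_le_of_le_one hd0.le hd1 (by have := P.hlam; omega)
  have hQd : Q * d ^ P.lam ≤ 1 / 4 := by
    refine (mul_le_mul_of_nonneg_left hdl hQ0).trans ?_
    rw [hd, mul_one_div, div_le_iff₀ (by positivity)]
    linarith
  have hQE : ENNReal.ofReal C * P.dn m = ENNReal.ofReal Q := by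
    rw [hQ, ENNReal.ofReal_mul hC.le, ENNReal.ofReal_toReal hdn]
  have hdiff : ∀ u v : ℝ → P.Space, Continuous u → Continuous v → P.tn r u ≤ ENNReal.ofReal d →
      P.tn r v ≤ ENNReal.ofReal d → ∀ δ : ℝ, 0 ≤ δ → (∀ t, ‖u t - v t‖ ≤ δ) →
      ∀ t, ‖duh u t - duh v t‖ ≤ 2 * (Q * d ^ P.lam) * δ := by
    intro u v hu hv hud hvd δ hδ huv t
    have h1 : ‖duh u t - duh v t‖ₑ ≤ ENNReal.ofReal (2 * (Q * d ^ P.lam) * δ) := by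
      refine (hsub u v hu hv t).trans ?_
      calc _ ≤ ENNReal.ofReal C * ∫⁻ τ, (P.dk (t - τ) * ‖u τ‖ₑ ^ P.lam +
            P.dk (t - τ) * ‖v τ‖ₑ ^ P.lam) * ENNReal.ofReal δ := by
            refine mul_le_mul_right (lintegral_mono fun τ => ?_) _
            rw [← mul_add, mul_assoc]
            refine mul_le_mul_right (mul_le_mul_right ?_ _) _
            rw [← ofReal_norm]
            exact ENNReal.ofReal_le_ofReal (huv τ)
        _ = ENNReal.ofReal C * ((∫⁻ τ, P.dk (t - τ) * ‖u τ‖ₑ ^ P.lam) +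
            ∫⁻ τ, P.dk (t - τ) * ‖v τ‖ₑ ^ P.lam) * ENNReal.ofReal δ := by
            have hmeas : Measurable fun τ => P.dk (t - τ) * ‖u τ‖ₑ ^ P.lam :=
              (measurable_dk.comp (measurable_const.sub measurable_id)).mul
                (hu.enorm.measurable.pow_const _)
            rw [lintegral_mul_const' _ _ ENNReal.ofReal_ne_top, lintegral_add_left hmeas, mul_assoc]
        _ ≤ ENNReal.ofReal C * (P.dn m * ENNReal.ofReal d ^ P.lam +
            P.dn m * ENNReal.ofReal d ^ P.lam) * ENNReal.ofReal δ := by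
            gcongr
            · exact (lintegral_dk_mul_le (by linarith) hm hmr hu t).trans (by gcongr)
            · exact (lintegral_dk_mul_le (by linarith) hm hmr hv t).trans (by gcongr)
        _ = 2 * ((ENNReal.ofReal C * P.dn m) * ENNReal.ofReal d ^ P.lam) * ENNReal.ofReal δ := by
            ring
        _ = _ := by
            rw [hQE, ← ENNReal.ofReal_pow hd0.le, ← ENNReal.ofReal_mul hQ0,
              ← ENNReal.ofReal_ofNat 2, ← ENNReal.ofReal_mul (by norm_num),
              ← ENNReal.ofReal_mul (by positivity)]
    rw [← ofReal_norm, ENNReal.ofReal_le_ofReal_iff (by positivity)] at h1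
    exact h1
  have htn0 : P.tn r (fun _ => 0) ≤ ENNReal.ofReal d := by simp [tn, hr0]
  have hsup : ∀ u : ℝ → P.Space, Continuous u → P.tn r u ≤ ENNReal.ofReal d → (∀ t, ‖u t‖ ≤ d) →
      ∀ t, ‖duh u t‖ ≤ d / 2 := by
    intro u hu hud hus t
    have h1 := hdiff u (fun _ => 0) hu continuous_const hud htn0 d hd0.le
      (by simpa using hus) t
    rw [duh_zero, sub_zero] at h1
    refine h1.trans ?_
    nlinarith
  have htn : ∀ u : ℝ → P.Space, Continuous u → P.tn r u ≤ ENNReal.ofReal d →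
      P.tn r (duh u) ≤ ENNReal.ofReal (d / 2) := by
    intro u hu hud
    have hdu : ∀ u : ℝ → P.Space, Continuous u →
        ∀ t, ‖duh u t‖ₑ ≤ ENNReal.ofReal C * ∫⁻ τ, P.dk (t - τ) * ‖u τ‖ₑ ^ (P.lam + 1) := by
      intro u hu t
      have := hsub u (fun _ => 0) hu continuous_const t
      have hl : P.lam ≠ 0 := by have := P.hlam; omega
      simpa [duh_zero, hl, pow_succ] using this
    have hmr' : m ≤ r := by
      have h1 : 1 / r ≤ 1 / m := by
        rw [hmr, le_sub_iff_add_le, ← add_div, div_le_one hr0]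
        linarith
      exact (one_div_le_one_div hr0 hm).1 h1
    have h1 := tn_duh_le hdu hm (b := r / (P.lam + 1)) (by positivity) hmr'
      (div_le_self hr0.le (by linarith)) (by rw [hmr, one_div_div]; field_simp; ring) hu
    rw [mul_div_cancel₀ _ (by positivity : (P.lam : ℝ) + 1 ≠ 0)] at h1
    refine h1.trans ?_
    calc _ ≤ ENNReal.ofReal C * (P.dn m * ENNReal.ofReal d ^ (P.lam + 1)) := by gcongr
      _ = ENNReal.ofReal (Q * d ^ P.lam * d) := by
          rw [← mul_assoc, hQE, ← ENNReal.ofReal_pow hd0.le, ← ENNReal.ofReal_mul hQ0, pow_succ,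
            ← mul_assoc Q]
      _ ≤ _ := ENNReal.ofReal_le_ofReal (by nlinarith)
  refine ⟨d, hd0, fun x K hK hK0 hKΦ hF hFr => ?_⟩
  have hcF : Continuous fun t => P.grp t x := continuous_grp_comp continuous_id continuous_const
  let X : Set (ℝ →ᵇ P.Space) := {u | P.tn r u ≤ ENNReal.ofReal d} ∩ {u | ‖u‖ ≤ d} ∩
    {u | ∀ t, u t ∈ K}
  have hXc : IsClosed X := by
    refine ((isClosed_tn_le hr0 _).inter (isClosed_le continuous_norm continuous_const)).inter ?_
    simp only [Set.ofPred_forall]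
    exact isClosed_iInter fun t => hK.preimage (continuous_eval_const t)
  have hΦb : ∀ u ∈ X, ∀ t, ‖P.grp t x + duh u t‖ ≤ d := by
    intro u hu t
    have h1 := hsup u u.continuous hu.1.1 (fun t => (u.norm_coe_le_norm t).trans hu.1.2) t
    exact (norm_add_le _ _).trans (by linarith [hF t])
  let Φ : X → X := fun u => ⟨BoundedContinuousFunction.ofNormedAddCommGroup
    (fun t => P.grp t x + duh u.1 t) (hcF.add (continuous_duh u.1.continuous)) d (hΦb u.1 u.2),
    ⟨by
      refine (tn_add_le (by linarith) hcF (continuous_duh u.1.continuous)).trans ?_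
      refine (add_le_add hFr (htn u.1 u.1.continuous u.2.1.1)).trans_eq ?_
      rw [← ENNReal.ofReal_add (by positivity) (by positivity), add_halves],
    BoundedContinuousFunction.norm_ofNormedAddCommGroup_le _ hd0.le _⟩,
    hKΦ u.1 u.1.continuous u.2.2⟩
  have hΦc : ContractingWith (1 / 2) Φ := by
    refine ⟨by rw [← NNReal.coe_lt_coe]; norm_num, LipschitzWith.of_dist_le_mul fun u v => ?_⟩
    rw [Subtype.dist_eq, Subtype.dist_eq]
    refine (BoundedContinuousFunction.dist_le (by positivity)).2 fun t => ?_
    have h1 := hdiff u.1 v.1 u.1.continuous v.1.continuous u.2.1.1 v.2.1.1 (dist u.1 v.1)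
      dist_nonneg (fun t => by
        rw [← dist_eq_norm]; exact BoundedContinuousFunction.dist_coe_le_dist t) t
    change dist (P.grp t x + duh u.1 t) (P.grp t x + duh v.1 t) ≤ _
    rw [dist_add_left, dist_eq_norm]
    refine h1.trans ?_
    have : (0 : ℝ) ≤ dist u.1 v.1 := dist_nonneg
    have h2 : ((1 / 2 : NNReal) : ℝ) = 1 / 2 := by norm_num
    rw [h2]
    nlinarith
  have : CompleteSpace X := hXc.completeSpace_coe
  have : Nonempty X := ⟨⟨0, ⟨htn0, by simpa using hd0.le⟩, fun _ => hK0⟩⟩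
  obtain ⟨u, hu⟩ : ∃ u : X, Φ u = u := ⟨_, hΦc.fixedPoint_isFixedPt⟩
  refine ⟨u.1, ⟨u.1.continuous, fun t => ?_⟩,
    fun t => (u.1.norm_coe_le_norm t).trans u.2.1.2, u.2.1.1, u.2.2⟩
  have h1 := congrArg (fun w : X => w.1 t) hu
  exact h1.symm

end Par

/-! ### Localised estimates for the free flow -/

theorem eLpNorm_fourier_two (f : 𝓢(ℝ, ℂ)) : eLpNorm (𝓕 f : 𝓢(ℝ, ℂ)) 2 volume = eLpNorm f 2 volume := by
  have h := SchwartzMap.norm_fourier_toL2_eq f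
  rw [SchwartzMap.norm_toLp, SchwartzMap.norm_toLp] at h
  exact (ENNReal.toReal_eq_toReal_iff' (eLpNorm_schwartz_ne_top _ _)
    (eLpNorm_schwartz_ne_top _ _)).1 h

theorem fourierInv_apply_eq_fourier (h : 𝓢(ℝ, ℂ)) (y : ℝ) : 𝓕⁻ h y = 𝓕 h (-y) := by
  rw [SchwartzMap.fourierInv_coe, SchwartzMap.fourier_coe, Real.fourierInv_eq_fourier_neg]

theorem fourier_fourier_apply (h : 𝓢(ℝ, ℂ)) (y : ℝ) : 𝓕 (𝓕 h) y = h (-y) := by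
  have := fourierInv_apply_eq_fourier (𝓕 h) (-y)
  rw [FourierTransform.fourierInv_fourier_eq, neg_neg] at this
  exact this.symm

theorem TG.comp_neg {m : ℝ → ℂ} (hm : TG m) : TG fun ξ => m (-ξ) := by
  have h1 : (fun ξ : ℝ => -ξ).HasTemperateGrowth := by fun_prop
  have h2 := Function.HasTemperateGrowth.comp hm h1
  unfold TG
  convert h2 using 2 with ξ
  simp

theorem mulT_eq {m : ℝ → ℂ} (hm : TG m) (f : 𝓢(ℝ, ℂ)) : mulT m f = mulS (fun ξ => m (-ξ)) f := by
  refine schwartz_ext_fourier fun ξ => ?_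
  rw [fourier_mulS hm.comp_neg, mulT, fourier_fourier_apply,
    SchwartzMap.smulLeftCLM_apply_apply hm, smul_eq_mul, fourierInv_apply_eq_fourier, neg_neg,
    mul_neg]

/-- Multiplication by `x - c`. -/
def mulX (c : ℝ) : 𝓢(ℝ, ℂ) →L[ℂ] 𝓢(ℝ, ℂ) :=
  SchwartzMap.smulLeftCLM ℂ fun x : ℝ => ((x - c : ℝ) : ℂ)

theorem mulX_apply (c : ℝ) (f : 𝓢(ℝ, ℂ)) (x : ℝ) : mulX c f x = ((x - c : ℝ) : ℂ) * f x := by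
  have h1 : (fun x : ℝ => x - c).HasTemperateGrowth := by fun_prop
  exact SchwartzMap.smulLeftCLM_apply_apply
    (Function.Complex.hasTemperateGrowth_ofReal.comp h1) f x

theorem hasDerivAt_fourier_schwartz (f : 𝓢(ℝ, ℂ)) (ξ : ℝ) :
    HasDerivAt (fun ξ => 𝓕 f ξ) (-2 * Real.pi * Complex.I * 𝓕 (mulX 0 f) ξ) ξ := by
  have h2 : ∀ x : ℝ, mulX 0 f x = x • f x := fun x => by
    rw [mulX_apply, sub_zero, Complex.real_smul]
  have h := Real.hasDerivAt_fourier (f := f) f.integrable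
    (by simpa only [← h2] using (mulX 0 f).integrable) ξ
  have e : 𝓕 (fun x : ℝ => (-2 * Real.pi * Complex.I * x) • f x) ξ =
      -2 * Real.pi * Complex.I * 𝓕 (mulX 0 f) ξ := by
    rw [SchwartzMap.fourier_coe]
    simp only [Real.fourier_real_eq_integral_exp_smul]
    rw [← integral_const_mul]
    refine integral_congr_ae (Eventually.of_forall fun x => ?_)
    simp only [h2, smul_eq_mul, Complex.real_smul]
    ring
  rw [e] at h
  exact h

theorem mulX_eq (c : ℝ) (f : 𝓢(ℝ, ℂ)) : mulX c f = mulX 0 f - (c : ℂ) • f := by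
  ext x
  rw [sub_apply, smul_apply, mulX_apply, mulX_apply, smul_eq_mul]
  push_cast
  ring

theorem fourier_mulX_mulS {m : ℝ → ℂ} (hm : TG m) {m' : ℝ → ℂ} (hm' : ∀ ξ, HasDerivAt m (m' ξ) ξ)
    (c : ℝ) (f : 𝓢(ℝ, ℂ)) (ξ : ℝ) : 𝓕 (mulX c (mulS m f)) ξ =
      Complex.I * m' (2 * Real.pi * ξ) * 𝓕 f ξ + m (2 * Real.pi * ξ) * 𝓕 (mulX c f) ξ := by
  have hlin : ∀ g : 𝓢(ℝ, ℂ), 𝓕 (mulX c g) ξ = 𝓕 (mulX 0 g) ξ - c * 𝓕 g ξ := by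
    intro g
    have : 𝓕 (mulX c g) = 𝓕 (mulX 0 g) - (c : ℂ) • 𝓕 g := by
      rw [mulX_eq, sub_eq_add_neg, FourierTransform.fourier_add, FourierTransform.fourier_neg,
        FourierTransform.fourier_smul, ← sub_eq_add_neg]
    rw [this, sub_apply, smul_apply, smul_eq_mul]
  have h1 := hasDerivAt_fourier_schwartz (mulS m f) ξ
  have h2 : HasDerivAt (fun ξ : ℝ => m (2 * Real.pi * ξ)) (m' (2 * Real.pi * ξ) * (2 * Real.pi)) ξ := by
    have := (hm' (2 * Real.pi * ξ)).scomp ξ ((hasDerivAt_id ξ).const_mul (2 * Real.pi))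
    rw [mul_one, show (2 * Real.pi : ℝ) • m' (2 * Real.pi * ξ) =
      m' (2 * Real.pi * ξ) * (2 * Real.pi) by rw [Complex.real_smul]; push_cast; ring] at this
    exact this
  have h3 := h2.mul (hasDerivAt_fourier_schwartz f ξ)
  have h4 : (fun ξ => 𝓕 (mulS m f) ξ) = fun ξ => m (2 * Real.pi * ξ) * 𝓕 f ξ :=
    funext fun ξ => fourier_mulS hm f ξ
  rw [h4] at h1
  have h5 := h1.unique h3
  have hpi : (-2 * Real.pi * Complex.I : ℂ) ≠ 0 := by
    simp [Real.pi_ne_zero]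
  have h6 : 𝓕 (mulX 0 (mulS m f)) ξ = Complex.I * m' (2 * Real.pi * ξ) * 𝓕 f ξ +
      m (2 * Real.pi * ξ) * 𝓕 (mulX 0 f) ξ := by
    refine mul_left_cancel₀ hpi (h5.trans ?_)
    linear_combination (2 * Real.pi * m' (2 * Real.pi * ξ) * 𝓕 f ξ) * Complex.I_mul_I
  rw [hlin, hlin, h6, fourier_mulS hm]
  ring

theorem eLpNorm_mulS_two_le {m : ℝ → ℂ} (hm : TG m) (h : ∀ ξ, ‖m ξ‖ ≤ 1) (f : 𝓢(ℝ, ℂ)) :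
    eLpNorm (mulS m f) 2 volume ≤ eLpNorm f 2 volume := by
  rw [← eLpNorm_fourier_two, ← eLpNorm_fourier_two f]
  refine eLpNorm_mono fun ξ => ?_
  rw [fourier_mulS hm, norm_mul]
  exact mul_le_of_le_one_left (norm_nonneg _) (h _)

theorem eLpNorm_mulX_mulS_le {m : ℝ → ℂ} (hm : TG m) (h : ∀ ξ, ‖m ξ‖ ≤ 1) {m' : ℝ → ℂ}
    (hm' : ∀ ξ, HasDerivAt m (m' ξ) ξ) {M : ℝ} (hM : ∀ ξ, ‖m' ξ‖ ≤ M) (c : ℝ) (f : 𝓢(ℝ, ℂ)) :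
    eLpNorm (mulX c (mulS m f)) 2 volume ≤
      eLpNorm (mulX c f) 2 volume + ENNReal.ofReal M * eLpNorm f 2 volume := by
  have hM0 : 0 ≤ M := (norm_nonneg _).trans (hM 0)
  rw [← eLpNorm_fourier_two, ← eLpNorm_fourier_two f, ← eLpNorm_fourier_two (mulX c f)]
  calc eLpNorm (𝓕 (mulX c (mulS m f)) : 𝓢(ℝ, ℂ)) 2 volume
      ≤ eLpNorm ((fun ξ => ‖𝓕 (mulX c f) ξ‖) + fun ξ => M * ‖𝓕 f ξ‖) 2 volume := by
        refine eLpNorm_mono_real fun ξ => ?_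
        rw [fourier_mulX_mulS hm hm']
        refine (norm_add_le _ _).trans ?_
        rw [norm_mul, norm_mul, norm_mul, Complex.norm_I, one_mul, add_comm, Pi.add_apply]
        refine add_le_add (mul_le_of_le_one_left (norm_nonneg _) (h _)) ?_
        gcongr
        exact hM _
    _ ≤ eLpNorm (fun ξ => ‖𝓕 (mulX c f) ξ‖) 2 volume + eLpNorm (fun ξ => M * ‖𝓕 f ξ‖) 2 volume :=
        eLpNorm_add_le (𝓕 (mulX c f) : 𝓢(ℝ, ℂ)).continuous.norm.aestronglyMeasurable
          (continuous_const.mul (𝓕 f : 𝓢(ℝ, ℂ)).continuous.norm).aestronglyMeasurable one_le_two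
    _ = _ := by
        rw [eLpNorm_norm, show (fun ξ => M * ‖𝓕 f ξ‖) = M • fun ξ => ‖𝓕 f ξ‖ from rfl,
          eLpNorm_const_smul, eLpNorm_norm, ← ofReal_norm, Real.norm_of_nonneg hM0]

theorem lintegral_comp_affine {g : ℝ → ℝ≥0∞} (hg : Measurable g) {R : ℝ} (hR : 0 < R) (c : ℝ) :
    ∫⁻ x, g ((x - c) / R) = ENNReal.ofReal R * ∫⁻ x, g x := by
  rw [lintegral_sub_right_eq_self (fun x => g (x / R)) c]
  have h := Real.map_volume_mul_left (a := R⁻¹) (inv_ne_zero hR.ne')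
  have h1 := lintegral_map (μ := volume) hg (measurable_const_mul R⁻¹)
  rw [h, lintegral_smul_measure, inv_inv, abs_of_pos hR, smul_eq_mul] at h1
  rw [h1]
  refine lintegral_congr fun x => ?_
  rw [div_eq_inv_mul]

theorem exists_eLpNorm_le_weighted {p : ℝ} (hp : 2 < p) : ∃ C : ℝ≥0∞, C ≠ ⊤ ∧
    ∀ (f : 𝓢(ℝ, ℂ)) (c R : ℝ), 0 < R → eLpNorm f (ENNReal.ofReal (p / (p - 1))) volume ≤
      C * ENNReal.ofReal (R ^ (1 / 2 - 1 / p)) *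
        (eLpNorm f 2 volume + ENNReal.ofReal (1 / R) * eLpNorm (mulX c f) 2 volume) := by
  set b := 1 / 2 - 1 / p with hb
  have hb0 : 0 < b := sub_pos.2 (one_div_lt_one_div_of_lt two_pos hp)
  have hb1 : b < 1 := by
    have : 0 < 1 / p := by positivity
    rw [hb]; linarith
  have he : 1 < 1 / b := by rw [lt_div_iff₀ hb0]; linarith
  have : ENNReal.HolderTriple (ENNReal.ofReal (1 / b)) 2 (ENNReal.ofReal (p / (p - 1))) := by
    constructor
    have hp1 : 0 < p - 1 := by linarith
    rw [← ENNReal.ofReal_ofNat 2, ← ENNReal.ofReal_inv_of_pos (by positivity),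
      ← ENNReal.ofReal_inv_of_pos two_pos, ← ENNReal.ofReal_inv_of_pos (by positivity),
      ← ENNReal.ofReal_add (by positivity) (by positivity)]
    congr 1
    rw [hb]
    field_simp
    ring
  set I := ∫⁻ y : ℝ, ENNReal.ofReal ((1 + |y|) ^ (-1 : ℝ)) ^ (1 / b) with hI
  have hItop : I ≠ ⊤ := (Par.lintegral_decay_lt_top (by positivity) (by simpa using he)).ne
  refine ⟨I ^ b, ENNReal.rpow_ne_top_of_nonneg hb0.le hItop, fun f c R hR => ?_⟩
  set w : ℝ → ℝ := fun x => (1 + |(x - c) / R|) ^ (-1 : ℝ) with hw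
  have hwc : Continuous w := by
    refine Continuous.rpow_const (by fun_prop) fun x => Or.inl ?_
    positivity
  have hw0 : ∀ x, 0 < w x := fun x => by simp only [hw]; positivity
  have h1 : eLpNorm w (ENNReal.ofReal (1 / b)) volume = ENNReal.ofReal (R ^ b) * I ^ b := by
    rw [eLpNorm_eq_lintegral_rpow_enorm_toReal (by simpa using hb0) ENNReal.ofReal_ne_top,
      ENNReal.toReal_ofReal (by positivity), one_div_one_div]
    have h2 : ∀ x, ‖w x‖ₑ ^ (1 / b) =
        (fun y : ℝ => ENNReal.ofReal ((1 + |y|) ^ (-1 : ℝ)) ^ (1 / b)) ((x - c) / R) := by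
      intro x
      simp only
      rw [← ofReal_norm, Real.norm_of_nonneg (hw0 x).le]
    simp only [h2]
    rw [lintegral_comp_affine (g := fun y : ℝ => ENNReal.ofReal ((1 + |y|) ^ (-1 : ℝ)) ^ (1 / b))
      (by fun_prop) hR, ENNReal.mul_rpow_of_nonneg _ _ hb0.le,
      ENNReal.ofReal_rpow_of_pos hR]
  set g : ℝ → ℂ := fun x => ((w x)⁻¹ : ℝ) • f x with hg
  have hgc : Continuous g := (hwc.inv₀ fun x => (hw0 x).ne').smul f.continuous
  have h2 : eLpNorm g 2 volume ≤
      eLpNorm f 2 volume + ENNReal.ofReal (1 / R) * eLpNorm (mulX c f) 2 volume := by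
    calc eLpNorm g 2 volume ≤ eLpNorm ((fun x => ‖f x‖) + fun x => (1 / R) * ‖mulX c f x‖) 2 volume := by
          refine eLpNorm_mono_real fun x => ?_
          rw [hg]
          simp only [Pi.add_apply]
          rw [norm_smul, mulX_apply, norm_mul, Complex.norm_real, Real.norm_of_nonneg
            (inv_nonneg.2 (hw0 x).le), hw]
          simp only
          rw [Real.rpow_neg_one, inv_inv, abs_div, abs_of_pos hR, Real.norm_eq_abs]
          apply le_of_eq
          ring
      _ ≤ eLpNorm (fun x => ‖f x‖) 2 volume + eLpNorm (fun x => (1 / R) * ‖mulX c f x‖) 2 volume :=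
          eLpNorm_add_le f.continuous.norm.aestronglyMeasurable
            (continuous_const.mul (mulX c f).continuous.norm).aestronglyMeasurable one_le_two
      _ = _ := by
          rw [eLpNorm_norm, show (fun x => (1 / R) * ‖mulX c f x‖) =
            (1 / R) • fun x => ‖mulX c f x‖ from rfl, eLpNorm_const_smul, eLpNorm_norm,
            ← ofReal_norm, Real.norm_of_nonneg (by positivity)]
  have h3 : (f : ℝ → ℂ) = w • g := by
    ext x
    rw [Pi.smul_apply', hg]
    simp only
    rw [smul_smul, mul_inv_cancel₀ (hw0 x).ne', one_smul]
  calc eLpNorm f (ENNReal.ofReal (p / (p - 1))) volume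
      = eLpNorm (w • g) (ENNReal.ofReal (p / (p - 1))) volume := by rw [← h3]
    _ ≤ eLpNorm w (ENNReal.ofReal (1 / b)) volume * eLpNorm g 2 volume :=
        eLpNorm_smul_le_mul_eLpNorm hgc.aestronglyMeasurable hwc.aestronglyMeasurable
    _ ≤ _ := by
        rw [h1, mul_comm (ENNReal.ofReal (R ^ b))]
        gcongr

theorem phi_neg (ξ : ℝ) : phi (-ξ) = -phi ξ := by
  rw [phi, phi, neg_sq, neg_div]

theorem S_apply (t : ℝ) (T : 𝓢'(ℝ, ℂ)) (f : 𝓢(ℝ, ℂ)) :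
    S t T f = T (mulS (fun ξ => Complex.exp (-(Complex.I * (-t : ℝ) * phi ξ))) f) := by
  rw [S, multiplier_apply, mulT_eq (tg_group t)]
  have e : (fun ξ : ℝ => Complex.exp (-(Complex.I * t * phi (-ξ)))) =
      fun ξ : ℝ => Complex.exp (-(Complex.I * (-t : ℝ) * phi ξ)) := by
    funext ξ
    rw [phi_neg]
    push_cast
    ring_nf
  rw [e]

theorem conjExponent_ofReal {p : ℝ} (hp : 1 < p) :
    ENNReal.conjExponent (ENNReal.ofReal p) = ENNReal.ofReal (p / (p - 1)) := by
  have h1 : 0 < p - 1 := by linarith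
  rw [ENNReal.conjExponent, ← ENNReal.ofReal_one, ← ENNReal.ofReal_sub _ zero_le_one,
    ← ENNReal.ofReal_inv_of_pos h1, ← ENNReal.ofReal_add zero_le_one (by positivity)]
  congr 1
  field_simp
  ring

namespace Par
variable {P : Par}

variable (P) in
theorem exists_enorm_grp_apply_le : ∃ C : ℝ≥0∞, C ≠ ⊤ ∧
    ∀ (x : P.Space) (f : 𝓢(ℝ, ℂ)) (c R τ : ℝ), 0 < R → ‖(P.grp τ x).val f‖ₑ ≤
      C * ENNReal.ofReal (R ^ (1 / 2 - 1 / P.p)) * ‖x‖ₑ * (eLpNorm f 2 volume +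
        ENNReal.ofReal (1 / R) * (eLpNorm (mulX c f) 2 volume +
          ENNReal.ofReal |τ| * eLpNorm f 2 volume)) := by
  obtain ⟨C, hC, h⟩ := exists_eLpNorm_le_weighted P.two_lt_p
  obtain ⟨C', hC0', h'⟩ := P.exists_lpNorm_le
  refine ⟨C * ENNReal.ofReal C', ENNReal.mul_ne_top hC ENNReal.ofReal_ne_top,
    fun x f c R τ hR => ?_⟩
  rw [val_grp, S_apply]
  set m : ℝ → ℂ := fun ξ => Complex.exp (-(Complex.I * (-τ : ℝ) * phi ξ))
  have h1 := enorm_apply_le P.one_le_ofReal_p (mulS m f) x.val x.lpNorm_ne_top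
  rw [conjExponent_ofReal (by linarith [P.two_lt_p])] at h1
  have h2 := h (mulS m f) c R hR
  have h3 := eLpNorm_mulS_two_le (tg_group (-τ)) (fun ξ => (norm_cexp_phi (-τ) ξ).le) f
  have h4 := eLpNorm_mulX_mulS_le (tg_group (-τ)) (fun ξ => (norm_cexp_phi (-τ) ξ).le)
    (hasDerivAt_cexp_phi (-τ)) (norm_deriv_cexp_phi_le (-τ)) c f
  rw [abs_neg] at h4
  have h5 := h' x.val x.N_ne_top
  rw [← enorm_eq] at h5
  calc _ ≤ _ := h1
    _ ≤ C * ENNReal.ofReal (R ^ (1 / 2 - 1 / P.p)) * (eLpNorm f 2 volume +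
        ENNReal.ofReal (1 / R) * (eLpNorm (mulX c f) 2 volume +
          ENNReal.ofReal |τ| * eLpNorm f 2 volume)) * (ENNReal.ofReal C' * ‖x‖ₑ) := by
        refine mul_le_mul' (h2.trans ?_) h5
        gcongr
    _ = _ := by ring

theorem lintegral_one_add_abs_rpow_eq_top {a : ℝ} (ha : a ≤ 1) :
    ∫⁻ t : ℝ, ENNReal.ofReal ((1 + |t|) ^ (-a)) = ⊤ := by
  by_contra hne
  have h1 : Integrable fun t : ℝ => (1 + |t|) ^ (-1 : ℝ) := by
    refine ⟨(Continuous.rpow_const (by fun_prop) fun t => Or.inl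
      (by positivity)).aestronglyMeasurable, ?_⟩
    rw [hasFiniteIntegral_iff_ofReal (Eventually.of_forall fun t => by positivity)]
    refine lt_of_le_of_lt (lintegral_mono fun t => ?_) (lt_top_iff_ne_top.2 hne)
    refine ENNReal.ofReal_le_ofReal (Real.rpow_le_rpow_of_exponent_le ?_ (by linarith))
    linarith [abs_nonneg t]
  have h2 : IntegrableOn (fun t : ℝ => t ^ (-1 : ℝ)) (Set.Ioi 1) := by
    refine (h1.const_mul 2).integrableOn.mono' (by fun_prop) ?_
    filter_upwards [ae_restrict_mem measurableSet_Ioi] with t ht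
    have ht : 1 < t := ht
    rw [Real.norm_of_nonneg (by positivity), Real.rpow_neg_one, Real.rpow_neg_one,
      abs_of_pos (by linarith), ← div_eq_mul_inv, inv_eq_one_div,
      div_le_div_iff₀ (by linarith) (by linarith)]
    linarith
  rw [integrableOn_Ioi_rpow_iff one_pos] at h2
  linarith

/-- A free solution which decays too fast vanishes. -/
theorem eq_zero_of_tn_lt_top {r : ℝ} (hr : 0 < r) (hbr : (1 / 2 - 1 / P.p) * r ≤ 1) {x : P.Space}
    (h : P.tn r (fun t => P.grp t x) ≠ ⊤) : x = 0 := by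
  refine ext_eval fun f => ?_
  rw [map_zero, eval_apply]
  by_contra hf
  obtain ⟨C, hC, hb⟩ := P.exists_enorm_grp_apply_le
  set b := 1 / 2 - 1 / P.p
  set D : ℝ≥0∞ := C * (eLpNorm f 2 volume + (eLpNorm (mulX 0 f) 2 volume + eLpNorm f 2 volume))
  have hD : D ≠ ⊤ := ENNReal.mul_ne_top hC (by
    simp [eLpNorm_schwartz_ne_top])
  have key : ∀ t : ℝ, ‖x.val f‖ₑ ≤ D * (ENNReal.ofReal ((1 + |t|) ^ b) * ‖P.grp t x‖ₑ) := by
    intro t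
    have ht : 0 < 1 + |t| := by positivity
    have h1 := hb (P.grp t x) f 0 (1 + |t|) (-t) ht
    rw [grp_grp, neg_add_cancel, grp_zero] at h1
    refine h1.trans ?_
    have h2 : ENNReal.ofReal (1 / (1 + |t|)) * (eLpNorm (mulX 0 f) 2 volume +
        ENNReal.ofReal |(-t)| * eLpNorm f 2 volume) ≤
        eLpNorm (mulX 0 f) 2 volume + eLpNorm f 2 volume := by
      rw [mul_add, ← mul_assoc, ← ENNReal.ofReal_mul (by positivity), abs_neg]
      refine add_le_add (mul_le_of_le_one_left' ?_) (mul_le_of_le_one_left' ?_)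
      · rw [← ENNReal.ofReal_one]
        refine ENNReal.ofReal_le_ofReal ?_
        rw [div_le_one ht]; linarith [abs_nonneg t]
      · rw [← ENNReal.ofReal_one]
        refine ENNReal.ofReal_le_ofReal ?_
        rw [one_div_mul_eq_div, div_le_one ht]; linarith [abs_nonneg t]
    calc _ ≤ C * ENNReal.ofReal ((1 + |t|) ^ b) * ‖P.grp t x‖ₑ * (eLpNorm f 2 volume +
          (eLpNorm (mulX 0 f) 2 volume + eLpNorm f 2 volume)) := by gcongr
      _ = _ := by simp only [D]; ring
  have key2 : ∀ t : ℝ, ‖x.val f‖ₑ ^ r * ENNReal.ofReal ((1 + |t|) ^ (-(b * r))) ≤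
      D ^ r * ‖P.grp t x‖ₑ ^ r := by
    intro t
    have ht : 0 < 1 + |t| := by positivity
    have h1 := ENNReal.rpow_le_rpow (key t) hr.le
    rw [ENNReal.mul_rpow_of_nonneg D _ hr.le,
      ENNReal.mul_rpow_of_nonneg (ENNReal.ofReal _) _ hr.le,
      ENNReal.ofReal_rpow_of_pos (by positivity), ← Real.rpow_mul ht.le] at h1
    calc _ ≤ D ^ r * (ENNReal.ofReal ((1 + |t|) ^ (b * r)) * ‖P.grp t x‖ₑ ^ r) *
          ENNReal.ofReal ((1 + |t|) ^ (-(b * r))) := by gcongr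
      _ = D ^ r * ‖P.grp t x‖ₑ ^ r * (ENNReal.ofReal ((1 + |t|) ^ (b * r)) *
          ENNReal.ofReal ((1 + |t|) ^ (-(b * r)))) := by ring
      _ = _ := by
          rw [← ENNReal.ofReal_mul (by positivity), ← Real.rpow_add ht, add_neg_cancel,
            Real.rpow_zero, ENNReal.ofReal_one, mul_one]
  have h0 : ‖x.val f‖ₑ ^ r ≠ 0 := by
    simp only [ne_eq, ENNReal.rpow_eq_zero_iff, not_or, not_and]
    exact ⟨fun h => absurd (enorm_eq_zero.1 h) hf, fun h => absurd h enorm_ne_top⟩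
  have h1 := lintegral_mono (μ := volume) key2
  rw [lintegral_const_mul' _ _ (ENNReal.rpow_ne_top_of_nonneg hr.le enorm_ne_top),
    lintegral_const_mul' _ _ (ENNReal.rpow_ne_top_of_nonneg hr.le hD), ← rpow_tn hr,
    lintegral_one_add_abs_rpow_eq_top hbr, ENNReal.mul_top h0, top_le_iff] at h1
  exact ENNReal.mul_ne_top (ENNReal.rpow_ne_top_of_nonneg hr.le hD)
    (ENNReal.rpow_ne_top_of_nonneg hr.le h) h1

end Par

/-! ### Local square integrability -/

theorem eLpNorm_mul_le_of_apply_le {T : 𝓢'(ℝ, ℂ)} {g : ℝ → ℂ} (hT : IsFunction T g) (ψ : 𝓢(ℝ, ℂ))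
    {C : ℝ≥0∞} (hC : C ≠ ⊤) (h : ∀ f, ‖T (mulSS ψ f)‖ₑ ≤ C * eLpNorm f 2 volume) :
    eLpNorm (fun x => ψ x * g x) 2 volume ≤ C := by
  have hadd : ∀ f k : 𝓢(ℝ, ℂ), mulSS ψ (f + k) = mulSS ψ f + mulSS ψ k := fun f k => by
    ext x; simp [mul_add]
  have hsmul : ∀ (a : ℂ) (f : 𝓢(ℝ, ℂ)), mulSS ψ (a • f) = a • mulSS ψ f := fun a f => by
    ext x; simp [mul_left_comm]
  let L : 𝓢(ℝ, ℂ) →ₗ[ℂ] ℂ :=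
    { toFun := fun f => T (mulSS ψ f)
      map_add' := fun f k => by rw [hadd, map_add]
      map_smul' := fun a f => by rw [hsmul, map_smul]; rfl }
  let e : 𝓢(ℝ, ℂ) →ₗ[ℂ] Lp ℂ 2 (volume : Measure ℝ) := (SchwartzMap.toLpCLM ℂ ℂ 2 volume).toLinearMap
  have hed : DenseRange e := SchwartzMap.denseRange_toLpCLM (F := ℂ) (E := ℝ) (p := 2)
    ENNReal.ofNat_ne_top
  have hLe : ∀ f, ‖L f‖ ≤ C.toReal * ‖e f‖ := by
    intro f
    have h1 := ENNReal.toReal_mono (ENNReal.mul_ne_top hC (eLpNorm_schwartz_ne_top f 2)) (h f)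
    rw [toReal_enorm, ENNReal.toReal_mul] at h1
    have h2 : ‖e f‖ = (eLpNorm f 2 volume).toReal := SchwartzMap.norm_toLp
    rw [h2]
    exact h1
  set F := L.extendOfNorm e
  have hF : ∀ f, F (e f) = L f := LinearMap.extendOfNorm_eq hed ⟨_, hLe⟩
  have hFn : ‖F‖ ≤ C.toReal := LinearMap.opNorm_extendOfNorm_le hed ENNReal.toReal_nonneg hLe
  set G := (InnerProductSpace.toDual ℂ (Lp ℂ 2 (volume : Measure ℝ))).symm F
  have hGn : ‖G‖ ≤ C.toReal := by rwa [LinearIsometryEquiv.norm_map]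
  have hG : ∀ f, inner ℂ G (e f) = L f := fun f => by
    rw [InnerProductSpace.toDual_symm_apply, hF]
  set G' : ℝ → ℂ := fun x => starRingEnd ℂ (G x) with hG'
  have hGm : MemLp G' 2 volume := (Lp.memLp G).star
  obtain ⟨T', hT'⟩ := exists_isFunction_of_memLp one_le_two hGm
  have hT'L : ∀ f, T' f = L f := by
    intro f
    rw [(hT' f).2, ← hG, L2.inner_def]
    refine integral_congr_ae ?_
    have h1 : (e f : ℝ → ℂ) =ᵐ[volume] f := SchwartzMap.coeFn_toLp f 2 volume
    filter_upwards [h1] with x hx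
    rw [hx, hG', RCLike.inner_apply]
  have hT'2 : IsFunction T' (fun x => ψ x * g x) := by
    intro f
    have h1 := hT (mulSS ψ f)
    have e1 : (fun x => mulSS ψ f x * g x) = fun x => f x * (ψ x * g x) := by
      funext x
      rw [mulSS_apply]
      ring
    rw [e1] at h1
    exact ⟨h1.1, (hT'L f).trans h1.2⟩
  rw [eLpNorm_congr_ae (hT'2.ae_eq hT')]
  have h3 : eLpNorm G' 2 volume = ‖G‖ₑ := by
    rw [Lp.enorm_def]
    refine eLpNorm_congr_norm_ae (Eventually.of_forall fun x => ?_)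
    rw [hG', RCLike.norm_conj]
  rw [h3, ← ofReal_norm, ← ENNReal.ofReal_toReal hC]
  exact ENNReal.ofReal_le_ofReal hGn

theorem enorm_apply_le_eLpNorm_fourier (f : 𝓢(ℝ, ℂ)) (x : ℝ) :
    ‖f x‖ₑ ≤ eLpNorm (𝓕 f : 𝓢(ℝ, ℂ)) 1 volume := by
  have h : f x = 𝓕⁻ (𝓕 f) x := by rw [FourierTransform.fourierInv_fourier_eq]
  rw [h, SchwartzMap.fourierInv_coe, Real.fourierInv_eq', eLpNorm_one_eq_lintegral_enorm]
  refine (enorm_integral_le_lintegral_enorm _).trans (le_of_eq (lintegral_congr fun v => ?_))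
  rw [enorm_smul]
  have : ‖Complex.exp (((2 * Real.pi * inner ℝ v x : ℝ) : ℂ) * Complex.I)‖ₑ = 1 := by
    rw [← ofReal_norm, Complex.norm_exp_ofReal_mul_I, ENNReal.ofReal_one]
  rw [this, one_mul]

theorem eLpNorm_le_of_two_top {p : ℝ} (hp : 2 ≤ p) {f : 𝓢(ℝ, ℂ)} {B : ℝ≥0∞}
    (h1 : ∀ x, ‖f x‖ₑ ≤ B) (h2 : eLpNorm f 2 volume ≤ B) :
    eLpNorm f (ENNReal.ofReal p) volume ≤ B := by
  have hp0 : 0 < p := by linarith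
  have h3 : ∫⁻ x, ‖f x‖ₑ ^ (2 : ℝ) ≤ B ^ (2 : ℝ) := by
    rw [← ENNReal.ofReal_ofNat 2, eLpNorm_ofReal two_pos, one_div,
      ENNReal.rpow_inv_le_iff two_pos] at h2
    exact h2
  rw [eLpNorm_ofReal hp0, one_div, ENNReal.rpow_inv_le_iff hp0]
  calc ∫⁻ x, ‖f x‖ₑ ^ p = ∫⁻ x, ‖f x‖ₑ ^ (p - 2) * ‖f x‖ₑ ^ (2 : ℝ) := by
        refine lintegral_congr fun x => ?_
        rw [← ENNReal.rpow_add_of_nonneg _ _ (by linarith) (by norm_num), sub_add_cancel]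
    _ ≤ ∫⁻ x, B ^ (p - 2) * ‖f x‖ₑ ^ (2 : ℝ) := by
        refine lintegral_mono fun x => mul_le_mul_left (ENNReal.rpow_le_rpow (h1 x) ?_) _
        linarith
    _ = B ^ (p - 2) * ∫⁻ x, ‖f x‖ₑ ^ (2 : ℝ) :=
        lintegral_const_mul _ (f.continuous.enorm.measurable.pow_const _)
    _ ≤ B ^ (p - 2) * B ^ (2 : ℝ) := by gcongr
    _ = B ^ p := by
        rw [← ENNReal.rpow_add_of_nonneg _ _ (by linarith) (by norm_num), sub_add_cancel]

theorem abs_phi_le_inv (ξ : ℝ) : |phi (-(2 * Real.pi * ξ))| ≤ 2 * (1 + |ξ|) ^ (-1 : ℝ) := by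
  have hpi := Real.pi_gt_three
  set y := 2 * Real.pi * ξ with hy
  have h1 : |ξ| ≤ |y| := by
    rw [hy, abs_mul, abs_of_pos (by positivity : (0 : ℝ) < 2 * Real.pi)]
    nlinarith [abs_nonneg ξ]
  rw [phi, neg_sq, abs_div, abs_neg, abs_of_pos (by positivity : (0 : ℝ) < 1 + y ^ 2),
    Real.rpow_neg_one, ← div_eq_mul_inv, div_le_div_iff₀ (by positivity) (by positivity),
    ← sq_abs y]
  nlinarith [abs_nonneg ξ, abs_nonneg y, sq_nonneg (|y| - 1)]

theorem exists_eLpNorm_phi_le {p : ℝ} (hp : 2 ≤ p) : ∃ C : ℝ≥0∞, C ≠ ⊤ ∧ ∀ f : 𝓢(ℝ, ℂ),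
    eLpNorm (mulT (fun ξ => (phi ξ : ℂ)) f) (ENNReal.ofReal p) volume ≤ C * eLpNorm f 2 volume := by
  set m : ℝ → ℂ := fun ξ => (phi (-ξ) : ℂ) with hm
  have htg : TG m := tg_phi.comp_neg
  have hfin : eLpNorm (fun ξ => m (2 * Real.pi * ξ)) 2 volume ≠ ⊤ := by
    have h1 : ∫⁻ ξ, ‖m (2 * Real.pi * ξ)‖ₑ ^ (2 : ℝ) < ⊤ := by
      have h2 := Par.lintegral_decay_lt_top (a := 1) two_pos (by norm_num)
      refine lt_of_le_of_lt (lintegral_mono (g := fun ξ => ENNReal.ofReal 2 ^ (2 : ℝ) *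
        ENNReal.ofReal ((1 + |ξ|) ^ (-1 : ℝ)) ^ (2 : ℝ)) fun ξ => ?_) ?_
      · simp only
        rw [← ENNReal.mul_rpow_of_nonneg _ _ zero_le_two, ← ENNReal.ofReal_mul zero_le_two]
        refine ENNReal.rpow_le_rpow ?_ zero_le_two
        rw [← ofReal_norm, hm]
        simp only [Complex.norm_real, Real.norm_eq_abs]
        exact ENNReal.ofReal_le_ofReal (abs_phi_le_inv ξ)
      · rw [lintegral_const_mul' _ _ (by finiteness)]
        exact ENNReal.mul_lt_top (by finiteness) h2
    rw [← ENNReal.ofReal_ofNat 2, eLpNorm_ofReal two_pos]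
    exact ENNReal.rpow_ne_top_of_nonneg (by norm_num) h1.ne
  refine ⟨eLpNorm (fun ξ => m (2 * Real.pi * ξ)) 2 volume + 1,
    ENNReal.add_ne_top.2 ⟨hfin, ENNReal.one_ne_top⟩, fun f => ?_⟩
  rw [mulT_eq tg_phi]
  change eLpNorm (mulS m f) _ _ ≤ _
  refine eLpNorm_le_of_two_top hp (fun x => ?_) ?_
  · refine (enorm_apply_le_eLpNorm_fourier _ x).trans ?_
    have h1 : ((𝓕 (mulS m f) : 𝓢(ℝ, ℂ)) : ℝ → ℂ) =
        (fun ξ => m (2 * Real.pi * ξ)) • ((𝓕 f : 𝓢(ℝ, ℂ)) : ℝ → ℂ) := by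
      ext ξ
      rw [fourier_mulS htg]
      rfl
    rw [h1]
    refine (eLpNorm_smul_le_mul_eLpNorm (p := 2) (q := 2) (r := 1)
      (𝓕 f : 𝓢(ℝ, ℂ)).continuous.aestronglyMeasurable ?_).trans ?_
    · exact htg.1.continuous.aestronglyMeasurable
    · rw [eLpNorm_fourier_two]
      gcongr
      exact le_self_add
  · refine (eLpNorm_mulS_two_le htg (fun ξ => ?_) f).trans ?_
    · rw [hm]
      simp only [Complex.norm_real, Real.norm_eq_abs]
      exact abs_phi_le _
    · rw [add_mul, one_mul]
      exact le_add_self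

/-- A smooth cut-off of the interval of centre `c` and radius `R`. -/
def bumpAt (c R : ℝ) (hR : 0 < R) : ContDiffBump c := ⟨R, 2 * R, hR, by linarith⟩

/-- The cut-off as a Schwartz function. -/
def bumpS (c R : ℝ) (hR : 0 < R) : 𝓢(ℝ, ℂ) :=
  ofCompact (bumpAt c R hR).contDiff (bumpAt c R hR).hasCompactSupport

theorem bumpS_eq_one {c R : ℝ} (hR : 0 < R) {x : ℝ} (hx : |x - c| ≤ R) : bumpS c R hR x = 1 := by
  rw [bumpS, ofCompact_apply, ContDiffBump.one_of_mem_closedBall, Complex.ofReal_one]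
  rw [Metric.mem_closedBall, Real.dist_eq]
  exact hx

theorem norm_bumpS_le {c R : ℝ} (hR : 0 < R) (x : ℝ) : ‖bumpS c R hR x‖ ≤ 1 := by
  rw [bumpS, ofCompact_apply, Complex.norm_real, Real.norm_of_nonneg (ContDiffBump.nonneg _)]
  exact ContDiffBump.le_one _

theorem eLpNorm_bumpS_le {c R : ℝ} (hR : 0 < R) (f : 𝓢(ℝ, ℂ)) :
    eLpNorm (mulSS (bumpS c R hR) f) 2 volume ≤ eLpNorm f 2 volume := by
  refine eLpNorm_mono fun x => ?_
  rw [mulSS_apply, norm_mul]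
  exact mul_le_of_le_one_left (norm_nonneg _) (norm_bumpS_le hR x)

theorem eLpNorm_mulX_bumpS_le {c R : ℝ} (hR : 0 < R) (f : 𝓢(ℝ, ℂ)) :
    eLpNorm (mulX c (mulSS (bumpS c R hR) f)) 2 volume ≤
      ENNReal.ofReal (2 * R) * eLpNorm f 2 volume := by
  have h := eLpNorm_const_smul (2 * R) (f : ℝ → ℂ) 2 volume
  rw [← ofReal_norm, Real.norm_of_nonneg (by positivity)] at h
  rw [← h]
  refine eLpNorm_mono fun x => ?_
  rw [mulX_apply, mulSS_apply, Pi.smul_apply, norm_smul, norm_mul, norm_mul, ← mul_assoc]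
  refine mul_le_mul_of_nonneg_right ?_ (norm_nonneg _)
  rw [Complex.norm_real, Real.norm_eq_abs, Real.norm_of_nonneg (by positivity : 0 ≤ 2 * R)]
  by_cases hx : |x - c| ≤ 2 * R
  · calc _ ≤ 2 * R * 1 := by gcongr; exact norm_bumpS_le hR x
      _ = _ := mul_one _
  · have : bumpS c R hR x = 0 := by
      rw [bumpS, ofCompact_apply, ContDiffBump.zero_of_le_dist, Complex.ofReal_zero]
      rw [Real.dist_eq]
      exact (not_le.1 hx).le
    rw [this, norm_zero, mul_zero]
    positivity

namespace Par
variable {P : Par}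

theorem eLpNorm_pow (g : ℝ → ℂ) : eLpNorm (fun y => g y ^ (P.lam + 1))
    (ENNReal.ofReal (P.p / (P.p - 1))) volume = eLpNorm g (ENNReal.ofReal P.p) volume ^ (P.lam + 1) := by
  have hp := P.two_lt_p
  have hl := P.one_le_lam
  have e : P.p - 1 = P.lam + 1 := by rw [p]; ring
  rw [eLpNorm_ofReal (div_pos P.p_pos (by linarith)), eLpNorm_ofReal P.p_pos,
    ← ENNReal.rpow_natCast _ (P.lam + 1), ← ENNReal.rpow_mul, e]
  congr 1
  · refine lintegral_congr fun y => ?_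
    rw [enorm_pow, ← ENNReal.rpow_natCast, ← ENNReal.rpow_mul]
    congr 1
    push_cast
    field_simp
  · push_cast
    rw [one_div_div]
    ring

theorem Space.lpNorm_power (x : P.Space) :
    lpNorm (ENNReal.ofReal (P.p / (P.p - 1))) (power (P.lam + 1) x.val) =
      lpNorm (ENNReal.ofReal P.p) x.val ^ (P.lam + 1) := by
  obtain ⟨g, hg, -⟩ := x.exists_isFunction
  rw [hg.lpNorm_eq, (Space.isFunction_power hg).lpNorm_eq, eLpNorm_pow]

variable (P) in
theorem exists_enorm_grp_nonl_apply_le : ∃ C : ℝ≥0∞, C ≠ ⊤ ∧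
    ∀ (t : ℝ) (x : P.Space) (f : 𝓢(ℝ, ℂ)), ‖(P.grp t (P.nonl x)).val f‖ₑ ≤
      C * ‖x‖ₑ ^ (P.lam + 1) * eLpNorm f 2 volume := by
  have hp := P.two_lt_p
  obtain ⟨C, hC, h⟩ := exists_eLpNorm_phi_le hp.le
  obtain ⟨C', hC0', h'⟩ := P.exists_lpNorm_le
  refine ⟨C * ENNReal.ofReal C' ^ (P.lam + 1), ENNReal.mul_ne_top hC (by finiteness),
    fun t x f => ?_⟩
  rw [val_grp, S_apply, val_nonl, phiD, multiplier_apply]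
  set k := mulS (fun ξ => Complex.exp (-(Complex.I * (-t : ℝ) * phi ξ))) f with hk
  have h1 := enorm_apply_le P.one_le_conj (mulT (fun ξ => (phi ξ : ℂ)) k)
    (power (P.lam + 1) x.val) (by
      rw [Space.lpNorm_power]; exact ENNReal.pow_ne_top x.lpNorm_ne_top)
  rw [conjExponent_ofReal (by rw [lt_div_iff₀] <;> linarith),
    show P.p / (P.p - 1) / (P.p / (P.p - 1) - 1) = P.p by
      have : P.p - 1 ≠ 0 := by linarith
      field_simp
      ring, Space.lpNorm_power] at h1
  refine h1.trans ?_
  have h2 := h k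
  have h3 := eLpNorm_mulS_two_le (tg_group (-t)) (fun ξ => (norm_cexp_phi (-t) ξ).le) f
  have h4 := h' x.val x.N_ne_top
  rw [← enorm_eq] at h4
  calc _ ≤ (C * eLpNorm f 2 volume) * (ENNReal.ofReal C' * ‖x‖ₑ) ^ (P.lam + 1) := by
        gcongr
        exact h2.trans (by gcongr)
    _ = _ := by rw [mul_pow]; ring

variable (P) in
theorem exists_enorm_duh_apply_le : ∃ C : ℝ≥0∞, C ≠ ⊤ ∧ ∀ u : ℝ → P.Space, Continuous u →
    ∀ (t : ℝ) (f : 𝓢(ℝ, ℂ)), ‖(duh u t).val f‖ₑ ≤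
      C * (∫⁻ τ, ‖u τ‖ₑ ^ (P.lam + 1)) * eLpNorm f 2 volume := by
  obtain ⟨C, hC, h⟩ := P.exists_enorm_grp_nonl_apply_le
  refine ⟨C, hC, fun u hu t f => ?_⟩
  have hui := (continuous_duhamel hu t).intervalIntegrable (μ := volume) 0 t
  rw [duh, map_smul]
  change ‖P.cD • (∫ τ in (0 : ℝ)..t, P.grp (t - τ) (P.nonl (u τ))).val f‖ₑ ≤ _
  rw [eval_integral hui, enorm_smul]
  have h1 : ‖P.cD‖ₑ ≤ 1 := by
    rw [← ofReal_norm, ← ENNReal.ofReal_one]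
    exact ENNReal.ofReal_le_ofReal norm_cD_le
  have h2 : ‖∫ τ in (0 : ℝ)..t, (P.grp (t - τ) (P.nonl (u τ))).val f‖ₑ ≤
      ∫⁻ τ in Set.uIoc 0 t, ‖(P.grp (t - τ) (P.nonl (u τ))).val f‖ₑ := by
    rw [← ofReal_norm, intervalIntegral.norm_intervalIntegral_eq, ofReal_norm]
    exact enorm_integral_le_lintegral_enorm _
  refine (mul_le_mul' h1 (h2.trans (setLIntegral_le_lintegral _ _))).trans ?_
  rw [one_mul]
  calc _ ≤ ∫⁻ τ, C * ‖u τ‖ₑ ^ (P.lam + 1) * eLpNorm f 2 volume :=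
        lintegral_mono fun τ => h _ _ _
    _ = _ := by
        rw [lintegral_mul_const' _ _ (eLpNorm_schwartz_ne_top _ _), lintegral_const_mul' _ _ hC]

variable (P) in
theorem exists_enorm_grp_bump_le {r : ℝ} (hr : 0 < r) : ∃ C : ℝ≥0∞, C ≠ ⊤ ∧
    ∀ (x : P.Space) (t c R : ℝ) (hR : 0 < R) (f : 𝓢(ℝ, ℂ)),
      ‖(P.grp t x).val (mulSS (bumpS c R hR) f)‖ₑ ≤
        C * P.tn r (fun t => P.grp t x) * ENNReal.ofReal (R ^ (1 / 2 - 1 / P.p - 1 / r)) *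
          eLpNorm f 2 volume := by
  obtain ⟨C, hC, h⟩ := P.exists_enorm_grp_apply_le
  refine ⟨4 * C, ENNReal.mul_ne_top (by finiteness) hC, fun x t c R hR f => ?_⟩
  set b := 1 / 2 - 1 / P.p
  set a := ‖(P.grp t x).val (mulSS (bumpS c R hR) f)‖ₑ
  set D : ℝ≥0∞ := 4 * C * ENNReal.ofReal (R ^ b) * eLpNorm f 2 volume with hD
  have hDtop : D ≠ ⊤ := by
    have := eLpNorm_schwartz_ne_top f 2
    finiteness
  have key : ∀ t' ∈ Set.Icc t (t + R), a ≤ D * ‖P.grp t' x‖ₑ := by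
    intro t' ht'
    have h1 := h (P.grp t' x) (mulSS (bumpS c R hR) f) c R (t - t') hR
    rw [grp_grp, sub_add_cancel] at h1
    refine h1.trans ?_
    have h2 : |t - t'| ≤ R := by rw [abs_le]; constructor <;> linarith [ht'.1, ht'.2]
    calc _ ≤ C * ENNReal.ofReal (R ^ b) * ‖P.grp t' x‖ₑ * (eLpNorm f 2 volume +
          ENNReal.ofReal (1 / R) * (ENNReal.ofReal (2 * R) * eLpNorm f 2 volume +
            ENNReal.ofReal R * eLpNorm f 2 volume)) := by
          gcongr
          · exact eLpNorm_bumpS_le hR f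
          · exact eLpNorm_mulX_bumpS_le hR f
          · exact eLpNorm_bumpS_le hR f
      _ = C * ENNReal.ofReal (R ^ b) * ‖P.grp t' x‖ₑ * (4 * eLpNorm f 2 volume) := by
          rw [← add_mul, ← mul_assoc, ← ENNReal.ofReal_add (by positivity) hR.le,
            ← ENNReal.ofReal_mul (by positivity), show 1 / R * (2 * R + R) = 3 by field_simp; ring,
            ENNReal.ofReal_ofNat]
          ring
      _ = _ := by rw [hD]; ring
  have h3 : ENNReal.ofReal R * a ^ r ≤ D ^ r * ∫⁻ t', ‖P.grp t' x‖ₑ ^ r := by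
    calc ENNReal.ofReal R * a ^ r = ∫⁻ _ in Set.Icc t (t + R), a ^ r := by
          rw [setLIntegral_const, Real.volume_Icc, add_sub_cancel_left, mul_comm]
      _ ≤ ∫⁻ t' in Set.Icc t (t + R), D ^ r * ‖P.grp t' x‖ₑ ^ r := by
          refine setLIntegral_mono' measurableSet_Icc fun t' ht' => ?_
          rw [← ENNReal.mul_rpow_of_nonneg _ _ hr.le]
          exact ENNReal.rpow_le_rpow (key t' ht') hr.le
      _ ≤ ∫⁻ t', D ^ r * ‖P.grp t' x‖ₑ ^ r := setLIntegral_le_lintegral _ _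
      _ = _ := lintegral_const_mul' _ _ (ENNReal.rpow_ne_top_of_nonneg hr.le hDtop)
  rw [← rpow_tn hr, ← ENNReal.mul_rpow_of_nonneg _ _ hr.le] at h3
  have h4 := ENNReal.rpow_le_rpow h3 (z := 1 / r) (by positivity)
  rw [ENNReal.mul_rpow_of_nonneg _ _ (by positivity), ← ENNReal.rpow_mul, ← ENNReal.rpow_mul,
    mul_one_div_cancel hr.ne', ENNReal.rpow_one, ENNReal.rpow_one,
    ENNReal.ofReal_rpow_of_pos hR] at h4
  calc a = ENNReal.ofReal (R ^ (-(1 / r))) * (ENNReal.ofReal (R ^ (1 / r)) * a) := by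
        rw [← mul_assoc, ← ENNReal.ofReal_mul (by positivity), ← Real.rpow_add hR,
          neg_add_cancel, Real.rpow_zero, ENNReal.ofReal_one, one_mul]
    _ ≤ ENNReal.ofReal (R ^ (-(1 / r))) * (D * P.tn r fun t' => P.grp t' x) := by gcongr
    _ = 4 * C * (P.tn r fun t' => P.grp t' x) *
        (ENNReal.ofReal (R ^ b) * ENNReal.ofReal (R ^ (-(1 / r)))) * eLpNorm f 2 volume := by
        rw [hD]; ring
    _ = _ := by
        rw [← ENNReal.ofReal_mul (by positivity), ← Real.rpow_add hR, ← sub_eq_add_neg]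

/-- Local square integrability of a solution, with a power of the radius. -/
theorem IsMild.exists_local_sq_le {x : P.Space} {u : ℝ → P.Space} (hu : IsMild x u) {r : ℝ}
    (hr : 0 < r) (hγ : 0 ≤ 1 / 2 - 1 / P.p - 1 / r) (hx : P.tn r (fun t => P.grp t x) ≠ ⊤)
    (hint : ∫⁻ τ, ‖u τ‖ₑ ^ (P.lam + 1) ≠ ⊤) : ∃ M : ℝ≥0∞, M ≠ ⊤ ∧
      ∀ (τ : ℝ) (g : ℝ → ℂ), IsFunction (u τ).val g → ∀ c R : ℝ, 1 ≤ R →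
        ∫⁻ y in Metric.closedBall c R, ‖g y‖ₑ ^ (2 : ℝ) ≤
          (M * ENNReal.ofReal (R ^ (1 / 2 - 1 / P.p - 1 / r))) ^ (2 : ℝ) := by
  obtain ⟨C₁, hC₁, h₁⟩ := P.exists_enorm_grp_bump_le hr
  obtain ⟨C₂, hC₂, h₂⟩ := P.exists_enorm_duh_apply_le
  set γ := 1 / 2 - 1 / P.p - 1 / r
  refine ⟨C₁ * P.tn r (fun t => P.grp t x) + C₂ * ∫⁻ τ, ‖u τ‖ₑ ^ (P.lam + 1),
    ENNReal.add_ne_top.2 ⟨ENNReal.mul_ne_top hC₁ hx, ENNReal.mul_ne_top hC₂ hint⟩,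
    fun τ g hg c R hR => ?_⟩
  have hR0 : 0 < R := by linarith
  have h3 := eLpNorm_mul_le_of_apply_le hg (bumpS c R hR0)
    (C := (C₁ * P.tn r (fun t => P.grp t x) + C₂ * ∫⁻ τ, ‖u τ‖ₑ ^ (P.lam + 1)) *
      ENNReal.ofReal (R ^ γ)) (by finiteness) (fun f => by
      have hR1 : 1 ≤ ENNReal.ofReal (R ^ γ) := by
        rw [← ENNReal.ofReal_one]
        exact ENNReal.ofReal_le_ofReal (Real.one_le_rpow hR hγ)
      have e : u τ = P.grp τ x + duh u τ := hu.eq τ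
      have e2 : (u τ).val (mulSS (bumpS c R hR0) f) =
          (P.grp τ x).val (mulSS (bumpS c R hR0) f) + (duh u τ).val (mulSS (bumpS c R hR0) f) := by
        rw [e, map_add]; rfl
      rw [e2]
      refine (enorm_add_le _ _).trans ?_
      calc _ ≤ C₁ * P.tn r (fun t => P.grp t x) * ENNReal.ofReal (R ^ γ) * eLpNorm f 2 volume +
            C₂ * (∫⁻ τ, ‖u τ‖ₑ ^ (P.lam + 1)) * (1 * eLpNorm f 2 volume) := by
            rw [one_mul]
            refine add_le_add (h₁ x τ c R hR0 f) ((h₂ u hu.continuous τ _).trans ?_)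
            gcongr
            exact eLpNorm_bumpS_le hR0 f
        _ ≤ C₁ * P.tn r (fun t => P.grp t x) * ENNReal.ofReal (R ^ γ) * eLpNorm f 2 volume +
            C₂ * (∫⁻ τ, ‖u τ‖ₑ ^ (P.lam + 1)) * (ENNReal.ofReal (R ^ γ) * eLpNorm f 2 volume) := by
            gcongr
        _ = _ := by ring)
  rw [← ENNReal.ofReal_ofNat 2, eLpNorm_ofReal two_pos, one_div,
    ENNReal.rpow_inv_le_iff two_pos] at h3
  refine le_trans ?_ h3
  rw [← lintegral_indicator Metric.isClosed_closedBall.measurableSet]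
  refine lintegral_mono fun y => ?_
  by_cases hy : y ∈ Metric.closedBall c R
  · rw [Set.indicator_of_mem hy, bumpS_eq_one hR0 (by simpa [Real.dist_eq] using hy), one_mul]
  · rw [Set.indicator_of_notMem hy]
    exact zero_le

end Par

/-! ### Convolution with slowly decaying kernels -/

/-- The weight `(1 + |x|) ^ (-κ)`. -/
def dec (κ x : ℝ) : ℝ≥0∞ := ENNReal.ofReal ((1 + |x|) ^ (-κ))

theorem measurable_dec (κ : ℝ) : Measurable (dec κ) :=
  (((measurable_const.add continuous_abs.measurable)).pow_const _).ennreal_ofReal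

theorem exists_lintegral_dec_mul_le {κ δ : ℝ} (hδ : 0 ≤ δ) (h : δ < κ) : ∃ D : ℝ≥0∞, D ≠ ⊤ ∧
    ∀ (G : ℝ → ℝ≥0∞) (_ : Measurable G) (N : ℝ≥0∞) (c : ℝ),
      (∀ R : ℝ, 1 ≤ R → ∫⁻ y in Metric.closedBall c R, G y ≤ N * ENNReal.ofReal (R ^ δ)) →
      ∫⁻ y, dec κ (c - y) * G y ≤ D * N := by
  have hκ : 0 < κ := hδ.trans_lt h
  set q : ℝ := 2 ^ (δ - κ) with hq
  have hq0 : 0 ≤ q := by positivity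
  have hq1 : q < 1 := Real.rpow_lt_one_of_one_lt_of_neg one_lt_two (by linarith)
  refine ⟨∑' j : ℕ, ENNReal.ofReal (2 ^ δ * q ^ j),
    ((summable_geometric_of_lt_one hq0 hq1).mul_left _).tsum_ofReal_ne_top, fun G hG N c hN => ?_⟩
  have key : ∀ y, dec κ (c - y) * G y ≤ ∑' j : ℕ, ENNReal.ofReal (((2 : ℝ) ^ j) ^ (-κ)) *
      (Metric.closedBall c (2 ^ (j + 1))).indicator G y := by
    intro y
    obtain ⟨j, hj1, hj2⟩ := exists_nat_pow_near (x := 1 + |c - y|) (y := (2 : ℝ))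
      (by linarith [abs_nonneg (c - y)]) one_lt_two
    refine le_trans ?_ (ENNReal.le_tsum j)
    rw [Set.indicator_of_mem]
    · refine mul_le_mul_left (ENNReal.ofReal_le_ofReal ?_) _
      exact Real.rpow_le_rpow_of_nonpos (by positivity) hj1 (by linarith)
    · rw [Metric.mem_closedBall, dist_comm, Real.dist_eq]
      linarith
  refine (lintegral_mono key).trans ?_
  rw [lintegral_tsum fun j => ((hG.indicator
    Metric.isClosed_closedBall.measurableSet).const_mul _).aemeasurable, ← ENNReal.tsum_mul_right]
  refine ENNReal.tsum_le_tsum fun j => ?_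
  rw [lintegral_const_mul' _ _ ENNReal.ofReal_ne_top,
    lintegral_indicator Metric.isClosed_closedBall.measurableSet]
  refine (mul_le_mul_right (hN _ (one_le_pow₀ one_le_two)) _).trans_eq ?_
  rw [mul_left_comm, ← ENNReal.ofReal_mul (by positivity), mul_comm]
  congr 2
  rw [hq, pow_succ, Real.mul_rpow (by positivity) (by positivity), ← Real.rpow_natCast 2 j,
    ← Real.rpow_natCast _ j, ← Real.rpow_mul zero_le_two, ← Real.rpow_mul zero_le_two,
    ← Real.rpow_mul zero_le_two, ← mul_assoc, ← Real.rpow_add two_pos, mul_comm]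
  ring_nf

theorem lintegral_conv_pow_five_le {K G : ℝ → ℝ≥0∞} (hK : Measurable K) (hG : Measurable G)
    {N : ℝ≥0∞} (hN : ∀ x, ∫⁻ y, K (x - y) * G y ^ (2 : ℝ) ≤ N) :
    ∫⁻ x, (∫⁻ y, K (x - y) * G y ^ (5 : ℝ)) ^ (6 : ℝ) ≤
      N ^ (3 / 2 : ℝ) * (∫⁻ x, K x ^ (9 / 2 : ℝ)) * (∫⁻ y, G y ^ (6 : ℝ)) ^ (9 / 2 : ℝ) := by
  set E := ∫⁻ y, G y ^ (6 : ℝ)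
  have hKx : ∀ x, Measurable fun y => K (x - y) := fun x =>
    hK.comp (measurable_const.sub measurable_id)
  have key : ∀ x, (∫⁻ y, K (x - y) * G y ^ (5 : ℝ)) ^ (6 : ℝ) ≤ N ^ (3 / 2 : ℝ) *
      (∫⁻ y, K (x - y) ^ (9 / 2 : ℝ) * G y ^ (6 : ℝ)) * E ^ (7 / 2 : ℝ) := by
    intro x
    let w : Fin 3 → ℝ → ℝ≥0∞ := ![fun y => K (x - y) * G y ^ (2 : ℝ),
      fun y => K (x - y) ^ (9 / 2 : ℝ) * G y ^ (6 : ℝ), fun y => G y ^ (6 : ℝ)]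
    let e : Fin 3 → ℝ := ![1 / 4, 1 / 6, 7 / 12]
    have := ENNReal.lintegral_prod_norm_pow_le (μ := volume) Finset.univ (f := w) (p := e)
      (by
        intro i _
        fin_cases i
        · exact ((hKx x).mul (hG.pow_const _)).aemeasurable
        · exact (((hKx x).pow_const _).mul (hG.pow_const _)).aemeasurable
        · exact (hG.pow_const _).aemeasurable)
      (by simp only [Fin.sum_univ_three, e, Matrix.cons_val]; norm_num)
      (by intro i _; fin_cases i <;> norm_num [e])
    simp only [Fin.prod_univ_three, w, e, Matrix.cons_val_zero, Matrix.cons_val_one,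
      Matrix.cons_val_two, Matrix.head_cons, Matrix.tail_cons] at this
    have h1 : ∫⁻ y, K (x - y) * G y ^ (5 : ℝ) ≤ N ^ (1 / 4 : ℝ) *
        (∫⁻ y, K (x - y) ^ (9 / 2 : ℝ) * G y ^ (6 : ℝ)) ^ (1 / 6 : ℝ) * E ^ (7 / 12 : ℝ) := by
      refine le_trans (le_of_eq (lintegral_congr fun y => ?_)) (this.trans ?_)
      · rw [ENNReal.mul_rpow_of_nonneg _ _ (by norm_num), ENNReal.mul_rpow_of_nonneg _ _ (by norm_num)]
        simp only [← ENNReal.rpow_mul]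
        rw [mul_mul_mul_comm, ← ENNReal.rpow_add_of_nonneg _ _ (by norm_num) (by norm_num),
          ← ENNReal.rpow_add_of_nonneg _ _ (by norm_num) (by norm_num), mul_assoc,
          ← ENNReal.rpow_add_of_nonneg _ _ (by norm_num) (by norm_num)]
        norm_num
      · gcongr
        exact hN x
    refine (ENNReal.rpow_le_rpow h1 (by norm_num : (0 : ℝ) ≤ 6)).trans_eq ?_
    rw [ENNReal.mul_rpow_of_nonneg _ _ (by norm_num), ENNReal.mul_rpow_of_nonneg _ _ (by norm_num)]
    simp only [← ENNReal.rpow_mul]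
    norm_num
  refine (lintegral_mono key).trans_eq ?_
  have hm : Measurable fun z : ℝ × ℝ => K (z.1 - z.2) ^ (9 / 2 : ℝ) * G z.2 ^ (6 : ℝ) :=
    ((hK.comp (measurable_fst.sub measurable_snd)).pow_const _).mul
      ((hG.comp measurable_snd).pow_const _)
  rw [lintegral_mul_const _ (hm.lintegral_prod_right'.const_mul _),
    lintegral_const_mul _ hm.lintegral_prod_right', lintegral_lintegral_swap hm.aemeasurable]
  have e1 : ∀ y, ∫⁻ x, K (x - y) ^ (9 / 2 : ℝ) * G y ^ (6 : ℝ) =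
      (∫⁻ x, K x ^ (9 / 2 : ℝ)) * G y ^ (6 : ℝ) := fun y => by
    have h1 : Measurable fun x => K (x - y) := hK.comp (measurable_id.sub measurable_const)
    rw [lintegral_mul_const _ (h1.pow_const _),
      lintegral_sub_right_eq_self (fun y => K y ^ (9 / 2 : ℝ)) y]
  simp_rw [e1]
  rw [lintegral_const_mul _ (hG.pow_const _)]
  have e2 : E ^ (9 / 2 : ℝ) = E * E ^ (7 / 2 : ℝ) := by
    conv_rhs => rw [← ENNReal.rpow_one E]
    rw [← ENNReal.rpow_mul, ← ENNReal.rpow_add_of_nonneg _ _ (by norm_num) (by norm_num)]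
    norm_num
  rw [e2]
  ring

theorem Sym.comp_neg {m : ℝ → ℂ} (h : Sym m) : Sym fun ξ => m (-ξ) :=
  ⟨h.smooth.comp contDiff_neg, h.compact.comp_homeomorph (Homeomorph.neg ℝ)⟩

theorem ker_comp_neg {m : ℝ → ℂ} (h : Sym m) (x : ℝ) : h.comp_neg.ker x = h.ker (-x) := by
  rw [Sym.ker, Sym.ker, SchwartzMap.fourierInv_coe, SchwartzMap.fourierInv_coe, Real.fourierInv_eq',
    Real.fourierInv_eq', ← integral_neg_eq_self]
  refine integral_congr_ae (Eventually.of_forall fun v => ?_)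
  simp [Sym.toS_apply]

/-- A multiplier acts on functions by convolution. -/
theorem lpNorm_multiplier_le_conv {p : ℝ} (hp : 1 < p) {m : ℝ → ℂ} (h : Sym m) {T : 𝓢'(ℝ, ℂ)}
    {w : ℝ → ℂ} (hw : StronglyMeasurable w) (hT : IsFunction T w) {K : ℝ → ℝ≥0∞} (hK : Measurable K)
    (hKm : ∀ x, ‖h.ker x‖ₑ ≤ K x) : lpNorm (ENNReal.ofReal p) (multiplier m T) ≤
      (∫⁻ x, (∫⁻ y, K (x - y) * ‖w y‖ₑ) ^ p) ^ (1 / p) := by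
  have hp0 : 0 < p := by linarith
  by_cases hfin : (∫⁻ x, (∫⁻ y, K (x - y) * ‖w y‖ₑ) ^ p) ^ (1 / p) = ⊤
  · rw [hfin]; exact le_top
  have hHm : Measurable fun x => ∫⁻ y, K (x - y) * ‖w y‖ₑ :=
    Measurable.lintegral_prod_right' (f := fun z : ℝ × ℝ => K (z.1 - z.2) * ‖w z.2‖ₑ)
      ((hK.comp (measurable_fst.sub measurable_snd)).mul (hw.enorm.comp measurable_snd))
  have hfun : IsFunction (multiplier m T) (fun x => ∫ y, h.ker (x - y) * w y) := by
    intro f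
    have hint : Integrable (fun z : ℝ × ℝ => f z.1 * (h.ker (z.1 - z.2) * w z.2))
        (volume.prod volume) := by
      refine ⟨StronglyMeasurable.aestronglyMeasurable ?_, ?_⟩
      · exact (f.continuous.comp continuous_fst).stronglyMeasurable.mul
          ((h.ker.continuous.comp (continuous_fst.sub continuous_snd)).stronglyMeasurable.mul
            (hw.comp_measurable measurable_snd))
      · rw [HasFiniteIntegral, lintegral_prod _ (by
          refine Measurable.aemeasurable (Measurable.enorm ?_)
          exact (f.continuous.comp continuous_fst).measurable.mul
            ((h.ker.continuous.comp (continuous_fst.sub continuous_snd)).measurable.mul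
              (hw.measurable.comp measurable_snd)))]
        have hH := ENNReal.lintegral_mul_le_Lp_mul_Lq volume
          (Real.HolderConjugate.conjExponent hp).symm (f := fun x => ‖f x‖ₑ)
          (f.continuous.enorm.measurable.aemeasurable) hHm.aemeasurable
        refine lt_of_le_of_lt (lintegral_mono fun x => ?_) (hH.trans_lt
          (ENNReal.mul_lt_top ?_ (lt_top_iff_ne_top.2 hfin)))
        · simp only [enorm_mul, Pi.mul_apply]
          rw [lintegral_const_mul' _ _ enorm_ne_top]
          gcongr
          exact hKm _
        · have hc := (Real.HolderConjugate.conjExponent hp).symm.pos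
          rw [← eLpNorm_ofReal hc]
          exact lt_top_iff_ne_top.2 (eLpNorm_schwartz_ne_top f _)
    refine ⟨?_, ?_⟩
    · have := hint.integral_prod_left
      simpa only [integral_const_mul] using this
    · rw [multiplier_apply, (hT _).2]
      calc ∫ y, mulT m f y * w y = ∫ y, ∫ x, f x * (h.ker (x - y) * w y) := by
            refine integral_congr_ae (Eventually.of_forall fun y => ?_)
            simp only
            rw [mulT_eq h.tg, h.comp_neg.mulS_apply, ← integral_mul_const]
            refine integral_congr_ae (Eventually.of_forall fun x => ?_)
            simp only
            rw [ker_comp_neg h, neg_sub]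
            ring
        _ = ∫ x, ∫ y, f x * (h.ker (x - y) * w y) := (integral_integral_swap hint).symm
        _ = _ := by simp only [integral_const_mul]
  rw [hfun.lpNorm_eq, eLpNorm_ofReal hp0]
  gcongr with x
  refine (enorm_integral_le_lintegral_enorm _).trans (lintegral_mono fun y => ?_)
  rw [enorm_mul]
  gcongr
  exact hKm _

/-! ### Dispersive decay of locally square integrable functions -/

/-- The inflection points of `phi`. -/
def inflection : Fin 3 → ℝ := ![0, √3, -√3]

/-- The decay in space of the low frequency part of the group. -/
def slow (t x : ℝ) : ℝ≥0∞ := ∑ i, dec (1 / 4) (x - phi₁ (inflection i) * t)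

theorem measurable_slow (t : ℝ) : Measurable (slow t) :=
  Finset.measurable_sum _ fun _ _ => (measurable_dec _).comp (measurable_id.sub measurable_const)

theorem enorm_osc_low_le {a : ℝ → ℂ} {c B : ℝ} (h : IsAmp a c B) (hc : |c| < 4) {t : ℝ}
    (ht : 1 ≤ |t|) (x : ℝ) :
    ‖osc a t x‖ₑ ≤ ENNReal.ofReal (1000000 * B * |t| ^ (-(1 / 4) : ℝ)) * slow t x := by
  have hB := h.nonneg
  obtain ⟨i, hi⟩ := Finite.exists_min fun i => |x - phi₁ (inflection i) * t|
  have h1 := h.norm_osc_low_caustic hc ht (abs_nonneg (x - phi₁ (inflection i) * t)) x (by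
    intro z hz
    have h3 : ∃ j, z = inflection j := by
      rcases mul_eq_zero.1 hz with h0 | h0
      · exact ⟨0, h0⟩
      · have h4 : z ^ 2 = √3 ^ 2 := by rw [Real.sq_sqrt (by norm_num)]; linarith
        rcases sq_eq_sq_iff_eq_or_eq_neg.1 h4 with h5 | h5
        · exact ⟨1, h5⟩
        · exact ⟨2, h5⟩
    obtain ⟨j, rfl⟩ := h3
    exact hi j)
  rw [← ofReal_norm]
  refine (ENNReal.ofReal_le_ofReal h1).trans ?_
  rw [Real.mul_rpow (by positivity) (by positivity), ← mul_assoc, ENNReal.ofReal_mul (by positivity)]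
  exact mul_le_mul_right (Finset.single_le_sum (f := fun i =>
    dec (1 / 4) (x - phi₁ (inflection i) * t)) (fun _ _ => zero_le) (Finset.mem_univ i)) _

theorem exists_lintegral_slow_le : ∃ J : ℝ≥0∞, J ≠ ⊤ ∧
    ∀ t, ∫⁻ x, slow t x ^ (9 / 2 : ℝ) ≤ J := by
  have h1 := Par.lintegral_decay_lt_top (a := 1 / 4) (m := 9 / 2) (by norm_num) (by norm_num)
  refine ⟨3 ^ (9 / 2 - 1 : ℝ) * (3 * ∫⁻ x, dec (1 / 4) x ^ (9 / 2 : ℝ)),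
    ENNReal.mul_ne_top (by finiteness) (ENNReal.mul_ne_top (by finiteness) h1.ne), fun t => ?_⟩
  calc _ ≤ ∫⁻ x, 3 ^ (9 / 2 - 1 : ℝ) *
        ∑ i, dec (1 / 4) (x - phi₁ (inflection i) * t) ^ (9 / 2 : ℝ) := by
        refine lintegral_mono fun x => ?_
        have := ENNReal.rpow_sum_le_const_mul_sum_rpow (Finset.univ : Finset (Fin 3))
          (fun i => dec (1 / 4) (x - phi₁ (inflection i) * t)) (p := 9 / 2) (by norm_num)
        simpa [slow] using this
    _ = _ := by
        rw [lintegral_const_mul' _ _ (by finiteness), lintegral_finsetSum]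
        · congr 1
          simp only [lintegral_sub_right_eq_self (fun x => dec (1 / 4) x ^ (9 / 2 : ℝ))]
          simp
        · exact fun i _ => ((measurable_dec _).comp
            (measurable_id.sub measurable_const)).pow_const _

theorem exists_lpNorm_low_le {δ : ℝ} (hδ : 0 ≤ δ) (hδ' : δ < 1 / 4) {B : ℝ} :
    ∃ C : ℝ≥0∞, C ≠ ⊤ ∧ ∀ (a : ℝ → ℂ) (c : ℝ), IsAmp a c B → |c| < 4 →
      ∀ (T W : 𝓢'(ℝ, ℂ)) (g : ℝ → ℂ), IsFunction T g → IsFunction W (fun y => g y ^ 5) →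
      ∀ N : ℝ≥0∞, (∀ c R : ℝ, 1 ≤ R →
        ∫⁻ y in Metric.closedBall c R, ‖g y‖ₑ ^ (2 : ℝ) ≤ N * ENNReal.ofReal (R ^ δ)) →
      ∀ t : ℝ, 1 ≤ |t| → lpNorm (ENNReal.ofReal 6) (multiplier (grp a t) W) ≤
        C * N ^ (1 / 4 : ℝ) * ENNReal.ofReal (|t| ^ (-(1 / 4) : ℝ)) *
          lpNorm (ENNReal.ofReal 6) T ^ (9 / 2 : ℝ) := by
  obtain ⟨D, hD, hDb⟩ := exists_lintegral_dec_mul_le hδ hδ'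
  obtain ⟨J, hJ, hJb⟩ := exists_lintegral_slow_le
  refine ⟨ENNReal.ofReal (1000000 * B) * (3 * D) ^ (1 / 4 : ℝ) * J ^ (1 / 6 : ℝ), by finiteness,
    fun a c ha hc T W g hT hW N hN t ht => ?_⟩
  have hB := ha.nonneg
  wlog hg : StronglyMeasurable g generalizing g with H
  · have hae := hT.aestronglyMeasurable.ae_eq_mk
    refine H _ (hT.congr hae) (hW.congr ?_) (fun c R hR => ?_)
      hT.aestronglyMeasurable.stronglyMeasurable_mk
    · filter_upwards [hae] with y hy
      rw [hy]
    · refine le_trans (le_of_eq (lintegral_congr_ae ?_)) (hN c R hR)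
      filter_upwards [ae_restrict_of_ae hae] with y hy
      rw [hy]
  set b := ENNReal.ofReal (1000000 * B * |t| ^ (-(1 / 4) : ℝ)) with hb
  have h1 := lpNorm_multiplier_le_conv (p := 6) (by norm_num) (ha.sym.grp t) (hg.pow 5) hW
    ((measurable_slow t).const_mul b) (fun x => le_trans (by
      rw [← ofReal_norm, ← ofReal_norm]
      exact ENNReal.ofReal_le_ofReal (norm_ker_grp_le ha.sym t x)) (enorm_osc_low_le ha hc ht x))
  have h2 : ∀ x, ∫⁻ y, b * slow t (x - y) * ‖(g ^ 5) y‖ₑ =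
      b * ∫⁻ y, slow t (x - y) * ‖g y‖ₑ ^ (5 : ℝ) := fun x => by
    rw [← lintegral_const_mul' b _ ENNReal.ofReal_ne_top]
    refine lintegral_congr fun y => ?_
    rw [Pi.pow_apply, enorm_pow, ← ENNReal.rpow_natCast, mul_assoc]
    norm_num
  simp only [h2] at h1
  have h3 := lintegral_conv_pow_five_le (measurable_slow t) hg.enorm (N := 3 * (D * N)) (fun x => by
    simp only [slow, Finset.sum_mul]
    rw [lintegral_finsetSum]
    · refine (Finset.sum_le_sum (g := fun _ => D * N) fun i _ => ?_).trans_eq (by simp)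
      have := hDb _ (hg.enorm.pow_const 2) N (x - phi₁ (inflection i) * t) (hN _)
      simpa only [sub_right_comm] using this
    · exact fun i _ => ((measurable_dec _).comp ((measurable_const.sub measurable_id).sub
        measurable_const)).mul (hg.enorm.pow_const _))
  simp only [ENNReal.mul_rpow_of_nonneg _ _ (by norm_num : (0 : ℝ) ≤ 6)] at h1
  rw [lintegral_const_mul' _ _ (by finiteness), ENNReal.mul_rpow_of_nonneg _ _ (by norm_num),
    ← ENNReal.rpow_mul, mul_one_div_cancel (by norm_num), ENNReal.rpow_one] at h1
  refine h1.trans ?_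
  calc _ ≤ b * ((3 * (D * N)) ^ (3 / 2 : ℝ) * J *
        (∫⁻ y, ‖g y‖ₑ ^ (6 : ℝ)) ^ (9 / 2 : ℝ)) ^ (1 / 6 : ℝ) := by
        gcongr
        refine h3.trans ?_
        gcongr
        exact hJb t
    _ = _ := by
        rw [hT.lpNorm_eq, eLpNorm_ofReal (by norm_num), hb, ENNReal.ofReal_mul (by positivity),
          ENNReal.mul_rpow_of_nonneg _ _ (by norm_num), ENNReal.mul_rpow_of_nonneg _ _ (by norm_num),
          ← mul_assoc 3 D N, ENNReal.mul_rpow_of_nonneg (3 * D) _ (by norm_num)]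
        simp only [← ENNReal.rpow_mul, ENNReal.mul_rpow_of_nonneg _ _ (by norm_num : (0 : ℝ) ≤ 1 / 6)]
        norm_num
        ring

theorem exists_lpNorm_high_le {ρ : ℝ → ℝ} (hρ : IsCutoff ρ) :
    ∃ C : ℝ≥0∞, C ≠ ⊤ ∧ ∀ (k : ℤ) (t : ℝ) (W : 𝓢'(ℝ, ℂ)), 4 ≤ |(k : ℝ)| → 1 ≤ |t| →
      lpNorm (ENNReal.ofReal 6) (box ρ k (S t (phiD W))) ≤
        C * ENNReal.ofReal (|t| ^ (-(1 / 4) : ℝ)) *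
          (wt k ^ (-(1 / 6) : ℝ) * lpNorm (ENNReal.ofReal (6 / (6 - 1))) (box ρ k W)) := by
  have hχ := one_le_chiB
  have hd : 0 < dispC 6 := by unfold dispC; positivity
  refine ⟨ENNReal.ofReal (dispC 6 * (12 * chiB) * 20000 ^ (2 / 3 : ℝ)), ENNReal.ofReal_ne_top,
    fun k t W hk ht => ?_⟩
  have ht0 : 0 < |t| := by linarith
  set K := 1 + |(k : ℝ)| with hK
  have hK0 : 0 < K := by positivity
  set B := 12 * chiB / K with hB
  have hB0 : 0 < B := by positivity
  set A := 20000 * K ^ (5 / 4 : ℝ) * |t| ^ (-(5 / 12) : ℝ) with hA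
  have hA0 : 0 < A := by positivity
  have hosc : ∀ x, ‖osc (fun ξ => chi k ξ * (phi ξ : ℂ)) t x‖ ≤ B * A := by
    intro x
    have h1 := (isAmp_chi_phi k).norm_osc_high hk (abs_pos.1 ht0) x
    have h2 := (isAmp_chi_phi k).norm_osc_uniform t x
    refine abs_le_of_sq_le_sq' ?_ (by positivity) |>.2
    have h3 : √(|(k : ℝ)| ^ 3 / |t|) ≤ K ^ (3 / 2 : ℝ) * |t| ^ (-(1 / 2) : ℝ) := by
      rw [Real.sqrt_le_left (by positivity), mul_pow, ← Real.rpow_natCast (K ^ _), ← Real.rpow_natCast (|t| ^ _),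
        ← Real.rpow_mul hK0.le, ← Real.rpow_mul ht0.le, div_eq_mul_inv]
      norm_num
      rw [Real.rpow_neg_one]
      gcongr
      rw [hK]; linarith
    have h4 : (1 + |t|) ^ (-(1 / 3) : ℝ) ≤ |t| ^ (-(1 / 3) : ℝ) :=
      Real.rpow_le_rpow_of_nonpos ht0 (by linarith) (by norm_num)
    calc _ = ‖osc (fun ξ => chi k ξ * (phi ξ : ℂ)) t x‖ *
          ‖osc (fun ξ => chi k ξ * (phi ξ : ℂ)) t x‖ := sq _
      _ ≤ (600 * B * (K ^ (3 / 2 : ℝ) * |t| ^ (-(1 / 2) : ℝ))) *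
          (B * (400000 * K * |t| ^ (-(1 / 3) : ℝ))) := by
          refine mul_le_mul (h1.trans ?_) (h2.trans ?_) (norm_nonneg _) (by positivity) <;> gcongr
      _ = B ^ 2 * (240000000 * (K ^ (3 / 2 : ℝ) * K ^ (1 : ℝ)) *
          (|t| ^ (-(1 / 2) : ℝ) * |t| ^ (-(1 / 3) : ℝ))) := by rw [Real.rpow_one]; ring
      _ ≤ B ^ 2 * (20000 ^ 2 * (K ^ (5 / 4 : ℝ) * K ^ (5 / 4 : ℝ)) *
          (|t| ^ (-(5 / 12) : ℝ) * |t| ^ (-(5 / 12) : ℝ))) := by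
          simp only [← Real.rpow_add hK0, ← Real.rpow_add ht0]
          norm_num
          gcongr
          norm_num
      _ = _ := by rw [hA]; ring
  rw [box_group_phi hρ]
  refine ((isAmp_chi_phi k).lpNorm_disp_le (by norm_num : (2 : ℝ) < 6) hB0 hA0 hosc _).trans ?_
  rw [← mul_assoc]
  refine mul_le_mul_left ?_ _
  rw [wt, ENNReal.ofReal_rpow_of_pos hK0, ← ENNReal.ofReal_mul (by positivity),
    ← ENNReal.ofReal_mul (by positivity)]
  refine ENNReal.ofReal_le_ofReal ?_
  have e0 : ((6 : ℝ) - 2) / 6 = 2 / 3 := by norm_num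
  have e1 : K⁻¹ * K ^ (5 / 6 : ℝ) = K ^ (-(1 / 6) : ℝ) := by
    rw [← Real.rpow_neg_one, ← Real.rpow_add hK0]; norm_num
  rw [e0, hA, Real.mul_rpow (by positivity) (by positivity), Real.mul_rpow (by positivity) (by positivity),
    ← Real.rpow_mul hK0.le, ← Real.rpow_mul ht0.le, ← hK, ← e1]
  have e2 : |t| ^ (-(5 / 12) * (2 / 3) : ℝ) ≤ |t| ^ (-(1 / 4) : ℝ) :=
    Real.rpow_le_rpow_of_exponent_le ht (by norm_num)
  calc _ = dispC 6 * (12 * chiB) * 20000 ^ (2 / 3 : ℝ) * |t| ^ (-(5 / 12) * (2 / 3) : ℝ) *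
        (K⁻¹ * K ^ (5 / 6 : ℝ)) := by norm_num; ring
    _ ≤ _ := by gcongr

theorem box_group_phi_window {ρ : ℝ → ℝ} (hρ : IsCutoff ρ) (k : ℤ) (t : ℝ) (W : 𝓢'(ℝ, ℂ)) :
    box ρ k (S t (phiD W)) = multiplier (grp (fun ξ => (window ρ k ξ : ℂ) * (phi ξ : ℂ)) t) W := by
  rw [S, phiD, box, multiplier_multiplier (tg_group t) tg_phi,
    multiplier_multiplier (tg_window hρ k) ((tg_group t).mul tg_phi)]
  congr 2
  funext ξ
  rw [grp]
  ring

theorem isAmp_window_phi {ρ : ℝ → ℝ} (hρ : IsCutoff ρ) (k : ℤ) :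
    IsAmp (fun ξ => (window ρ k ξ : ℂ) * (phi ξ : ℂ)) k (2 * winB hρ * 6) := by
  have h6 : 6 / (1 + |(k : ℝ)|) ≤ 6 := div_le_self (by norm_num) (by simp)
  refine (isAmp_window hρ k).mul (Complex.ofRealCLM.contDiff.comp contDiff_phi)
    (fun ξ h => ?_) (fun ξ h => ?_)
  · rw [Complex.norm_real]; exact (abs_phi_le_of_near h).trans h6
  · rw [(deriv_phi ξ).ofReal_comp.deriv, Complex.norm_real]; exact (abs_phi₁_le_of_near h).trans h6

theorem ofReal_abs_rpow_le_dec {t : ℝ} (ht : 1 ≤ |t|) :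
    ENNReal.ofReal (|t| ^ (-(1 / 4) : ℝ)) ≤ 2 * dec (1 / 4) t := by
  rw [dec, ← ENNReal.ofReal_ofNat 2, ← ENNReal.ofReal_mul zero_le_two]
  refine ENNReal.ofReal_le_ofReal ((Real.rpow_le_rpow_of_nonpos (x := (1 + |t|) / 2) (by positivity)
    (by linarith) (by norm_num)).trans ?_)
  rw [Real.div_rpow (by positivity) zero_le_two, div_eq_mul_inv, ← Real.rpow_neg zero_le_two, neg_neg,
    mul_comm]
  gcongr
  exact (Real.rpow_le_rpow_of_exponent_le one_le_two (by norm_num)).trans (Real.rpow_one 2).le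

theorem one_le_dec {t : ℝ} (ht : |t| ≤ 1) : 1 ≤ 2 * dec (1 / 4) t := by
  rw [dec, ← ENNReal.ofReal_ofNat 2, ← ENNReal.ofReal_mul zero_le_two, ← ENNReal.ofReal_one]
  refine ENNReal.ofReal_le_ofReal ?_
  have h1 : (2 : ℝ) ^ (-1 : ℝ) ≤ (1 + |t|) ^ (-(1 / 4) : ℝ) :=
    (Real.rpow_le_rpow_of_exponent_le one_le_two (by norm_num)).trans
      (Real.rpow_le_rpow_of_nonpos (by positivity) (by linarith) (by norm_num))
  rw [Real.rpow_neg_one] at h1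
  linarith

namespace Par
variable {P : Par}

theorem p_eq_six (hl : P.lam = 4) : P.p = 6 := by rw [p, hl]; norm_num

variable (P) in
theorem exists_enorm_grp_nonl_le : ∃ C : ℝ≥0∞, C ≠ ⊤ ∧ ∀ (t : ℝ) (x : P.Space),
    ‖P.grp t (P.nonl x)‖ₑ ≤ C * ‖x‖ₑ ^ (P.lam + 1) := by
  obtain ⟨C, hC, h⟩ := P.exists_norm_grp_nonl_sub_le
  refine ⟨ENNReal.ofReal C, ENNReal.ofReal_ne_top, fun t x => ?_⟩
  have h1 := h t x 0 ‖x‖ le_rfl (by simp)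
  have hA : 0 ≤ P.A := by
    have := P.two_lt_p
    exact div_nonneg (div_nonneg (by linarith) P.p_pos.le) (by norm_num)
  rw [nonl_zero, sub_zero, sub_zero, ← pow_succ] at h1
  rw [← ofReal_norm, ← ofReal_norm, ← ENNReal.ofReal_pow (norm_nonneg x),
    ← ENNReal.ofReal_mul hC.le]
  refine ENNReal.ofReal_le_ofReal (h1.trans ?_)
  gcongr
  exact mul_le_of_le_one_right hC.le
    (Real.rpow_le_one_of_one_le_of_nonpos (by simp) (by linarith))

theorem pow_five_le {a d : ℝ≥0∞} (h : a ≤ d) : a ^ 5 ≤ d ^ (1 / 2 : ℝ) * a ^ (9 / 2 : ℝ) := by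
  calc a ^ 5 = a ^ (1 / 2 : ℝ) * a ^ (9 / 2 : ℝ) := by
        rw [← ENNReal.rpow_add_of_nonneg _ _ (by norm_num) (by norm_num), ← ENNReal.rpow_natCast]
        norm_num
    _ ≤ _ := by gcongr

variable (P) in
theorem exists_enorm_grp_nonl_le_of_local (hl : P.lam = 4) {δ : ℝ} (hδ : 0 ≤ δ) (hδ' : δ < 1 / 4)
    {d N : ℝ≥0∞} (hd : d ≠ ⊤) (hN : N ≠ ⊤) : ∃ C : ℝ≥0∞, C ≠ ⊤ ∧ ∀ x : P.Space, ‖x‖ₑ ≤ d →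
      (∀ g, IsFunction x.val g → ∀ c R : ℝ, 1 ≤ R →
        ∫⁻ y in Metric.closedBall c R, ‖g y‖ₑ ^ (2 : ℝ) ≤ N * ENNReal.ofReal (R ^ δ)) →
      ∀ t : ℝ, ‖P.grp t (P.nonl x)‖ₑ ≤ C * dec (1 / 4) t * ‖x‖ₑ ^ (9 / 2 : ℝ) := by
  have hp := p_eq_six hl
  have hq0 : 0 < P.q := by linarith [P.hq]
  obtain ⟨C₀, hC₀, h₀⟩ := P.exists_enorm_grp_nonl_le
  obtain ⟨C₁, hC₁, h₁⟩ := exists_lpNorm_low_le hδ hδ' (B := 2 * winB P.hρ * 6)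
  obtain ⟨C₂, hC₂, h₂⟩ := exists_lpNorm_high_le P.hρ
  obtain ⟨C₃, hC₃, h₃⟩ := P.exists_power_sub_le
  obtain ⟨C₄, -, h₄⟩ := P.exists_lpNorm_le
  set Z := lq P.q fun k => wt k ^ (-2 : ℝ) with hZ
  have hZt : Z ≠ ⊤ := by
    have := tsum_wt_rpow_lt_top (κ := 2 * P.q) (by linarith [P.hq])
    refine ENNReal.rpow_ne_top_of_nonneg (by positivity) (ne_of_lt ?_)
    simpa only [← ENNReal.rpow_mul, neg_mul] using this
  set L := 5 ^ (P.s + 2) * (C₁ * N ^ (1 / 4 : ℝ) * ENNReal.ofReal C₄ ^ (9 / 2 : ℝ)) with hL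
  have hs2 : 0 ≤ P.s + 2 := by linarith [P.s_nonneg]
  refine ⟨2 * (C₀ * d ^ (1 / 2 : ℝ)) + (2 * (L * Z) + 2 * (C₂ * (C₃ * d ^ (1 / 2 : ℝ)))),
    by finiteness, fun x hx hloc t => ?_⟩
  rw [add_mul, add_mul]
  rcases le_total |t| 1 with ht | ht
  · refine le_trans ?_ le_self_add
    refine (h₀ t x).trans ?_
    rw [hl]
    calc _ ≤ (2 * dec (1 / 4) t) * (C₀ * (d ^ (1 / 2 : ℝ) * ‖x‖ₑ ^ (9 / 2 : ℝ))) := by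
          rw [← one_mul (C₀ * _)]
          gcongr
          · exact one_le_dec ht
          · exact pow_five_le hx
      _ = _ := by ring
  refine le_trans ?_ le_add_self
  set W := power (P.lam + 1) x.val
  obtain ⟨g, hg, -⟩ := x.exists_isFunction
  have hW : IsFunction W fun y => g y ^ 5 := by
    have := Space.isFunction_power hg
    rw [hl] at this
    change IsFunction (power (P.lam + 1) x.val) _
    rwa [hl]
  set τ := ENNReal.ofReal (|t| ^ (-(1 / 4) : ℝ))
  have key : ∀ k, wt k ^ P.s * lpNorm (ENNReal.ofReal P.p) (box P.ρ k (GBBM.S t (phiD W))) ≤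
      L * τ * ‖x‖ₑ ^ (9 / 2 : ℝ) * wt k ^ (-2 : ℝ) + C₂ * τ * (wt k ^ (P.s - P.η) *
        lpNorm (ENNReal.ofReal (P.p / (P.p - 1))) (box P.ρ k W)) := by
    intro k
    rcases lt_or_ge |(k : ℝ)| 4 with hk | hk
    · refine le_trans ?_ le_self_add
      have h5 := h₁ _ _ (isAmp_window_phi P.hρ k) hk x.val W g hg hW N (hloc g hg) t ht
      have h6 := h₄ x.val x.N_ne_top
      rw [← enorm_eq, hp] at h6
      have h7 : wt k ≤ 5 := by
        rw [wt, ← ENNReal.ofReal_ofNat 5]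
        exact ENNReal.ofReal_le_ofReal (by linarith)
      rw [hp, box_group_phi_window P.hρ, show P.s = P.s + 2 + -2 by ring, wt_rpow_add]
      calc _ ≤ 5 ^ (P.s + 2) * wt k ^ (-2 : ℝ) * (C₁ * N ^ (1 / 4 : ℝ) * τ *
            (ENNReal.ofReal C₄ * ‖x‖ₑ) ^ (9 / 2 : ℝ)) := by
            gcongr
            exact h5.trans (by gcongr)
        _ = _ := by
            rw [hL, ENNReal.mul_rpow_of_nonneg _ _ (by norm_num)]
            ring
    · refine le_trans ?_ le_add_self
      rw [hp]
      refine (mul_le_mul_right (h₂ k t W hk ht) _).trans ?_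
      rw [← mul_assoc, mul_comm (wt k ^ P.s), mul_assoc, ← mul_assoc (wt k ^ P.s), ← wt_rpow_add]
      gcongr
      · exact one_le_wt k
      · have : P.η ≤ 1 / P.p := min_le_right _ _
        rw [hp] at this
        linarith
  have h8 : lq P.q (fun k => wt k ^ (P.s - P.η) *
      lpNorm (ENNReal.ofReal (P.p / (P.p - 1))) (box P.ρ k W)) ≤
      C₃ * (d ^ (1 / 2 : ℝ) * ‖x‖ₑ ^ (9 / 2 : ℝ)) := by
    have h9 := h₃ x 0 ‖x‖ₑ (enorm_eq (P := P) x).ge (by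
      rw [← enorm_eq, enorm_zero]; exact zero_le)
    rw [map_zero, power_zero, sub_zero, sub_zero, modNorm_eq P.hq, ← enorm_eq, mul_assoc,
      ← pow_succ, hl] at h9
    simp only [hl, W] at h9 ⊢
    exact h9.trans (by gcongr; exact pow_five_le hx)
  rw [enorm_eq, val_grp, val_nonl, Par.N, modNorm_eq P.hq]
  refine (lq_mono hq0 key).trans ((lq_add_le P.hq _ _).trans ?_)
  rw [lq_const_mul hq0, lq_const_mul hq0, ← hZ]
  have hτ : τ ≤ 2 * dec (1 / 4) t := ofReal_abs_rpow_le_dec ht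
  calc _ ≤ L * (2 * dec (1 / 4) t) * ‖x‖ₑ ^ (9 / 2 : ℝ) * Z + C₂ * (2 * dec (1 / 4) t) *
        (C₃ * (d ^ (1 / 2 : ℝ) * ‖x‖ₑ ^ (9 / 2 : ℝ))) := by gcongr
    _ = _ := by ring

end Par

namespace Par
variable {P : Par}

theorem exists_enorm_grp_le_tn {r : ℝ} (hr : 0 < r) : ∃ K : ℝ, 0 < K ∧ ∀ (x : P.Space) (t : ℝ),
    ‖P.grp t x‖ₑ ≤ ENNReal.ofReal K * P.tn r (fun t => P.grp t x) := by
  have hχ := one_le_chiB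
  refine ⟨12 * chiB, by positivity, fun x t => ?_⟩
  rw [← ENNReal.rpow_le_rpow_iff hr, ENNReal.mul_rpow_of_nonneg _ _ hr.le, rpow_tn hr]
  calc _ = ∫⁻ _ in Set.Icc t (t + 1), ‖P.grp t x‖ₑ ^ r := by
        rw [setLIntegral_const, Real.volume_Icc, add_sub_cancel_left, ENNReal.ofReal_one, mul_one]
    _ ≤ ∫⁻ τ in Set.Icc t (t + 1), ENNReal.ofReal (12 * chiB) ^ r * ‖P.grp τ x‖ₑ ^ r := by
        refine setLIntegral_mono' measurableSet_Icc fun τ hτ => ?_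
        rw [← ENNReal.mul_rpow_of_nonneg _ _ hr.le]
        refine ENNReal.rpow_le_rpow ?_ hr.le
        have h1 := norm_grp_le (t - τ) (P.grp τ x)
        rw [grp_grp, sub_add_cancel] at h1
        have h2 : |t - τ| ≤ 1 := by rw [abs_le]; constructor <;> linarith [hτ.1, hτ.2]
        rw [← ofReal_norm, ← ofReal_norm, ← ENNReal.ofReal_mul (by positivity)]
        refine ENNReal.ofReal_le_ofReal (h1.trans (mul_le_mul_of_nonneg_right ?_ (norm_nonneg _)))
        nlinarith
    _ ≤ _ := by
        rw [lintegral_const_mul' _ _ (by finiteness)]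
        exact mul_le_mul_right (setLIntegral_le_lintegral _ _) _

theorem exists_tn_grp_le {r m : ℝ} (hr : 0 < r) (hm : r ≤ m) : ∃ K : ℝ, 0 < K ∧ ∀ x : P.Space,
    P.tn m (fun t => P.grp t x) ≤ ENNReal.ofReal K * P.tn r (fun t => P.grp t x) := by
  obtain ⟨K, hK, h⟩ := exists_enorm_grp_le_tn (P := P) hr
  have hm0 : 0 < m := hr.trans_le hm
  have hmr : 0 ≤ m - r := sub_nonneg.2 hm
  refine ⟨K ^ ((m - r) / m), by positivity, fun x => ?_⟩
  set w := P.tn r (fun t => P.grp t x)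
  by_cases hw : w = ⊤
  · rw [hw, ENNReal.mul_top (by simp; positivity)]; exact le_top
  rw [← ENNReal.rpow_le_rpow_iff hm0, rpow_tn hm0, ENNReal.mul_rpow_of_nonneg _ _ hm0.le,
    ENNReal.ofReal_rpow_of_pos (by positivity), ← Real.rpow_mul hK.le, div_mul_cancel₀ _ hm0.ne']
  calc _ ≤ ∫⁻ t, (ENNReal.ofReal K * w) ^ (m - r) * ‖P.grp t x‖ₑ ^ r := by
        refine lintegral_mono fun t => ?_
        conv_lhs => rw [← sub_add_cancel m r, ENNReal.rpow_add_of_nonneg _ _ hmr hr.le]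
        gcongr
        exact h x t
    _ = _ := by
        rw [lintegral_const_mul' _ _ (by finiteness), ← rpow_tn hr,
          ENNReal.mul_rpow_of_nonneg _ _ hmr, mul_assoc, ← ENNReal.rpow_add_of_nonneg _ _ hmr hr.le,
          sub_add_cancel, ENNReal.ofReal_rpow_of_pos hK]

theorem tn_ne_top_iff {r : ℝ} (hr : 0 < r) (u : ℝ → P.Space) :
    P.tn r u ≠ ⊤ ↔ ∫⁻ t, ‖u t‖ₑ ^ r ≠ ⊤ := by
  rw [← rpow_tn hr]
  exact (ENNReal.rpow_eq_top_iff_of_pos hr).not.symm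

theorem IsMild.tn_ne_top {x : P.Space} {u : ℝ → P.Space} (hu : IsMild x u) {r : ℝ} (hr : 1 ≤ r)
    (hx : P.tn r (fun t => P.grp t x) ≠ ⊤) (hd : P.tn r (duh u) ≠ ⊤) : P.tn r u ≠ ⊤ := by
  have e : u = fun t => P.grp t x + duh u t := funext hu.eq
  rw [e]
  exact ne_top_of_le_ne_top (ENNReal.add_ne_top.2 ⟨hx, hd⟩)
    (tn_add_le hr (continuous_grp_comp continuous_id continuous_const) (continuous_duh hu.continuous))

/-- The Duhamel term of an integrable nonlinearity. -/
theorem tn_duh_ne_top {r : ℝ} (hr : 1 ≤ r) (hA : 1 < P.A * r) {u : ℝ → P.Space} (hu : Continuous u)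
    (h : P.tn (P.lam + 1) u ≠ ⊤) : P.tn r (duh u) ≠ ⊤ := by
  obtain ⟨C, -, hC⟩ := P.exists_enorm_duh_le
  have hr0 : 0 < r := by linarith
  have h1 := tn_duh_le hC hr0 one_pos le_rfl hr (by ring) hu
  rw [mul_one] at h1
  exact ne_top_of_le_ne_top (ENNReal.mul_ne_top ENNReal.ofReal_ne_top
    (ENNReal.mul_ne_top (dn_ne_top hr0 hA) (ENNReal.pow_ne_top h))) h1

/-- The quintic case, in which the decay of the group alone does not suffice. -/
theorem IsMild.tn_ne_top_of_four (hl : P.lam = 4) {x : P.Space} {u : ℝ → P.Space} (hu : IsMild x u)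
    {r d : ℝ} (hr : 4 < r) (hr' : r < 9 / 2) (hd : ∀ t, ‖u t‖ ≤ d)
    (hx : P.tn r (fun t => P.grp t x) ≠ ⊤) (h5 : P.tn (P.lam + 1) u ≠ ⊤) : P.tn r u ≠ ⊤ := by
  have hp := p_eq_six hl
  have hr0 : 0 < r := by linarith
  refine hu.tn_ne_top (by linarith) hx ?_
  have hr4 : 1 / r < 1 / 4 := one_div_lt_one_div_of_lt (by norm_num) hr
  have hr5 : 2 / 9 < 1 / r := by rw [lt_div_iff₀ hr0]; linarith
  set b := 1 / (1 - (1 / 4 - 1 / r) / 2) with hb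
  have hden : 0 < 1 - (1 / 4 - 1 / r) / 2 := by linarith
  have hb1 : 1 < b := by rw [hb, lt_div_iff₀ hden]; linarith
  have hb0 : 0 < b := by linarith
  have hb2 : b < 2 := by rw [hb, div_lt_iff₀ hden]; linarith
  set a := 1 / ((1 / 4 + 1 / r) / 2) with ha
  have ha4 : 4 < a := by rw [ha, lt_div_iff₀ (by linarith)]; linarith
  have har : a ≤ r := by
    rw [ha, div_le_iff₀ (by linarith)]
    have : r * (1 / r) = 1 := mul_one_div_cancel hr0.ne'
    nlinarith
  have hA : P.A = 2 / 9 := by rw [A, hp]; norm_num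
  have hcast : ((P.lam : ℝ) + 1) = 5 := by rw [hl]; norm_num
  have hm : P.tn (9 / 2 * b) u ≠ ⊤ := by
    refine hu.tn_ne_top (by linarith) ?_ (tn_duh_ne_top (by linarith) (by rw [hA]; linarith)
      hu.continuous h5)
    obtain ⟨K, -, hK⟩ := exists_tn_grp_le (P := P) hr0 (m := 9 / 2 * b) (by linarith)
    exact ne_top_of_le_ne_top (ENNReal.mul_ne_top ENNReal.ofReal_ne_top hx) (hK x)
  have hint : ∫⁻ τ, ‖u τ‖ₑ ^ (P.lam + 1) ≠ ⊤ := by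
    rw [tn_ne_top_iff (by linarith)] at h5
    simpa only [← ENNReal.rpow_natCast, Nat.cast_add, Nat.cast_one] using h5
  obtain ⟨M, hM, hloc⟩ := hu.exists_local_sq_le hr0 (by rw [hp]; linarith) hx hint
  set γ := 1 / 2 - 1 / P.p - 1 / r with hγ
  rw [hp] at hγ
  obtain ⟨C, hC, hCb⟩ := P.exists_enorm_grp_nonl_le_of_local hl (δ := γ * 2) (by linarith)
    (by linarith) (d := ENNReal.ofReal d) (N := M ^ (2 : ℝ)) ENNReal.ofReal_ne_top (by finiteness)
  have hgrp : ∀ t τ, ‖P.grp t (P.nonl (u τ))‖ₑ ≤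
      C * dec (1 / 4) t * ‖u τ‖ₑ ^ (9 / 2 : ℝ) := fun t τ =>
    hCb (u τ) (by rw [← ofReal_norm]; exact ENNReal.ofReal_le_ofReal (hd τ)) (fun g hg c R hR => by
      refine (hloc τ g hg c R hR).trans_eq ?_
      rw [ENNReal.mul_rpow_of_nonneg _ _ zero_le_two, ENNReal.ofReal_rpow_of_pos (by positivity),
        ← Real.rpow_mul (by linarith)]) t
  have hduh : ∀ t, ‖duh u t‖ₑ ≤ C * ∫⁻ τ, dec (1 / 4) (t - τ) * ‖u τ‖ₑ ^ (9 / 2 : ℝ) := by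
    intro t
    rw [duh, enorm_smul]
    have h1 : ‖P.cD‖ₑ ≤ 1 := by
      rw [← ofReal_norm, ← ENNReal.ofReal_one]
      exact ENNReal.ofReal_le_ofReal norm_cD_le
    have h2 : ‖∫ τ in (0 : ℝ)..t, P.grp (t - τ) (P.nonl (u τ))‖ₑ ≤
        ∫⁻ τ, ‖P.grp (t - τ) (P.nonl (u τ))‖ₑ := by
      rw [← ofReal_norm, intervalIntegral.norm_intervalIntegral_eq, ofReal_norm]
      exact (enorm_integral_le_lintegral_enorm _).trans (setLIntegral_le_lintegral _ _)
    refine (mul_le_mul' h1 h2).trans ?_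
    rw [one_mul, ← lintegral_const_mul' _ _ hC]
    refine lintegral_mono fun τ => ?_
    rw [← mul_assoc]
    exact hgrp _ _
  have hY := lintegral_conv_rpow_le volume (measurable_dec (1 / 4))
    (hu.continuous.enorm.measurable.pow_const (9 / 2 : ℝ)) (a := a) (b := b) (r := r) (by linarith)
    hb0 har (by linarith) (by rw [ha, hb, one_div_one_div, one_div_one_div]; ring)
  have hdec := lintegral_decay_lt_top (a := 1 / 4) (m := a) (by linarith) (by linarith)
  rw [tn_ne_top_iff (by positivity)] at hm
  simp only [← ENNReal.rpow_mul] at hY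
  have hfin : (∫⁻ t, (∫⁻ τ, dec (1 / 4) (t - τ) * ‖u τ‖ₑ ^ (9 / 2 : ℝ)) ^ r) ≠ ⊤ := by
    refine (ENNReal.rpow_eq_top_iff_of_pos (one_div_pos.2 hr0)).not.1 (ne_top_of_le_ne_top ?_ hY)
    exact ENNReal.mul_ne_top (ENNReal.rpow_ne_top_of_nonneg (by positivity) hdec.ne)
      (ENNReal.rpow_ne_top_of_nonneg (by positivity) hm)
  rw [tn_ne_top_iff hr0]
  refine ne_top_of_le_ne_top (ENNReal.mul_ne_top (ENNReal.rpow_ne_top_of_nonneg hr0.le hC) hfin) ?_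
  rw [← lintegral_const_mul' _ _ (by finiteness)]
  refine lintegral_mono fun t => ?_
  rw [← ENNReal.mul_rpow_of_nonneg _ _ hr0.le]
  exact ENNReal.rpow_le_rpow (hduh t) hr0.le

end Par

/-! ### Real-valued distributions -/

/-- Complex conjugation of Schwartz functions. -/
def conjS : 𝓢(ℝ, ℂ) →L[ℝ] 𝓢(ℝ, ℂ) :=
  SchwartzMap.postcompCLM (Complex.conjCLE : ℂ →L[ℝ] ℂ)

theorem conjS_apply (f : 𝓢(ℝ, ℂ)) (x : ℝ) : conjS f x = starRingEnd ℂ (f x) := rfl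

theorem isRealValued_iff {T : 𝓢'(ℝ, ℂ)} :
    IsRealValued T ↔ ∀ f, T (conjS f) = starRingEnd ℂ (T f) := by
  refine ⟨fun h f => h f _ fun x => rfl, fun h f g hg => ?_⟩
  have : g = conjS f := by ext x; exact hg x
  rw [this, h]

theorem fourier_conjS (f : 𝓢(ℝ, ℂ)) (ξ : ℝ) :
    𝓕 (conjS f) ξ = starRingEnd ℂ (𝓕 f (-ξ)) := by
  rw [SchwartzMap.fourier_coe, SchwartzMap.fourier_coe, Real.fourier_eq', Real.fourier_eq',
    ← integral_conj]
  refine integral_congr_ae (Eventually.of_forall fun v => ?_)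
  simp [conjS_apply, ← Complex.exp_conj, map_ofNat]

theorem IsRealValued.multiplier {T : 𝓢'(ℝ, ℂ)} (hT : IsRealValued T) {m : ℝ → ℂ} (hm : TG m)
    (h : ∀ ξ, m (-ξ) = starRingEnd ℂ (m ξ)) : IsRealValued (multiplier m T) := by
  rw [isRealValued_iff] at hT ⊢
  intro f
  rw [multiplier_apply, multiplier_apply, ← hT, mulT_eq hm, mulT_eq hm]
  congr 1
  refine schwartz_ext_fourier fun ξ => ?_
  rw [fourier_mulS hm.comp_neg, fourier_conjS, fourier_conjS, fourier_mulS hm.comp_neg, map_mul, h]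
  simp

theorem IsRealValued.group {T : 𝓢'(ℝ, ℂ)} (hT : IsRealValued T) (t : ℝ) :
    IsRealValued (S t T) := by
  rw [S]
  refine hT.multiplier (tg_group t) fun ξ => ?_
  rw [phi_neg, ← Complex.exp_conj]
  simp

theorem IsFunction.isRealValued_iff {T : 𝓢'(ℝ, ℂ)} {g : ℝ → ℂ} (hT : IsFunction T g) :
    IsRealValued T ↔ ∀ᵐ x, starRingEnd ℂ (g x) = g x := by
  have hint : ∀ f : 𝓢(ℝ, ℂ), ∫ x, f x * starRingEnd ℂ (g x) = starRingEnd ℂ (T (conjS f)) := by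
    intro f
    rw [(hT _).2, ← integral_conj]
    simp [conjS_apply]
  rw [GBBM.isRealValued_iff]
  constructor
  · intro h
    have h1 : IsFunction T fun x => starRingEnd ℂ (g x) := fun f => by
      refine ⟨?_, ?_⟩
      · have := Complex.conjCLE.toContinuousLinearMap.integrable_comp (hT (conjS f)).1
        simpa [conjS_apply] using this
      · rw [hint, h, Complex.conj_conj]
    exact h1.ae_eq hT
  · intro h f
    rw [← Complex.conj_conj (T (conjS f)), ← hint, (hT f).2]
    congr 1
    refine integral_congr_ae ?_
    filter_upwards [h] with x hx
    simp only [hx]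

namespace Par
variable {P : Par}

theorem isRealValued_grp {x : P.Space} (hx : IsRealValued x.val) (t : ℝ) :
    IsRealValued (P.grp t x).val := by
  rw [val_grp]
  exact hx.group t

theorem isRealValued_power {x : P.Space} (hx : IsRealValued x.val) :
    IsRealValued (power (P.lam + 1) x.val) := by
  obtain ⟨g, hg, -⟩ := x.exists_isFunction
  rw [(Space.isFunction_power hg).isRealValued_iff]
  filter_upwards [hg.isRealValued_iff.1 hx] with y hy
  rw [map_pow, hy]

theorem isRealValued_duh {u : ℝ → P.Space} (hu : Continuous u) (h : ∀ t, IsRealValued (u t).val)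
    (t : ℝ) : IsRealValued (duh u t).val := by
  rw [isRealValued_iff]
  intro f
  have hi : IntervalIntegrable (fun τ => P.cD • P.grp (t - τ) (P.nonl (u τ))) volume 0 t :=
    ((continuous_duhamel hu t).const_smul P.cD).intervalIntegrable 0 t
  have e : ∀ τ, (P.cD • P.grp (t - τ) (P.nonl (u τ))).val (conjS f) =
      starRingEnd ℂ ((P.cD • P.grp (t - τ) (P.nonl (u τ))).val f) := by
    intro τ
    rw [map_smul, val_grp, val_nonl, ← map_smul, phiD, ← multiplier_const_mul tg_phi]
    refine isRealValued_iff.1 (((isRealValued_power (h τ)).multiplier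
      ((tg_const _).mul tg_phi) fun ξ => ?_).group (t - τ)) f
    rw [phi_neg, cD]
    simp
    ring
  rw [duh, ← intervalIntegral.integral_smul, eval_integral hi, eval_integral hi]
  simp only [e, intervalIntegral, integral_conj, map_sub]

theorem isClosed_isRealValued : IsClosed {x : P.Space | IsRealValued x.val} := by
  have e : {x : P.Space | IsRealValued x.val} =
      ⋂ f, {x | P.eval (conjS f) x = starRingEnd ℂ (P.eval f x)} := by
    ext x
    rw [Set.mem_iInter]
    exact isRealValued_iff
  rw [e]
  exact isClosed_iInter fun f => isClosed_eq (P.eval _).continuous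
    (Complex.continuous_conj.comp (P.eval f).continuous)

/-! ### Global solutions for small data -/

theorem exists_exponents {r : ℝ} (hl : 4 ≤ P.lam) (hr : P.lam < r)
    (hr' : r * (8 * P.lam + 18) ≤ 9 * P.lam * (P.lam + 2)) : ∃ r₁ m : ℝ, P.lam + 1 ≤ r₁ ∧ r ≤ r₁ ∧
      0 < m ∧ 1 / m = 1 - P.lam / r₁ ∧ 1 < P.A * m ∧ (r₁ ≠ r → r₁ = P.lam + 1) := by
  have hl' : (4 : ℝ) ≤ P.lam := by exact_mod_cast hl
  have hA : P.A = P.lam / (3 * (P.lam + 2)) := by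
    rw [A, p, add_sub_cancel_right, div_div, mul_comm]
  set l := (P.lam : ℝ)
  have hr0 : 0 < r := by linarith
  rcases le_total (l + 1) r with h | h
  · have hd : 0 < 1 - l / r := by rw [sub_pos, div_lt_one hr0]; exact hr
    refine ⟨r, 1 / (1 - l / r), h, le_rfl, by positivity, one_div_one_div _, ?_, fun h => (h rfl).elim⟩
    rw [hA, mul_one_div, lt_div_iff₀ hd, one_mul, sub_lt_comm, lt_div_iff₀ hr0,
      one_sub_div (by positivity), div_mul_eq_mul_div, div_lt_iff₀ (by positivity)]
    nlinarith
  · refine ⟨l + 1, l + 1, le_rfl, h, by positivity, by field_simp; ring, ?_, fun _ => rfl⟩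
    rw [hA, div_mul_eq_mul_div, lt_div_iff₀ (by positivity)]
    nlinarith

variable (P) in
theorem exists_isMild {r : ℝ} (hr : P.lam < r)
    (hr' : r * (8 * P.lam + 18) ≤ 9 * P.lam * (P.lam + 2)) : ∃ ε : ℝ, 0 < ε ∧ ∀ x : P.Space,
      P.tn r (fun t => P.grp t x) < ENNReal.ofReal ε → ∃ u, IsMild x u ∧ P.tn r u ≠ ⊤ ∧
        (IsRealValued x.val → ∀ t, IsRealValued (u t).val) := by
  have hl1 : (1 : ℝ) ≤ P.lam := P.one_le_lam
  have hr0 : 0 < r := by linarith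
  have hp : P.p = P.lam + 2 := rfl
  rcases Nat.lt_or_ge P.lam 4 with hl | hl
  · have hl3 : (P.lam : ℝ) ≤ 3 := by exact_mod_cast Nat.lt_succ_iff.1 hl
    refine ⟨1, one_pos, fun x hx => ?_⟩
    have h0 : x = 0 := eq_zero_of_tn_lt_top hr0 (by
      rw [hp, div_sub_div _ _ two_ne_zero (by positivity), div_mul_eq_mul_div,
        div_le_one (by positivity)]
      nlinarith) (ne_top_of_lt hx)
    subst h0
    refine ⟨fun _ => 0, ⟨continuous_const, fun t => by simp [nonl_zero]⟩, ?_, fun h _ => h⟩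
    simp [tn, hr0]
  obtain ⟨r₁, m, h1, h2, hm, hmr, hAm, hne⟩ := exists_exponents hl hr hr'
  obtain ⟨d, hd, hsol⟩ := P.exists_isMild_of_small h1 hm hmr hAm
  obtain ⟨K₁, hK₁, hb₁⟩ := exists_enorm_grp_le_tn (P := P) hr0
  obtain ⟨K₂, hK₂, hb₂⟩ := exists_tn_grp_le (P := P) hr0 h2
  refine ⟨d / 2 / (K₁ + K₂), by positivity, fun x hx => ?_⟩
  have hsmall : ∀ K, 0 < K → K ≤ K₁ + K₂ →
      ENNReal.ofReal K * P.tn r (fun t => P.grp t x) ≤ ENNReal.ofReal (d / 2) := by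
    intro K hK hK'
    refine (mul_le_mul_right hx.le _).trans ?_
    rw [← ENNReal.ofReal_mul hK.le]
    refine ENNReal.ofReal_le_ofReal ?_
    rw [mul_div_assoc', div_le_iff₀ (by positivity), mul_comm]
    gcongr
  have hs1 : ∀ t, ‖P.grp t x‖ ≤ d / 2 := fun t => by
    have := (hb₁ x t).trans (hsmall K₁ hK₁ (by linarith))
    rwa [← ofReal_norm, ENNReal.ofReal_le_ofReal_iff (by positivity)] at this
  have hs2 := (hb₂ x).trans (hsmall K₂ hK₂ (by linarith))
  obtain ⟨u, hu, hud, hut, huK⟩ := hsol x {y | IsRealValued x.val → IsRealValued y.val}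
    (by
      by_cases hx : IsRealValued x.val
      · simpa only [hx, true_imp_iff] using isClosed_isRealValued
      · simp [hx])
    (fun _ => by rw [map_zero]; intro f g _; simp)
    (fun v hv hvK t hx' => by
      have h3 := isRealValued_iff.1 (isRealValued_grp hx' t)
      have h4 := isRealValued_iff.1 (isRealValued_duh hv (fun t => hvK t hx') t)
      rw [isRealValued_iff]
      intro f
      change (P.grp t x).val (conjS f) + (duh v t).val (conjS f) =
        starRingEnd ℂ ((P.grp t x).val f + (duh v t).val f)
      rw [h3, h4, map_add])
    hs1 hs2
  refine ⟨u, hu, ?_, fun hx t => huK t hx⟩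
  have hut' := ne_top_of_le_ne_top ENNReal.ofReal_ne_top hut
  by_cases h : r₁ = r
  · rwa [← h]
  rw [hne h] at hut'
  have hl' : (4 : ℝ) ≤ P.lam := by exact_mod_cast hl
  rcases hl.eq_or_lt with h4 | h5
  · have h4' : (P.lam : ℝ) = 4 := by rw [← h4]; norm_num
    refine hu.tn_ne_top_of_four h4.symm (by rwa [h4'] at hr) (by rw [h4'] at hr'; linarith) hud
      (ne_top_of_lt hx) hut'
  · refine hu.tn_ne_top (by linarith) (ne_top_of_lt hx)
      (tn_duh_ne_top (by linarith) ?_ hu.continuous hut')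
    have h5' : (5 : ℝ) ≤ P.lam := by exact_mod_cast h5
    rw [A, hp, add_sub_cancel_right, div_div, div_mul_eq_mul_div, lt_div_iff₀ (by positivity)]
    nlinarith

variable (P) in
theorem exists_solution {r : ℝ} (hr : P.lam < r)
    (hr' : r * (8 * P.lam + 18) ≤ 9 * P.lam * (P.lam + 2)) : ∃ ε : ℝ, 0 < ε ∧ ∀ u₀ : 𝓢'(ℝ, ℂ),
      timeNorm P.ρ r P.s ((P.lam : ℝ≥0∞) + 2) P.q (fun t => GBBM.S t u₀) < ENNReal.ofReal ε →
      ∃ u : ℝ → 𝓢'(ℝ, ℂ), MemTime P.ρ r P.s ((P.lam : ℝ≥0∞) + 2) P.q u ∧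
        IsSolution P.ρ P.s ((P.lam : ℝ≥0∞) + 2) P.q P.lam u₀ u ∧
        (IsRealValued u₀ → ∀ᵐ t : ℝ, IsRealValued (u t)) ∧
        ∀ v : ℝ → 𝓢'(ℝ, ℂ), MemTime P.ρ r P.s ((P.lam : ℝ≥0∞) + 2) P.q v →
          IsSolution P.ρ P.s ((P.lam : ℝ≥0∞) + 2) P.q P.lam u₀ v → ∀ᵐ t : ℝ, v t = u t := by
  have hr0 : 0 < r := by have := P.one_le_lam; linarith
  obtain ⟨ε, hε, h⟩ := P.exists_isMild hr hr'
  refine ⟨ε, hε, fun u₀ hu₀ => ?_⟩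
  rw [← P.ofReal_p] at hu₀ ⊢
  have hN : P.N u₀ ≠ ⊤ := by
    by_contra hN
    have h1 : ∀ t, P.N (GBBM.S t u₀) = ⊤ := fun t => by
      by_contra h2
      have h3 := N_S_le (P := P) (-t) (GBBM.S t u₀)
      rw [S_S, neg_add_cancel, S_zero, hN] at h3
      exact ENNReal.mul_ne_top ENNReal.ofReal_ne_top h2 (top_le_iff.1 h3)
    have h4 : ∀ t, modNorm P.ρ P.s (ENNReal.ofReal P.p) P.q (GBBM.S t u₀) = ⊤ := h1
    simp [timeNorm, h4, hr0, ENNReal.top_rpow_of_pos] at hu₀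
  obtain ⟨x, rfl⟩ : ∃ x : P.Space, x.val = u₀ := ⟨ofN u₀ hN, val_ofN _ _⟩
  have hx : P.tn r (fun t => P.grp t x) < ENNReal.ofReal ε :=
    (timeNorm_val (fun t => P.grp t x) r).symm.trans_lt hu₀
  obtain ⟨u, hu, hur, hreal⟩ := h x hx
  refine ⟨fun t => (u t).val, ⟨measurable_val hu.continuous.aestronglyMeasurable, ?_⟩,
    hu.isSolution, fun hr => Eventually.of_forall (hreal hr), fun v hv hvs => ?_⟩
  · exact (timeNorm_val u r).trans_lt hur.lt_top
  · obtain ⟨w, hw, hvw⟩ := exists_isMild_of_isSolution (P := P) hv.measurable hvs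
    rw [hu.unique hw]
    exact hvw

end Par

theorem neg_mul_beta_le {σ θ : ℝ} (hσ : σ < -1) (hθ : 0 < θ) (hθ' : θ ≤ -1 / σ) :
    -(θ * beta σ) ≤ 1 / 9 := by
  have h1 : θ * (-σ) ≤ 1 := by
    rwa [neg_div, ← div_neg, le_div_iff₀ (by linarith)] at hθ'
  have hd : 0 < 1 - 2 * σ := by linarith
  rw [beta]
  split_ifs with h
  · rw [mul_div_assoc', ← neg_div, div_le_iff₀ hd]
    nlinarith [sq_nonneg (σ + 2), mul_le_mul_of_nonneg_right h1 (by linarith : 0 ≤ -(σ + 1)),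
      mul_pos hθ hd]
  · rw [mul_div_assoc', ← neg_div, div_le_iff₀ hd]
    nlinarith

end GBBM

end

theorem mainTheorem1 (lam : ℕ) (hlam : 1 ≤ lam) (q s θ σ r : ℝ) (ρ : ℝ → ℝ)
    (hρ : GBBM.IsCutoff ρ) (hq : 1 ≤ q) (hs : 1 - 1 / q ≤ s) (hs' : s < 1 / q)
    (hσ : σ < -1) (hθ : 0 < θ) (hθ' : θ ≤ -1 / σ)
    (hβ : 0 < -((lam : ℝ) * θ * GBBM.beta σ) / ((lam : ℝ) + 2))
    (hβ' : -((lam : ℝ) * θ * GBBM.beta σ) / ((lam : ℝ) + 2) < 1)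
    (hr : r = (lam : ℝ) * ((lam : ℝ) + 2) / ((lam : ℝ) + 2 + (lam : ℝ) * θ * GBBM.beta σ)) :
    ∃ ε : ℝ, 0 < ε ∧ ∀ u₀ : 𝓢'(ℝ, ℂ),
      GBBM.timeNorm ρ r s ((lam : ℝ≥0∞) + 2) q (fun t => GBBM.S t u₀) < ENNReal.ofReal ε →
      ∃ u : ℝ → 𝓢'(ℝ, ℂ),
        GBBM.MemTime ρ r s ((lam : ℝ≥0∞) + 2) q u ∧
        GBBM.IsSolution ρ s ((lam : ℝ≥0∞) + 2) q lam u₀ u ∧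
        (GBBM.IsRealValued u₀ → ∀ᵐ t : ℝ, GBBM.IsRealValued (u t)) ∧
        ∀ v : ℝ → 𝓢'(ℝ, ℂ),
          GBBM.MemTime ρ r s ((lam : ℝ≥0∞) + 2) q v →
          GBBM.IsSolution ρ s ((lam : ℝ≥0∞) + 2) q lam u₀ v →
          ∀ᵐ t : ℝ, v t = u t := by
  have hl : (1 : ℝ) ≤ lam := by exact_mod_cast hlam
  have hl0 : (0 : ℝ) < lam := by linarith
  have hb := mul_le_mul_of_nonneg_left (GBBM.neg_mul_beta_le hσ hθ hθ') hl0.le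
  rw [lt_div_iff₀ (by positivity), zero_mul] at hβ
  rw [div_lt_one (by positivity)] at hβ'
  have hden : 0 < (lam : ℝ) + 2 + lam * θ * GBBM.beta σ := by linarith
  refine GBBM.Par.exists_solution ⟨lam, q, s, ρ, hlam, hρ, hq, hs, hs'⟩ ?_ ?_
  · change (lam : ℝ) < r
    rw [hr, lt_div_iff₀ hden]
    exact mul_lt_mul_of_pos_left (by linarith) hl0
  · change r * (8 * (lam : ℝ) + 18) ≤ 9 * lam * (lam + 2)
    have h1 : 8 * (lam : ℝ) + 18 ≤ 9 * (lam + 2 + lam * θ * GBBM.beta σ) := by linarith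
    rw [hr, div_mul_eq_mul_div, div_le_iff₀ hden]
    calc _ ≤ (lam : ℝ) * (lam + 2) * (9 * (lam + 2 + lam * θ * GBBM.beta σ)) := by gcongr
      _ = _ := by ring
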